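/- **Setting.** Let $k$ be an algebraically closed field of characteristic $0$, $M=\mathbb Z^n$, $M_{\mathbb R}=\mathbb R^n$, and let $\Sigma$ be a complete nonsingular fan in $M_{\mathbb R}$ with toric variety $X_\Sigma$. Let $\rho_1,\dots,\rho_s$ be distinct rays of $\Sigma$, with primitive generators $m_i$, such that no cone of $\Sigma$ contains two of them. For each $i$ let $H_i\subset D_{\rho_i}$ be a nonsingular hypersurface meeting the toric boundary of the toric divisor $D_{\rho_i}\subset X_\Sigma$ transversally (it contains no toric stratum of $D_{\rho_i}$, and its scheme-theoretic intersection with every toric stratum is nonsingular). Let $\widetilde\Sigma$ be the star subdivision of the fan $\{\sigma\times 0,\ \sigma\times\mathbb R_{\ge0}\mid\sigma\in\Sigma\}$ in $M_{\mathbb R}\oplus\mathbb R$ at the cones $\rho_i\times\mathbb R_{\ge0}$, so that the toric variety $X_{\widetilde\Sigma}$ is the blow-up of $X_\Sigma\times\mathbb A^1$ along $\bigcup_i D_{\rho_i}\times 0$; its rays are generated by $(m_\rho,0)$ ($\rho$ a ray of $\Sigma$ with primitive generator $m_\rho$), $(0,1)$ and $(m_i,1)$. Let $\widetilde H_i\subset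 X_{\widetilde\Sigma}$ be the strict transform of $H_i\times\mathbb A^1$, let $\widetilde X\to X_{\widetilde\Sigma}$ be the blow-up along $\bigcup_i\widetilde H_i$, and for each ray $a$ of $\widetilde\Sigma$ let $\widetilde D_a\subset\widetilde X$ be the strict transform of the corresponding toric divisor. Let $(\widetilde B,\widetilde{\mathscr P})$ be the tropicalization of $(\widetilde X,\bigcup_a\widetilde D_a)$: its cones are $\sum_{a\in T}\mathbb R_{\ge 0}\widetilde D_a^*$, in the dual of $\bigoplus_a\mathbb R\widetilde D_a$, for the sets $T$ of rays with $\widetilde D_T:=\bigcap_{a\in T}\widetilde D_a\neq\emptyset$, and $\widetilde B$ is their union. The open star of a cone is the union of the relative interiors of the cones containing it. Let $\Delta$ be the union of the cones of codimension $\ge2$. The integral affine structure on $\widetilde B\setminus\Delta$ is the one for which the following are charts. For each cone $T$ of codimension one, take on its open star a map $\psi_T$ to $M_{\mathbb R}\oplus\mathbb R$ which is induced by a map linear on the maximal cones containing $T$, sends the generators $\widetilde D_a^*$ of each of these to a basis of the lattice $M\oplus\mathbb Z$, and, if there are two of them, with additional rays $a,a'$, satisfies $$\psi_T(\widetilde D_a^*)+\psi_T(\widetilde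 D_{a'}^*)=-\sum_{b\in T}(\widetilde D_b\cdot\widetilde D_T)\,\psi_T(\widetilde D_b^*).$$ Let $\Psi:\widetilde B\to M_{\mathbb R}\times\mathbb R_{\ge0}$ be the piecewise linear map that is linear on cones and sends $\widetilde D_a^*$ to the primitive generator of $a$. For a cone $\rho\in\Sigma$ containing $\rho_i$ let $\tilde\rho$ be the cone of $\widetilde\Sigma$ generated by $\rho\times0$ and $(m_i,1)$, regarded as a cone of $\widetilde B$, and put $$U=\widetilde B\setminus\bigcup_i\ \bigcup_{\rho_i\subseteq\rho\in\Sigma,\ \dim\rho=n-1}\tilde\rho,\qquad V=\bigcup_i\mathrm{Star}(\tilde\rho_i),\qquad \widetilde\Delta=\widetilde B\setminus(U\cup V).$$ Let $\pi_i:M_{\mathbb R}\to M_{\mathbb R}/\mathbb R\rho_i$ be the quotient map, and let $\varphi_i:M_{\mathbb R}/\mathbb R\rho_i\to\mathbb R$ be a piecewise linear function on the fan $\Sigma(\rho_i)=\{(\sigma+\mathbb R\rho_i)/\mathbb R\rho_i\mid\rho_i\subseteq\sigma\in\Sigma\}$ of $D_{\rho_i}$ corresponding to $H_i$: if $H_i$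 is linearly equivalent to $\sum_\tau a_\tau D_\tau$, the sum over the rays $\tau$ of $\Sigma(\rho_i)$, then $\varphi_i$ takes the value $a_\tau$ on the primitive generator of $\tau$. (So $\varphi_i$ is determined up to an integral linear function.) **Theorem.** The map $\Psi$ is a homeomorphism onto $M_{\mathbb R}\times\mathbb R_{\ge 0}$, the sets $\mathrm{Star}(\tilde\rho_i)$ are pairwise disjoint, $\widetilde\Delta\subseteq\Delta$, every cone of codimension one has a chart $\psi_T$, and the charts $\psi_T$ belong to an integral affine structure (with boundary) on $\widetilde B\setminus\Delta$. This integral affine structure is the restriction of an integral affine structure on $\widetilde B\setminus\widetilde\Delta$ for which 1. $\psi_U:=\Psi|_U:U\to M_{\mathbb R}\oplus\mathbb R$ is an integral affine coordinate chart; 2. for each $i$, the map on $\mathrm{Star}(\tilde\rho_i)$ given by $$\psi_V(\Psi^{-1}(m,r))=(m+\varphi_i(\pi_i(m))\,m_i,\ r)$$ is an integral affine coordinate chart; 3. after adding suitable integral linear functions to the $\varphi_i$, the map $\psi_V:V\to M_{\mathbb R}\oplus\mathbb R$ given by the formula in 2 on each $\mathrm{Star}(\tilde\rho_i)$ is injective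 and is an integral affine coordinate chart on all of $V$. -/

import Mathlib

open CategoryTheory CategoryTheory.Limits AlgebraicGeometry TopologicalSpace

universe u

namespace TropBlowup

/-- A nonsingular simplicial fan in a lattice `L`, recorded by the primitive generators `gen b` of its
rays and by the set `cones` of those finite sets of rays that span a cone. The field `unimodular`
says that the generators of a cone are part of a `ℤ`-basis of `L`: the evaluation map
`Hom(L, ℤ) → ℤ ^ T` is surjective. That the cones meet along common faces is stated separately
where it is needed. -/
structure SmoothFan (L : Type) [AddCommGroup L] (ι : Type) where
  gen : ι → L
  cones : Set (Finset ι)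
  empty_mem : ∅ ∈ cones
  down_closed : ∀ {S T : Finset ι}, T ∈ cones → S ⊆ T → S ∈ cones
  unimodular : ∀ T ∈ cones, ∀ c : ι → ℤ, ∃ χ : L →+ ℤ, ∀ b ∈ T, χ (gen b) = c b

namespace SmoothFan

variable {L : Type} [AddCommGroup L] {ι : Type} (F : SmoothFan L ι)

/-- The monoid `σ^∨ ∩ Hom(L, ℤ)` of characters that are regular on the affine chart of the cone `T`. -/
def dualMonoid (T : Finset ι) : AddSubmonoid (L →+ ℤ) where
  carrier := {χ | ∀ b ∈ T, 0 ≤ χ (F.gen b)}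
  zero_mem' := fun _ _ => le_rfl
  add_mem' := fun h h' b hb => add_nonneg (h b hb) (h' b hb)

theorem dualMonoid_anti {S T : Finset ι} (h : S ⊆ T) : F.dualMonoid T ≤ F.dualMonoid S :=
  fun _ hχ b hb => hχ b (h hb)

variable (k : Type u) [Field k]

/-- Restriction of regular functions from the chart of `T` to the chart of a face `S` of `T`. -/
noncomputable def restr {S T : Finset ι} (h : S ⊆ T) :
    AddMonoidAlgebra k (F.dualMonoid T) →+* AddMonoidAlgebra k (F.dualMonoid S) :=
  AddMonoidAlgebra.mapDomainRingHom k (AddSubmonoid.inclusion (F.dualMonoid_anti h))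

theorem restr_single {S T : Finset ι} (h : S ⊆ T) (χ : F.dualMonoid T) (a : k) :
    F.restr k h (AddMonoidAlgebra.single χ a) =
      AddMonoidAlgebra.single (AddSubmonoid.inclusion (F.dualMonoid_anti h) χ) a := by
  simp [restr]

theorem restr_comp {R S T : Finset ι} (h : R ⊆ S) (h' : S ⊆ T) :
    (F.restr k h).comp (F.restr k h') = F.restr k (h.trans h') := by
  rw [restr, restr, ← AddMonoidAlgebra.mapDomainRingHom_comp]
  rfl

theorem restr_rfl (S : Finset ι) : F.restr k (Finset.Subset.refl S) = RingHom.id _ := by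
  rw [restr, ← AddMonoidAlgebra.mapDomainRingHom_id]
  rfl

theorem restr_isLocalization {S T : Finset ι} (h : S ⊆ T) (χ : F.dualMonoid T)
    (h0 : ∀ b ∈ S, χ.1 (F.gen b) = 0) (h1 : ∀ b ∈ T, b ∉ S → 0 < χ.1 (F.gen b)) :
    @IsLocalization.Away _ _ (AddMonoidAlgebra.single χ (1 : k)) (AddMonoidAlgebra k (F.dualMonoid S)) _
      (F.restr k h).toAlgebra := by
  let _ := (F.restr k h).toAlgebra
  have hinj : Function.Injective (F.restr k h) :=
    AddMonoidAlgebra.mapDomain_injective (AddSubmonoid.inclusion_injective _)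
  have hpow : ∀ N : ℕ, F.restr k h ((AddMonoidAlgebra.single χ (1 : k)) ^ N) =
      AddMonoidAlgebra.single (N • AddSubmonoid.inclusion (F.dualMonoid_anti h) χ) 1 := by
    intro N
    rw [AddMonoidAlgebra.single_pow, restr_single, map_nsmul, one_pow]
  refine (isLocalization_iff _ _).2 ⟨?_, ?_, ?_⟩
  · rintro ⟨_, N, rfl⟩
    let ψ : F.dualMonoid S := ⟨-χ.1, fun b hb => by simp [h0 b hb]⟩
    have hψ : AddSubmonoid.inclusion (F.dualMonoid_anti h) χ + ψ = 0 := by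
      apply Subtype.ext
      simp [ψ]
    refine IsUnit.of_mul_eq_one (AddMonoidAlgebra.single (N • ψ) (1 : k)) ?_
    rw [RingHom.algebraMap_toAlgebra]
    show F.restr k h ((AddMonoidAlgebra.single χ (1 : k)) ^ N) * _ = 1
    rw [hpow, AddMonoidAlgebra.single_mul_single, ← nsmul_add, hψ, nsmul_zero, one_mul]
    rfl
  · intro z
    suffices H : ∃ N : ℕ, ∃ y, z * F.restr k h ((AddMonoidAlgebra.single χ (1 : k)) ^ N) =
        F.restr k h y by
      obtain ⟨N, y, hy⟩ := H
      exact ⟨(y, ⟨_, N, rfl⟩), hy⟩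
    induction z using AddMonoidAlgebra.induction_linear with
    | zero => exact ⟨0, 0, by simp⟩
    | add f g hf hg =>
      obtain ⟨N, y, hy⟩ := hf
      obtain ⟨N', y', hy'⟩ := hg
      refine ⟨N + N', y * (AddMonoidAlgebra.single χ (1 : k)) ^ N' +
        y' * (AddMonoidAlgebra.single χ (1 : k)) ^ N, ?_⟩
      rw [map_add, map_mul, map_mul, ← hy, ← hy', pow_add, map_mul]
      ring
    | single ψ a =>
      obtain ⟨N, hN⟩ : ∃ N : ℕ, ∀ b ∈ T, 0 ≤ ψ.1 (F.gen b) + N * χ.1 (F.gen b) := by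
        refine ⟨∑ b ∈ T, (ψ.1 (F.gen b)).natAbs, fun b hb => ?_⟩
        by_cases hbS : b ∈ S
        · rw [h0 b hbS, mul_zero, add_zero]
          exact ψ.2 b hbS
        · have h2 := h1 b hb hbS
          have h3 : (ψ.1 (F.gen b)).natAbs ≤ ∑ b ∈ T, (ψ.1 (F.gen b)).natAbs :=
            Finset.single_le_sum (f := fun b => (ψ.1 (F.gen b)).natAbs) (fun _ _ => Nat.zero_le _) hb
          have h4 : ((ψ.1 (F.gen b)).natAbs : ℤ) ≤ ((∑ b ∈ T, (ψ.1 (F.gen b)).natAbs : ℕ) : ℤ) := by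
            exact_mod_cast h3
          have h5 : -ψ.1 (F.gen b) ≤ ((ψ.1 (F.gen b)).natAbs : ℤ) := by omega
          nlinarith
      refine ⟨N, AddMonoidAlgebra.single ⟨ψ.1 + N • χ.1, fun b hb => by simpa using hN b hb⟩ a, ?_⟩
      rw [hpow, restr_single, AddMonoidAlgebra.single_mul_single, mul_one]
      congr 1
  · intro x y hxy
    exact ⟨1, by rw [hinj hxy]⟩

theorem exists_cutting {S T : Finset ι} (hT : T ∈ F.cones) :
    ∃ χ : F.dualMonoid T, (∀ b ∈ T, b ∈ S → χ.1 (F.gen b) = 0) ∧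
      ∀ b ∈ T, b ∉ S → 0 < χ.1 (F.gen b) := by
  classical
  obtain ⟨χ, hχ⟩ := F.unimodular T hT (fun b => if b ∈ S then 0 else 1)
  refine ⟨⟨χ, fun b hb => ?_⟩, fun b hb hbS => ?_, fun b hb hbS => ?_⟩
  · rw [hχ b hb]; split_ifs <;> simp
  · simp [hχ b hb, hbS]
  · simp [hχ b hb, hbS]

/-- The diagram of affine toric charts `Spec k[σ^∨ ∩ Hom(L, ℤ)]`, indexed by the cones. -/
noncomputable def chartDiagram : F.cones ⥤ Scheme.{u} where
  obj T := Spec (CommRingCat.of (AddMonoidAlgebra k (F.dualMonoid T.1)))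
  map {S T} f := Spec.map (CommRingCat.ofHom (F.restr k (leOfHom f)))
  map_id T := by
    rw [restr_rfl]
    exact Spec.map_id _
  map_comp {R S T} f g := by
    rw [← Spec.map_comp, ← CommRingCat.ofHom_comp, restr_comp]

instance isOpenImmersion_map {S T : F.cones} (f : S ⟶ T) :
    IsOpenImmersion ((F.chartDiagram k).map f) := by
  obtain ⟨χ, h0, h1⟩ := F.exists_cutting (S := S.1) T.2
  let _ := (F.restr k (leOfHom f)).toAlgebra
  have := F.restr_isLocalization k (leOfHom f) χ (fun b hb => h0 b (leOfHom f hb) hb) h1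
  exact IsOpenImmersion.of_isLocalization (S := AddMonoidAlgebra k (F.dualMonoid S.1))
    (AddMonoidAlgebra.single χ (1 : k))

theorem range_map {S T : F.cones} (f : S ⟶ T) (χ : F.dualMonoid T.1)
    (h0 : ∀ b ∈ S.1, χ.1 (F.gen b) = 0) (h1 : ∀ b ∈ T.1, b ∉ S.1 → 0 < χ.1 (F.gen b)) :
    Set.range ((F.chartDiagram k).map f) =
      (PrimeSpectrum.basicOpen (AddMonoidAlgebra.single χ (1 : k)) : Set (PrimeSpectrum _)) := by
  let _ := (F.restr k (leOfHom f)).toAlgebra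
  have := F.restr_isLocalization k (leOfHom f) χ h0 h1
  exact PrimeSpectrum.localization_away_comap_range (AddMonoidAlgebra k (F.dualMonoid S.1))
    (AddMonoidAlgebra.single χ (1 : k))

instance isLocallyDirected :
    ((F.chartDiagram k) ⋙ Scheme.forget).IsLocallyDirected where
  cond := by
    classical
    intro i j l fi fj xi xj hx
    replace hx : (F.chartDiagram k).map fi xi = (F.chartDiagram k).map fj xj := hx
    let m : F.cones := ⟨i.1 ∩ j.1, F.down_closed i.2 Finset.inter_subset_left⟩
    let mi : m ⟶ i := homOfLE Finset.inter_subset_left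
    let mj : m ⟶ j := homOfLE Finset.inter_subset_right
    obtain ⟨χ, hχ0, hχ1⟩ := F.exists_cutting (S := i.1) l.2
    obtain ⟨ψ, hψ0, hψ1⟩ := F.exists_cutting (S := j.1) l.2
    have hi := F.range_map k fi χ (fun b hb => hχ0 b (leOfHom fi hb) hb) hχ1
    have hj := F.range_map k fj ψ (fun b hb => hψ0 b (leOfHom fj hb) hb) hψ1
    have hm := F.range_map k (mi ≫ fi) (χ + ψ)
      (fun b hb => by
        have h1 := (Finset.mem_inter.1 hb).1
        have h2 := (Finset.mem_inter.1 hb).2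
        simp [hχ0 b (leOfHom fi h1) h1, hψ0 b (leOfHom fi h1) h2])
      (fun b hb hbm => by
        have e1 := χ.2 b hb
        have e2 := ψ.2 b hb
        by_cases h1 : b ∈ i.1
        · have h2 : b ∉ j.1 := fun h2 => hbm (Finset.mem_inter.2 ⟨h1, h2⟩)
          have := hψ1 b hb h2
          simp only [AddSubmonoid.coe_add, AddMonoidHom.add_apply]
          omega
        · have := hχ1 b hb h1
          simp only [AddSubmonoid.coe_add, AddMonoidHom.add_apply]
          omega)
    have hmem : (F.chartDiagram k).map fi xi ∈ Set.range ((F.chartDiagram k).map (mi ≫ fi)) := by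
      rw [hm]
      have hs : AddMonoidAlgebra.single (χ + ψ) (1 : k) =
          AddMonoidAlgebra.single χ (1 : k) * AddMonoidAlgebra.single ψ (1 : k) := by
        rw [AddMonoidAlgebra.single_mul_single, one_mul]
      rw [hs, PrimeSpectrum.basicOpen_mul]
      refine ⟨?_, ?_⟩
      · rw [← hi]; exact ⟨xi, rfl⟩
      · rw [← hj, hx]; exact ⟨xj, rfl⟩
    obtain ⟨x, hx'⟩ := hmem
    refine ⟨m, mi, mj, x, ?_, ?_⟩
    · apply ((F.chartDiagram k).map fi).isOpenEmbedding.injective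
      rw [← hx']
      show _ = ((F.chartDiagram k).map (mi ≫ fi)) x
      rw [Functor.map_comp]; rfl
    · apply ((F.chartDiagram k).map fj).isOpenEmbedding.injective
      rw [← hx, ← hx']
      show ((F.chartDiagram k).map mj ≫ (F.chartDiagram k).map fj) x = _
      rw [← Functor.map_comp]; rfl

/-- The toric variety of the fan: the affine charts glued along the charts of common faces. -/
noncomputable def toricScheme : Scheme.{u} := colimit (F.chartDiagram k)

/-- The affine chart of a cone, an open subscheme of the toric variety. -/
noncomputable def chart (T : F.cones) :
    Spec (CommRingCat.of (AddMonoidAlgebra k (F.dualMonoid T.1))) ⟶ F.toricScheme k :=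
  colimit.ι (F.chartDiagram k) T

theorem restr_chart {S T : F.cones} (h : S ≤ T) :
    Spec.map (CommRingCat.ofHom (F.restr k h)) ≫ F.chart k T = F.chart k S :=
  colimit.w (F.chartDiagram k) (homOfLE h)

/-- Morphisms out of the toric variety, glued from the charts. -/
noncomputable def glueMap {Y : Scheme.{u}}
    (app : ∀ T : F.cones, Spec (CommRingCat.of (AddMonoidAlgebra k (F.dualMonoid T.1))) ⟶ Y)
    (w : ∀ (S T : F.cones) (h : S ≤ T),
      Spec.map (CommRingCat.ofHom (F.restr k h)) ≫ app T = app S) :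
    F.toricScheme k ⟶ Y :=
  colimit.desc (F.chartDiagram k)
    { pt := Y
      ι :=
        { app := app
          naturality := fun S T f => (w S T (leOfHom f)).trans (Category.comp_id _).symm } }

theorem chart_glueMap {Y : Scheme.{u}}
    (app : ∀ T : F.cones, Spec (CommRingCat.of (AddMonoidAlgebra k (F.dualMonoid T.1))) ⟶ Y)
    (w : ∀ (S T : F.cones) (h : S ≤ T),
      Spec.map (CommRingCat.ofHom (F.restr k h)) ≫ app T = app S) (T : F.cones) :
    F.chart k T ≫ F.glueMap k app w = app T :=
  colimit.ι_desc _ _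

theorem toricScheme_hom_ext {Y : Scheme.{u}} {f g : F.toricScheme k ⟶ Y}
    (h : ∀ T, F.chart k T ≫ f = F.chart k T ≫ g) : f = g :=
  colimit.hom_ext h

/-- The structure morphism of the toric variety. -/
noncomputable def toSpec : F.toricScheme k ⟶ Spec (CommRingCat.of k) :=
  F.glueMap k
    (fun T => Spec.map (CommRingCat.ofHom (algebraMap k (AddMonoidAlgebra k (F.dualMonoid T.1)))))
    (by
      intro S T h
      rw [← Spec.map_comp, ← CommRingCat.ofHom_comp]
      congr 2
      ext x
      simp [restr])

noncomputable def charHom (χ : L →+ ℤ) (hχ : ∀ b, 0 ≤ χ (F.gen b)) (T : Finset ι) :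
    Polynomial k →ₐ[k] AddMonoidAlgebra k (F.dualMonoid T) :=
  Polynomial.aeval (AddMonoidAlgebra.single (⟨χ, fun b _ => hχ b⟩ : F.dualMonoid T) (1 : k))

/-- The morphism to `𝔸¹` given by a character that is nonnegative on all rays. -/
noncomputable def charMap (χ : L →+ ℤ) (hχ : ∀ b, 0 ≤ χ (F.gen b)) :
    F.toricScheme k ⟶ Spec (CommRingCat.of (Polynomial k)) :=
  F.glueMap k
    (fun T => Spec.map (CommRingCat.ofHom (F.charHom k χ hχ T.1).toRingHom))
    (by
      intro S T h
      rw [← Spec.map_comp, ← CommRingCat.ofHom_comp]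
      congr 2
      refine Polynomial.ringHom_ext (fun a => ?_) ?_
      · simp [charHom, restr]
      · simp [charHom, restr]
        rfl)

theorem charMap_toSpec (χ : L →+ ℤ) (hχ : ∀ b, 0 ≤ χ (F.gen b)) :
    F.charMap k χ hχ ≫ Spec.map (CommRingCat.ofHom (algebraMap k (Polynomial k))) =
      F.toSpec k := by
  refine F.toricScheme_hom_ext k fun T => ?_
  rw [charMap, toSpec, chart_glueMap, ← Category.assoc, chart_glueMap, ← Spec.map_comp,
    ← CommRingCat.ofHom_comp]
  congr 2
  exact (F.charHom k χ hχ T.1).comp_algebraMap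

/-- A linear map of lattices that sends the cone `T` into the cone `target T`. -/
structure FanMap {L' : Type} [AddCommGroup L'] {ι' : Type} (F : SmoothFan L ι)
    (G : SmoothFan L' ι') where
  lin : L →+ L'
  target : F.cones → G.cones
  target_mono : ∀ S T, S ≤ T → target S ≤ target T
  pull_mem : ∀ T, ∀ χ ∈ G.dualMonoid (target T).1, χ.comp lin ∈ F.dualMonoid T.1

section
variable {F} {L' : Type} [AddCommGroup L'] {ι' : Type} {G : SmoothFan L' ι'} (g : FanMap F G)

def FanMap.pull (T : F.cones) : G.dualMonoid (g.target T).1 →+ F.dualMonoid T.1 where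
  toFun χ := ⟨χ.1.comp g.lin, g.pull_mem T χ.1 χ.2⟩
  map_zero' := rfl
  map_add' _ _ := rfl

/-- The toric morphism of a map of fans. -/
noncomputable def FanMap.toricMap : F.toricScheme k ⟶ G.toricScheme k :=
  F.glueMap k
    (fun T => Spec.map (CommRingCat.ofHom (AddMonoidAlgebra.mapDomainRingHom k (g.pull T))) ≫
      G.chart k (g.target T))
    (by
      intro S T h
      rw [← G.restr_chart k (g.target_mono S T h), ← Category.assoc, ← Category.assoc,
        ← Spec.map_comp, ← Spec.map_comp, ← CommRingCat.ofHom_comp, ← CommRingCat.ofHom_comp]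
      congr 3
      rw [restr, restr, ← AddMonoidAlgebra.mapDomainRingHom_comp,
        ← AddMonoidAlgebra.mapDomainRingHom_comp]
      rfl)

theorem FanMap.toricMap_toSpec : g.toricMap k ≫ G.toSpec k = F.toSpec k := by
  refine F.toricScheme_hom_ext k fun T => ?_
  rw [FanMap.toricMap, toSpec, toSpec, ← Category.assoc, chart_glueMap, chart_glueMap,
    Category.assoc, chart_glueMap, ← Spec.map_comp, ← CommRingCat.ofHom_comp]
  congr 2
  ext x
  simp

end

/-- The underlying open set of the chart of `T` (empty if `T` is not a cone). -/
def chartSet (T : Finset ι) : Set (F.toricScheme k) :=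
  {x | ∃ h : T ∈ F.cones, x ∈ Set.range (F.chart k ⟨T, h⟩)}

/-- The toric prime divisor `D_b`: the closure of the torus orbit of the ray `b`. -/
def toricDivisor (b : ι) : Closeds (F.toricScheme k) :=
  ⟨closure (F.chartSet k {b} \ F.chartSet k ∅), isClosed_closure⟩

end SmoothFan

section Divisors

variable {X Y : Scheme.{u}}

/-- The strict transform of `Z` under a morphism `f` which is an isomorphism away from `C`,
as a closed set. -/
def strictTransform (f : Y ⟶ X) (C Z : Set X) : Closeds Y :=
  ⟨closure (f ⁻¹' (Z \ C)), isClosed_closure⟩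

/-- The closed subscheme of `I` is an effective Cartier divisor: `I` is locally generated by one
nonzerodivisor. -/
def IsEffectiveCartier (I : X.IdealSheafData) : Prop :=
  ∀ x : X, ∃ U : X.affineOpens, x ∈ U.1 ∧
    ∃ g ∈ nonZeroDivisors Γ(X, U.1), I.ideal U = Ideal.span {g}

/-- `f : Y ⟶ X` is the blow-up of `X` along the closed subscheme of `I`: the inverse image ideal is
an effective Cartier divisor, and `f` is terminal with this property. This determines `Y` over `X`
up to a unique isomorphism. -/
structure IsBlowup (f : Y ⟶ X) (I : X.IdealSheafData) : Prop where
  isEffectiveCartier : IsEffectiveCartier (I.comap f)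
  existsUnique_lift : ∀ (W : Scheme.{u}) (g : W ⟶ X), IsEffectiveCartier (I.comap g) →
    ∃! h : W ⟶ Y, h ≫ f = g

/-- Two quasi-coherent ideal sheaves are isomorphic as sheaves of modules. For effective Cartier
divisors this is linear equivalence. -/
def IdealIso (I J : X.IdealSheafData) : Prop :=
  ∃ e : ∀ U : X.affineOpens, I.ideal U ≃ₗ[Γ(X, U.1)] J.ideal U,
    ∀ (U V : X.affineOpens) (h : U ≤ V) (x : I.ideal V),
      (e U ⟨(X.presheaf.map (homOfLE (show U.1 ≤ V.1 from h)).op).hom x.1,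
          I.ideal_le_comap_ideal h x.2⟩ : Γ(X, U.1)) =
        (X.presheaf.map (homOfLE (show U.1 ≤ V.1 from h)).op).hom (e V x : Γ(X, V.1))

variable {k : Type u} [Field k]

/-- `dim_k Γ(X, 𝒪_X)`; the degree of `X` if `X` is a finite `k`-scheme. -/
noncomputable def globalDim (f : X ⟶ Spec (CommRingCat.of k)) : ℕ :=
  let _ : Module k Γ(X, ⊤) :=
    (((Scheme.ΓSpecIso (CommRingCat.of k)).inv ≫ f.appTop).hom : k →+* Γ(X, ⊤)).toModule
  Module.finrank k Γ(X, ⊤)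

/-- The degree of the scheme-theoretic intersection of the closed subscheme of `I` with the reduced
subscheme on `C`. -/
noncomputable def meetDegree (f : X ⟶ Spec (CommRingCat.of k)) (I : X.IdealSheafData)
    (C : Closeds X) : ℕ :=
  globalDim ((I ⊔ Scheme.IdealSheafData.vanishingIdeal C).subschemeι ≫ f)

/-- The intersection number `D · C` of a divisor with a complete integral curve is `d`: the divisor
`D` is linearly equivalent to a difference `I - J` of effective Cartier divisors whose supports do
not contain `C`, and `d = deg (I ∩ C) - deg (J ∩ C)`. Equivalently `d` is the degree of `𝒪(D)|_C`,
which does not depend on the choice of `I` and `J`. -/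
def HasIntersectionNumber (f : X ⟶ Spec (CommRingCat.of k)) (D C : Closeds X) (d : ℤ) : Prop :=
  ∃ I J : X.IdealSheafData, IsEffectiveCartier I ∧ IsEffectiveCartier J ∧
    ¬ C ≤ I.support ∧ ¬ C ≤ J.support ∧
    IdealIso (Scheme.IdealSheafData.vanishingIdeal D * J) I ∧
    d = (meetDegree f I C : ℤ) - meetDegree f J C

/-- The intersection number `D · C = deg 𝒪(D)|_C`. -/
noncomputable def intersectionNumber (f : X ⟶ Spec (CommRingCat.of k)) (D C : Closeds X) : ℤ :=
  Classical.epsilon (HasIntersectionNumber f D C)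

end Divisors

section AffineStructures

variable (E : Type) [NormedAddCommGroup E] [NormedSpace ℝ E] (Λ : AddSubgroup E)

/-- A coordinate chart, with values in the real vector space `E`, on an open subset of a topological
manifold with boundary `B`: an embedding of `source` onto a subset that near each of its points is a
neighbourhood of that point in `E` or in a closed half-space with the point on its boundary.
Values of `toFun` off `source` have no meaning. -/
structure AffineChart (B : Type) [TopologicalSpace B] where
  source : Set B
  isOpen_source : IsOpen source
  toFun : B → E
  isEmbedding : Topology.IsEmbedding (source.domRestrict toFun)
  locally_half : ∀ x ∈ source, Filter.map toFun (nhds x) = nhds (toFun x) ∨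
    ∃ h : E →ₗ[ℝ] ℝ, h ≠ 0 ∧
      Filter.map toFun (nhds x) = nhdsWithin (toFun x) {y | h (toFun x) ≤ h y}

variable {E} {B : Type} [TopologicalSpace B]

/-- The transition map is locally the restriction of an integral affine transformation: an element of
`Λ ⋊ GL(Λ)`. -/
def AffineChart.Compatible (e e' : AffineChart E B) : Prop :=
  ∀ x ∈ e.source ∩ e'.source, ∃ (A : E ≃ₗ[ℝ] E) (b : E), (∀ v, A v ∈ Λ ↔ v ∈ Λ) ∧ b ∈ Λ ∧
    ∀ᶠ y in nhds x, e'.toFun y = A (e.toFun y) + b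

/-- An integral affine structure on the open subset `S` of `B`: a maximal atlas of charts with values
in `E` whose transition maps are integral affine with respect to the lattice `Λ`. -/
structure IntegralAffineStructure (S : Set B) where
  charts : Set (AffineChart E B)
  source_subset : ∀ e ∈ charts, e.source ⊆ S
  covers : ∀ x ∈ S, ∃ e ∈ charts, x ∈ e.source
  compatible : ∀ e ∈ charts, ∀ e' ∈ charts, e.Compatible Λ e'
  maximal : ∀ e : AffineChart E B, e.source ⊆ S → (∀ e' ∈ charts, e.Compatible Λ e') →
    e ∈ charts

end AffineStructures

section Tropicalization

variable {X : Scheme.{u}} {A : Type} (D : A → Closeds X)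

/-- The closed stratum `D_T`, the intersection of the divisors `D a`, `a ∈ T`. -/
def stratum (T : Finset A) : Closeds X :=
  ⟨⋂ a ∈ T, (D a : Set X), isClosed_biInter fun a _ => (D a).isClosed⟩

/-- The cones of the tropicalization, spanned by the `D_a^*`, `a ∈ T`, for those `T` for which the
intersection of the `D a` is non-empty. -/
def tropCones : Set (Finset A) := {T | (stratum D T : Set X).Nonempty}

/-- The tropicalization of `(X, ⋃ D a)`: the union of the cones `∑ a ∈ T, ℝ≥0 D_a^*` in the dual of
`⨁ ℝ D_a`. A point is given by its coordinates with respect to the basis `D_a^*`. -/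
def TropSpace : Type :=
  {x : A → ℝ // (∀ a, 0 ≤ x a) ∧ ∃ T ∈ tropCones D, ∀ a ∉ T, x a = 0}

instance : TopologicalSpace (TropSpace D) := instTopologicalSpaceSubtype

/-- The (closed) cone spanned by `T`. -/
def tropCell (T : Finset A) : Set (TropSpace D) := {x | ∀ a ∉ T, x.1 a = 0}

/-- The relative interior of the cone spanned by `T`. -/
def tropInterior (T : Finset A) : Set (TropSpace D) := {x | ∀ a, x.1 a ≠ 0 ↔ a ∈ T}

/-- The open star of the cone spanned by `T`. -/
def tropStar (T : Finset A) : Set (TropSpace D) :=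
  {x | ∃ S ∈ tropCones D, T ⊆ S ∧ x ∈ tropInterior D S}

/-- The union of the cones of codimension at least two, where `N` is the dimension. -/
def tropDiscriminant (N : ℕ) : Set (TropSpace D) :=
  {x | ∃ T ∈ tropCones D, T.card + 2 ≤ N ∧ x ∈ tropCell D T}

/-- The vectors `w a`, `a ∈ T`, form a `ℤ`-basis of the lattice `Λ`. -/
def IsLatticeBasis {E : Type} [AddCommGroup E] (Λ : AddSubgroup E) (w : A → E)
    (T : Finset A) : Prop :=
  ∃ β : Module.Basis T ℤ Λ, ∀ a : T, (β a : E) = w a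

variable [Fintype A] [DecidableEq A] {k : Type u} [Field k]
  {E : Type} [NormedAddCommGroup E] [NormedSpace ℝ E]

/-- `e` is a chart `ψ_T` of the affine structure of the tropicalization on the open star of the cone
`T` of codimension one. It is induced by a map that is linear on the maximal cones containing `T`,
identifies each of them with a standard cone, and satisfies
`ψ(m_a) + ψ(m_a') = - ∑ b ∈ T, (D_b · D_T) ψ(m_b)` if there are two such cones, with additional
rays `a` and `a'`. (If there is just one, then `T` lies on the boundary.) -/
structure IsFacetChart (f : X ⟶ Spec (CommRingCat.of k)) (N : ℕ) (Λ : AddSubgroup E)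
    (T : Finset A) (e : AffineChart E (TropSpace D)) : Prop where
  mem : T ∈ tropCones D
  card : T.card + 1 = N
  source : e.source = tropStar D T
  exists_gens : ∃ w : A → E,
    (∀ x ∈ tropStar D T, e.toFun x = ∑ a, x.1 a • w a) ∧
    (∀ S ∈ tropCones D, T ⊆ S → S.card = N → IsLatticeBasis Λ w S) ∧
    (∀ a a', a ∉ T → a' ∉ T → a ≠ a' → insert a T ∈ tropCones D → insert a' T ∈ tropCones D →
      w a + w a' = -∑ b ∈ T, (intersectionNumber f (D b) (stratum D T) : ℝ) • w b)

end Tropicalization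

section Degeneration

variable {ι : Type} [DecidableEq ι]

namespace SmoothFan

variable {n : ℕ} (F : SmoothFan (Fin n → ℤ) ι)

def realGen (b : ι) : Fin n → ℝ := fun j => (F.gen b j : ℝ)

/-- The cone in `ℝ ^ n` spanned by the rays in `T`. -/
def realCone (T : Finset ι) : Set (Fin n → ℝ) :=
  {x | ∃ c : ι → ℝ, (∀ b, 0 ≤ c b) ∧ x = ∑ b ∈ T, c b • F.realGen b}

/-- The cones form a complete fan with exactly the given rays. -/
structure IsCompleteFan : Prop where
  singleton_mem : ∀ b, {b} ∈ F.cones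
  inter_subset : ∀ S ∈ F.cones, ∀ T ∈ F.cones,
    F.realCone S ∩ F.realCone T ⊆ F.realCone (S ∩ T)
  complete : ∀ x, ∃ T ∈ F.cones, x ∈ F.realCone T

end SmoothFan

/-- The rays of the fan `Σ~`: `ℝ≥0 (m_b, 0)`, `ℝ≥0 (0, 1)` and `ν_i = ℝ≥0 (m_i, 1)`, where `m_i`
generates the `i`-th chosen ray. -/
inductive TildeRay (ι : Type) (s : ℕ) : Type
  | horizontal (b : ι)
  | vertical
  | exceptional (i : Fin s)
  deriving DecidableEq, Fintype

section

variable {L : Type} [AddCommGroup L] (F : SmoothFan L ι) {s : ℕ} (P : Fin s → ι)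

open TildeRay

/-- The primitive generators of the rays of `Σ~`. -/
def tildeGen : TildeRay ι s → L × ℤ
  | horizontal b => (F.gen b, 0)
  | vertical => (0, 1)
  | exceptional i => (F.gen (P i), 1)

/-- The cones of `Σ~`, the star subdivision of the fan `{σ × 0, σ × ℝ≥0}` of `X_Σ × 𝔸¹` at the cones
`ρ_i × ℝ≥0`: sets of generators of `σ × ℝ≥0`, to which `(m_i, 1)` may be added if `ρ_i ⊆ σ`, that do
not contain both `(m_i, 0)` and `(0, 1)`. -/
def tildeCones : Set (Finset (TildeRay ι s)) :=
  {T | ∃ σ ∈ F.cones, (∀ b, horizontal b ∈ T → b ∈ σ) ∧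
    (∀ i, ¬(horizontal (P i) ∈ T ∧ vertical ∈ T)) ∧
    ((∀ j, exceptional j ∉ T) ∨ ∃ i, P i ∈ σ ∧ ∀ j, exceptional j ∈ T → j = i)}

/-- The fan `Σ~` in `L × ℤ`. Its toric variety is the blow-up of `X_Σ × 𝔸¹` along the union of the
`D_{ρ_i} × 0`. -/
def tildeFan : SmoothFan (L × ℤ) (TildeRay ι s) where
  gen := tildeGen F P
  cones := tildeCones F P
  empty_mem := ⟨∅, F.empty_mem, by simp, by simp, Or.inl (by simp)⟩
  down_closed := by
    rintro S T ⟨σ, hσ, h1, h2, h3⟩ hST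
    refine ⟨σ, hσ, fun b hb => h1 b (hST hb), fun i hi => h2 i ⟨hST hi.1, hST hi.2⟩, ?_⟩
    rcases h3 with h3 | ⟨i, hi, h3⟩
    · exact Or.inl fun j hj => h3 j (hST hj)
    · exact Or.inr ⟨i, hi, fun j hj => h3 j (hST hj)⟩
  unimodular := by
    classical
    rintro T ⟨σ, hσ, h1, h2, h3⟩ c
    have key : ∀ (c' : ι → ℤ) (t : ℤ), (∀ b, horizontal b ∈ T → c' b = c (horizontal b)) →
        (vertical ∈ T → t = c vertical) →
        (∀ i, exceptional i ∈ T → P i ∈ σ ∧ c' (P i) + t = c (exceptional i)) →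
        ∃ χ : L × ℤ →+ ℤ, ∀ a ∈ T, χ (tildeGen F P a) = c a := by
      intro c' t e1 e2 e3
      obtain ⟨χ, hχ⟩ := F.unimodular σ hσ c'
      refine ⟨χ.comp (AddMonoidHom.fst L ℤ) +
        ((AddMonoidHom.mulLeft t).comp (AddMonoidHom.snd L ℤ)), ?_⟩
      rintro (b | _ | i) ha
      · simp [tildeGen, hχ b (h1 b ha), e1 b ha]
      · simp [tildeGen, e2 ha]
      · obtain ⟨e4, e5⟩ := e3 i ha
        simp [tildeGen, hχ _ e4, e5]
    rcases h3 with h3 | ⟨i, hi, h3⟩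
    · exact key (fun b => c (horizontal b)) (c vertical) (fun _ _ => rfl) (fun _ => rfl)
        (fun i hi => absurd hi (h3 i))
    · by_cases hv : vertical ∈ T
      · refine key (fun b => if b = P i then c (exceptional i) - c vertical else
          c (horizontal b)) (c vertical) (fun b hb => ?_) (fun _ => rfl) (fun j hj => ?_)
        · have : b ≠ P i := by
            rintro rfl
            exact h2 i ⟨hb, hv⟩
          simp [this]
        · obtain rfl := h3 j hj
          exact ⟨hi, by simp⟩
      · refine key (fun b => c (horizontal b)) (c (exceptional i) - c (horizontal (P i)))
          (fun _ _ => rfl) (fun h => absurd h hv) (fun j hj => ?_)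
        obtain rfl := h3 j hj
        exact ⟨hi, by ring⟩

/-- The smallest cone of `Σ` that contains the projection of a cone of `Σ~`. -/
def baseSimplex (T : Finset (TildeRay ι s)) : Finset ι :=
  T.biUnion fun a =>
    match a with
    | horizontal b => {b}
    | vertical => ∅
    | exceptional i => {P i}

theorem horizontal_mem_base {T : Finset (TildeRay ι s)} {b : ι} (h : horizontal b ∈ T) :
    b ∈ baseSimplex P T :=
  Finset.mem_biUnion.2 ⟨_, h, Finset.mem_singleton_self _⟩

theorem exceptional_mem_base {T : Finset (TildeRay ι s)} {i : Fin s} (h : exceptional i ∈ T) :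
    P i ∈ baseSimplex P T :=
  Finset.mem_biUnion.2 ⟨_, h, Finset.mem_singleton_self _⟩

theorem baseSimplex_mem {T : Finset (TildeRay ι s)} (hT : T ∈ tildeCones F P) :
    baseSimplex P T ∈ F.cones := by
  obtain ⟨σ, hσ, h1, h2, h3⟩ := hT
  refine F.down_closed hσ fun b hb => ?_
  obtain ⟨a, ha, hb⟩ := Finset.mem_biUnion.1 hb
  rcases a with c | _ | i
  · rw [Finset.mem_singleton.1 hb]
    exact h1 c ha
  · simp at hb
  · rw [Finset.mem_singleton.1 hb]
    rcases h3 with h3 | ⟨j, hj, h3⟩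
    · exact absurd ha (h3 i)
    · rw [h3 i ha]
      exact hj

def fanProjection : SmoothFan.FanMap (tildeFan F P) F where
  lin := AddMonoidHom.fst L ℤ
  target T := ⟨baseSimplex P T.1, baseSimplex_mem F P T.2⟩
  target_mono _ _ h := Finset.biUnion_subset_biUnion_of_subset_left _ h
  pull_mem := by
    rintro T χ hχ (b | _ | i) ha
    · exact hχ b (horizontal_mem_base P ha)
    · exact (map_zero χ).ge
    · exact hχ (P i) (exceptional_mem_base P ha)

variable (k : Type u) [Field k]

/-- The toric morphism `X_{Σ~} ⟶ X_Σ`. -/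
noncomputable def toBase : (tildeFan F P).toricScheme k ⟶ F.toricScheme k :=
  (fanProjection F P).toricMap k

/-- The toric morphism `X_{Σ~} ⟶ 𝔸¹`. -/
noncomputable def toLine :
    (tildeFan F P).toricScheme k ⟶ Spec (CommRingCat.of (Polynomial k)) :=
  (tildeFan F P).charMap k (AddMonoidHom.snd L ℤ) (by
    rintro (b | _ | i) <;> simp [tildeFan, tildeGen])

noncomputable def lineToSpec :
    Spec (CommRingCat.of (Polynomial k)) ⟶ Spec (CommRingCat.of k) :=
  Spec.map (CommRingCat.ofHom (algebraMap k (Polynomial k)))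

/-- `X_Σ × 𝔸¹`. -/
noncomputable abbrev productWithLine : Scheme.{u} := pullback (F.toSpec k) (lineToSpec k)

/-- The toric blow-up `X_{Σ~} ⟶ X_Σ × 𝔸¹`. -/
noncomputable def blowdown : (tildeFan F P).toricScheme k ⟶ productWithLine F k :=
  pullback.lift (toBase F P k) (toLine F P k)
    (((fanProjection F P).toricMap_toSpec k).trans
      ((tildeFan F P).charMap_toSpec k _ _).symm)

def lineOrigin : Set (Spec (CommRingCat.of (Polynomial k))) :=
  PrimeSpectrum.zeroLocus {(Polynomial.X : Polynomial k)}

/-- The centre of the toric blow-up, the union of the `D_{ρ_i} × 0`. -/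
def normalConeCenter : Set (productWithLine F k) :=
  {z | pullback.snd (F.toSpec k) (lineToSpec k) z ∈ lineOrigin k ∧
    ∃ i, pullback.fst (F.toSpec k) (lineToSpec k) z ∈ F.toricDivisor k (P i)}

end

namespace SmoothFan

variable {L : Type} [AddCommGroup L] (F : SmoothFan L ι) (k : Type u) [Field k]

/-- The toric divisor `D_b` as a reduced scheme. -/
noncomputable def divisorScheme (b : ι) : Scheme.{u} :=
  (Scheme.IdealSheafData.vanishingIdeal (F.toricDivisor k b)).subscheme

noncomputable def divisorInclusion (b : ι) : F.divisorScheme k b ⟶ F.toricScheme k :=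
  (Scheme.IdealSheafData.vanishingIdeal (F.toricDivisor k b)).subschemeι

/-- For a cone `T` containing `b`: the toric stratum `D_T` as a closed subset of `D_b`. -/
noncomputable def divisorStratum (b : ι) (T : Finset ι) : Closeds (F.divisorScheme k b) :=
  (stratum (F.toricDivisor k) T).preimage (F.divisorInclusion k b).continuous

/-- The closed subscheme of `J` is a nonsingular hypersurface in `D_b` that meets the toric boundary
of `D_b` transversally: it contains no toric stratum, and its scheme-theoretic intersection with
each stratum `D_T` (in particular, for `T = {b}`, the hypersurface itself) is nonsingular. -/
structure IsTransverseHypersurface (b : ι) (J : (F.divisorScheme k b).IdealSheafData) :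
    Prop where
  isEffectiveCartier : IsEffectiveCartier J
  not_le : ∀ T ∈ F.cones, b ∈ T → ¬ F.divisorStratum k b T ≤ J.support
  smooth : ∀ T ∈ F.cones, b ∈ T →
    Smooth ((J ⊔ Scheme.IdealSheafData.vanishingIdeal (F.divisorStratum k b T)).subschemeι ≫
      F.divisorInclusion k b ≫ F.toSpec k)

variable [Fintype ι]

open Classical in
noncomputable def link (b : ι) : Finset ι :=
  Finset.univ.filter fun c => c ≠ b ∧ {b, c} ∈ F.cones

/-- In `D_b`, the hypersurface of `J` is linearly equivalent to `∑ a_c (D_c ∩ D_b)`, the sum over the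
rays of the fan `Σ(b)` of `D_b`. Positive and negative coefficients are separated:
`H + ∑ a_c⁻ D_c ∼ ∑ a_c⁺ D_c`. -/
def IsToricRepresentative (b : ι) (J : (F.divisorScheme k b).IdealSheafData) (a : ι → ℤ) :
    Prop :=
  IdealIso
    (J * ∏ c ∈ F.link b,
      (Scheme.IdealSheafData.vanishingIdeal (F.divisorStratum k b {c})) ^ (-a c).toNat)
    (∏ c ∈ F.link b,
      (Scheme.IdealSheafData.vanishingIdeal (F.divisorStratum k b {c})) ^ (a c).toNat)

end SmoothFan

section

variable {n : ℕ} (F : SmoothFan (Fin n → ℤ) ι) {s : ℕ} (P : Fin s → ι)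

/-- `M_ℝ / ℝ ρ`, in which the fan `Σ(ρ)` of `D_ρ` lives. -/
abbrev QuotientByRay (b : ι) : Type :=
  (Fin n → ℝ) ⧸ Submodule.span ℝ {F.realGen b}

/-- `φ` is a piecewise linear function on `Σ(ρ)` corresponding to the hypersurface of `J` in `D_ρ`: it
is linear on the images of the cones containing `ρ`, and it takes the values `a_c` on the primitive
generators of the rays of `Σ(ρ)`, for some toric divisor `∑ a_c D_c` linearly equivalent to the
hypersurface. -/
structure IsSupportFunction (k : Type u) [Field k] [Fintype ι] (b : ι)
    (J : (F.divisorScheme k b).IdealSheafData) (φ : QuotientByRay F b → ℝ) : Prop where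
  piecewise_linear : ∀ T ∈ F.cones, b ∈ T → ∃ h : QuotientByRay F b →ₗ[ℝ] ℝ,
    ∀ x ∈ F.realCone T, φ (Submodule.Quotient.mk x) = h (Submodule.Quotient.mk x)
  values : ∃ a : ι → ℤ, F.IsToricRepresentative k b J a ∧
    ∀ c ∈ F.link b, φ (Submodule.Quotient.mk (F.realGen c)) = a c

/-- The lattice `ℤ ^ n × ℤ` in `ℝ ^ n × ℝ`. -/
def integralPoints (n : ℕ) : AddSubgroup ((Fin n → ℝ) × ℝ) :=
  AddMonoidHom.range (AddMonoidHom.prodMap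
    (AddMonoidHom.compLeft (Int.castAddHom ℝ) (Fin n)) (Int.castAddHom ℝ))

def tildeRealGen (a : TildeRay ι s) : (Fin n → ℝ) × ℝ :=
  (fun j => ((tildeGen F P a).1 j : ℝ), ((tildeGen F P a).2 : ℝ))

variable (k : Type u) [Field k] (J : ∀ i, (F.divisorScheme k (P i)).IdealSheafData)

/-- The strict transform in `X_{Σ~}` of `H_i × 𝔸¹`. -/
noncomputable def tildeHypersurface (i : Fin s) : Closeds ((tildeFan F P).toricScheme k) :=
  strictTransform (blowdown F P k) (normalConeCenter F P k)
    {z | pullback.fst (F.toSpec k) (lineToSpec k) z ∈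
      F.divisorInclusion k (P i) '' ((J i).support : Set (F.divisorScheme k (P i)))}

/-- The centre of the second blow-up, the union of the strict transforms of the `H_i × 𝔸¹`. -/
noncomputable def tildeCenter : Closeds ((tildeFan F P).toricScheme k) :=
  ⟨⋃ i, tildeHypersurface F P k J i, isClosed_iUnion_of_finite fun i =>
    (tildeHypersurface F P k J i).isClosed⟩

variable {X : Scheme.{u}} (π : X ⟶ (tildeFan F P).toricScheme k)

/-- The components of the divisor `D~`: the strict transforms of the toric divisors of `X_{Σ~}`. -/
noncomputable def tildeDivisor (a : TildeRay ι s) : Closeds X :=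
  strictTransform π (tildeCenter F P k J) ((tildeFan F P).toricDivisor k a)

variable [Fintype ι] (D : TildeRay ι s → Closeds X)

/-- The piecewise linear map `Ψ` to `M_ℝ × ℝ≥0` that identifies the cones of the tropicalization with
the cones of `Σ~`. -/
noncomputable def Psi (x : TropSpace D) : (Fin n → ℝ) × ℝ :=
  ∑ a, x.1 a • tildeRealGen F P a

/-- The cone `ρ~` of `Σ~` for a cone `ρ = T` of `Σ` containing the ray `ρ_i`. -/
def cellTilde (i : Fin s) (T : Finset ι) : Finset (TildeRay ι s) :=
  insert (TildeRay.exceptional i) (T.image TildeRay.horizontal)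

def openU : Set (TropSpace D) :=
  {x | ¬ ∃ i, ∃ T ∈ F.cones, P i ∈ T ∧ T.card + 1 = n ∧ x ∈ tropCell D (cellTilde i T)}

/-- The open star of `ρ~_i`. -/
def starTilde (i : Fin s) : Set (TropSpace D) := tropStar D (cellTilde i {P i})

def openV : Set (TropSpace D) := ⋃ i, starTilde P D i

/-- With `Ψ x = (m, r)`, the point `(m + φ_i(π_i(m)) m_i, r)`. -/
noncomputable def shearMap (i : Fin s) (φ : QuotientByRay F (P i) → ℝ) (x : TropSpace D) :
    (Fin n → ℝ) × ℝ :=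
  ((Psi F P D x).1 + φ (Submodule.Quotient.mk (Psi F P D x).1) • F.realGen (P i),
    (Psi F P D x).2)

end

end Degeneration

end TropBlowup

/-!
The proof reduces the geometry of `X~` to the combinatorics of the fan `Σ~`, and then treats the
affine structure as a statement about piecewise linear maps.

*Charts of the second blow-up.* On the chart of a cone of `Σ~` that contains the ray of `(m_i, 0)`
and, as may be assumed, that of `(m_i, 1)`, the strict transform of `H_i × 𝔸¹` has the ideal
`(x, f)`, where `x` is the coordinate of the divisor of `(m_i, 0)`. Here `f` is a Laurent polynomial
`g`, independent of the cone, times a character `m` with `m(m_b) = a_b`, for coefficients `a_b`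
with `H_i ∼ ∑ a_b D_b` (`exists_isEquation`, `exists_isCenterEquation`). On the other charts the
centre is empty. The universal property gives the two charts of the blow-up of `(x, f)`. On the one
where `x` generates, the strict transform of the divisor of `(m_i, 0)` is empty. The one where `f`
generates is again an affine toric variety, with the generators `m_b + a_b m_i` instead of `m_b`
(`IsCenterEquation.shear_universal`, `IsCenterEquation.exists_shear_chart`). In terms of the tori,
the blow-down sends a character `χ` to `g ^ χ(m_i) χ`, which does not depend on the cone.

*Consequences.* The strata of `X~` are indexed by the cones of `Σ~` (`tropCones_tildeDivisor`).
Along the curve of a cone `T` of codimension one, `X~` is locally a toric variety, of the sheared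
fan if `T` contains `(m_i, 0)` and of `Σ~` otherwise. The curve is a projective line, and the
intersection number with `D~_b` is the exponent of the transition function between the two local
equations of `D~_b` (`ProjectiveLineCharts.intersectionNumber_eq`). Hence it is the coefficient of
`b` in the linear relation between the generators of the fan (`intersectionNumber_eq_of_relation`).

*The affine structure.* Since the fan is complete and its cones are unimodular, `Ψ` is a closed
embedding with image the half space. The reference maps are `Ψ` on `U`, and on the star of `ρ~_i`
the map that is linear on cones and sends `D~_b^*` to the generator sheared by `a`. This map is `Ψ`
after a change of the coordinate of `(m_i, 0)`, followed by a translation, hence a local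
homeomorphism to the half space, and injective (`tropMap_shearRealGen_eq_slide`). On cones of codimension one both kinds of
maps satisfy the relation with the intersection numbers, which determines a chart `ψ_T` up to an
integral linear map (`refGen_add_refGen`, `exists_equiv_refGen`); and `U` meets the star of `ρ~_i`
only in interiors of maximal cones. So all charts are compatible. A monomial of `g` is a character
`χ_i` for which the numbers `a_b + χ_i(m_b)` are nonnegative (`IsEquation.exists_char`); with these
coefficients the images of the stars remain disjoint (`unionShear_injOn`).
-/

namespace TropBlowup

noncomputable section

open Scheme
open IdealSheafData (vanishingIdeal coe_support_vanishingIdeal map_ideal)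
open AddMonoidAlgebra (single single_mul_single single_pow induction_linear mapDomainRingHom
  lift_single coeff_single mapDomainRingHom_comp)
open Ideal (span mem_span_singleton map_span subset_span mem_map_of_mem span_le
  span_singleton_le_iff_mem mul_mem_left mem_span_singleton_self span_singleton_one)
open RingHom (ker mem_ker)
open ConcreteCategory (congr_hom)
open Category (assoc id_comp)
open LaurentPolynomial (invert T_add exists_T_pow single_eq_C_mul_T coeff_toLaurent)
open Finset (singleton_subset_iff mem_filter sum_congr mem_insert mem_insert_self subset_insert
  mem_singleton mem_univ mem_singleton_self sum_eq_single mem_insert_of_mem sum_eq_zero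
  sum_add_distrib insert_subset mem_sdiff sum_nonneg prod_insert sum_insert sum_smul)
open CommRingCat (ofHom_comp ofHom)
open AddMonoidHom (fst snd zsmul_apply)
open IsOpenImmersion (lift_fac)
open IsLocalization.Away (lift_eq algebraMap_isUnit surj)
open Ideal.Quotient (eq_zero_iff_mem mk_surjective)
open PrimeSpectrum (mem_vanishingIdeal zeroLocus)
open Localization (Away)
open Submonoid (powers)
open Multiplicative (ofAdd)
open Ideal.Quotient renaming mk → quotMk

local notation "Spec(" R ")" => Spec (CommRingCat.of R)
local notation "SpecMap(" φ ")" => Spec.map (ofHom φ)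

/-! ### Ideals of ideal sheaves on affine charts -/

section

section Charts

variable {X Y : Scheme.{u}} {R S : Type u} [CommRing R] [CommRing S]

theorem top_le_preimage (j : Y ⟶ X) {U : X.Opens} (h : Set.range j ⊆ U) : ⊤ ≤ j ⁻¹ᵁ U :=
  fun x _ => h ⟨x, rfl⟩

theorem range_le_opensRange (j : Y ⟶ X) [IsOpenImmersion j] :
    Set.range j ⊆ (j.opensRange : Set X) :=
  le_rfl

/-- A section over an open set that contains the image of `j : Spec R ⟶ X`, pulled back to `R`. -/
def sectionHom (j : Spec(R) ⟶ X) (U : X.Opens) (h : Set.range j ⊆ U) : Γ(X, U) →+* R :=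
  ((ΓSpecIso (CommRingCat.of R)).hom.hom).comp (j.appLE U ⊤ (top_le_preimage j h)).hom

theorem sectionHom_res (j : Spec(R) ⟶ X) {U V : X.Opens} (hUV : U ≤ V)
    (h : Set.range j ⊆ U) (x : Γ(X, V)) :
    sectionHom j U h ((X.presheaf.map (homOfLE hUV).op).hom x) =
      sectionHom j V (h.trans hUV) x := by
  simp only [sectionHom, RingHom.comp_apply]
  congr 1
  exact congr_hom (Hom.map_appLE j (top_le_preimage j h) (homOfLE hUV).op) x

theorem sectionHom_specMap (α : R →+* S) (j : Spec(R) ⟶ X) {U : X.Opens} (h : Set.range j ⊆ U)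
    (h' : Set.range (SpecMap(α) ≫ j) ⊆ U) (x : Γ(X, U)) :
    sectionHom (SpecMap(α) ≫ j) U h' x = α (sectionHom j U h x) := by
  simp only [sectionHom, RingHom.comp_apply]
  rw [← Hom.appLE_comp_appLE (SpecMap(α)) j U ⊤ ⊤ (top_le_preimage j h) le_top]
  have := Scheme.ΓSpecIso_naturality (ofHom α)
  have h2 := congr_hom this ((j.appLE U ⊤ (top_le_preimage j h)).hom x)
  rw [CommRingCat.comp_apply]
  rw [show Hom.appLE (SpecMap(α)) ⊤ ⊤ le_top = (SpecMap(α)).appTop from Hom.appLE_eq_app _]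
  exact h2

theorem sectionHom_bijective (j : Spec(R) ⟶ X) [IsOpenImmersion j] :
    Function.Bijective (sectionHom j j.opensRange (range_le_opensRange j)) := by
  have : IsIso (j.appLE j.opensRange ⊤ (top_le_preimage j (range_le_opensRange j))) := by
    unfold Hom.appLE
    have := Hom.isIso_app j j.opensRange le_rfl
    have h2 : (⊤ : (Spec(R)).Opens) = j ⁻¹ᵁ j.opensRange := (Hom.preimage_opensRange j).symm
    have h3 : IsIso ((Spec(R)).presheaf.map
      (homOfLE (show (⊤ : (Spec(R)).Opens) ≤ j ⁻¹ᵁ j.opensRange from h2.le)).op) := by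
      have h4 : IsIso (homOfLE (show (⊤ : (Spec(R)).Opens) ≤
        j ⁻¹ᵁ j.opensRange from h2.le)) := ⟨homOfLE h2.ge, by simp, by simp⟩
      infer_instance
    exact IsIso.comp_isIso
  exact (ConcreteCategory.bijective_of_isIso (ΓSpecIso (CommRingCat.of R)).hom).comp
    (ConcreteCategory.bijective_of_isIso _)

/-- The inverse image of an ideal sheaf under `j : Spec R ⟶ X`, as an ideal of `R`. -/
def chartIdeal (j : Spec(R) ⟶ X) (I : X.IdealSheafData) : Ideal R :=
  ((I.comap j).ideal ⟨⊤, isAffineOpen_top _⟩).map (ΓSpecIso (CommRingCat.of R)).hom.hom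

theorem comap_ideal_top [IsAffine X] [IsAffine Y] (f : X ⟶ Y) (I : Y.IdealSheafData) :
    (I.comap f).ideal ⟨⊤, isAffineOpen_top X⟩ =
      (I.ideal ⟨⊤, isAffineOpen_top Y⟩).map f.appTop.hom := by
  apply le_antisymm
  · have h : I.comap f ≤
        IdealSheafData.ofIdealTop ((I.ideal ⟨⊤, isAffineOpen_top Y⟩).map f.appTop.hom) := by
      rw [← IdealSheafData.le_map_iff_comap_le]
      apply IdealSheafData.le_of_isAffine
      rw [IdealSheafData.ideal_map_of_isAffineHom]
      rw [← Ideal.map_le_iff_le_comap]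
      have h1 : ∀ K : Ideal Γ(X, ⊤), K ≤ (IdealSheafData.ofIdealTop K).ideal
          ⟨⊤, isAffineOpen_top X⟩ := fun K => by simp
      exact h1 _
    have h2 := h ⟨⊤, isAffineOpen_top X⟩
    refine h2.trans ?_
    simp
  · rw [Ideal.map_le_iff_le_comap]
    have h := I.le_map_comap f ⟨⊤, isAffineOpen_top Y⟩
    rw [IdealSheafData.ideal_map_of_isAffineHom] at h
    exact h

theorem chartIdeal_specMap (α : R →+* S) (j : Spec(R) ⟶ X) (I : X.IdealSheafData) :
    chartIdeal (SpecMap(α) ≫ j) I = (chartIdeal j I).map α := by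
  rw [chartIdeal, chartIdeal, IdealSheafData.comap_comp, comap_ideal_top, Ideal.map_map,
    Ideal.map_map, ← CommRingCat.hom_comp]
  rw [Scheme.ΓSpecIso_naturality (ofHom α)]
  rfl

theorem chartIdeal_comap (j : Spec(R) ⟶ X) (f : X ⟶ Y) (I : Y.IdealSheafData) :
    chartIdeal j (I.comap f) = chartIdeal (j ≫ f) I := by
  rw [chartIdeal, chartIdeal, IdealSheafData.comap_comp]

theorem chartIdeal_opensRange (j : Spec(R) ⟶ X) [IsOpenImmersion j]
    (I : X.IdealSheafData) {U : X.Opens} (hU : IsAffineOpen U) (h : Set.range j ⊆ U) :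
    chartIdeal j I = (I.ideal ⟨U, hU⟩).map (sectionHom j U h) := by
  have h1 : j ''ᵁ ⊤ ≤ U := by rw [Hom.image_top_eq_opensRange]; exact h
  rw [chartIdeal, IdealSheafData.ideal_comap_of_isOpenImmersion]
  rw [← map_ideal I
    (U := ⟨j ''ᵁ ⊤, (isAffineOpen_top _).image_of_isOpenImmersion j⟩) (V := ⟨U, hU⟩) h1]
  have e : ∀ K : Ideal Γ(X, j ''ᵁ ⊤), K.comap (j.appIso ⊤).inv.hom = K.map (j.appIso ⊤).hom.hom :=
    fun K => (Ideal.map_comap_of_equiv (j.appIso ⊤).commRingCatIsoToRingEquiv).symm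
  rw [e, Ideal.map_map, Ideal.map_map]
  congr 1
  rw [RingHom.comp_assoc, sectionHom]
  congr 1
  rw [← CommRingCat.hom_comp, Hom.appIso_hom']
  rw [Hom.map_appLE]

theorem range_fromSpec_le {U : X.Opens} (hU : IsAffineOpen U) : Set.range hU.fromSpec ⊆ U := by
  rw [hU.range_fromSpec]

theorem sectionHom_fromSpec {U : X.Opens} (hU : IsAffineOpen U) (x : Γ(X, U)) :
    sectionHom (R := Γ(X, U)) hU.fromSpec U (range_fromSpec_le hU) x = x := by
  simp only [sectionHom, RingHom.comp_apply, Hom.appLE, CommRingCat.comp_apply]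
  rw [IsAffineOpen.fromSpec_app_self]
  simp only [CommRingCat.comp_apply]
  have e : ∀ (V : (Spec Γ(X, U)).Opens) (h : V = ⊤) (y : Γ(Spec Γ(X, U), ⊤)),
    ((Spec Γ(X, U)).presheaf.map (homOfLE h.ge).op).hom
      (((Spec Γ(X, U)).presheaf.map (eqToHom h).op).hom y) = y := by
    rintro _ rfl y
    simp
  erw [e _ hU.fromSpec_preimage_self]
  exact CategoryTheory.Iso.inv_hom_id_apply (ΓSpecIso Γ(X, U)) x

/-- A morphism from an affine scheme to an affine open set is given by its ring homomorphism. -/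
theorem specMap_sectionHom (j : Spec(R) ⟶ X) {U : X.Opens} (hU : IsAffineOpen U)
    (h : Set.range j ⊆ U) :
    SpecMap(sectionHom j U h) ≫ hU.fromSpec = j := by
  have h1 : IsOpenImmersion.lift hU.fromSpec j (by rw [hU.range_fromSpec]; exact h) ≫
      hU.fromSpec = j := lift_fac _ _ _
  obtain ⟨β, hβ⟩ := Spec.map_surjective
    (IsOpenImmersion.lift hU.fromSpec j (by rw [hU.range_fromSpec]; exact h))
  rw [← hβ] at h1
  have h2 : sectionHom j U h = β.hom := by
    ext x
    have h3 := sectionHom_specMap (R := Γ(X, U)) (S := R) β.hom hU.fromSpec (range_fromSpec_le hU)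
      (by rw [CommRingCat.ofHom_hom]; erw [h1]; exact h) x
    rw [sectionHom_fromSpec] at h3
    rw [← h3]
    congr 1
    congr 1
    exact h1.symm
  rw [h2]
  exact h1

theorem chartIdeal_fromSpec (I : X.IdealSheafData) {U : X.Opens} (hU : IsAffineOpen U) :
    chartIdeal (R := Γ(X, U)) hU.fromSpec I = I.ideal ⟨U, hU⟩ := by
  have h2 := chartIdeal_opensRange (R := Γ(X, U)) hU.fromSpec I hU (range_fromSpec_le hU)
  refine h2.trans ?_
  have h3 : sectionHom (R := Γ(X, U)) hU.fromSpec U (range_fromSpec_le hU) = RingHom.id _ :=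
    RingHom.ext fun x => sectionHom_fromSpec hU x
  rw [h3]
  exact Ideal.map_id _

variable (j : Spec(R) ⟶ X)

/-- The image of an affine chart, as an affine open set. -/
abbrev chartOpen [IsOpenImmersion j] : X.affineOpens := ⟨j.opensRange, isAffineOpen_opensRange j⟩

theorem mem_chartIdeal_iff [IsOpenImmersion j] (I : X.IdealSheafData) (x : Γ(X, j.opensRange)) :
    sectionHom j j.opensRange (range_le_opensRange j) x ∈ chartIdeal j I ↔
      x ∈ I.ideal (chartOpen j) := by
  have hA := isAffineOpen_opensRange j
  rw [chartIdeal_opensRange j I (isAffineOpen_opensRange j) (range_le_opensRange j)]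
  let e := RingEquiv.ofBijective _ (sectionHom_bijective j)
  have : (I.ideal (chartOpen j)).map (sectionHom j j.opensRange (range_le_opensRange j)) =
      (I.ideal (chartOpen j)).map (e : Γ(X, j.opensRange) →+* R) := rfl
  rw [this]
  refine ⟨fun h => ?_, fun h => mem_map_of_mem (e : Γ(X, j.opensRange) →+* R) h⟩
  obtain ⟨y, hy, h2⟩ := (Ideal.mem_map_of_equiv e _).1 h
  rwa [← e.injective h2]

theorem chartIdeal_mul [IsOpenImmersion j] (I J : X.IdealSheafData) :
    chartIdeal j (I * J) = chartIdeal j I * chartIdeal j J := by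
  simp only [chartIdeal_opensRange j _ (isAffineOpen_opensRange j) (range_le_opensRange j),
    IdealSheafData.ideal_mul, Pi.mul_apply, Ideal.map_mul]

theorem chartIdeal_top : chartIdeal j ⊤ = ⊤ := by
  rw [chartIdeal, IdealSheafData.comap_top]
  simp [Ideal.map_top]

theorem chartIdeal_sup (I J : X.IdealSheafData) :
    chartIdeal j (I ⊔ J) = chartIdeal j I ⊔ chartIdeal j J := by
  simp only [chartIdeal, IdealSheafData.comap_sup, IdealSheafData.ideal_sup, Pi.sup_apply,
    Ideal.map_sup]

theorem chartIdeal_pow [IsOpenImmersion j] (I : X.IdealSheafData) (m : ℕ) :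
    chartIdeal j (I ^ m) = chartIdeal j I ^ m := by
  simp only [chartIdeal_opensRange j _ (isAffineOpen_opensRange j) (range_le_opensRange j),
    IdealSheafData.ideal_pow, Pi.pow_apply, Ideal.map_pow]

theorem chartIdeal_prod [IsOpenImmersion j] {β : Type} (s : Finset β) (I : β → X.IdealSheafData) :
    chartIdeal j (∏ b ∈ s, I b) = ∏ b ∈ s, chartIdeal j (I b) := by
  classical
  induction s using Finset.induction_on with
  | empty => simpa using chartIdeal_top j
  | insert b s hb ih => rw [prod_insert hb, prod_insert hb, chartIdeal_mul, ih]

theorem mem_support_chart (I : X.IdealSheafData) (p : Spec(R)) :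
    j p ∈ I.support ↔ chartIdeal j I ≤ p.asIdeal := by
  have h1 : j p ∈ I.support ↔ p ∈ (I.comap j).support := by rw [IdealSheafData.support_comap]; rfl
  rw [h1, chartIdeal, IdealSheafData.mem_support_iff_of_mem
    (U := ⟨⊤, isAffineOpen_top _⟩) (show p ∈ (⊤ : (Spec(R)).Opens) from trivial)]
  rw [Ideal.map_le_iff_le_comap]
  simp only [Scheme.mem_zeroLocus_iff]
  constructor
  · intro h x hx
    have h2 := h x hx
    by_contra h3
    apply h2
    have h4 : x = (ΓSpecIso (CommRingCat.of R)).inv.hom ((ΓSpecIso (CommRingCat.of R)).hom.hom x) :=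
        (CategoryTheory.Iso.hom_inv_id_apply (ΓSpecIso (CommRingCat.of R)) x).symm
    rw [h4, AlgebraicGeometry.basicOpen_eq_of_affine]
    exact h3
  · intro h x hx h2
    have h4 : x = (ΓSpecIso (CommRingCat.of R)).inv.hom ((ΓSpecIso (CommRingCat.of R)).hom.hom x) :=
        (CategoryTheory.Iso.hom_inv_id_apply (ΓSpecIso (CommRingCat.of R)) x).symm
    rw [h4, AlgebraicGeometry.basicOpen_eq_of_affine] at h2
    exact h2 (h hx)

end Charts

end

local notation "I(" j "," Z ")" => chartIdeal j (vanishingIdeal Z)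

/-! ### Vanishing ideals and effective Cartier divisors on charts -/

section

section Charts

variable {X Y : Scheme.{u}} {R S : Type u} [CommRing R] [CommRing S]

theorem fromSpec_specMap_sectionHom (j : Spec(R) ⟶ X) {U : X.Opens}
    (hU : IsAffineOpen U) (h : Set.range j ⊆ U) (p : Spec(R)) :
    hU.fromSpec (SpecMap(sectionHom j U h) p) = j p := by
  rw [← Hom.comp_apply]
  exact congrArg (fun f : Spec(R) ⟶ X => f p) (specMap_sectionHom j hU h)

theorem chartIdeal_vanishingIdeal (j : Spec(R) ⟶ X) [IsOpenImmersion j] (Z : Closeds X) : I(j, Z) =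
      PrimeSpectrum.vanishingIdeal (R := R) (j ⁻¹' (Z : Set X)) := by
  have hU := isAffineOpen_opensRange j
  let e := RingEquiv.ofBijective _ (sectionHom_bijective j)
  have hj := fromSpec_specMap_sectionHom j hU (range_le_opensRange j)
  ext r
  obtain ⟨x, rfl⟩ := (sectionHom_bijective j).surjective r
  rw [mem_chartIdeal_iff, IdealSheafData.vanishingIdeal_ideal, mem_vanishingIdeal,
    mem_vanishingIdeal]
  constructor
  · intro h p hp
    refine h (SpecMap(sectionHom j _ (range_le_opensRange j)) p) ?_
    have h3 : j p ∈ (Z : Set X) := hp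
    rw [← hj p] at h3
    exact h3
  · intro h q hq
    obtain ⟨p, hp⟩ : ∃ p, Spec.map (ofHom (sectionHom j _ (range_le_opensRange j))) p = q :=
      ⟨PrimeSpectrum.comap (e.symm : R →+* Γ(X, j.opensRange)) q, by
        apply PrimeSpectrum.ext
        ext y
        show e.symm (e y) ∈ q.asIdeal ↔ _
        rw [e.symm_apply_apply]⟩
    rw [← hp] at hq ⊢
    have h3 : hU.fromSpec _ ∈ (Z : Set X) := hq
    rw [hj p] at h3
    exact h p h3

theorem isEffectiveCartier_of_charts {I : X.IdealSheafData}
    (h : ∀ x : X, ∃ (R : Type u) (_ : CommRing R) (j : Spec(R) ⟶ X)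
      (_ : IsOpenImmersion j), x ∈ Set.range j ∧
        ∃ g ∈ nonZeroDivisors R, chartIdeal j I = span {g}) : IsEffectiveCartier I := by
  intro x
  obtain ⟨R, _, j, _, hx, g, hg, hI⟩ := h x
  obtain ⟨y, rfl⟩ := (sectionHom_bijective j).surjective g
  refine ⟨(chartOpen j), hx, y, ?_, ?_⟩
  · rw [mem_nonZeroDivisors_iff_right] at hg ⊢
    intro z hz
    apply (sectionHom_bijective j).injective
    rw [map_zero]
    apply hg
    rw [← map_mul, hz, map_zero]
  · ext z
    rw [← mem_chartIdeal_iff, hI, mem_span_singleton, mem_span_singleton]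
    constructor
    · rintro ⟨w, hw⟩
      obtain ⟨v, rfl⟩ := (sectionHom_bijective j).surjective w
      exact ⟨v, (sectionHom_bijective j).injective (by rw [hw, map_mul])⟩
    · rintro ⟨w, rfl⟩
      exact ⟨_, map_mul _ _ _⟩

theorem flat_res {U V : X.Opens} (hU : IsAffineOpen U) (hV : IsAffineOpen V) (h : U ≤ V) :
    (X.presheaf.map (homOfLE h).op).hom.Flat := by
  have h1 := Flat.flat_appLE (f := 𝟙 X) hV hU h
  have h2 : (𝟙 X : X ⟶ X).appLE V U h = X.presheaf.map (homOfLE h).op := by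
    simp only [Hom.appLE, Hom.id_app]
    exact id_comp _
  rw [h2] at h1
  exact h1

theorem nonZeroDivisors_of_flat {α : R →+* S} (h : α.Flat) {x : R}
    (hx : x ∈ nonZeroDivisors R) : α x ∈ nonZeroDivisors S := by
  algebraize [α]
  have : Module.Flat R S := h
  have h2 : IsSMulRegular R x := fun a b hab => (mul_cancel_left_mem_nonZeroDivisors hx).1 hab
  have h3 : IsSMulRegular S x := h2.of_flat
  rw [mem_nonZeroDivisors_iff_right]
  intro z hz
  refine h3 (?_ : x • z = x • 0)
  rw [smul_zero, Algebra.smul_def, mul_comm]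
  exact hz

end Charts

end

/-! ### Charts of a blow-up -/

section

section BlowupCharts

variable {X Y : Scheme.{u}} {A R : Type u} [CommRing A] [CommRing R]

theorem exists_chart_mem (x : X) (U : X.Opens) (hx : x ∈ U) :
    ∃ (B : Type u) (_ : CommRing B) (j : Spec(B) ⟶ X) (_ : IsOpenImmersion j),
      x ∈ Set.range j ∧ Set.range j ⊆ U := by
  obtain ⟨_, ⟨V, hV, rfl⟩, hxV, hVU⟩ := X.isBasis_affineOpens.exists_subset_of_mem_open hx U.isOpen
  have hV' : IsAffineOpen V := hV
  refine ⟨Γ(X, V), inferInstance, hV'.fromSpec, inferInstance, ?_, ?_⟩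
  · rw [hV'.range_fromSpec]; exact hxV
  · rw [hV'.range_fromSpec]; exact hVU

/-- The points of `X` over the chart `c : Spec A ⟶ Y` near which the inverse image of the ideal sheaf
`I` is an effective Cartier divisor with the equation `a ∈ A`. -/
def generatorLocus (π : X ⟶ Y) (I : Y.IdealSheafData) (c : Spec(A) ⟶ Y) (a : A) : Set X :=
  {x | ∃ (B : Type u) (_ : CommRing B) (j : Spec(B) ⟶ X)
    (_ : IsOpenImmersion j) (β : A →+* B), x ∈ Set.range j ∧
      j ≫ π = SpecMap(β) ≫ c ∧ β a ∈ nonZeroDivisors B ∧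
      chartIdeal j (I.comap π) = span {β a}}

/-- Around a point over an affine chart of the base, an effective Cartier divisor has one equation
on an affine chart that maps to the given one. -/
theorem exists_chart_over {π : X ⟶ Y} {E : X.IdealSheafData} (hE : IsEffectiveCartier E)
    (c : Spec(A) ⟶ Y) [IsOpenImmersion c] {x : X} (hx : π x ∈ Set.range c) :
    ∃ (B : Type u) (_ : CommRing B) (j : Spec(B) ⟶ X) (_ : IsOpenImmersion j)
      (β : A →+* B) (e : B), x ∈ Set.range j ∧
      j ≫ π = SpecMap(β) ≫ c ∧ e ∈ nonZeroDivisors B ∧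
      chartIdeal j E = span {e} := by
  obtain ⟨U, hxU, e, he, hEe⟩ := hE x
  obtain ⟨_, ⟨V, hV, rfl⟩, hxV, hVU⟩ := X.isBasis_affineOpens.exists_subset_of_mem_open
      (show x ∈ U.1 ⊓ π ⁻¹ᵁ c.opensRange from ⟨hxU, hx⟩) (U.1 ⊓ π ⁻¹ᵁ c.opensRange).isOpen
  have hV1 : V ≤ U.1 := fun y hy => (hVU hy).1
  have hV' : IsAffineOpen V := hV
  have hr : Set.range (hV'.fromSpec ≫ π) ⊆ Set.range c := by
    rintro _ ⟨y, rfl⟩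
    have h1 : hV'.fromSpec y ∈ (V : Set X) := by rw [← hV'.range_fromSpec]; exact ⟨y, rfl⟩
    exact (hVU h1).2
  obtain ⟨β, hβ⟩ := Spec.map_surjective (IsOpenImmersion.lift c (hV'.fromSpec ≫ π) hr)
  refine ⟨Γ(X, V), inferInstance, hV'.fromSpec, inferInstance, β.hom,
    (X.presheaf.map (homOfLE hV1).op).hom e, ?_, ?_, ?_, ?_⟩
  · rw [hV'.range_fromSpec]; exact hxV
  · rw [CommRingCat.ofHom_hom]
    erw [hβ]
    exact (lift_fac _ _ _).symm
  · exact nonZeroDivisors_of_flat (flat_res hV' U.2 hV1) he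
  · rw [chartIdeal_fromSpec, ← map_ideal E (U := ⟨V, hV⟩) (V := U) hV1, hEe,
      map_span, Set.image_singleton]
    rfl

theorem mem_generatorLocus_of_notMem {π : X ⟶ Y} {I : Y.IdealSheafData}
    {c : Spec(A) ⟶ Y} {B : Type u} [CommRing B]
    (j : Spec(B) ⟶ X) [IsOpenImmersion j] (β : A →+* B) {e : B}
    (hj : j ≫ π = SpecMap(β) ≫ c) (he : e ∈ nonZeroDivisors B)
    (hE : chartIdeal j (I.comap π) = span {e}) {a : A} {a' : B} (ha : β a = e * a')
    (q : Spec(B)) (hq : a' ∉ q.asIdeal) :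
    j q ∈ generatorLocus π I c a := by
  let L := Away a'
  have hop : IsOpenImmersion (SpecMap(algebraMap B L)) :=
    IsOpenImmersion.of_isLocalization (S := L) a'
  have hu : IsUnit (algebraMap B L a') := algebraMap_isUnit a'
  refine ⟨L, inferInstance, SpecMap(algebraMap B L) ≫ j, inferInstance,
    (algebraMap B L).comp β, ?_, ?_, ?_, ?_⟩
  · have h1 : q ∈ Set.range (SpecMap(algebraMap B L)) := by
      have := PrimeSpectrum.localization_away_comap_range L a'
      exact this.ge hq
    obtain ⟨p, rfl⟩ := h1
    exact ⟨p, Hom.comp_apply _ _ _⟩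
  · rw [assoc, hj, ← assoc, ← Spec.map_comp, ← ofHom_comp]
  · rw [RingHom.comp_apply, ha, map_mul]
    refine mul_mem ?_ hu.mem_nonZeroDivisors
    exact IsLocalization.map_nonZeroDivisors_le (powers a') L ⟨e, he, rfl⟩
  · rw [chartIdeal_specMap, hE, map_span, Set.image_singleton, RingHom.comp_apply, ha, map_mul]
    exact (Ideal.span_singleton_mul_right_unit hu _).symm

theorem generatorLocus_cover {π : X ⟶ Y} {I : Y.IdealSheafData} (hE : IsEffectiveCartier (I.comap π))
    (c : Spec(A) ⟶ Y) [IsOpenImmersion c] {a b : A}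
    (hI : chartIdeal c I = span {a, b}) {x : X} (hx : π x ∈ Set.range c) :
    x ∈ generatorLocus π I c a ∨ x ∈ generatorLocus π I c b := by
  obtain ⟨B, _, j, _, β, e, ⟨q, rfl⟩, hj, he, hEe⟩ := exists_chart_over hE c hx
  have h1 : span {e} = span {β a, β b} := by
    rw [← hEe, chartIdeal_comap, hj, chartIdeal_specMap, hI, map_span, Set.image_pair]
  have h2 : β a ∈ span {e} := by rw [h1]; exact subset_span (by simp)
  have h3 : β b ∈ span {e} := by rw [h1]; exact subset_span (by simp)
  obtain ⟨a', ha'⟩ := mem_span_singleton.1 h2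
  obtain ⟨b', hb'⟩ := mem_span_singleton.1 h3
  have h4 : e ∈ span {β a, β b} := by rw [← h1]; exact mem_span_singleton_self e
  obtain ⟨r, s, hrs⟩ := Ideal.mem_span_pair.1 h4
  have h5 : r * a' + s * b' = 1 := by
    have : e * (r * a' + s * b') = e * 1 := by
      rw [ha', hb'] at hrs
      linear_combination hrs
    exact (mul_cancel_left_mem_nonZeroDivisors he).1 this
  by_cases hqa : a' ∈ q.asIdeal
  · right
    refine mem_generatorLocus_of_notMem j β hj he hEe hb' q fun hqb => ?_
    apply q.2.ne_top
    rw [Ideal.eq_top_iff_one, ← h5]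
    exact add_mem (mul_mem_left _ _ hqa) (mul_mem_left _ _ hqb)
  · exact Or.inl (mem_generatorLocus_of_notMem j β hj he hEe ha' q hqa)

theorem IsBlowup.hom_ext {π : X ⟶ Y} {I : Y.IdealSheafData} (hπ : IsBlowup π I) {W : Scheme.{u}}
    {g g' : W ⟶ X} (h : g ≫ π = g' ≫ π) (hW : IsEffectiveCartier (I.comap (g ≫ π))) : g = g' :=
  (hπ.existsUnique_lift W (g ≫ π) hW).unique rfl h.symm

theorem isEffectiveCartier_spec {I : (Spec(R)).IdealSheafData} {a : R}
    (ha : a ∈ nonZeroDivisors R) (hI : chartIdeal (𝟙 _) I = span {a}) :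
    IsEffectiveCartier I :=
  isEffectiveCartier_of_charts fun x =>
    ⟨R, inferInstance, 𝟙 _, inferInstance, ⟨x, by simp⟩, a, ha, hI⟩

theorem isEffectiveCartier_comap_spec {I : X.IdealSheafData} (j : Spec(R) ⟶ X)
    {a : R} (ha : a ∈ nonZeroDivisors R) (hI : chartIdeal j I = span {a}) :
    IsEffectiveCartier (I.comap j) :=
  isEffectiveCartier_spec ha (by rw [chartIdeal_comap, id_comp, hI])

theorem specMap_ringHom_injective {α β : A →+* R} (h : SpecMap(α) = SpecMap(β)) : α = β := by
  have := Spec.map_injective h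
  exact congrArg (·.hom) this

theorem exists_specMap_eq (f : Spec(R) ⟶ Spec(A)) : ∃ α : A →+* R, f = SpecMap(α) := by
  obtain ⟨β, hβ⟩ := Spec.map_surjective f
  exact ⟨β.hom, hβ.symm⟩

/-- Charts of a blow-up. Over an affine chart of the base with ring `A`, on which the centre has the
ideal `(a, b)`, let `R` be universal among the `A`-algebras in which `a` is a nonzerodivisor that
divides `b`. Then `Spec R` is the open part of the blow-up on which `a` generates the inverse image
ideal. -/
theorem IsBlowup.exists_chart {π : X ⟶ Y} {I : Y.IdealSheafData} (hπ : IsBlowup π I)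
    (c : Spec(A) ⟶ Y) [IsOpenImmersion c] {a b : A}
    (hI : chartIdeal c I = span {a, b}) (α : A →+* R) (ha : α a ∈ nonZeroDivisors R)
    (hb : α b ∈ span {α a})
    (huniv : ∀ (B : Type u) [CommRing B] (β : A →+* B), β a ∈ nonZeroDivisors B →
      β b ∈ span {β a} → ∃! γ : R →+* B, γ.comp α = β) :
    ∃ j : Spec(R) ⟶ X, IsOpenImmersion j ∧
      j ≫ π = SpecMap(α) ≫ c ∧ Set.range j = generatorLocus π I c a ∧
      chartIdeal j (I.comap π) = span {α a} := by
  have hpair : ∀ (B : Type u) [CommRing B] (β : A →+* B), β b ∈ span {β a} →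
      chartIdeal (SpecMap(β) ≫ c) I = span {β a} := by
    intro B _ β hβ
    rw [chartIdeal_specMap, hI, map_span, Set.image_pair]
    apply le_antisymm
    · rw [span_le]
      rintro _ (rfl | rfl)
      · exact mem_span_singleton_self _
      · exact hβ
    · exact Ideal.span_mono (by simp)
  obtain ⟨j, hj, -⟩ := hπ.existsUnique_lift _ (SpecMap(α) ≫ c)
    (isEffectiveCartier_comap_spec _ ha (hpair R α hb))
  replace hj : j ≫ π = SpecMap(α) ≫ c := hj
  have hjE : chartIdeal j (I.comap π) = span {α a} := by rw [chartIdeal_comap, hj, hpair R α hb]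
  have hrange : Set.range j ⊆ generatorLocus π I c a := by
    rintro _ ⟨p, rfl⟩
    have hx : π (j p) ∈ Set.range c := by
      rw [← Hom.comp_apply, hj]
      exact ⟨_, (Hom.comp_apply _ _ _).symm⟩
    obtain ⟨B, _, j0, _, β, e, ⟨q, hq⟩, hj0, he, hEe⟩ :=
      exists_chart_over hπ.isEffectiveCartier c hx
    have h1 : span {e} = span {β a, β b} := by
      rw [← hEe, chartIdeal_comap, hj0, chartIdeal_specMap, hI, map_span, Set.image_pair]
    have h2 : β a ∈ span {e} := by rw [h1]; exact subset_span (by simp)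
    obtain ⟨a', ha'⟩ := mem_span_singleton.1 h2
    rw [← hq]
    refine mem_generatorLocus_of_notMem j0 β hj0 he hEe ha' q fun hqa => ?_
    -- an affine neighbourhood of `p` that is mapped into the chart `j0`
    obtain ⟨W, _, ι, _, ⟨p', hp'⟩, hr⟩ := exists_chart_mem p (j ⁻¹ᵁ j0.opensRange) ⟨q, hq⟩
    obtain ⟨γ, rfl⟩ := exists_specMap_eq ι
    replace hr : Set.range (SpecMap(γ) ≫ j) ⊆ Set.range j0 := by
      rintro _ ⟨y, rfl⟩
      exact hr ⟨y, rfl⟩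
    obtain ⟨δ, hδ⟩ := exists_specMap_eq (IsOpenImmersion.lift j0 (SpecMap(γ) ≫ j) hr)
    have hfac : SpecMap(δ) ≫ j0 = SpecMap(γ) ≫ j := by rw [← hδ]; exact lift_fac _ _ _
    have hcomp : δ.comp β = γ.comp α := by
      apply specMap_ringHom_injective
      rw [← cancel_mono c, ofHom_comp, ofHom_comp, Spec.map_comp,
        Spec.map_comp, assoc, assoc, ← hj, ← hj0, reassoc_of% hfac]
    have hflat : γ.Flat := by
      have h4 : Flat (SpecMap(γ)) := inferInstance
      exact (HasRingHomProperty.Spec_iff (P := @Flat)).1 h4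
    have hnz : γ (α a) ∈ nonZeroDivisors _ := nonZeroDivisors_of_flat hflat ha
    have hs : span {γ (α a)} = span {δ e} := by
      have h5 := congrArg (chartIdeal · (I.comap π)) hfac
      rw [chartIdeal_specMap, chartIdeal_specMap, hEe, hjE, map_span, map_span,
        Set.image_singleton, Set.image_singleton] at h5
      exact h5.symm
    have h6 : γ (α a) = δ e * δ a' := by
      rw [← map_mul, ← ha']; exact (RingHom.congr_fun hcomp a).symm
    have h7 : δ e ∈ span {γ (α a)} := by rw [hs]; exact mem_span_singleton_self _
    obtain ⟨w, hw⟩ := mem_span_singleton.1 h7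
    have h8 : IsUnit (δ a') := by
      refine IsUnit.of_mul_eq_one w ?_
      refine (mul_cancel_left_mem_nonZeroDivisors hnz).1 ?_
      rw [mul_one]
      calc γ (α a) * (δ a' * w) = (γ (α a) * w) * δ a' := by ring
        _ = δ e * δ a' := by rw [← hw]
        _ = _ := h6.symm
    have h9 : SpecMap(δ) p' = q := by
      apply j0.isOpenEmbedding.injective
      rw [← Hom.comp_apply, hfac, Hom.comp_apply, hp', hq]
    rw [← h9] at hqa
    have h10 : δ a' ∈ p'.asIdeal := hqa
    exact p'.2.ne_top (Ideal.eq_top_of_isUnit_mem _ h10 h8)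
  have hfactor : ∀ (B : Type u) [CommRing B] (j0 : Spec(B) ⟶ X)
      [IsOpenImmersion j0] (β : A →+* B), j0 ≫ π = SpecMap(β) ≫ c →
      β a ∈ nonZeroDivisors B → chartIdeal j0 (I.comap π) = span {β a} →
      ∃ γ : R →+* B, SpecMap(γ) ≫ j = j0 := by
    intro B _ j0 _ β hj0 hβ hE
    have hbB : β b ∈ span {β a} := by
      rw [← hE, chartIdeal_comap, hj0, chartIdeal_specMap, hI]
      exact mem_map_of_mem _ (subset_span (by simp))
    obtain ⟨γ, hγ, -⟩ := huniv B β hβ hbB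
    have h1 : (SpecMap(γ) ≫ j) ≫ π = j0 ≫ π := by
      rw [assoc, hj, hj0, ← hγ, ofHom_comp, Spec.map_comp, assoc]
    refine ⟨γ, hπ.hom_ext h1 ?_⟩
    rw [h1]
    refine isEffectiveCartier_comap_spec _ hβ ?_
    rw [← chartIdeal_comap, hE]
  refine ⟨j, ?_, hj, ?_, hjE⟩
  · -- two lifts of an open part of a chart to `Spec R` agree
    have hlift : ∀ (W : Scheme.{u}) (g g' : W ⟶ Spec(R)) [IsOpenImmersion g],
        g ≫ j = g' ≫ j → g = g' := by
      intro W g g' _ hg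
      refine Scheme.hom_ext_of_forall g g' fun x => ?_
      obtain ⟨B, _, w, _, hx, -⟩ := exists_chart_mem x ⊤ trivial
      refine ⟨w.opensRange, hx, ?_⟩
      obtain ⟨γ, hγ⟩ := exists_specMap_eq (w ≫ g)
      obtain ⟨γ', hγ'⟩ := exists_specMap_eq (w ≫ g')
      have h1 : w ≫ g ≫ j = w ≫ g' ≫ j := by rw [hg]
      have h2 : γ.comp α = γ'.comp α := by
        apply specMap_ringHom_injective
        rw [← cancel_mono c, ofHom_comp, ofHom_comp, Spec.map_comp,
          Spec.map_comp, assoc, assoc, ← hj, ← hγ, ← hγ', assoc,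
          assoc, reassoc_of% h1]
      have hflat : γ.Flat := by
        have h4 : Flat (SpecMap(γ)) := by rw [← hγ]; infer_instance
        exact (HasRingHomProperty.Spec_iff (P := @Flat)).1 h4
      have h3 : γ = γ' := by
        refine (huniv B (γ.comp α) (nonZeroDivisors_of_flat hflat ha) ?_).unique rfl h2.symm
        have := mem_map_of_mem γ hb
        rwa [map_span, Set.image_singleton] at this
      have h4 : w ≫ g = w ≫ g' := by rw [hγ, hγ', h3]
      rw [← cancel_epi w.isoOpensRange.hom, ← assoc, ← assoc, Hom.isoOpensRange_hom_ι, h4]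
    have hloc : ∀ p : Spec(R), ∃ O : (Spec(R)).Opens,
        p ∈ O ∧ (∀ q, j q = j p → q ∈ O) ∧ IsOpenImmersion (O.ι ≫ j) := by
      intro p
      obtain ⟨B, _, j0, _, β, ⟨q, hq⟩, hj0, hβ, hE⟩ := hrange ⟨p, rfl⟩
      obtain ⟨γ, hγ⟩ := hfactor B j0 β hj0 hβ hE
      let m := SpecMap(γ)
      let O := j ⁻¹ᵁ j0.opensRange
      have hr : Set.range (O.ι ≫ j) ⊆ Set.range j0 := by
        rintro _ ⟨⟨y, hy⟩, rfl⟩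
        exact hy
      let l := IsOpenImmersion.lift j0 (O.ι ≫ j) hr
      have hl : l ≫ j0 = O.ι ≫ j := lift_fac _ _ _
      have hlm : O.ι = l ≫ m := hlift _ _ _ (by rw [assoc, hγ, hl])
      have hr' : Set.range m ⊆ Set.range O.ι := by
        rintro _ ⟨y, rfl⟩
        rw [Scheme.Opens.range_ι]
        refine ⟨y, ?_⟩
        rw [← hγ]; rfl
      let l' := IsOpenImmersion.lift O.ι m hr'
      have hl' : l' ≫ O.ι = m := lift_fac _ _ _
      have hiso : IsIso l := by
        refine ⟨l', ?_, ?_⟩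
        · rw [← cancel_mono O.ι, assoc, hl', ← hlm, id_comp]
        · rw [← cancel_mono j0, assoc, hl, reassoc_of% hl', hγ, id_comp]
      refine ⟨O, ⟨q, hq⟩, fun r hr => ⟨q, ?_⟩, ?_⟩
      · rw [hq, hr]
      · rw [← hl]; infer_instance
    refine IsOpenImmersion.of_forall_source_exists j ?_ ?_
    · intro r p hrp
      obtain ⟨O, hp, hO, _⟩ := hloc p
      have := (O.ι ≫ j).isOpenEmbedding.injective (a₁ := ⟨r, hO r hrp⟩) (a₂ := ⟨p, hp⟩) hrp
      exact congr_arg Subtype.val this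
    · intro p
      obtain ⟨O, hp, -, h⟩ := hloc p
      exact ⟨O.toScheme, O.ι, inferInstance, by simpa using hp, h⟩
  · refine hrange.antisymm ?_
    rintro x ⟨B, _, j0, _, β, ⟨q, rfl⟩, hj0, hβ, hE⟩
    obtain ⟨γ, hγ⟩ := hfactor B j0 β hj0 hβ hE
    rw [← hγ]
    exact ⟨_, (Hom.comp_apply _ _ _).symm⟩

end BlowupCharts

end

/-! ### Charts of toric varieties -/

section

/-- Additive maps on a monoid algebra that agree on monomials are equal. -/
theorem eq_of_single {k M A : Type*} [Semiring k] {f g : AddMonoidAlgebra k M → A}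
    (z : AddMonoidAlgebra k M) (h : ∀ χ c, f (single χ c) = g (single χ c))
    (zero : f 0 = g 0 := by simp)
    (add : ∀ z w, f z = g z → f w = g w → f (z + w) = g (z + w) := by
      intro z w hz hw; simp only [map_add, hz, hw]) : f z = g z := by
  induction z using induction_linear with
  | zero => exact zero
  | add z w hz hw => exact add z w hz hw
  | single χ c => exact h χ c

theorem chartIdeal_vanishingIdeal_eq {X : Scheme.{u}} {R : Type u} [CommRing R]
    (j : Spec(R) ⟶ X) [IsOpenImmersion j] (Z : Closeds X) {I : Ideal R}
    (hI : I.IsRadical) (h : ∀ p : Spec(R), j p ∈ Z ↔ I ≤ p.asIdeal) :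
    I(j, Z) = I := by
  rw [chartIdeal_vanishingIdeal]
  have h1 : (j ⁻¹' (Z : Set X) : Set (PrimeSpectrum R)) = zeroLocus (I : Set R) :=
    Set.ext fun p => (h p).trans Iff.rfl
  have h2 : PrimeSpectrum.vanishingIdeal (j ⁻¹' (Z : Set X) : Set (PrimeSpectrum R)) = I := by
    rw [h1, PrimeSpectrum.vanishingIdeal_zeroLocus_eq_radical, hI.radical]
  exact h2

theorem not_top_le_asIdeal {R : Type u} [CommRing R] (p : Spec(R)) : ¬ (⊤ : Ideal R) ≤ p.asIdeal :=
  fun h => p.2.ne_top (top_le_iff.1 h)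

namespace SmoothFan

section Algebra

variable {L : Type} [AddCommGroup L] {ι : Type} (F : SmoothFan L ι) (k : Type u) [Field k]

/-- The coordinate ring of the affine chart of `S`. -/
abbrev ChartRing (S : Finset ι) : Type u := AddMonoidAlgebra k (F.dualMonoid S)

instance (S : Finset ι) : TwoUniqueSums (F.dualMonoid S) := TwoUniqueSums.of_injective_addHom
    (f := (⟨fun χ => ⇑χ.1, fun _ _ => rfl⟩ : AddHom (F.dualMonoid S) (L → ℤ)))
    (fun _ _ h => Subtype.ext (DFunLike.coe_injective h)) inferInstance

instance (S : Finset ι) : IsDomain (F.ChartRing k S) := NoZeroDivisors.to_isDomain _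

variable {k F}

theorem single_ne_zero' {S : Finset ι} (χ : F.dualMonoid S) :
    (single χ (1 : k) : F.ChartRing k S) ≠ 0 := by
  intro h
  have := congrArg (·.coeff χ) h
  simp at this

open Classical in
/-- The homomorphism that kills the characters that do not vanish on the face `T` of `S` and that is
given by `f` on the others. -/
def truncHom {S T : Finset ι} (h : T ⊆ S) {B : Type*} [CommRing B] [Algebra k B]
    (f : Multiplicative (F.dualMonoid S) →* B) : F.ChartRing k S →ₐ[k] B :=
  AddMonoidAlgebra.lift k B (F.dualMonoid S)
    { toFun := fun χ => if ∀ b ∈ T, χ.toAdd.1 (F.gen b) = 0 then f χ else 0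
      map_one' := by simp
      map_mul' := by
        intro χ ψ
        have h1 : (∀ b ∈ T, (χ * ψ).toAdd.1 (F.gen b) = 0) ↔
            (∀ b ∈ T, χ.toAdd.1 (F.gen b) = 0) ∧ ∀ b ∈ T, ψ.toAdd.1 (F.gen b) = 0 := by
          have h2 : ∀ b, (χ * ψ).toAdd.1 (F.gen b) = χ.toAdd.1 (F.gen b) + ψ.toAdd.1 (F.gen b) :=
            fun b => rfl
          constructor
          · intro h3
            constructor
            all_goals
              intro b hb
              have h4 := h3 b hb
              have h5 := χ.toAdd.2 b (h hb)
              have h6 := ψ.toAdd.2 b (h hb)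
              rw [h2] at h4
              omega
          · rintro ⟨h3, h4⟩ b hb
            rw [h2, h3 b hb, h4 b hb, add_zero]
        simp only [h1, map_mul]
        split_ifs <;> simp_all }

open Classical in
theorem truncHom_single {S T : Finset ι} (h : T ⊆ S) {B : Type*} [CommRing B] [Algebra k B]
    (f : Multiplicative (F.dualMonoid S) →* B) (χ : F.dualMonoid S) (c : k) :
    truncHom h f (single χ c) =
      if ∀ b ∈ T, χ.1 (F.gen b) = 0 then algebraMap k B c * f (ofAdd χ) else 0 := by
  rw [truncHom, lift_single, Algebra.smul_def]
  simp

/-- The projection of the coordinate ring to the functions on the orbit closure of `T`. -/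
def faceProj {S T : Finset ι} (h : T ⊆ S) : F.ChartRing k S →ₐ[k] F.ChartRing k S :=
  truncHom h (AddMonoidAlgebra.of k (F.dualMonoid S))

open Classical in
theorem faceProj_single {S T : Finset ι} (h : T ⊆ S) (χ : F.dualMonoid S) (c : k) :
    faceProj h (single χ c) = if ∀ b ∈ T, χ.1 (F.gen b) = 0 then single χ c else 0 := by
  rw [faceProj, truncHom_single]
  split_ifs
  · rw [AddMonoidAlgebra.coe_algebraMap]
    simp [single_mul_single]
  · rfl

open Classical in
theorem coeff_faceProj {S T : Finset ι} (h : T ⊆ S) (f : F.ChartRing k S) (χ : F.dualMonoid S) :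
    (faceProj h f).coeff χ = if ∀ b ∈ T, χ.1 (F.gen b) = 0 then f.coeff χ else 0 := by
  induction f using induction_linear with
  | zero => simp
  | add f g hf hg =>
    rw [map_add, AddMonoidAlgebra.coeff_add, Finsupp.add_apply, hf, hg, AddMonoidAlgebra.coeff_add,
      Finsupp.add_apply]
    split_ifs <;> simp
  | single ψ c =>
    rw [faceProj_single]
    by_cases hψ : ψ = χ
    · subst hψ
      split_ifs <;> simp
    · split_ifs <;> simp [hψ]

/-- The ideal of the orbit closure of the face `T` in the chart of `S`. -/
def orbitIdeal (k : Type u) [Field k] {S T : Finset ι} (h : T ⊆ S) : Ideal (F.ChartRing k S) :=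
  ker (faceProj (k := k) (F := F) h)

instance {S T : Finset ι} (h : T ⊆ S) : (F.orbitIdeal k h).IsPrime := RingHom.ker_isPrime _

theorem mem_orbitIdeal {S T : Finset ι} (h : T ⊆ S) (f : F.ChartRing k S) :
    f ∈ F.orbitIdeal k h ↔ ∀ χ, f.coeff χ ≠ 0 → ∃ b ∈ T, χ.1 (F.gen b) ≠ 0 := by
  classical
  rw [orbitIdeal, mem_ker, ← AddMonoidAlgebra.coeff_eq_zero, Finsupp.ext_iff]
  refine forall_congr' fun χ => ?_
  have : (faceProj h f).coeff χ = 0 ↔ (f.coeff χ ≠ 0 → ∃ b ∈ T, χ.1 (F.gen b) ≠ 0) := by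
    rw [coeff_faceProj]
    split_ifs with h1
    · constructor
      · intro h2 h3; exact absurd h2 h3
      · intro h2
        by_contra h3
        obtain ⟨b, hb, h4⟩ := h2 h3
        exact h4 (h1 b hb)
    · push Not at h1
      simpa using fun _ => h1
  exact this

theorem single_mem_orbitIdeal {S T : Finset ι} (h : T ⊆ S) (χ : F.dualMonoid S) :
    (single χ (1 : k)) ∈ F.orbitIdeal k h ↔ ∃ b ∈ T, χ.1 (F.gen b) ≠ 0 := by
  rw [mem_orbitIdeal]
  constructor
  · intro h1; exact h1 χ (by simp)
  · intro h1 ψ hψ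
    by_cases h2 : χ = ψ
    · exact h2 ▸ h1
    · simp [h2] at hψ

theorem exists_coord (S : F.cones) (b : ι) : ∃ χ : F.dualMonoid S.1,
    (b ∈ S.1 → χ.1 (F.gen b) = 1) ∧ ∀ c ∈ S.1, c ≠ b → χ.1 (F.gen c) = 0 := by
  classical
  obtain ⟨χ, hχ⟩ := F.unimodular S.1 S.2 (fun c => if c = b then 1 else 0)
  refine ⟨⟨χ, fun c hc => ?_⟩, fun hb => ?_, fun c hc hcb => ?_⟩
  · rw [hχ c hc]; split_ifs <;> simp
  · simp [hχ b hb]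
  · simp [hχ c hc, hcb]

variable (F) in
/-- For a cone `S` and `b ∈ S`, a character that is `1` on `b` and `0` on the other rays of `S`. -/
def coord (S : F.cones) (b : ι) : F.dualMonoid S.1 := (exists_coord S b).choose

theorem coord_self {S : F.cones} {b : ι} (hb : b ∈ S.1) : (F.coord S b).1 (F.gen b) = 1 :=
  (exists_coord S b).choose_spec.1 hb

theorem coord_of_ne {S : F.cones} {b c : ι} (hc : c ∈ S.1) (h : c ≠ b) :
    (F.coord S b).1 (F.gen c) = 0 :=
  (exists_coord S b).choose_spec.2 c hc h

variable (F k) in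
/-- An equation of the toric divisor of `b` on the chart of `S`, for `b ∈ S`. -/
def coordFun (S : F.cones) (b : ι) : F.ChartRing k S.1 := single (F.coord S b) 1

theorem coordFun_mem_orbitIdeal {S : F.cones} {T : Finset ι} (h : T ⊆ S.1) {b : ι} (hb : b ∈ S.1) :
    F.coordFun k S b ∈ F.orbitIdeal k h ↔ b ∈ T := by
  rw [coordFun, single_mem_orbitIdeal]
  constructor
  · rintro ⟨c, hc, h1⟩
    by_cases h2 : c = b
    · exact h2 ▸ hc
    · exact absurd (coord_of_ne (h hc) h2) h1
  · intro h1
    exact ⟨b, h1, by rw [coord_self hb]; simp⟩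

theorem coordFun_dvd_single {S : F.cones} {b : ι} (hb : b ∈ S.1) (χ : F.dualMonoid S.1)
    (hχ : χ.1 (F.gen b) ≠ 0) (c : k) :
    F.coordFun k S b ∣ single χ c := by
  refine ⟨single ⟨χ.1 - (F.coord S b).1, fun d hd => ?_⟩ c, ?_⟩
  · have h1 := χ.2 d hd
    by_cases hdb : d = b
    · subst hdb
      rw [AddMonoidHom.sub_apply, coord_self hb]
      omega
    · rw [AddMonoidHom.sub_apply, coord_of_ne hd hdb]
      omega
  · rw [coordFun, single_mul_single, one_mul]
    congr 1
    apply Subtype.ext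
    simp

theorem orbitIdeal_eq_span {S : F.cones} {T : Finset ι} (h : T ⊆ S.1) :
    F.orbitIdeal k h = span (F.coordFun k S '' T) := by
  classical
  apply le_antisymm
  · have key : ∀ f : F.ChartRing k S.1, f - faceProj h f ∈ span (F.coordFun k S '' T) := by
      intro f
      induction f using induction_linear with
      | zero => simp
      | add f g hf hg =>
        rw [map_add, add_sub_add_comm]
        exact add_mem hf hg
      | single χ c =>
        rw [faceProj_single]
        split_ifs with h1
        · simp
        · push Not at h1
          obtain ⟨b, hb, h1⟩ := h1
          rw [sub_zero]
          exact Ideal.mem_of_dvd _ (coordFun_dvd_single (h hb) χ h1 c) (subset_span ⟨b, hb, rfl⟩)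
    intro f hf
    have h1 := key f
    rwa [show faceProj h f = 0 from hf, sub_zero] at h1
  · rw [span_le]
    rintro _ ⟨b, hb, rfl⟩
    exact (coordFun_mem_orbitIdeal h (h hb)).2 hb

theorem orbitIdeal_singleton {S : F.cones} {b : ι} (h : {b} ⊆ S.1) :
    F.orbitIdeal k h = span {F.coordFun k S b} := by
  rw [orbitIdeal_eq_span]; simp

theorem coordFun_ne_zero (S : F.cones) (b : ι) : F.coordFun k S b ≠ 0 := single_ne_zero' _

theorem coordFun_prime {S : F.cones} {b : ι} (hb : b ∈ S.1) : Prime (F.coordFun k S b) := by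
  rw [← Ideal.span_singleton_prime (coordFun_ne_zero S b),
    ← orbitIdeal_singleton (singleton_subset_iff.2 hb)]
  infer_instance

theorem isUnit_single {S : Finset ι} (χ : F.dualMonoid S) (h : ∀ b ∈ S, χ.1 (F.gen b) = 0) :
    IsUnit (single χ (1 : k)) := by
  refine IsUnit.of_mul_eq_one
    (single (⟨-χ.1, fun b hb => by simp [h b hb]⟩ : F.dualMonoid S) (1 : k)) ?_
  rw [single_mul_single, one_mul, AddMonoidAlgebra.one_def]
  congr 1
  apply Subtype.ext
  simp

end Algebra

section Geometry

variable {L : Type} [AddCommGroup L] {ι : Type} (F : SmoothFan L ι) (k : Type u) [Field k]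

instance (T : F.cones) : IsOpenImmersion (F.chart k T) :=
  inferInstanceAs (IsOpenImmersion (colimit.ι (F.chartDiagram k) T))

theorem chart_cover (x : F.toricScheme k) : ∃ T, x ∈ Set.range (F.chart k T) :=
  Scheme.IsLocallyDirected.ι_jointly_surjective (F.chartDiagram k) x

variable {F k}

theorem range_chart_mono {S T : F.cones} (h : S ≤ T) :
    Set.range (F.chart k S) ⊆ Set.range (F.chart k T) := by
  rw [← F.restr_chart k h]
  rintro _ ⟨y, rfl⟩
  exact ⟨_, (Hom.comp_apply _ _ _).symm⟩

variable [DecidableEq ι]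

variable (F) in
/-- The common face of two cones of a fan. -/
def interCone (S T : F.cones) : F.cones := ⟨S.1 ∩ T.1, F.down_closed S.2 Finset.inter_subset_left⟩

theorem interCone_le_left (S T : F.cones) : F.interCone S T ≤ S :=
  show S.1 ∩ T.1 ⊆ S.1 from Finset.inter_subset_left

theorem interCone_le_right (S T : F.cones) : F.interCone S T ≤ T :=
  show S.1 ∩ T.1 ⊆ T.1 from Finset.inter_subset_right

theorem range_chart_inter (S T : F.cones) :
    Set.range (F.chart k S) ∩ Set.range (F.chart k T) = Set.range (F.chart k (F.interCone S T)) := by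
  apply Set.Subset.antisymm
  · rintro x ⟨⟨y, rfl⟩, ⟨z, hz⟩⟩
    obtain ⟨R, f, g, w, rfl, -⟩ :=
      (Scheme.IsLocallyDirected.ι_eq_ι_iff (F.chartDiagram k)).1 hz.symm
    have hR : R ≤ F.interCone S T := Finset.subset_inter (leOfHom f) (leOfHom g)
    apply range_chart_mono hR
    refine ⟨w, ?_⟩
    rw [← F.restr_chart k (leOfHom f)]
    exact Hom.comp_apply _ _ _
  · exact Set.subset_inter (range_chart_mono (interCone_le_left S T))
      (range_chart_mono (interCone_le_right S T))

theorem mem_range_chart_of_le {S T : F.cones} (h : T ≤ S) (p : Spec(F.ChartRing k S.1)) :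
    F.chart k S p ∈ Set.range (F.chart k T) ↔
      ∀ b ∈ S.1, b ∉ T.1 → F.coordFun k S b ∉ p.asIdeal := by
  let χ : F.dualMonoid S.1 := ∑ b ∈ S.1 \ T.1, F.coord S b
  have hχ : ∀ c, χ.1 (F.gen c) = ∑ b ∈ S.1 \ T.1, (F.coord S b).1 (F.gen c) := by
    intro c
    simp only [χ, AddSubmonoid.coe_finsetSum, AddMonoidHom.finsetSum_apply]
  have h0 : ∀ b ∈ T.1, χ.1 (F.gen b) = 0 := by
    intro b hb
    rw [hχ]
    refine sum_eq_zero fun c hc => ?_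
    refine coord_of_ne (h hb) ?_
    rintro rfl
    exact (mem_sdiff.1 hc).2 hb
  have h1 : ∀ b ∈ S.1, b ∉ T.1 → 0 < χ.1 (F.gen b) := by
    intro b hb hbT
    rw [hχ, sum_eq_single b, coord_self hb]
    · exact one_pos
    · intro c _ hcb
      exact coord_of_ne hb (Ne.symm hcb)
    · intro h2
      exact absurd (mem_sdiff.2 ⟨hb, hbT⟩) h2
  have h2 := F.range_map k (homOfLE h) χ h0 h1
  have h3 : F.chart k S p ∈ Set.range (F.chart k T) ↔
      p ∈ Set.range ((F.chartDiagram k).map (homOfLE h)) := by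
    rw [← F.restr_chart k h]
    constructor
    · rintro ⟨y, hy⟩
      refine ⟨y, (F.chart k S).isOpenEmbedding.injective ?_⟩
      rw [← hy]
      exact (Hom.comp_apply _ _ _).symm
    · rintro ⟨y, rfl⟩
      exact ⟨y, Hom.comp_apply _ _ _⟩
  have h4 : single χ (1 : k) = ∏ b ∈ S.1 \ T.1, F.coordFun k S b := by
    have : ∀ s : Finset ι, single (∑ b ∈ s, F.coord S b) (1 : k) = ∏ b ∈ s, F.coordFun k S b := by
      intro s
      induction s using Finset.induction_on with
      | empty => rfl
      | insert a s ha ih =>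
        rw [sum_insert ha, prod_insert ha, ← ih, coordFun, single_mul_single, one_mul]
    exact this _
  rw [h3, h2]
  show single χ (1 : k) ∉ p.asIdeal ↔ _
  have := p.2
  rw [h4, Ideal.IsPrime.prod_mem_iff]
  constructor
  · intro h5 b hb hbT h6
    exact h5 ⟨b, mem_sdiff.2 ⟨hb, hbT⟩, h6⟩
  · rintro h5 ⟨b, hb, h6⟩
    exact h5 b (mem_sdiff.1 hb).1 (mem_sdiff.1 hb).2 h6

theorem mem_range_chart {S T : F.cones} (p : Spec(F.ChartRing k S.1)) :
    F.chart k S p ∈ Set.range (F.chart k T) ↔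
      ∀ b ∈ S.1, b ∉ T.1 → F.coordFun k S b ∉ p.asIdeal := by
  have h1 : F.chart k S p ∈ Set.range (F.chart k T) ↔
      F.chart k S p ∈ Set.range (F.chart k (F.interCone S T)) := by
    rw [← range_chart_inter]
    exact ⟨fun h => ⟨⟨p, rfl⟩, h⟩, fun h => h.2⟩
  rw [h1, mem_range_chart_of_le (interCone_le_left S T)]
  refine forall₂_congr fun b hb => ?_
  simp [interCone, hb]

theorem mem_toricDivisor_chart (S : F.cones) (b : ι) (p : Spec(F.ChartRing k S.1)) :
    F.chart k S p ∈ F.toricDivisor k b ↔ b ∈ S.1 ∧ F.coordFun k S b ∈ p.asIdeal := by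
  have h1 : ∀ q : Spec(F.ChartRing k S.1), F.chart k S q ∈ F.chartSet k {b} \ F.chartSet k ∅ ↔
      b ∈ S.1 ∧ F.coordFun k S b ∈ q.asIdeal ∧ ∀ c ∈ S.1, c ≠ b → F.coordFun k S c ∉ q.asIdeal := by
    intro q
    constructor
    · rintro ⟨⟨h1, h2⟩, h3⟩
      rw [mem_range_chart] at h2
      have h4 : ¬ F.chart k S q ∈ Set.range (F.chart k ⟨∅, F.empty_mem⟩) :=
        fun h5 => h3 ⟨F.empty_mem, h5⟩
      rw [mem_range_chart] at h4
      push Not at h4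
      obtain ⟨c, hc, -, hcq⟩ := h4
      have h6 : c = b := by
        by_contra h7
        exact h2 c hc (by simpa using h7) hcq
      subst h6
      exact ⟨hc, hcq, fun d hd hdc => h2 d hd (by simpa using hdc)⟩
    · rintro ⟨hb, hbq, h2⟩
      refine ⟨⟨F.down_closed S.2 (singleton_subset_iff.2 hb), ?_⟩, ?_⟩
      · rw [mem_range_chart]
        exact fun c hc hcb => h2 c hc (by simpa using hcb)
      · rintro ⟨h3, h4⟩
        rw [mem_range_chart] at h4
        exact h4 b hb (by simp) hbq
  have h2 : F.chart k S p ∈ F.toricDivisor k b ↔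
      p ∈ closure (F.chart k S ⁻¹' (F.chartSet k {b} \ F.chartSet k ∅)) := by
    rw [← (F.chart k S).isOpenEmbedding.isOpenMap.preimage_closure_eq_closure_preimage
      (F.chart k S).continuous]
    rfl
  rw [h2]
  constructor
  · intro h3
    by_cases hb : b ∈ S.1
    · refine ⟨hb, ?_⟩
      have h4 : IsClosed (zeroLocus {F.coordFun k S b}) := PrimeSpectrum.isClosed_zeroLocus _
      have h5 := closure_minimal (fun q hq => ?_) h4 h3
      · exact h5 (Set.mem_singleton _)
      · exact Set.singleton_subset_iff.2 ((h1 q).1 hq).2.1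
    · have h4 : F.chart k S ⁻¹' (F.chartSet k {b} \ F.chartSet k ∅) = ∅ := by
        rw [Set.eq_empty_iff_forall_notMem]
        exact fun q hq => hb ((h1 q).1 hq).1
      rw [h4, closure_empty] at h3
      exact h3.elim
  · rintro ⟨hb, hbp⟩
    have hs : {b} ⊆ S.1 := singleton_subset_iff.2 hb
    let η : PrimeSpectrum (F.ChartRing k S.1) := ⟨F.orbitIdeal k hs, inferInstance⟩
    have hη : η ∈ F.chart k S ⁻¹' (F.chartSet k {b} \ F.chartSet k ∅) := by
      refine (h1 η).2 ⟨hb, (coordFun_mem_orbitIdeal hs hb).2 (by simp), fun c hc hcb hc' => ?_⟩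
      exact hcb (by simpa using (coordFun_mem_orbitIdeal hs hc).1 hc')
    refine closure_mono (Set.singleton_subset_iff.2 hη) ?_
    refine (PrimeSpectrum.le_iff_mem_closure η p).1 ?_
    show F.orbitIdeal k hs ≤ p.asIdeal
    rw [orbitIdeal_singleton, span_singleton_le_iff_mem]
    exact hbp

theorem mem_stratum_chart (S : F.cones) (T : Finset ι) (p : Spec(F.ChartRing k S.1)) :
    F.chart k S p ∈ stratum (F.toricDivisor k) T ↔ ∃ h : T ⊆ S.1, F.orbitIdeal k h ≤ p.asIdeal := by
  have : F.chart k S p ∈ stratum (F.toricDivisor k) T ↔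
      ∀ b ∈ T, F.chart k S p ∈ F.toricDivisor k b := Set.mem_iInter₂
  rw [this]
  constructor
  · intro h
    have h1 : T ⊆ S.1 := fun b hb => ((mem_toricDivisor_chart S b p).1 (h b hb)).1
    refine ⟨h1, ?_⟩
    rw [orbitIdeal_eq_span, span_le]
    rintro _ ⟨b, hb, rfl⟩
    exact ((mem_toricDivisor_chart S b p).1 (h b hb)).2
  · rintro ⟨h1, h2⟩ b hb
    rw [mem_toricDivisor_chart]
    exact ⟨h1 hb, h2 ((coordFun_mem_orbitIdeal h1 (h1 hb)).2 hb)⟩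

theorem chartIdeal_toricDivisor_of_mem {S : F.cones} {b : ι} (hb : b ∈ S.1) :
    I(F.chart k S, F.toricDivisor k b) = span {F.coordFun k S b} := by
  have h2 : (span {F.coordFun k S b}).IsPrime :=
    (Ideal.span_singleton_prime (coordFun_ne_zero S b)).2 (coordFun_prime hb)
  refine chartIdeal_vanishingIdeal_eq _ _ h2.isRadical fun p => ?_
  rw [mem_toricDivisor_chart, span_singleton_le_iff_mem]
  exact and_iff_right hb

theorem chartIdeal_toricDivisor_of_notMem {S : F.cones} {b : ι} (hb : b ∉ S.1) :
    I(F.chart k S, F.toricDivisor k b) = ⊤ := by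
  refine chartIdeal_vanishingIdeal_eq _ _ (fun _ _ => trivial) fun p => ?_
  rw [mem_toricDivisor_chart]
  exact ⟨fun h => absurd h.1 hb, fun h => absurd h (not_top_le_asIdeal p)⟩

/-- Two factorizations of a morphism through charts come from the chart of the common face. -/
theorem exists_restr_of_chart_eq {S T : F.cones} {B : Type u} [CommRing B]
    {β : F.ChartRing k S.1 →+* B} {γ : F.ChartRing k T.1 →+* B}
    (h : SpecMap(β) ≫ F.chart k S = SpecMap(γ) ≫ F.chart k T) :
    ∃ δ : F.ChartRing k (F.interCone S T).1 →+* B, δ.comp (F.restr k (interCone_le_left S T)) = β ∧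
      δ.comp (F.restr k (interCone_le_right S T)) = γ := by
  have hr : Set.range (SpecMap(β) ≫ F.chart k S) ⊆ Set.range (F.chart k (F.interCone S T)) := by
    rw [← range_chart_inter]
    apply Set.subset_inter
    · rintro _ ⟨y, rfl⟩
      exact ⟨_, (Hom.comp_apply _ _ _).symm⟩
    · rw [h]
      rintro _ ⟨y, rfl⟩
      exact ⟨_, (Hom.comp_apply _ _ _).symm⟩
  obtain ⟨δ, hδ⟩ := exists_specMap_eq (IsOpenImmersion.lift (F.chart k (F.interCone S T)) _ hr)
  have hfac : SpecMap(δ) ≫ F.chart k (F.interCone S T) = SpecMap(β) ≫ F.chart k S := by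
    rw [← hδ]; exact lift_fac _ _ _
  refine ⟨δ, ?_, ?_⟩
  · apply specMap_ringHom_injective
    rw [← cancel_mono (F.chart k S), ← hfac, ofHom_comp, Spec.map_comp, assoc,
      F.restr_chart k (interCone_le_left S T)]
  · apply specMap_ringHom_injective
    rw [← cancel_mono (F.chart k T), ← h, ← hfac, ofHom_comp, Spec.map_comp,
      assoc, F.restr_chart k (interCone_le_right S T)]

end Geometry

end SmoothFan

end

local notation "starProj(" h ")" => SmoothFan.faceProj (Iff.mpr singleton_subset_iff h)

/-! ### Isomorphisms of ideal sheaves with local generators -/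

section

section Gluing

variable {X : Scheme.{u}}

/-- Restriction of sections, as a ring homomorphism. -/
def resHom {U V : X.Opens} (h : U ≤ V) : Γ(X, V) →+* Γ(X, U) := (X.presheaf.map (homOfLE h).op).hom

theorem resHom_resHom {U V W : X.Opens} (h : U ≤ V) (h' : V ≤ W) (x : Γ(X, W)) :
    resHom h (resHom h' x) = resHom (h.trans h') x := by
  rw [resHom, resHom, resHom, ← CommRingCat.comp_apply, ← Functor.map_comp]
  rfl

theorem section_eq_of_locally {ι : Type*} (U : ι → X.Opens) (V : X.Opens) (hU : ∀ i, U i ≤ V)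
    (hV : V ≤ iSup U) {s t : Γ(X, V)} (h : ∀ i, resHom (hU i) s = resHom (hU i) t) : s = t :=
  X.sheaf.eq_of_locally_eq' U V (fun i => homOfLE (hU i)) hV s t h

theorem exists_section_of_compatible {ι : Type*} (U : ι → X.Opens) (V : X.Opens)
    (hU : ∀ i, U i ≤ V) (hV : V ≤ iSup U) (s : ∀ i, Γ(X, U i))
    (h : ∀ i j, resHom (inf_le_left : U i ⊓ U j ≤ U i) (s i) =
      resHom (inf_le_right : U i ⊓ U j ≤ U j) (s j)) :
    ∃ t : Γ(X, V), ∀ i, resHom (hU i) t = s i :=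
  (X.sheaf.existsUnique_gluing' U V (fun i => homOfLE (hU i)) hV s h).exists

theorem exists_affine_le {O : X.Opens} {x : X} (hx : x ∈ O) :
    ∃ W : X.affineOpens, x ∈ W.1 ∧ W.1 ≤ O := by
  obtain ⟨_, ⟨W, hW, rfl⟩, hxW, hWO⟩ := X.isBasis_affineOpens.exists_subset_of_mem_open hx O.isOpen
  exact ⟨⟨W, hW⟩, hxW, hWO⟩

/-- Sections over `O` agree if they agree after restriction to all affine open subsets. -/
theorem section_eq_of_affine {O : X.Opens} {s t : Γ(X, O)}
    (h : ∀ (W : X.affineOpens) (hW : W.1 ≤ O), resHom hW s = resHom hW t) : s = t := by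
  refine section_eq_of_locally (fun W : {W : X.affineOpens // W.1 ≤ O} => W.1.1) O
    (fun W => W.2) ?_ fun W => h W.1 W.2
  intro x hx
  obtain ⟨W, hxW, hW⟩ := exists_affine_le hx
  exact Opens.mem_iSup.2 ⟨⟨W, hW⟩, hxW⟩

theorem resHom_mem_nonZeroDivisors {V : X.affineOpens} {O : X.Opens} (h : O ≤ V.1) {p : Γ(X, V.1)}
    (hp : p ∈ nonZeroDivisors Γ(X, V.1)) : resHom h p ∈ nonZeroDivisors Γ(X, O) := by
  rw [mem_nonZeroDivisors_iff_right]
  intro z hz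
  refine section_eq_of_affine fun W hW => ?_
  have h1 : resHom (hW.trans h) p ∈ nonZeroDivisors Γ(X, W.1) :=
    nonZeroDivisors_of_flat (flat_res W.2 V.2 (hW.trans h)) hp
  rw [map_zero]
  refine (mem_nonZeroDivisors_iff_right.1 h1) _ ?_
  rw [← resHom_resHom hW h, ← map_mul, hz, map_zero]

/-- Membership in the ideal of an affine open set is local. -/
theorem mem_ideal_of_locally {J : X.IdealSheafData} {U : X.affineOpens} {y : Γ(X, U.1)}
    (h : ∀ x ∈ U.1, ∃ (W : X.affineOpens) (hW : W.1 ≤ U.1), x ∈ W.1 ∧ resHom hW y ∈ J.ideal W) :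
    y ∈ J.ideal U := by
  have h0 : ∀ (W : X.affineOpens) (z : Γ(X, W.1)),
      z ∈ J.ideal W ↔ (J.subschemeι.app W.1).hom z = 0 := by
    intro W z
    rw [← IdealSheafData.ker_subschemeι_app, mem_ker]
  rw [h0]
  choose W hW hxW hy using h
  refine section_eq_of_locally (fun x : U.1 => J.subschemeι ⁻¹ᵁ (W x.1 x.2).1) _
    (fun x => J.subschemeι.preimage_mono (hW x.1 x.2)) ?_ fun x => ?_
  · intro z hz
    exact Opens.mem_iSup.2 ⟨⟨J.subschemeι z, hz⟩, hxW _ hz⟩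
  · have h1 := (h0 _ _).1 (hy x.1 x.2)
    rw [map_zero]
    have h2 := congr_hom (J.subschemeι.naturality (homOfLE (hW x.1 x.2)).op) y
    exact h2.symm.trans h1

/-- A description of two ideal sheaves by generators on the members of an affine cover, such that
the quotients of the generators agree on overlaps. -/
structure GeneratorCover (I J : X.IdealSheafData) where
  {index : Type*}
  opens : index → X.affineOpens
  covers : ∀ x, ∃ i, x ∈ (opens i).1
  genI : ∀ i, Γ(X, (opens i).1)
  genJ : ∀ i, Γ(X, (opens i).1)
  genI_mem : ∀ i, genI i ∈ nonZeroDivisors _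
  genJ_mem : ∀ i, genJ i ∈ nonZeroDivisors _
  ideal_I : ∀ i, I.ideal (opens i) = span {genI i}
  ideal_J : ∀ i, J.ideal (opens i) = span {genJ i}
  compatible : ∀ (i j) (W : X.affineOpens) (hi : W.1 ≤ (opens i).1) (hj : W.1 ≤ (opens j).1),
    resHom hi (genI i) * resHom hj (genJ j) = resHom hj (genI j) * resHom hi (genJ i)

namespace GeneratorCover

variable {I J : X.IdealSheafData} (c : GeneratorCover I J)

/-- The same cover, with the ideal sheaves exchanged. -/
def symm : GeneratorCover J I where
  opens := c.opens
  covers := c.covers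
  genI := c.genJ
  genJ := c.genI
  genI_mem := c.genJ_mem
  genJ_mem := c.genI_mem
  ideal_I := c.ideal_J
  ideal_J := c.ideal_I
  compatible i j W hi hj := by rw [mul_comm, ← c.compatible i j W hi hj, mul_comm]

/-- `y` corresponds to `x` under the isomorphism that maps `genI i` to `genJ i`. -/
def Rel {U : X.Opens} (x y : Γ(X, U)) : Prop :=
  ∀ (i : c.index) (W : X.affineOpens) (hi : W.1 ≤ (c.opens i).1) (hU : W.1 ≤ U),
    resHom hi (c.genJ i) * resHom hU x = resHom hi (c.genI i) * resHom hU y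

theorem rel_symm {U : X.Opens} {x y : Γ(X, U)} : c.symm.Rel x y ↔ c.Rel y x :=
  ⟨fun h i W hi hU => (h i W hi hU).symm, fun h i W hi hU => (h i W hi hU).symm⟩

theorem rel_unique {U : X.Opens} {x y y' : Γ(X, U)} (h : c.Rel x y) (h' : c.Rel x y') : y = y' := by
  refine section_eq_of_locally (fun a : {a : c.index × X.affineOpens //
    a.2.1 ≤ (c.opens a.1).1 ∧ a.2.1 ≤ U} => a.1.2.1) U (fun a => a.2.2) ?_ ?_
  · intro x hx
    obtain ⟨i, hi⟩ := c.covers x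
    obtain ⟨W, hxW, hW⟩ := exists_affine_le (show x ∈ (c.opens i).1 ⊓ U from ⟨hi, hx⟩)
    exact Opens.mem_iSup.2 ⟨⟨(i, W), hW.trans inf_le_left, hW.trans inf_le_right⟩, hxW⟩
  · rintro ⟨⟨i, W⟩, hi, hU⟩
    refine (mul_cancel_left_mem_nonZeroDivisors (resHom_mem_nonZeroDivisors hi (c.genI_mem i))).1 ?_
    exact (h i W hi hU).symm.trans (h' i W hi hU)

theorem rel_add {U : X.Opens} {x y x' y' : Γ(X, U)} (h : c.Rel x y) (h' : c.Rel x' y') :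
    c.Rel (x + x') (y + y') := by
  intro i W hi hU
  rw [map_add, map_add, mul_add, mul_add, h i W hi hU, h' i W hi hU]

theorem rel_mul {U : X.Opens} {x y : Γ(X, U)} (a : Γ(X, U)) (h : c.Rel x y) :
    c.Rel (a * x) (a * y) := by
  intro i W hi hU
  rw [map_mul, map_mul, mul_left_comm, h i W hi hU, mul_left_comm]

theorem rel_res {U V : X.Opens} {x y : Γ(X, V)} (hUV : U ≤ V) (h : c.Rel x y) :
    c.Rel (resHom hUV x) (resHom hUV y) := by
  intro i W hi hU
  rw [resHom_resHom, resHom_resHom]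
  exact h i W hi (hU.trans hUV)

theorem ideal_eq_span (i : c.index) {W : X.affineOpens} (h : W.1 ≤ (c.opens i).1) :
    I.ideal W = span {resHom h (c.genI i)} := by
  rw [← map_ideal I (U := W) (V := c.opens i) h, c.ideal_I, map_span, Set.image_singleton]
  rfl

theorem exists_rel (U : X.affineOpens) (x : Γ(X, U.1)) (hx : x ∈ I.ideal U) :
    ∃ y ∈ J.ideal U, c.Rel x y := by
  let N := {a : c.index × X.affineOpens // a.2.1 ≤ (c.opens a.1).1 ∧ a.2.1 ≤ U.1}
  have hcov : ∀ z ∈ U.1, ∃ a : N, z ∈ a.1.2.1 := by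
    intro z hz
    obtain ⟨i, hi⟩ := c.covers z
    obtain ⟨W, hzW, hW⟩ := exists_affine_le (show z ∈ (c.opens i).1 ⊓ U.1 from ⟨hi, hz⟩)
    exact ⟨⟨(i, W), hW.trans inf_le_left, hW.trans inf_le_right⟩, hzW⟩
  have h1 : ∀ a : N, ∃ r : Γ(X, a.1.2.1), resHom a.2.2 x = resHom a.2.1 (c.genI a.1.1) * r := by
    intro a
    have h2 : resHom a.2.2 x ∈ I.ideal a.1.2 := I.ideal_le_comap_ideal (U := a.1.2) (V := U) a.2.2 hx
    rw [c.ideal_eq_span a.1.1 a.2.1] at h2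
    exact mem_span_singleton.1 h2
  choose r hr using h1
  let s : ∀ a : N, Γ(X, a.1.2.1) := fun a => resHom a.2.1 (c.genJ a.1.1) * r a
  -- the local relation, with two indices
  have h3 : ∀ (a : N) (i : c.index) (W : X.affineOpens) (hi : W.1 ≤ (c.opens i).1)
      (ha : W.1 ≤ a.1.2.1), resHom hi (c.genJ i) * resHom (ha.trans a.2.2) x =
        resHom hi (c.genI i) * resHom ha (s a) := by
    intro a i W hi ha
    have h4 := c.compatible a.1.1 i W (ha.trans a.2.1) hi
    have h5 := congr_arg (resHom ha) (hr a)
    rw [resHom_resHom, map_mul, resHom_resHom] at h5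
    rw [h5]
    simp only [s, map_mul, resHom_resHom]
    linear_combination (resHom ha (r a)) * h4
  obtain ⟨y, hy⟩ := exists_section_of_compatible (fun a : N => a.1.2.1) U.1 (fun a => a.2.2)
    (fun z hz => Opens.mem_iSup.2 (hcov z hz)) s (by
      intro a b
      refine section_eq_of_affine fun W hW => ?_
      rw [resHom_resHom, resHom_resHom]
      have ha : W.1 ≤ a.1.2.1 := hW.trans inf_le_left
      have hb : W.1 ≤ b.1.2.1 := hW.trans inf_le_right
      refine (mul_cancel_left_mem_nonZeroDivisors
        (resHom_mem_nonZeroDivisors (ha.trans a.2.1) (c.genI_mem a.1.1))).1 ?_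
      rw [← h3 a a.1.1 W (ha.trans a.2.1) ha]
      exact h3 b a.1.1 W (ha.trans a.2.1) hb)
  refine ⟨y, ?_, ?_⟩
  · refine mem_ideal_of_locally fun z hz => ?_
    obtain ⟨a, ha⟩ := hcov z hz
    refine ⟨a.1.2, a.2.2, ha, ?_⟩
    rw [hy a, c.symm.ideal_eq_span a.1.1 a.2.1]
    exact Ideal.mul_mem_right _ _ (mem_span_singleton_self _)
  · intro i W hi hU
    refine section_eq_of_locally (fun b : {b : N × X.affineOpens //
      b.2.1 ≤ b.1.1.2.1 ∧ b.2.1 ≤ W.1} => b.1.2.1) W.1 (fun b => b.2.2) ?_ ?_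
    · intro z hz
      obtain ⟨a, ha⟩ := hcov z (hU hz)
      obtain ⟨W', hzW', hW'⟩ := exists_affine_le (show z ∈ a.1.2.1 ⊓ W.1 from ⟨ha, hz⟩)
      exact Opens.mem_iSup.2 ⟨⟨(a, W'), hW'.trans inf_le_left, hW'.trans inf_le_right⟩, hzW'⟩
    · rintro ⟨⟨a, W'⟩, ha, hW'⟩
      have h4 := h3 a i W' (hW'.trans hi) ha
      rw [← hy a, resHom_resHom] at h4
      rw [map_mul, map_mul, resHom_resHom, resHom_resHom, resHom_resHom, resHom_resHom]
      exact h4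

/-- The homomorphism that sends the generator of `I` to that of `J`. -/
def hom (U : X.affineOpens) : I.ideal U →ₗ[Γ(X, U.1)] J.ideal U where
  toFun x := ⟨(c.exists_rel U x.1 x.2).choose, (c.exists_rel U x.1 x.2).choose_spec.1⟩
  map_add' x y := Subtype.ext <| c.rel_unique (c.exists_rel U _ (x + y).2).choose_spec.2
    (c.rel_add (c.exists_rel U x.1 x.2).choose_spec.2 (c.exists_rel U y.1 y.2).choose_spec.2)
  map_smul' a x := Subtype.ext <| c.rel_unique (c.exists_rel U _ (a • x).2).choose_spec.2
    (c.rel_mul a (c.exists_rel U x.1 x.2).choose_spec.2)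

theorem hom_rel (U : X.affineOpens) (x : I.ideal U) :
    c.Rel (x.1 : Γ(X, U.1)) (c.hom U x : Γ(X, U.1)) :=
  (c.exists_rel U x.1 x.2).choose_spec.2

theorem symm_hom_hom (U : X.affineOpens) (x : I.ideal U) : c.symm.hom U (c.hom U x) = x :=
  Subtype.ext <| c.symm.rel_unique (c.symm.hom_rel U _) (c.rel_symm.2 (c.hom_rel U x))

theorem idealIso (c : GeneratorCover I J) : IdealIso I J := by
  refine ⟨fun U => LinearEquiv.ofLinear (c.hom U) (c.symm.hom U)
    (LinearMap.ext fun x => c.symm.symm_hom_hom U x)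
    (LinearMap.ext fun x => c.symm_hom_hom U x), ?_⟩
  intro U V h x
  exact c.rel_unique (c.hom_rel U ⟨_, I.ideal_le_comap_ideal h x.2⟩)
    (c.rel_res (show U.1 ≤ V.1 from h) (c.hom_rel V x))

end GeneratorCover

theorem sectionHom_mem_nonZeroDivisors {R : Type u} [CommRing R]
    (j : Spec(R) ⟶ X) [IsOpenImmersion j] {y : Γ(X, j.opensRange)}
    (h : sectionHom j j.opensRange (range_le_opensRange j) y ∈ nonZeroDivisors R) :
    y ∈ nonZeroDivisors Γ(X, j.opensRange) := by
  rw [mem_nonZeroDivisors_iff_right] at h ⊢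
  intro z hz
  apply (sectionHom_bijective j).injective
  rw [map_zero]
  apply h
  rw [← map_mul, hz, map_zero]

theorem ideal_opensRange_eq_span {R : Type u} [CommRing R]
    (j : Spec(R) ⟶ X) [IsOpenImmersion j] {I : X.IdealSheafData}
    {y : Γ(X, j.opensRange)}
    (h : chartIdeal j I = span {sectionHom j j.opensRange (range_le_opensRange j) y}) :
    I.ideal (chartOpen j) = span {y} := by
  ext z
  rw [← mem_chartIdeal_iff, h, mem_span_singleton, mem_span_singleton]
  constructor
  · rintro ⟨w, hw⟩
    obtain ⟨v, rfl⟩ := (sectionHom_bijective j).surjective w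
    exact ⟨v, (sectionHom_bijective j).injective (by rw [hw, map_mul])⟩
  · rintro ⟨w, rfl⟩
    exact ⟨_, map_mul _ _ _⟩

/-- Ideal sheaves with generators `p a` and `q a` on affine charts `j a` are isomorphic if the
quotients `p a / q a` agree on overlaps. -/
theorem idealIso_of_charts {I J : X.IdealSheafData} {N : Type*} (R : N → Type u)
    [∀ a, CommRing (R a)] (j : ∀ a, Spec(R a) ⟶ X) [∀ a, IsOpenImmersion (j a)]
    (hcov : ∀ x, ∃ a, x ∈ Set.range (j a)) (p q : ∀ a, R a)
    (hp : ∀ a, p a ∈ nonZeroDivisors (R a)) (hq : ∀ a, q a ∈ nonZeroDivisors (R a))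
    (hI : ∀ a, chartIdeal (j a) I = span {p a})
    (hJ : ∀ a, chartIdeal (j a) J = span {q a})
    (h : ∀ (a b) (W : Type u) [CommRing W] (α : R a →+* W) (β : R b →+* W),
      SpecMap(α) ≫ j a = SpecMap(β) ≫ j b →
      α (p a) * β (q b) = β (p b) * α (q a)) : IdealIso I J := by
  have hp' := fun a => (sectionHom_bijective (j a)).surjective (p a)
  have hq' := fun a => (sectionHom_bijective (j a)).surjective (q a)
  choose P hP using hp'
  choose Q hQ using hq'
  let c : GeneratorCover I J :=
    { opens := fun a => ⟨(j a).opensRange, isAffineOpen_opensRange (j a)⟩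
      covers := hcov
      genI := P
      genJ := Q
      genI_mem := fun a => sectionHom_mem_nonZeroDivisors (j a) (by rw [hP]; exact hp a)
      genJ_mem := fun a => sectionHom_mem_nonZeroDivisors (j a) (by rw [hQ]; exact hq a)
      ideal_I := fun a => ideal_opensRange_eq_span (j a) (by rw [hP]; exact hI a)
      ideal_J := fun a => ideal_opensRange_eq_span (j a) (by rw [hQ]; exact hJ a)
      compatible := by
        intro a b W ha hb
        have hr : ∀ a (_ : W.1 ≤ (j a).opensRange), Set.range W.2.fromSpec ⊆ Set.range (j a) := by
          intro a ha
          rw [W.2.range_fromSpec]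
          exact ha
        obtain ⟨α, hα⟩ := exists_specMap_eq (IsOpenImmersion.lift (j a) W.2.fromSpec (hr a ha))
        obtain ⟨β, hβ⟩ := exists_specMap_eq (IsOpenImmersion.lift (j b) W.2.fromSpec (hr b hb))
        have hα' : SpecMap(α) ≫ j a = W.2.fromSpec := by rw [← hα]; exact lift_fac _ _ _
        have hβ' : SpecMap(β) ≫ j b = W.2.fromSpec := by rw [← hβ]; exact lift_fac _ _ _
        have key : ∀ (a) (ha : W.1 ≤ (j a).opensRange) (α : R a →+* Γ(X, W.1))
            (_ : SpecMap(α) ≫ j a = W.2.fromSpec)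
            (y : Γ(X, (j a).opensRange)), resHom ha y =
              α (sectionHom (j a) (j a).opensRange (range_le_opensRange (j a)) y) := by
          intro a ha α hα y
          have hr' : Set.range (SpecMap(α) ≫ j a) ⊆ W.1 := by rw [hα, W.2.range_fromSpec]
          rw [← sectionHom_specMap α (j a) (range_le_opensRange (j a)) (hr'.trans ha),
            ← sectionHom_res (SpecMap(α) ≫ j a) ha hr']
          have h1 : ∀ (g : Spec(Γ(X, W.1)) ⟶ X) (hg : Set.range g ⊆ W.1),
              g = W.2.fromSpec → ∀ z, sectionHom g W.1 hg z = z := by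
            rintro _ hg rfl z
            exact sectionHom_fromSpec W.2 z
          exact (h1 _ hr' hα _).symm
        have h2 := h a b Γ(X, W.1) α β (hα'.trans hβ'.symm)
        rw [key a ha α hα', key a ha α hα', key b hb β hβ', key b hb β hβ', hP, hQ, hP, hQ]
        exact h2 }
  exact c.idealIso

end Gluing

end

/-! ### Subschemes of the projective line -/

section

section LaurentPolynomials

open Polynomial

variable {k : Type u} [Field k]

theorem isUnit_laurent {w : LaurentPolynomial k} (hw : IsUnit w) :
    ∃ (c : k) (m : ℤ), c ≠ 0 ∧ w = LaurentPolynomial.C c * LaurentPolynomial.T m := by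
  obtain ⟨v, hv⟩ := hw.exists_right_inv
  obtain ⟨a, f, hf⟩ := exists_T_pow w
  obtain ⟨b, g, hg⟩ := exists_T_pow v
  have h1 : f * g = X ^ (a + b) := by
    apply toLaurent_injective
    rw [map_mul, hf, hg, toLaurent_X_pow, Nat.cast_add, T_add]
    linear_combination LaurentPolynomial.T (a : ℤ) * LaurentPolynomial.T (b : ℤ) * hv
  obtain ⟨i, -, hi⟩ := (dvd_prime_pow prime_X (a + b)).1 (Dvd.intro g h1)
  obtain ⟨y, hy⟩ := hi.symm
  obtain ⟨c, hc, hcy⟩ := isUnit_iff.1 y.isUnit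
  refine ⟨c, i - a, hc.ne_zero, ?_⟩
  have h2 : w = toLaurent f * LaurentPolynomial.T (-a : ℤ) := by
    rw [hf, LaurentPolynomial.mul_T_assoc, add_neg_cancel, LaurentPolynomial.T_zero, mul_one]
  rw [h2, ← hy, ← hcy, map_mul, toLaurent_X_pow, toLaurent_C, sub_eq_add_neg, T_add]
  ring

theorem finrank_of_ker_eq_span {M : Type*} [CommRing M] [Algebra k M] (l : k[X] →ₐ[k] M)
    (hl : Function.Surjective l) {p : k[X]} (hp : p ≠ 0) (hker : ker l = span {p}) :
    Module.Finite k M ∧ Module.finrank k M = p.natDegree := by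
  let e := Ideal.quotientKerAlgEquivOfSurjective hl
  have e' : (k[X] ⧸ span {p}) ≃ₐ[k] M := (Ideal.quotientEquivAlgOfEq k hker.symm).trans e
  have h1 : Module.Finite k (k[X] ⧸ span {p}) := (AdjoinRoot.powerBasis hp).finite
  exact ⟨Module.Finite.equiv e'.toLinearEquiv,
    e'.toLinearEquiv.finrank_eq.symm.trans (finrank_quotient_span_eq_natDegree)⟩

/-- The degree of a closed subscheme of the projective line, glued from `k[t] / p₀`, `k[1/t] / p₁` and
their common localization, is the exponent `m` for which `p₀ = c t ^ m p₁`. -/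
theorem finrank_glued {E M₀ M₁ M : Type*} [CommRing M₀] [CommRing M₁] [CommRing M] [Algebra k M₀]
    [Algebra k M₁] [Algebra k M] [AddCommGroup E] [Module k E]
    (l₀ : k[X] →ₐ[k] M₀) (l₁ : k[X] →ₐ[k] M₁) (l : LaurentPolynomial k →ₐ[k] M)
    (hl₀ : Function.Surjective l₀) (hl₁ : Function.Surjective l₁) (hl : Function.Surjective l)
    {p₀ p₁ : k[X]} (hp₀ : p₀ ≠ 0) (hp₁ : p₁ ≠ 0)
    (hk₀ : ker l₀ = span {p₀}) (hk₁ : ker l₁ = span {p₁})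
    (hk : ker l = span {toLaurent p₀})
    (r₀ : M₀ →ₗ[k] M) (r₁ : M₁ →ₗ[k] M) (hr₀ : ∀ g, r₀ (l₀ g) = l (toLaurent g))
    (i₀ : E →ₗ[k] M₀) (i₁ : E →ₗ[k] M₁) (hinj : ∀ x, i₀ x = 0 → i₁ x = 0 → x = 0)
    (hcomp : ∀ x, r₀ (i₀ x) = r₁ (i₁ x))
    (hglue : ∀ a b, r₀ a = r₁ b → ∃ x, i₀ x = a ∧ i₁ x = b)
    {c : k} (hc : c ≠ 0) {m : ℤ}
    (h : toLaurent p₀ = LaurentPolynomial.C c * LaurentPolynomial.T m * invert (toLaurent p₁)) :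
    (Module.finrank k E : ℤ) = m := by
  obtain ⟨hf₀, hd₀⟩ := finrank_of_ker_eq_span l₀ hl₀ hp₀ hk₀
  obtain ⟨hf₁, hd₁⟩ := finrank_of_ker_eq_span l₁ hl₁ hp₁ hk₁
  obtain ⟨q, hq, hXq⟩ := exists_eq_pow_rootMultiplicity_mul_and_not_dvd p₀ hp₀ 0
  rw [C_0, sub_zero] at hq hXq
  set r := rootMultiplicity 0 p₀
  have hq0 : q ≠ 0 := by rintro rfl; simp at hXq
  have hcop : ∀ n : ℕ, IsCoprime (X ^ n) q := fun n =>
    ((irreducible_X.coprime_iff_not_dvd).2 hXq).pow_left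
  have hkq : ker l = span {toLaurent q} := by
    rw [hk, hq, map_mul, toLaurent_X_pow]
    exact Ideal.span_singleton_mul_left_unit (LaurentPolynomial.isUnit_T _) _
  let lq : k[X] →ₐ[k] M := l.comp toLaurentAlg
  have hlq : ∀ g, lq g = l (toLaurent g) := fun g => rfl
  have hlq0 : l (toLaurent q) = 0 := by
    have : toLaurent q ∈ ker l := by rw [hkq]; exact mem_span_singleton_self _
    exact this
  have hlqs : Function.Surjective lq := by
    intro y
    obtain ⟨w, rfl⟩ := hl y
    obtain ⟨n, g, hg⟩ := exists_T_pow w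
    obtain ⟨a, b, hab⟩ := hcop n
    refine ⟨a * g, ?_⟩
    have h1 : toLaurent (a * g) = w - w * toLaurent b * toLaurent q := by
      have h2 := congr_arg toLaurent hab
      rw [map_add, map_mul, map_mul, toLaurent_X_pow, toLaurent_one] at h2
      rw [map_mul, hg]
      linear_combination w * h2
    rw [hlq, h1, map_sub, map_mul l, hlq0, mul_zero, sub_zero]
  have hlqk : ker lq = span {q} := by
    ext g
    have h1 : g ∈ ker lq ↔ toLaurent g ∈ ker l := Iff.rfl
    rw [h1, hkq, mem_span_singleton, mem_span_singleton]
    constructor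
    · rintro ⟨w, hw⟩
      obtain ⟨n, g', hg'⟩ := exists_T_pow w
      refine (hcop n).symm.dvd_of_dvd_mul_left (⟨g', ?_⟩ : q ∣ X ^ n * g)
      apply toLaurent_injective
      rw [map_mul, map_mul, toLaurent_X_pow, hw, hg']
      ring
    · rintro ⟨w, rfl⟩
      exact ⟨_, map_mul _ _ _⟩
  obtain ⟨hf, hd⟩ := finrank_of_ker_eq_span lq hlqs hq0 hlqk
  have hdeg : p₀.natDegree = r + q.natDegree := by
    conv_lhs => rw [hq]
    rw [natDegree_mul (pow_ne_zero _ X_ne_zero) hq0, natDegree_X_pow]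
  -- the order of `p₀` at `0` from the degree of `p₁`
  have hcoef : ∀ i : ℤ, (toLaurent p₀).coeff i = c * (toLaurent p₁).coeff (m - i) := by
    intro i
    rw [h, mul_assoc, ← LaurentPolynomial.smul_eq_C_mul, AddMonoidAlgebra.coeff_smul,
      Finsupp.smul_apply, smul_eq_mul]
    congr 1
    have h2 := AddMonoidAlgebra.coeff_single_mul_apply (invert (toLaurent p₁)) (1 : k) m i
    rw [LaurentPolynomial.T, h2]
    simp [sub_eq_add_neg, add_comm]
  have hnat : ∀ (p : k[X]) (n : ℕ), (toLaurent p).coeff (n : ℤ) = p.coeff n := by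
    intro p n
    rw [coeff_toLaurent]
    exact Finsupp.mapDomain_apply Nat.cast_injective _ _
  have hneg : ∀ (p : k[X]) (i : ℤ), (toLaurent p).coeff i ≠ 0 → ∃ n : ℕ, i = n := by
    intro p i hi
    by_contra h3
    push Not at h3
    apply hi
    rw [coeff_toLaurent]
    refine Finsupp.mapDomain_notin_range _ _ ?_
    rintro ⟨n, hn⟩
    exact h3 n hn.symm
  have hlow : ∀ n : ℕ, p₀.coeff n ≠ 0 → r ≤ n := by
    intro n hn
    by_contra h3
    apply hn
    rw [hq, mul_comm, coeff_mul_X_pow', if_neg h3]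
  have hr : p₀.coeff r ≠ 0 := by
    rw [hq, mul_comm, coeff_mul_X_pow', if_pos le_rfl, Nat.sub_self]
    intro h3
    exact hXq (X_dvd_iff.2 h3)
  have hrm : (r : ℤ) = m - p₁.natDegree := by
    apply le_antisymm
    · have h3 : (toLaurent p₀).coeff (m - p₁.natDegree) ≠ 0 := by
        rw [hcoef, sub_sub_cancel, hnat]
        exact mul_ne_zero hc (by simpa using hp₁)
      obtain ⟨n, hn⟩ := hneg _ _ h3
      rw [hn, hnat] at h3
      rw [hn]
      exact_mod_cast hlow n h3
    · have h3 : (toLaurent p₁).coeff (m - r) ≠ 0 := by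
        intro h4
        apply hr
        rw [← hnat, hcoef, h4, mul_zero]
      obtain ⟨n, hn⟩ := hneg _ _ h3
      rw [hn, hnat] at h3
      have h5 := le_natDegree_of_ne_zero h3
      have h6 : (n : ℤ) ≤ p₁.natDegree := by exact_mod_cast h5
      omega
  -- the Mayer-Vietoris sequence
  let d : M₀ × M₁ →ₗ[k] M := r₀.comp (LinearMap.fst k M₀ M₁) - r₁.comp (LinearMap.snd k M₀ M₁)
  have hds : Function.Surjective d := by
    intro y
    obtain ⟨g, rfl⟩ := hlqs y
    exact ⟨(l₀ g, 0), by simp [d, hr₀, hlq]⟩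
  let ε : E →ₗ[k] LinearMap.ker d := (i₀.prod i₁).codRestrict _ fun x => by simp [d, hcomp]
  have hε : Function.Bijective ε := by
    constructor
    · rw [injective_iff_map_eq_zero]
      intro x hx
      have h3 : (i₀ x, i₁ x) = 0 := congr_arg Subtype.val hx
      exact hinj x (congr_arg Prod.fst h3) (congr_arg Prod.snd h3)
    · rintro ⟨⟨a, b⟩, hab⟩
      obtain ⟨x, rfl, rfl⟩ := hglue a b (by simpa [d, sub_eq_zero] using hab)
      exact ⟨x, rfl⟩
  have h3 := LinearMap.finrank_range_add_finrank_ker d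
  rw [LinearMap.range_eq_top.2 hds, finrank_top, Module.finrank_prod,
    ← (LinearEquiv.ofBijective ε hε).finrank_eq, hd, hd₀, hd₁] at h3
  omega

end LaurentPolynomials

end

/-! ### Intersection numbers with a projective line -/

section

section IdealIsoCharts

variable {X : Scheme.{u}} {R S : Type u} [CommRing R] [CommRing S]

variable {A B : X.IdealSheafData} (e : ∀ U : X.affineOpens, A.ideal U ≃ₗ[Γ(X, U.1)] B.ideal U)

section

variable (j : Spec(R) ⟶ X) [IsOpenImmersion j]

/-- The functions on the image of an affine chart are the elements of its ring. -/
def sectionEquiv : Γ(X, j.opensRange) ≃+* R := RingEquiv.ofBijective _ (sectionHom_bijective j)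

theorem sectionEquiv_apply (y : Γ(X, j.opensRange)) :
    sectionEquiv j y = sectionHom j j.opensRange (range_le_opensRange j) y := rfl

theorem sectionEquiv_symm_mem (I : X.IdealSheafData) (a : R) :
    (sectionEquiv j).symm a ∈ I.ideal (chartOpen j) ↔ a ∈ chartIdeal j I := by
  rw [← mem_chartIdeal_iff, ← sectionEquiv_apply, RingEquiv.apply_symm_apply]

open Classical in
/-- The isomorphism of two ideal sheaves on an affine chart, extended by zero to a function on the
coordinate ring. -/
def chartFun (a : R) : R := if h : (sectionEquiv j).symm a ∈ A.ideal (chartOpen j) then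
    sectionEquiv j (e (chartOpen j) ⟨_, h⟩).1
  else 0

theorem chartFun_apply (x : A.ideal (chartOpen j)) : chartFun e j (sectionEquiv j x.1) =
      sectionEquiv j (e (chartOpen j) x).1 := by
  have h : (sectionEquiv j).symm (sectionEquiv j x.1) ∈ A.ideal (chartOpen j) := by
    rw [RingEquiv.symm_apply_apply]; exact x.2
  rw [chartFun, dif_pos h]
  congr 3
  exact Subtype.ext (RingEquiv.symm_apply_apply _ _)

theorem exists_section_of_mem {I : X.IdealSheafData} {a : R} (ha : a ∈ chartIdeal j I) :
    ∃ x : I.ideal (chartOpen j), sectionEquiv j x.1 = a :=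
  ⟨⟨_, (sectionEquiv_symm_mem j I a).2 ha⟩, RingEquiv.apply_symm_apply _ _⟩

theorem chartFun_mem {a : R} (ha : a ∈ chartIdeal j A) : chartFun e j a ∈ chartIdeal j B := by
  obtain ⟨x, rfl⟩ := exists_section_of_mem j ha
  rw [chartFun_apply]
  exact (mem_chartIdeal_iff j B _).2 (e _ x).2

theorem chartFun_mul {a : R}
    (ha : a ∈ chartIdeal j A) (r : R) : chartFun e j (r * a) = r * chartFun e j a := by
  obtain ⟨x, rfl⟩ := exists_section_of_mem j ha
  obtain ⟨s, rfl⟩ := (sectionEquiv j).surjective r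
  have h := chartFun_apply e j (s • x)
  rw [map_smul] at h
  rw [chartFun_apply]
  simpa using h

theorem chartFun_inj {a b : R}
    (ha : a ∈ chartIdeal j A) (hb : b ∈ chartIdeal j A) (h : chartFun e j a = chartFun e j b) :
    a = b := by
  obtain ⟨x, rfl⟩ := exists_section_of_mem j ha
  obtain ⟨y, rfl⟩ := exists_section_of_mem j hb
  rw [chartFun_apply, chartFun_apply] at h
  have h1 := (e _).injective (Subtype.ext ((sectionEquiv j).injective h))
  rw [h1]

theorem chartFun_surj {b : R}
    (hb : b ∈ chartIdeal j B) : ∃ a ∈ chartIdeal j A, chartFun e j a = b := by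
  obtain ⟨y, rfl⟩ := exists_section_of_mem j hb
  obtain ⟨x, rfl⟩ := (e _).surjective y
  exact ⟨_, (mem_chartIdeal_iff j A _).2 x.2, chartFun_apply e j x⟩

end

theorem opensRange_le_of_comp {α : R →+* S} {j : Spec(R) ⟶ X} [IsOpenImmersion j]
    {j' : Spec(S) ⟶ X} [IsOpenImmersion j']
    (h : SpecMap(α) ≫ j = j') : j'.opensRange ≤ j.opensRange := by
  subst h
  rintro _ ⟨y, rfl⟩
  exact ⟨_, (Hom.comp_apply _ _ _).symm⟩

theorem sectionEquiv_res {α : R →+* S} {j : Spec(R) ⟶ X} [IsOpenImmersion j]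
    {j' : Spec(S) ⟶ X} [IsOpenImmersion j']
    (h : SpecMap(α) ≫ j = j') (y : Γ(X, j.opensRange)) :
    sectionEquiv j' (resHom (opensRange_le_of_comp h) y) = α (sectionEquiv j y) := by
  rw [sectionEquiv_apply, sectionEquiv_apply]
  refine (sectionHom_res j' (opensRange_le_of_comp h) (range_le_opensRange j') y).trans ?_
  subst h
  exact sectionHom_specMap α j (range_le_opensRange j) _ y

theorem chartFun_comp (he : ∀ (U V : X.affineOpens) (h : U ≤ V) (x : A.ideal V),
      (e U ⟨(X.presheaf.map (homOfLE (show U.1 ≤ V.1 from h)).op).hom x.1,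
          A.ideal_le_comap_ideal h x.2⟩ : Γ(X, U.1)) =
        (X.presheaf.map (homOfLE (show U.1 ≤ V.1 from h)).op).hom (e V x : Γ(X, V.1)))
    {α : R →+* S} {j : Spec(R) ⟶ X} [IsOpenImmersion j]
    {j' : Spec(S) ⟶ X} [IsOpenImmersion j']
    (h : SpecMap(α) ≫ j = j') {a : R} (ha : a ∈ chartIdeal j A) :
    chartFun e j' (α a) = α (chartFun e j a) := by
  obtain ⟨x, rfl⟩ := exists_section_of_mem j ha
  have h1 := he (chartOpen j') (chartOpen j) (opensRange_le_of_comp h) x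
  have h2 := chartFun_apply e j' ⟨_, A.ideal_le_comap_ideal (U := (chartOpen j'))
    (V := (chartOpen j)) (opensRange_le_of_comp h) x.2⟩
  rw [chartFun_apply, ← sectionEquiv_res h, ← sectionEquiv_res h]
  exact h2.trans (congr_arg (sectionEquiv j') h1)

end IdealIsoCharts

section Curves

open Polynomial

variable {X : Scheme.{u}} {k : Type u} [Field k]

/-- Functions on the part of the closed subscheme of `Z` in an affine chart, as a quotient of the ring
`P` of functions on the curve in the chart. -/
theorem exists_quotientHom {R P : Type u} [CommRing R] [CommRing P]
    (j : Spec(R) ⟶ X) [IsOpenImmersion j] {Z : X.IdealSheafData}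
    (ρ : R →+* P) (hρ : Function.Surjective ρ) {K : Ideal P}
    (hZ : chartIdeal j Z = K.comap ρ) :
    ∃ l : P →+* Γ(Z.subscheme, Z.subschemeι ⁻¹ᵁ j.opensRange), Function.Surjective l ∧ ker l = K ∧
      ∀ s : Γ(X, j.opensRange), l (ρ (sectionEquiv j s)) = (Z.subschemeι.app j.opensRange).hom s := by
  let ρ' : Γ(X, j.opensRange) →+* P := ρ.comp (sectionEquiv j : Γ(X, j.opensRange) →+* R)
  have hρ' : Function.Surjective ρ' := hρ.comp (sectionEquiv j).surjective
  have h0 : ∀ s, (Z.subschemeι.app j.opensRange).hom s = 0 ↔ ρ' s ∈ K := by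
    intro s
    rw [← mem_ker]
    have h1 := IdealSheafData.ker_subschemeι_app Z (chartOpen j)
    rw [show ker (Z.subschemeι.app j.opensRange).hom = _ from h1, ← mem_chartIdeal_iff, hZ]
    rfl
  have hker : ker ρ' ≤ ker (Z.subschemeι.app j.opensRange).hom := by
    intro s hs
    rw [mem_ker, h0, (mem_ker.1 hs)]
    exact zero_mem K
  let l := ρ'.liftOfSurjective hρ' ⟨(Z.subschemeι.app j.opensRange).hom, hker⟩
  have hl : ∀ s, l (ρ' s) = (Z.subschemeι.app j.opensRange).hom s :=
    fun s => RingHom.liftOfRightInverse_comp_apply _ _ _ _ _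
  refine ⟨l, ?_, ?_, hl⟩
  · intro y
    obtain ⟨s, rfl⟩ := IdealSheafData.subschemeι_app_surjective Z (chartOpen j) y
    exact ⟨_, hl s⟩
  · ext x
    obtain ⟨s, rfl⟩ := hρ' x
    rw [mem_ker, hl, h0]

/-- Affine charts that exhibit the closed subset `C` as a projective line: the coordinate rings of `C`
in the charts `j₀` and `j₁` are `k[t]` and `k[1/t]`, and it is `k[t, 1/t]` in the chart `jw`. -/
structure ProjectiveLineCharts (f : X ⟶ Spec(k)) (C : Closeds X) where
  {R₀ R₁ Rw : Type u}
  [commRing₀ : CommRing R₀]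
  [commRing₁ : CommRing R₁]
  [commRingw : CommRing Rw]
  j₀ : Spec(R₀) ⟶ X
  j₁ : Spec(R₁) ⟶ X
  jw : Spec(Rw) ⟶ X
  [open₀ : IsOpenImmersion j₀]
  [open₁ : IsOpenImmersion j₁]
  [openw : IsOpenImmersion jw]
  α₀ : R₀ →+* Rw
  α₁ : R₁ →+* Rw
  specMap_α₀ : SpecMap(α₀) ≫ j₀ = jw
  specMap_α₁ : SpecMap(α₁) ≫ j₁ = jw
  ρ₀ : R₀ →+* k[X]
  ρ₁ : R₁ →+* k[X]
  ρw : Rw →+* LaurentPolynomial k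
  surj₀ : Function.Surjective ρ₀
  surj₁ : Function.Surjective ρ₁
  surjw : Function.Surjective ρw
  ρw_α₀ : ∀ a, ρw (α₀ a) = toLaurent (ρ₀ a)
  ρw_α₁ : ∀ a, ρw (α₁ a) = invert (toLaurent (ρ₁ a))
  ker₀ : ker ρ₀ = I(j₀, C)
  ker₁ : ker ρ₁ = I(j₁, C)
  kerw : ker ρw = I(jw, C)
  κ₀ : k →+* R₀
  κ₁ : k →+* R₁
  specMap_κ₀ : j₀ ≫ f = SpecMap(κ₀)
  specMap_κ₁ : j₁ ≫ f = SpecMap(κ₁)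
  ρ₀_κ₀ : ∀ a, ρ₀ (κ₀ a) = Polynomial.C a
  ρ₁_κ₁ : ∀ a, ρ₁ (κ₁ a) = Polynomial.C a
  cover : (C : Set X) ⊆ Set.range j₀ ∪ Set.range j₁
  inter : (C : Set X) ∩ (Set.range j₀ ∩ Set.range j₁) ⊆ Set.range jw

namespace ProjectiveLineCharts

attribute [instance] commRing₀ commRing₁ commRingw open₀ open₁ openw

variable {f : X ⟶ Spec(k)} {C : Closeds X} (c : ProjectiveLineCharts f C)

theorem sectionEquiv_structure {R : Type u} [CommRing R] (j : Spec(R) ⟶ X)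
    [IsOpenImmersion j] {κ : k →+* R} (hκ : j ≫ f = SpecMap(κ)) (a : k) :
    sectionEquiv j (resHom le_top
      (((ΓSpecIso (CommRingCat.of k)).inv ≫ f.appTop).hom a)) = κ a := by
  have h1 : (ΓSpecIso (CommRingCat.of k)).inv ≫ f.appTop ≫ j.appTop =
      ofHom κ ≫ (ΓSpecIso (CommRingCat.of R)).inv := by
    rw [← Hom.comp_appTop, hκ]
    exact (Scheme.ΓSpecIso_inv_naturality (ofHom κ)).symm
  rw [sectionEquiv_apply]
  refine (sectionHom_res j le_top (range_le_opensRange j) _).trans ?_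
  have h2 := congrArg (ΓSpecIso (CommRingCat.of R)).hom.hom (congr_hom h1 a)
  have h3 : j.appLE ⊤ ⊤ (top_le_preimage j fun _ _ => trivial) = j.appTop := Hom.appLE_eq_app _
  simp only [sectionHom, RingHom.comp_apply]
  rw [h3]
  refine Eq.trans h2 ?_
  exact congr_hom (ΓSpecIso (CommRingCat.of R)).inv_hom_id (κ a)

theorem map_chartIdeal_eq (I : X.IdealSheafData) :
    (Ideal.map c.ρ₀ (chartIdeal c.j₀ I)).map (toLaurent (R := k)) =
      ((Ideal.map c.ρ₁ (chartIdeal c.j₁ I)).map (toLaurent (R := k))).map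
        (invert (R := k) : LaurentPolynomial k →+* LaurentPolynomial k) := by
  have h0 : (Ideal.map c.ρ₀ (chartIdeal c.j₀ I)).map (toLaurent (R := k)) =
      Ideal.map c.ρw (chartIdeal c.jw I) := by
    rw [← c.specMap_α₀, chartIdeal_specMap, Ideal.map_map, Ideal.map_map]
    congr 1
    exact RingHom.ext fun a => (c.ρw_α₀ a).symm
  have h1 : ((Ideal.map c.ρ₁ (chartIdeal c.j₁ I)).map (toLaurent (R := k))).map
        (invert (R := k) : LaurentPolynomial k →+* LaurentPolynomial k) =
      Ideal.map c.ρw (chartIdeal c.jw I) := by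
    rw [← c.specMap_α₁, chartIdeal_specMap, Ideal.map_map, Ideal.map_map, Ideal.map_map]
    congr 1
    exact RingHom.ext fun a => (c.ρw_α₁ a).symm
  rw [h0, h1]

/-- The degree of the intersection with the line, from equations on the two affine parts. -/
theorem meetDegree_spec (I : X.IdealSheafData) {p₀ p₁ : k[X]} (hp₀ : p₀ ≠ 0) (hp₁ : p₁ ≠ 0)
    (h₀ : Ideal.map c.ρ₀ (chartIdeal c.j₀ I) = span {p₀})
    (h₁ : Ideal.map c.ρ₁ (chartIdeal c.j₁ I) = span {p₁}) :
    ∃ a : k, a ≠ 0 ∧ toLaurent p₀ = LaurentPolynomial.C a *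
      LaurentPolynomial.T (meetDegree f I C : ℤ) * invert (toLaurent p₁) := by
  have hw : Ideal.map c.ρw (chartIdeal c.jw I) = span {toLaurent p₀} := by
    rw [← c.specMap_α₀, chartIdeal_specMap, Ideal.map_map,
      show c.ρw.comp c.α₀ = (toLaurent (R := k)).comp c.ρ₀ from RingHom.ext c.ρw_α₀,
      ← Ideal.map_map, h₀, map_span, Set.image_singleton]
  -- the two equations agree up to a unit on the overlap
  have hassoc : Associated (invert (toLaurent p₁)) (toLaurent p₀) := by
    have h := c.map_chartIdeal_eq I
    rw [h₀, h₁, map_span, map_span, map_span, Set.image_singleton,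
      Set.image_singleton, Set.image_singleton] at h
    exact (Ideal.span_singleton_eq_span_singleton.1 h).symm
  obtain ⟨v, hv⟩ := hassoc
  obtain ⟨a, m, ha, hm⟩ := isUnit_laurent v.isUnit
  have hpm : toLaurent p₀ = LaurentPolynomial.C a * LaurentPolynomial.T m *
      invert (toLaurent p₁) := by
    rw [← hv, hm]; ring
  refine ⟨a, ha, ?_⟩
  suffices hdeg : (meetDegree f I C : ℤ) = m by rw [hdeg]; exact hpm
  let Z := I ⊔ vanishingIdeal C
  have hZ : ∀ {R P : Type u} [CommRing R] [CommRing P] (j : Spec(R) ⟶ X)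
      [IsOpenImmersion j] (ρ : R →+* P) (_ : Function.Surjective ρ)
      (_ : ker ρ = I(j, C)),
      chartIdeal j Z = (Ideal.map ρ (chartIdeal j I)).comap ρ := by
    intro R P _ _ j _ ρ hρ hker
    rw [Ideal.comap_map_of_surjective ρ hρ, chartIdeal_sup, ← hker]
    rfl
  obtain ⟨l₀, hl₀, hk₀, hs₀⟩ := exists_quotientHom c.j₀ c.ρ₀ c.surj₀ (hZ c.j₀ c.ρ₀ c.surj₀ c.ker₀)
  obtain ⟨l₁, hl₁, hk₁, hs₁⟩ := exists_quotientHom c.j₁ c.ρ₁ c.surj₁ (hZ c.j₁ c.ρ₁ c.surj₁ c.ker₁)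
  obtain ⟨l, hl, hk, hs⟩ := exists_quotientHom c.jw c.ρw c.surjw (hZ c.jw c.ρw c.surjw c.kerw)
  rw [h₀] at hk₀
  rw [h₁] at hk₁
  rw [hw] at hk
  let ι := Z.subschemeι
  let U₀ := ι ⁻¹ᵁ c.j₀.opensRange
  let U₁ := ι ⁻¹ᵁ c.j₁.opensRange
  let U := ι ⁻¹ᵁ c.jw.opensRange
  have hle₀ : U ≤ U₀ := ι.preimage_mono (opensRange_le_of_comp c.specMap_α₀)
  have hle₁ : U ≤ U₁ := ι.preimage_mono (opensRange_le_of_comp c.specMap_α₁)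
  have hZC : ∀ z : Z.subscheme, ι z ∈ C := by
    intro z
    have h1 : ι z ∈ Z.support := by
      have h2 : ι z ∈ Set.range Z.subschemeι := ⟨z, rfl⟩
      rw [IdealSheafData.range_subschemeι] at h2
      exact h2
    have h3 : Z.support ≤ (vanishingIdeal C).support := IdealSheafData.support_antitone le_sup_right
    have h4 := h3 h1
    have h5 : (vanishingIdeal C).support = C := SetLike.coe_injective (coe_support_vanishingIdeal C)
    rwa [h5] at h4
  have hcov : (⊤ : Z.subscheme.Opens) ≤ U₀ ⊔ U₁ := fun z _ => c.cover (hZC z)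
  have hint : U₀ ⊓ U₁ ≤ U := fun z hz => c.inter ⟨hZC z, hz⟩
  let κ : k →+* Γ(Z.subscheme, ⊤) := ((ΓSpecIso (CommRingCat.of k)).inv ≫ (ι ≫ f).appTop).hom
  let _ : Algebra k Γ(Z.subscheme, ⊤) := κ.toAlgebra
  let _ : Algebra k Γ(Z.subscheme, U₀) := ((resHom (le_top : U₀ ≤ ⊤)).comp κ).toAlgebra
  let _ : Algebra k Γ(Z.subscheme, U₁) := ((resHom (le_top : U₁ ≤ ⊤)).comp κ).toAlgebra
  let _ : Algebra k Γ(Z.subscheme, U) := ((resHom (le_top : U ≤ ⊤)).comp κ).toAlgebra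
  -- compatibility with restriction
  have happ : ∀ {V W : X.Opens} (h : V ≤ W) (s : Γ(X, W)),
      (ι.app V).hom (resHom h s) = resHom (ι.preimage_mono h) ((ι.app W).hom s) :=
    fun h s => congr_hom (ι.naturality (homOfLE h).op) s
  have hκ : ∀ (V : X.Opens) (a : k), resHom (le_top : ι ⁻¹ᵁ V ≤ ⊤) (κ a) = (ι.app V).hom
      (resHom le_top (((ΓSpecIso (CommRingCat.of k)).inv ≫ f.appTop).hom a)) := by
    intro V a
    rw [happ]
    rfl
  have hr₀ : ∀ g, resHom hle₀ (l₀ g) = l (toLaurent g) := by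
    intro g
    obtain ⟨r, rfl⟩ := c.surj₀ g
    obtain ⟨s, rfl⟩ := (sectionEquiv c.j₀).surjective r
    rw [hs₀, ← c.ρw_α₀, ← sectionEquiv_res c.specMap_α₀, hs]
    exact (happ _ s).symm
  have hr₁ : ∀ g, resHom hle₁ (l₁ g) = l (invert (toLaurent g)) := by
    intro g
    obtain ⟨r, rfl⟩ := c.surj₁ g
    obtain ⟨s, rfl⟩ := (sectionEquiv c.j₁).surjective r
    rw [hs₁, ← c.ρw_α₁, ← sectionEquiv_res c.specMap_α₁, hs]
    exact (happ _ s).symm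
  have hc₀ : ∀ a, l₀ (Polynomial.C a) = resHom (le_top : U₀ ≤ ⊤) (κ a) := by
    intro a
    rw [hκ, ← c.ρ₀_κ₀, ← sectionEquiv_structure c.j₀ c.specMap_κ₀, hs₀]
  have hc₁ : ∀ a, l₁ (Polynomial.C a) = resHom (le_top : U₁ ≤ ⊤) (κ a) := by
    intro a
    rw [hκ, ← c.ρ₁_κ₁, ← sectionEquiv_structure c.j₁ c.specMap_κ₁, hs₁]
  have hc : ∀ a, l (LaurentPolynomial.C a) = resHom (le_top : U ≤ ⊤) (κ a) := by
    intro a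
    rw [← toLaurent_C, ← hr₀, hc₀, resHom_resHom]
  let L₀ : k[X] →ₐ[k] Γ(Z.subscheme, U₀) := { l₀ with commutes' := hc₀ }
  let L₁ : k[X] →ₐ[k] Γ(Z.subscheme, U₁) := { l₁ with commutes' := hc₁ }
  let L : LaurentPolynomial k →ₐ[k] Γ(Z.subscheme, U) := { l with
      commutes' := fun a => (congr_arg l (LaurentPolynomial.C_eq_algebraMap a).symm).trans (hc a) }
  let lin : ∀ {V W : Z.subscheme.Opens} (h : V ≤ W) [Algebra k Γ(Z.subscheme, V)]
      [Algebra k Γ(Z.subscheme, W)]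
      (_ : ∀ a, algebraMap k Γ(Z.subscheme, V) a = resHom h (algebraMap k Γ(Z.subscheme, W) a)),
      Γ(Z.subscheme, W) →ₗ[k] Γ(Z.subscheme, V) := fun h _ _ ha =>
    { toFun := resHom h
      map_add' := map_add _
      map_smul' := fun a x => by
        rw [Algebra.smul_def, map_mul, ← ha, ← Algebra.smul_def, RingHom.id_apply] }
  refine finrank_glued L₀ L₁ L hl₀ hl₁ hl hp₀ hp₁ hk₀ hk₁ hk
    (lin hle₀ fun a => (resHom_resHom hle₀ le_top (κ a)).symm)
    (lin hle₁ fun a => (resHom_resHom hle₁ le_top (κ a)).symm) hr₀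
    (lin (le_top : U₀ ≤ ⊤) fun a => rfl) (lin (le_top : U₁ ≤ ⊤) fun a => rfl)
    ?_ ?_ ?_ ha hpm
  · intro x h0 h1
    refine section_eq_of_locally (fun b : Bool => if b then U₀ else U₁) ⊤ (fun _ => le_top) ?_ ?_
    · intro z hz
      rcases hcov hz with h | h
      · exact Opens.mem_iSup.2 ⟨true, h⟩
      · exact Opens.mem_iSup.2 ⟨false, h⟩
    · rintro (_ | _)
      · rw [map_zero]; exact h1
      · rw [map_zero]; exact h0
  · intro x
    exact (resHom_resHom hle₀ le_top x).trans (resHom_resHom hle₁ le_top x).symm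
  · intro a b hab
    have hab' : resHom hle₀ a = resHom hle₁ b := hab
    have hab2 : resHom (inf_le_left : U₀ ⊓ U₁ ≤ U₀) a = resHom (inf_le_right : U₀ ⊓ U₁ ≤ U₁) b := by
      rw [← resHom_resHom hint hle₀, hab', resHom_resHom]
    let N : Bool → Z.subscheme.Opens := fun b => if b then U₀ else U₁
    let s : ∀ b : Bool, Γ(Z.subscheme, N b) := fun i => match i with
      | true => a
      | false => b
    obtain ⟨x, hx⟩ := exists_section_of_compatible N ⊤ (fun _ => le_top) (by
      intro z hz
      rcases hcov hz with h | h
      · exact Opens.mem_iSup.2 ⟨true, h⟩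
      · exact Opens.mem_iSup.2 ⟨false, h⟩) s (by
      have hab3 : resHom (inf_le_left : U₁ ⊓ U₀ ≤ U₁) b =
          resHom (inf_le_right : U₁ ⊓ U₀ ≤ U₀) a := by
        have h5 := congr_arg (resHom (inf_comm U₁ U₀).le) hab2
        rw [resHom_resHom, resHom_resHom] at h5
        exact h5.symm
      rintro (_ | _) (_ | _)
      · rfl
      · exact hab3
      · exact hab2
      · rfl)
    exact ⟨x, hx true, hx false⟩

theorem chartIdeal_le_of_map_eq_bot {R P : Type u} [CommRing R] [CommRing P]
    (j : Spec(R) ⟶ X) [IsOpenImmersion j] (ρ : R →+* P) {I : X.IdealSheafData}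
    (hker : ker ρ = I(j, C))
    (h : Ideal.map ρ (chartIdeal j I) = ⊥) {x : X} (hx : x ∈ C) (hxj : x ∈ Set.range j) :
    x ∈ I.support := by
  obtain ⟨p, rfl⟩ := hxj
  have h5 : (vanishingIdeal C).support = C := SetLike.coe_injective (coe_support_vanishingIdeal C)
  rw [← h5] at hx
  have h6 : j p ∈ (vanishingIdeal C).support := hx
  rw [mem_support_chart, ← hker] at h6
  rw [mem_support_chart]
  exact ((Ideal.map_eq_bot_iff_le_ker ρ).1 h).trans h6

theorem map_ne_bot {I : X.IdealSheafData} (h : ¬ C ≤ I.support) :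
    Ideal.map c.ρ₀ (chartIdeal c.j₀ I) ≠ ⊥ ∧ Ideal.map c.ρ₁ (chartIdeal c.j₁ I) ≠ ⊥ := by
  have hinj : Function.Injective (invert (R := k) :
    LaurentPolynomial k →+* LaurentPolynomial k) := (invert (R := k)).injective
  have h0 : Ideal.map c.ρ₀ (chartIdeal c.j₀ I) = ⊥ ↔ Ideal.map c.ρ₁ (chartIdeal c.j₁ I) = ⊥ := by
    rw [← Ideal.map_eq_bot_iff_of_injective (f := toLaurent (R := k)) toLaurent_injective,
      c.map_chartIdeal_eq, Ideal.map_eq_bot_iff_of_injective hinj,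
      Ideal.map_eq_bot_iff_of_injective toLaurent_injective]
  have h1 : ¬ Ideal.map c.ρ₀ (chartIdeal c.j₀ I) = ⊥ := by
    intro h1
    refine h fun x hx => ?_
    rcases c.cover hx with h2 | h2
    · exact chartIdeal_le_of_map_eq_bot c.j₀ c.ρ₀ c.ker₀ h1 hx h2
    · exact chartIdeal_le_of_map_eq_bot c.j₁ c.ρ₁ c.ker₁ (h0.1 h1) hx h2
  exact ⟨h1, fun h2 => h1 (h0.2 h2)⟩

/-- On one chart, an isomorphism `x J ≅ I` maps a suitable element `x y` to an element `z` whose image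
generates the ideal of `I` on the curve, such that `y` generates that of `J`. -/
theorem exists_generators {R : Type u} [CommRing R] (j : Spec(R) ⟶ X)
    [IsOpenImmersion j] (ρ : R →+* k[X]) (hρ : Function.Surjective ρ)
    {A I J : X.IdealSheafData} {x : R}
    (e : ∀ U : X.affineOpens, A.ideal U ≃ₗ[Γ(X, U.1)] I.ideal U)
    (hA : chartIdeal j A = span {x} * chartIdeal j J)
    (hI : Ideal.map ρ (chartIdeal j I) ≠ ⊥) (hJ : Ideal.map ρ (chartIdeal j J) ≠ ⊥) :
    ∃ y ∈ chartIdeal j J, x * y ∈ chartIdeal j A ∧ ρ y ≠ 0 ∧ ρ (chartFun e j (x * y)) ≠ 0 ∧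
      Ideal.map ρ (chartIdeal j J) = span {ρ y} ∧
      Ideal.map ρ (chartIdeal j I) = span {ρ (chartFun e j (x * y))} := by
  obtain ⟨q, hq⟩ := IsPrincipalIdealRing.principal (Ideal.map ρ (chartIdeal j J))
  replace hq : Ideal.map ρ (chartIdeal j J) = span {q} := hq
  have hq1 : q ∈ Ideal.map ρ (chartIdeal j J) := by rw [hq]; exact mem_span_singleton_self _
  obtain ⟨y, hy, rfl⟩ := (Ideal.mem_map_iff_of_surjective ρ hρ).1 hq1
  have hq0 : ρ y ≠ 0 := by
    intro h0
    apply hJ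
    rw [hq, h0, Ideal.span_singleton_eq_bot]
  have hxy : ∀ y ∈ chartIdeal j J, x * y ∈ chartIdeal j A := fun y hy => by
    rw [hA]; exact Ideal.mul_mem_mul (mem_span_singleton_self _) hy
  have hspan : Ideal.map ρ (chartIdeal j I) = span {ρ (chartFun e j (x * y))} := by
    apply le_antisymm
    · rw [Ideal.map_le_iff_le_comap]
      intro b hb
      obtain ⟨a, ha, rfl⟩ := chartFun_surj e j hb
      rw [hA] at ha
      obtain ⟨y', hy', rfl⟩ := Ideal.mem_span_singleton_mul.1 ha
      have h1 : y' * chartFun e j (x * y) = y * chartFun e j (x * y') := by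
        rw [← chartFun_mul e j (hxy y hy), ← chartFun_mul e j (hxy y' hy')]
        congr 1; ring
      have h2 : ρ y' ∈ span {ρ y} := by rw [← hq]; exact mem_map_of_mem _ hy'
      obtain ⟨t, ht⟩ := mem_span_singleton.1 h2
      rw [Ideal.mem_comap, mem_span_singleton]
      refine ⟨t, mul_left_cancel₀ hq0 ?_⟩
      have h3 := congr_arg ρ h1
      rw [map_mul, map_mul, ht] at h3
      rw [← h3]; ring
    · rw [span_singleton_le_iff_mem]
      exact mem_map_of_mem _ (chartFun_mem e j (hxy y hy))
  refine ⟨y, hy, hxy y hy, hq0, ?_, hq, hspan⟩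
  intro h0
  apply hI
  rw [hspan, h0, Ideal.span_singleton_eq_bot]

/-- The degree of a divisor `D` on a projective line, from equations of `D` on the two affine charts.
It does not depend on the choices in `HasIntersectionNumber`. -/
theorem intersectionNumber_eq {D : Closeds X} {x₀ : c.R₀} {x₁ : c.R₁} {u : c.Rw} {e : ℤ}
    (hx₀ : I(c.j₀, D) = span {x₀})
    (hx₁ : I(c.j₁, D) = span {x₁})
    (hnz : c.α₀ x₀ ∈ nonZeroDivisors c.Rw) (hu : c.α₁ x₁ = u * c.α₀ x₀)
    (he : c.ρw u = LaurentPolynomial.T e) (hex : ∃ d, HasIntersectionNumber f D C d) :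
    intersectionNumber f D C = -e := by
  suffices h : ∀ d, HasIntersectionNumber f D C d → d = -e from h _ (Classical.epsilon_spec hex)
  rintro d ⟨I, J, -, -, hCI, hCJ, ⟨φ, hφ⟩, rfl⟩
  obtain ⟨hI₀, hI₁⟩ := c.map_ne_bot hCI
  obtain ⟨hJ₀, hJ₁⟩ := c.map_ne_bot hCJ
  obtain ⟨y₀, hy₀, hxy₀, hq₀, hp₀, hJs₀, hIs₀⟩ := exists_generators c.j₀ c.ρ₀ c.surj₀ φ
    (by rw [chartIdeal_mul, hx₀]) hI₀ hJ₀
  obtain ⟨y₁, hy₁, hxy₁, hq₁, hp₁, hJs₁, hIs₁⟩ := exists_generators c.j₁ c.ρ₁ c.surj₁ φ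
    (by rw [chartIdeal_mul, hx₁]) hI₁ hJ₁
  obtain ⟨a, ha, hI⟩ := c.meetDegree_spec I hp₀ hp₁ hIs₀ hIs₁
  obtain ⟨b, hb, hJ⟩ := c.meetDegree_spec J hq₀ hq₁ hJs₀ hJs₁
  have hw₀ : c.α₀ (x₀ * y₀) ∈ chartIdeal c.jw (vanishingIdeal D * J) := by
    rw [← c.specMap_α₀, chartIdeal_specMap]; exact mem_map_of_mem _ hxy₀
  have hw₁ : c.α₁ (x₁ * y₁) ∈ chartIdeal c.jw (vanishingIdeal D * J) := by
    rw [← c.specMap_α₁, chartIdeal_specMap]; exact mem_map_of_mem _ hxy₁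
  have h1 : c.α₀ (x₀ * y₀) * c.α₁ (chartFun φ c.j₁ (x₁ * y₁)) =
      c.α₁ (x₁ * y₁) * c.α₀ (chartFun φ c.j₀ (x₀ * y₀)) := by
    rw [← chartFun_comp φ hφ c.specMap_α₀ hxy₀, ← chartFun_comp φ hφ c.specMap_α₁ hxy₁,
      ← chartFun_mul φ c.jw hw₀, ← chartFun_mul φ c.jw hw₁]
    exact congr_arg (chartFun φ c.jw) (mul_comm _ _)
  have h2 : c.α₀ y₀ * c.α₁ (chartFun φ c.j₁ (x₁ * y₁)) =
      u * c.α₁ y₁ * c.α₀ (chartFun φ c.j₀ (x₀ * y₀)) := by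
    refine (mul_cancel_left_mem_nonZeroDivisors hnz).1 ?_
    rw [map_mul, map_mul c.α₁ x₁ y₁, hu] at h1
    linear_combination h1
  have h3 := congr_arg c.ρw h2
  rw [map_mul, map_mul, map_mul, he, c.ρw_α₀, c.ρw_α₀, c.ρw_α₁, c.ρw_α₁, hI, hJ] at h3
  set P := invert (toLaurent (c.ρ₁ (chartFun φ c.j₁ (x₁ * y₁)))) with hP
  set Q := invert (toLaurent (c.ρ₁ y₁)) with hQ
  have hP0 : P ≠ 0 := by
    rw [hP]
    simpa using hp₁
  have hQ0 : Q ≠ 0 := by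
    rw [hQ]
    simpa using hq₁
  have h4 : LaurentPolynomial.C b * LaurentPolynomial.T (meetDegree f J C : ℤ) =
      LaurentPolynomial.C a * LaurentPolynomial.T (e + (meetDegree f I C : ℤ)) := by
    refine mul_right_cancel₀ (mul_ne_zero hQ0 hP0) ?_
    rw [T_add]
    linear_combination h3
  have h5 := congrArg (·.coeff (meetDegree f J C : ℤ)) h4
  rw [← single_eq_C_mul_T, ← single_eq_C_mul_T] at h5
  simp only [coeff_single, Finsupp.single_apply] at h5
  by_contra h6
  have h7 : ¬ e + (meetDegree f I C : ℤ) = (meetDegree f J C : ℤ) := by omega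
  rw [if_neg h7] at h5
  exact hb (by simpa using h5)

end ProjectiveLineCharts

end Curves

end

/-! ### Laurent polynomials and radical ideals -/

section

/-- A hypersurface that is formally smooth over the base is reduced, provided that `f ^ 2 ∣ a ^ 2`
implies `f ∣ a` in the ambient ring. -/
theorem isRadical_span_of_formallySmooth {k B N : Type u} [CommRing k] [CommRing B] [IsDomain B]
    [CommRing N] [Algebra k B] [Algebra k N] [Algebra.FormallySmooth k N] (l : B →ₐ[k] N)
    (hl : Function.Surjective l) {f : B} (hf : f ≠ 0) (hk : ker l = span {f})
    (hsq : ∀ a, f ^ 2 ∣ a ^ 2 → f ∣ a) : (span {f}).IsRadical := by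
  rw [Ideal.isRadical_iff_pow_one_lt 2 one_lt_two]
  intro a ha
  obtain ⟨b, hb⟩ := mem_span_singleton.1 ha
  have hle : span {f ^ 2} ≤ ker l := by
    rw [hk, span_singleton_le_iff_mem, mem_span_singleton]
    exact Dvd.intro_left f (by ring)
  -- a section of the first infinitesimal neighbourhood
  let g : (B ⧸ span {f ^ 2}) →ₐ[k] N := Ideal.Quotient.liftₐ _ l fun x hx => hle hx
  have hg : Function.Surjective g := fun y => by
    obtain ⟨x, rfl⟩ := hl y
    exact ⟨quotMk _ x, rfl⟩
  have hker : ∀ x : B, g (quotMk _ x) = 0 → ∃ y, quotMk (span {f ^ 2}) x = quotMk _ (f * y) := by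
    intro x hx
    have h1 : x ∈ ker l := hx
    rw [hk] at h1
    obtain ⟨y, rfl⟩ := mem_span_singleton.1 h1
    exact ⟨y, rfl⟩
  have hf2 : quotMk (span {f ^ 2}) f ^ 2 = 0 := by
    rw [← map_pow, eq_zero_iff_mem]
    exact mem_span_singleton_self _
  have hnil : IsNilpotent (ker (g : (B ⧸ span {f ^ 2}) →+* N)) := by
    refine ⟨2, ?_⟩
    refine (pow_two _).trans (le_bot_iff.1 (Ideal.mul_le.2 ?_))
    intro x hx y hy
    obtain ⟨x, rfl⟩ := mk_surjective x
    obtain ⟨y, rfl⟩ := mk_surjective y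
    obtain ⟨x', hx'⟩ := hker x hx
    obtain ⟨y', hy'⟩ := hker y hy
    rw [hx', hy', Ideal.mem_bot, map_mul, map_mul]
    linear_combination quotMk (span {f ^ 2}) x' * quotMk (span {f ^ 2}) y' * hf2
  let σ := Algebra.FormallySmooth.liftOfSurjective (AlgHom.id k N) g hg hnil
  have hσ : ∀ y, g (σ y) = y := fun y =>
    Algebra.FormallySmooth.liftOfSurjective_apply (AlgHom.id k N) g hg hnil y
  obtain ⟨s, hs⟩ := mk_surjective (σ (l a))
  obtain ⟨a', ha'⟩ := hker (a - s) (by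
    rw [map_sub, map_sub, hs, hσ]
    exact sub_self _)
  rw [map_sub, hs] at ha'
  have h0 : σ (l a) ^ 2 = 0 := by
    rw [← map_pow, ← map_pow]
    have : l (a ^ 2) = 0 := by
      have h2 : a ^ 2 ∈ ker l := by rw [hk]; exact ha
      exact h2
    rw [this, map_zero]
  have h1 : quotMk (span {f ^ 2}) (f * b - 2 * a * (f * a')) = 0 := by
    have h2 := congr_arg (quotMk (span {f ^ 2})) hb
    simp only [map_sub, map_mul, map_pow, map_ofNat] at h2 ha' ⊢
    rw [← h2]
    linear_combination (quotMk (span {f ^ 2}) a + σ (l a) -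
      quotMk (span {f ^ 2}) f * quotMk (span {f ^ 2}) a') * ha' -
      quotMk (span {f ^ 2}) a' ^ 2 * hf2 + h0
  rw [eq_zero_iff_mem, mem_span_singleton] at h1
  obtain ⟨c, hc⟩ := h1
  have h2 : f ∣ a - f * a' := by
    refine hsq _ ⟨a' ^ 2 + c, ?_⟩
    linear_combination hb + hc
  rw [mem_span_singleton]
  have := dvd_add h2 (Dvd.intro a' rfl)
  rwa [sub_add_cancel] at this

namespace SmoothFan

section Laurent

variable {L : Type} [AddCommGroup L] {ι : Type} (F : SmoothFan L ι) (k : Type u) [Field k]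

/-- The inclusion of the coordinate ring of a chart in the coordinate ring of the torus. -/
def embed (S : Finset ι) : F.ChartRing k S →+* AddMonoidAlgebra k (L →+ ℤ) :=
  mapDomainRingHom k (F.dualMonoid S).subtype

variable {F k}

theorem embed_single {S : Finset ι} (χ : F.dualMonoid S) (c : k) :
    F.embed k S (single χ c) = single χ.1 c := by
  simp [embed]

theorem embed_injective (S : Finset ι) : Function.Injective (F.embed k S) :=
  AddMonoidAlgebra.mapDomain_injective Subtype.val_injective

theorem embed_restr {S T : Finset ι} (h : S ⊆ T) (f : F.ChartRing k T) :
    F.embed k S (F.restr k h f) = F.embed k T f := by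
  have : (F.embed k S).comp (F.restr k h) = F.embed k T := by
    rw [embed, restr, embed, ← mapDomainRingHom_comp]
    rfl
  exact RingHom.congr_fun this f

theorem coeff_embed {S : Finset ι} (f : F.ChartRing k S) (χ : F.dualMonoid S) :
    (F.embed k S f).coeff χ.1 = f.coeff χ :=
  Finsupp.mapDomain_apply Subtype.val_injective _ _

theorem mem_of_coeff_embed {S : Finset ι} {f : F.ChartRing k S} {χ : L →+ ℤ}
    (h : (F.embed k S f).coeff χ ≠ 0) : χ ∈ F.dualMonoid S := by
  by_contra h1
  refine h (Finsupp.mapDomain_notin_range _ _ ?_)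
  rintro ⟨ψ, rfl⟩
  exact h1 ψ.2

theorem exists_embed {S : Finset ι} {g : AddMonoidAlgebra k (L →+ ℤ)}
    (h : ∀ χ, g.coeff χ ≠ 0 → χ ∈ F.dualMonoid S) : ∃ f, F.embed k S f = g := by
  refine ⟨AddMonoidAlgebra.comapDomain _ Subtype.val_injective g, ?_⟩
  refine AddMonoidAlgebra.mapDomain_comapDomain ?_ _
  intro χ hχ
  exact ⟨⟨χ, h χ (by simpa using hχ)⟩, rfl⟩

theorem mem_orbitIdeal_embed {S T : Finset ι} (h : T ⊆ S) (f : F.ChartRing k S) :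
    f ∈ F.orbitIdeal k h ↔ ∀ χ, (F.embed k S f).coeff χ ≠ 0 → ∃ b ∈ T, χ (F.gen b) ≠ 0 := by
  rw [mem_orbitIdeal]
  constructor
  · intro h1 χ hχ
    have h2 := mem_of_coeff_embed hχ
    exact h1 ⟨χ, h2⟩ (by rwa [← coeff_embed])
  · intro h1 χ hχ
    exact h1 χ.1 (by rwa [coeff_embed])

instance : TwoUniqueSums (L →+ ℤ) := TwoUniqueSums.of_injective_addHom
    (f := (⟨fun χ => ⇑χ, fun _ _ => rfl⟩ : AddHom (L →+ ℤ) (L → ℤ)))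
    (fun _ _ h => DFunLike.coe_injective h) inferInstance

theorem coeff_mul_single {G : Type*} [AddCommGroup G] (g : AddMonoidAlgebra k G) (m χ : G) :
    (g * single m 1).coeff χ = g.coeff (χ - m) := by
  rw [AddMonoidAlgebra.coeff_mul_single_apply, mul_one, sub_eq_add_neg]

theorem coeff_single_mul {G : Type*} [AddCommGroup G] (g : AddMonoidAlgebra k G) (m χ : G) :
    (single m 1 * g).coeff χ = g.coeff (χ - m) := by
  rw [mul_comm, coeff_mul_single]

/-- If a square root of a function on a chart is a function on the torus, it is a function on the
chart. -/
theorem exists_embed_of_sq (S : F.cones) {c : AddMonoidAlgebra k (L →+ ℤ)} {d : F.ChartRing k S.1}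
    (h : c ^ 2 = F.embed k S.1 d) : ∃ c', F.embed k S.1 c' = c := by
  apply exists_embed
  by_contra h0
  have hc : ∃ b ∈ S.1, ∃ χ, c.coeff χ ≠ 0 ∧ χ (F.gen b) < 0 := by
    push Not at h0
    obtain ⟨χ, hχ, h1⟩ := h0
    obtain ⟨b, hb, h1⟩ : ∃ b ∈ S.1, χ (F.gen b) < 0 := by
      by_contra! h2
      exact h1 h2
    exact ⟨b, hb, χ, hχ, h1⟩
  obtain ⟨b, hb, χ₀, hχ₀, hneg⟩ := hc
  obtain ⟨χ, hχ, hmin⟩ := Finset.exists_min_image c.coeff.support (fun χ => χ (F.gen b))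
    ⟨χ₀, by simpa using hχ₀⟩
  have hχneg : χ (F.gen b) < 0 := (hmin χ₀ (by simpa using hχ₀)).trans_lt hneg
  -- the translate of `c` by `-χ` is a function near the generic point of the divisor of `b`
  have hs : {b} ⊆ S.1 := singleton_subset_iff.2 hb
  let e : AddMonoidAlgebra k (L →+ ℤ) := single (-χ) 1 * c
  have he : ∀ ψ, e.coeff ψ ≠ 0 → ψ ∈ F.dualMonoid {b} := by
    intro ψ hψ b' hb'
    rw [mem_singleton.1 hb']
    rw [coeff_single_mul] at hψ
    have := hmin (ψ - -χ) (by simpa using hψ)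
    simp only [AddMonoidHom.sub_apply, AddMonoidHom.neg_apply] at this
    omega
  obtain ⟨e', he'⟩ := exists_embed he
  have h1 : e' ∉ F.orbitIdeal k (Finset.Subset.refl {b}) := by
    rw [mem_orbitIdeal_embed]
    intro h2
    obtain ⟨b', hb', h3⟩ := h2 0 (by
      rw [he', coeff_single_mul]
      simpa using hχ)
    exact h3 rfl
  have h2 : e' ^ 2 ∈ F.orbitIdeal k (Finset.Subset.refl {b}) := by
    rw [mem_orbitIdeal_embed]
    intro ψ hψ
    refine ⟨b, by simp, ?_⟩
    have h3 : F.embed k {b} (e' ^ 2) = single (-χ + -χ) 1 * F.embed k S.1 d := by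
      rw [map_pow, he', mul_pow, h, pow_two, single_mul_single, one_mul]
    rw [h3, coeff_single_mul] at hψ
    have h4 := mem_of_coeff_embed hψ b hb
    simp only [AddMonoidHom.sub_apply, AddMonoidHom.neg_apply, AddMonoidHom.add_apply] at h4
    omega
  have hp : (F.orbitIdeal k (Finset.Subset.refl {b})).IsPrime := inferInstance
  exact h1 (hp.mem_of_pow_mem 2 h2)

/-- The coordinate ring of a torus is integrally closed enough. -/
theorem dvd_of_sq_dvd_sq_torus {n : ℕ} {f a : AddMonoidAlgebra k ((Fin n → ℤ) →+ ℤ)}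
    (h : f ^ 2 ∣ a ^ 2) : f ∣ a := by
  classical
  let ν : (Fin n →₀ ℕ) →+ ((Fin n → ℤ) →+ ℤ) :=
    { toFun := fun α => ∑ j, (α j) • Pi.evalAddMonoidHom (fun _ : Fin n => ℤ) j
      map_zero' := by simp
      map_add' := fun α β => by simp [add_smul, sum_add_distrib] }
  have hν : ∀ α j, ν α (Pi.single j 1) = α j := by
    intro α j
    simp [ν, Pi.single_apply]
  have hνinj : Function.Injective ν := by
    intro α β hαβ
    ext j
    have := DFunLike.congr_fun hαβ (Pi.single j 1)
    rw [hν, hν] at this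
    exact_mod_cast this
  have hνsurj : ∀ χ : (Fin n → ℤ) →+ ℤ, (∀ j, 0 ≤ χ (Pi.single j 1)) → ∃ α, ν α = χ := by
    intro χ hχ
    refine ⟨Finsupp.equivFunOnFinite.symm fun j => (χ (Pi.single j 1)).toNat, ?_⟩
    refine AddMonoidHom.functions_ext' _ _ _ fun j => AddMonoidHom.ext_int ?_
    simp only [AddMonoidHom.comp_apply, AddMonoidHom.single_apply]
    rw [hν]
    simp [hχ j]
  let E : AddMonoidAlgebra k (Fin n →₀ ℕ) →+* AddMonoidAlgebra k ((Fin n → ℤ) →+ ℤ) := mapDomainRingHom k ν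
  have hE : Function.Injective E := AddMonoidAlgebra.mapDomain_injective hνinj
  have hdom : IsDomain (AddMonoidAlgebra k (Fin n →₀ ℕ)) := inferInstanceAs (IsDomain (MvPolynomial (Fin n) k))
  have hint : IsIntegrallyClosed (AddMonoidAlgebra k (Fin n →₀ ℕ)) := inferInstanceAs (IsIntegrallyClosed (MvPolynomial (Fin n) k))
  -- clearing denominators
  have hclear : ∀ z : AddMonoidAlgebra k ((Fin n → ℤ) →+ ℤ), ∃ (α : (Fin n →₀ ℕ)) (y : AddMonoidAlgebra k (Fin n →₀ ℕ)),
      E y = z * single (ν α) 1 := by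
    intro z
    induction z using induction_linear with
    | zero => exact ⟨0, 0, by simp⟩
    | add z w hz hw =>
      obtain ⟨α, y, hy⟩ := hz
      obtain ⟨β, x, hx⟩ := hw
      refine ⟨α + β, y * single β 1 + x * single α 1, ?_⟩
      have h1 : ∀ γ, E (single γ 1) = single (ν γ) 1 := by intro γ; simp [E]
      have h2 : single (ν (α + β)) (1 : k) = single (ν α) 1 * single (ν β) 1 := by
        rw [single_mul_single, one_mul, map_add]
      rw [map_add, map_mul, map_mul, hy, hx, h1, h1, h2]
      ring
    | single χ r =>
      let α : (Fin n →₀ ℕ) := Finsupp.equivFunOnFinite.symm fun j => (χ (Pi.single j 1)).natAbs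
      obtain ⟨β, hβ⟩ := hνsurj (χ + ν α) (fun j => by
        rw [AddMonoidHom.add_apply, hν]
        simp only [α, Finsupp.equivFunOnFinite_symm_apply_apply]
        omega)
      refine ⟨α, single β r, ?_⟩
      rw [single_mul_single, mul_one, ← hβ]
      simp [E]
  have hunit : ∀ χ : (Fin n → ℤ) →+ ℤ, IsUnit (single χ (1 : k)) := fun χ =>
    IsUnit.of_mul_eq_one (single (-χ) 1) (by rw [single_mul_single, one_mul, add_neg_cancel]; rfl)
  obtain ⟨d, hd⟩ := h
  obtain ⟨α, f', hf'⟩ := hclear f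
  obtain ⟨β, a', ha'⟩ := hclear a
  obtain ⟨γ, d', hd'⟩ := hclear d
  have h1 : ∀ γ, E (single γ 1) = single (ν γ) 1 := by intro γ; simp [E]
  have h2 : f' ^ 2 ∣ (a' * single (α + γ) 1) ^ 2 := by
    refine ⟨d' * single (β + β + γ) 1, hE ?_⟩
    have h3 : single (ν (α + γ)) (1 : k) = single (ν α) 1 * single (ν γ) 1 := by
      rw [single_mul_single, one_mul, map_add]
    have h4 : single (ν (β + β + γ)) (1 : k) = single (ν β) 1 ^ 2 * single (ν γ) 1 := by
      rw [pow_two, single_mul_single, single_mul_single, one_mul, one_mul, map_add, map_add]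
    simp only [map_pow, map_mul, h1, hf', ha', hd', h3, h4]
    linear_combination (single (ν β) 1 * single (ν α) 1 * single (ν γ) 1) ^ 2 * hd
  have h5 : f' ∣ a' * single (α + γ) 1 := (IsIntegrallyClosed.pow_dvd_pow_iff two_ne_zero).1 h2
  have h6 := map_dvd E h5
  rw [map_mul, ha', hf', h1, (hunit _).dvd_mul_right, (hunit _).dvd_mul_right,
    (hunit _).mul_right_dvd] at h6
  exact h6

theorem dvd_of_sq_dvd_sq {n : ℕ} {F : SmoothFan (Fin n → ℤ) ι} (S : F.cones)
    {f a : F.ChartRing k S.1} (h : f ^ 2 ∣ a ^ 2) : f ∣ a := by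
  by_cases hf : f = 0
  · subst hf
    obtain ⟨d, hd⟩ := h
    have : a = 0 := by
      rw [zero_pow two_ne_zero, zero_mul] at hd
      exact pow_eq_zero_iff two_ne_zero |>.1 hd
    rw [this]
  obtain ⟨d, hd⟩ := h
  have h1 : F.embed k S.1 f ∣ F.embed k S.1 a := by
    apply dvd_of_sq_dvd_sq_torus
    rw [← map_pow, ← map_pow, hd, map_mul]
    exact Dvd.intro _ rfl
  obtain ⟨c, hc⟩ := h1
  have hf' : F.embed k S.1 f ≠ 0 := by
    rwa [Ne, map_eq_zero_iff _ (embed_injective S.1)]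
  have h2 : c ^ 2 = F.embed k S.1 d := by
    refine mul_left_cancel₀ (pow_ne_zero 2 hf') ?_
    rw [← mul_pow, ← hc, ← map_pow, ← map_pow, hd, map_mul]
  obtain ⟨c', rfl⟩ := exists_embed_of_sq S h2
  exact ⟨c', embed_injective S.1 (by rw [hc, map_mul])⟩

end Laurent

end SmoothFan

end

/-! ### Affine charts of closed subschemes -/

section

/-- The affine chart of a closed subscheme that is induced by an affine chart of the ambient
scheme. -/
structure SubschemeChart {X : Scheme.{u}} {R : Type u} [CommRing R]
    (j : Spec(R) ⟶ X) (Z : X.IdealSheafData) where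
  ring : Type u
  [commRing : CommRing ring]
  quot : R →+* ring
  map : Spec(ring) ⟶ Z.subscheme
  [isOpenImmersion : IsOpenImmersion map]
  quot_surjective : Function.Surjective quot
  ker_quot : ker quot = chartIdeal j Z
  map_subschemeι : map ≫ Z.subschemeι = SpecMap(quot) ≫ j
  range_map : Set.range map = Z.subschemeι ⁻¹' Set.range j

namespace SubschemeChart

attribute [instance] commRing isOpenImmersion

variable {X : Scheme.{u}} {R : Type u} [CommRing R]
    {j : Spec(R) ⟶ X} {Z : X.IdealSheafData}

instance [IsOpenImmersion j] : Nonempty (SubschemeChart j Z) := by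
  obtain ⟨l, hl, hker, hls⟩ := exists_quotientHom j (Z := Z) (RingHom.id R)
    Function.surjective_id (K := chartIdeal j Z) (Ideal.comap_id _).symm
  have hU := isAffineOpen_opensRange j
  have hV : IsAffineOpen (Z.subschemeι ⁻¹ᵁ j.opensRange) := hU.preimage _
  refine ⟨⟨Γ(Z.subscheme, Z.subschemeι ⁻¹ᵁ j.opensRange), l, hV.fromSpec, hl, hker, ?_, ?_⟩⟩
  · have h1 := IsAffineOpen.SpecMap_appLE_fromSpec Z.subschemeι hU hV le_rfl
    have h2 : SpecMap(l) ≫ j =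
        Spec.map (Z.subschemeι.appLE j.opensRange (Z.subschemeι ⁻¹ᵁ j.opensRange) le_rfl) ≫
          hU.fromSpec := by
      refine (congrArg (SpecMap(l) ≫ ·)
        (specMap_sectionHom j hU (range_le_opensRange j)).symm).trans ?_
      show SpecMap(l) ≫ Spec.map _ ≫ _ = _
      rw [← assoc, ← Spec.map_comp]
      congr 2
      ext x
      have h3 := hls x
      rw [Hom.appLE_eq_app]
      exact h3
    rw [h2]
    exact h1.symm
  · exact hV.range_fromSpec

variable (c : SubschemeChart j Z)

theorem subschemeι_map (q : Spec(c.ring)) : Z.subschemeι (c.map q) = j (SpecMap(c.quot) q) := by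
  rw [← Hom.comp_apply, c.map_subschemeι, Hom.comp_apply]

theorem exists_of_mem {p : Spec(R)} (hp : chartIdeal j Z ≤ p.asIdeal) :
    ∃ q, SpecMap(c.quot) q = p := by
  have h1 : p ∈ Set.range (PrimeSpectrum.comap c.quot) := by
    rw [range_comap_of_surjective _ _ c.quot_surjective, c.ker_quot]
    exact hp
  exact h1

/-- Points of a closed subset of a closed subscheme, in terms of the ambient chart. -/
theorem mem_image_support [IsOpenImmersion j] (K : Z.subscheme.IdealSheafData) (p : Spec(R)) :
    j p ∈ Z.subschemeι '' (K.support : Set Z.subscheme) ↔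
      (chartIdeal c.map K).comap c.quot ≤ p.asIdeal := by
  constructor
  · rintro ⟨z, hz, hzp⟩
    have h1 : z ∈ Set.range c.map := by rw [c.range_map]; exact ⟨p, hzp.symm⟩
    obtain ⟨q, rfl⟩ := h1
    rw [c.subschemeι_map] at hzp
    have h2 := j.isOpenEmbedding.injective hzp
    have h3 := (mem_support_chart c.map K q).1 hz
    rw [← h2]
    exact Ideal.comap_mono h3
  · intro h
    have h0 : chartIdeal j Z ≤ p.asIdeal := by
      rw [← c.ker_quot]
      exact (Ideal.ker_le_comap c.quot).trans h
    obtain ⟨q, rfl⟩ := c.exists_of_mem h0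
    refine ⟨c.map q, (mem_support_chart c.map K q).2 fun x hx => ?_, c.subschemeι_map q⟩
    obtain ⟨y, rfl⟩ := c.quot_surjective x
    exact h hx

end SubschemeChart

/-- Smoothness over a field, as formal smoothness of the ring of sections over an affine open. -/
theorem formallySmooth_app {X : Scheme.{u}} {k : Type u} [Field k] {f : X ⟶ Spec(k)}
    [Smooth f] {V : X.Opens} (hV : IsAffineOpen V) :
    ((resHom (le_top : V ≤ ⊤)).comp
      ((ΓSpecIso (CommRingCat.of k)).inv ≫ f.appTop).hom).FormallySmooth := by
  have h1 : (f.appLE ⊤ V le_top).hom.Smooth := f.smooth_appLE (isAffineOpen_top _) hV _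
  have h2 : (f.appLE ⊤ V le_top).hom.FormallySmooth := h1.1
  have h3 : ((ΓSpecIso (CommRingCat.of k)).inv.hom).FormallySmooth :=
    RingHom.FormallySmooth.of_bijective
      (ConcreteCategory.bijective_of_isIso (ΓSpecIso (CommRingCat.of k)).inv)
  exact h3.comp h2

theorem isRadical_of_smooth {X : Scheme.{u}} {k : Type u} [Field k]
    {f : X ⟶ Spec(k)} (Z : X.IdealSheafData) [Smooth (Z.subschemeι ≫ f)]
    {R : Type u} [CommRing R] [IsDomain R] (j : Spec(R) ⟶ X) [IsOpenImmersion j]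
    {κ : k →+* R} (hκ : j ≫ f = SpecMap(κ)) {g : R} (hg : g ≠ 0)
    (hZ : chartIdeal j Z = span {g}) (hsq : ∀ a, g ^ 2 ∣ a ^ 2 → g ∣ a) :
    (span {g}).IsRadical := by
  obtain ⟨l, hl, hker, hls⟩ := exists_quotientHom j (Z := Z) (RingHom.id R)
    Function.surjective_id (K := chartIdeal j Z) (Ideal.comap_id _).symm
  have hV : IsAffineOpen (Z.subschemeι ⁻¹ᵁ j.opensRange) := (isAffineOpen_opensRange j).preimage _
  have h1 := formallySmooth_app (f := Z.subschemeι ≫ f) hV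
  have h2 : ∀ a, l (κ a) = ((resHom (le_top : (Z.subschemeι ⁻¹ᵁ j.opensRange) ≤ ⊤)).comp
      ((ΓSpecIso (CommRingCat.of k)).inv ≫ (Z.subschemeι ≫ f).appTop).hom) a := by
    intro a
    have h3 := hls (resHom le_top (((ΓSpecIso (CommRingCat.of k)).inv ≫ f.appTop).hom a))
    rw [ProjectiveLineCharts.sectionEquiv_structure j hκ] at h3
    refine h3.trans ?_
    rw [Hom.comp_appTop]
    simp only [resHom, RingHom.comp_apply, CommRingCat.hom_comp]
    exact congr_hom (Hom.naturality Z.subschemeι (homOfLE (le_top : j.opensRange ≤ ⊤)).op) _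
  let _ : Algebra k R := κ.toAlgebra
  let _ : Algebra k Γ(Z.subscheme, Z.subschemeι ⁻¹ᵁ j.opensRange) := (l.comp κ).toAlgebra
  have h4 : Algebra.FormallySmooth k Γ(Z.subscheme, Z.subschemeι ⁻¹ᵁ j.opensRange) := by
    have h5 : (l.comp κ).FormallySmooth := by
      rw [show l.comp κ = _ from RingHom.ext h2]
      exact h1
    exact h5
  exact isRadical_span_of_formallySmooth (k := k) { l with commutes' := fun _ => rfl } hl hg
    (hker.trans hZ) hsq

end

/-! ### Charts of a toric divisor -/

section

theorem subschemeι_vanishingIdeal_mem {X : Scheme.{u}} (Z : Closeds X)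
    (x : (vanishingIdeal Z).subscheme) :
    (vanishingIdeal Z).subschemeι x ∈ Z := by
  have h : (vanishingIdeal Z).subschemeι x ∈ Set.range (vanishingIdeal Z).subschemeι := ⟨x, rfl⟩
  rw [IdealSheafData.range_subschemeι, coe_support_vanishingIdeal] at h
  exact h

namespace SmoothFan

variable {L : Type} [AddCommGroup L] {ι : Type} {F : SmoothFan L ι} {k : Type u} [Field k]

theorem faceProj_restr {S T : Finset ι} (h : S ⊆ T) {U : Finset ι} (hS : U ⊆ S) (hT : U ⊆ T)
    (f : F.ChartRing k T) :
    faceProj hS (F.restr k h f) = F.restr k h (faceProj hT f) := by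
  classical
  apply eq_of_single f
  intro χ c
  rw [restr_single, faceProj_single, faceProj_single]
  split_ifs with h1 h2 h2
  · rw [restr_single]
  · exact absurd h1 h2
  · exact absurd h2 h1
  · rw [map_zero]

theorem faceProj_eq_self {S T : Finset ι} (h : T ⊆ S) {χ : F.dualMonoid S}
    (hχ : ∀ b ∈ T, χ.1 (F.gen b) = 0) (c : k) :
    faceProj h (single χ c) = single χ c := by
  classical
  rw [faceProj_single, if_pos hχ]

theorem faceProj_faceProj {S T : Finset ι} (h : T ⊆ S) (f : F.ChartRing k S) :
    faceProj h (faceProj h f) = faceProj h f := by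
  classical
  apply eq_of_single f
  intro χ c
  rw [faceProj_single]
  split_ifs with h1
  · rw [faceProj_eq_self h h1]
  · rw [map_zero]

theorem sub_faceProj_mem {S T : Finset ι} (h : T ⊆ S) (f : F.ChartRing k S) :
    f - faceProj h f ∈ F.orbitIdeal k h := by
  rw [orbitIdeal, mem_ker]
  show faceProj h (f - faceProj h f) = 0
  rw [map_sub, faceProj_faceProj, sub_self]

theorem orbitIdeal_mono {S T U : Finset ι} (h : T ⊆ S) (h' : U ⊆ S) (hTU : T ⊆ U) :
    F.orbitIdeal k h ≤ F.orbitIdeal k h' := by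
  intro f hf
  rw [mem_orbitIdeal] at hf ⊢
  intro χ hχ
  obtain ⟨b, hb, h1⟩ := hf χ hχ
  exact ⟨b, hTU hb, h1⟩

variable (F k)

theorem chart_toSpec (S : F.cones) : F.chart k S ≫ F.toSpec k =
    SpecMap(algebraMap k (F.ChartRing k S.1)) :=
  F.chart_glueMap k _ _ S

variable [DecidableEq ι]

/-- The chart of the toric divisor of `b` in the chart of a cone. -/
def divisorChart (b : ι) (S : F.cones) : SubschemeChart (F.chart k S)
    (vanishingIdeal (F.toricDivisor k b)) :=
  Classical.arbitrary _

/-- The coordinate ring of the chart of the toric divisor of `b` in the chart of a cone. -/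
abbrev DivisorRing (b : ι) (S : F.cones) : Type u := (F.divisorChart k b S).ring

/-- The restriction of functions from the chart of `S` to the toric divisor of `b`. -/
def divisorQuot (b : ι) (S : F.cones) :
    F.ChartRing k S.1 →+* F.DivisorRing k b S := (F.divisorChart k b S).quot

/-- The affine chart of the toric divisor of `b` in the chart of `S`. -/
def divisorMap (b : ι) (S : F.cones) : Spec(F.DivisorRing k b S) ⟶ F.divisorScheme k b :=
  (F.divisorChart k b S).map

instance (b : ι) (S : F.cones) : IsOpenImmersion (F.divisorMap k b S) :=
  (F.divisorChart k b S).isOpenImmersion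

instance (b : ι) : Mono (F.divisorInclusion k b) :=
  inferInstanceAs (Mono (vanishingIdeal (F.toricDivisor k b)).subschemeι)

variable {F k} {b : ι}

local notation "q(" S ")" => F.divisorQuot k b S
local notation "δ(" S ")" => F.divisorMap k b S

theorem divisorQuot_surjective (S : F.cones) : Function.Surjective q(S) :=
  (F.divisorChart k b S).quot_surjective

theorem divisorMap_divisorInclusion (S : F.cones) : δ(S) ≫ F.divisorInclusion k b =
      SpecMap(q(S)) ≫ F.chart k S :=
  (F.divisorChart k b S).map_subschemeι

theorem divisorInclusion_divisorMap (S : F.cones) (q : Spec(F.DivisorRing k b S)) :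
    F.divisorInclusion k b (δ(S) q) = F.chart k S (SpecMap(q(S)) q) :=
  (F.divisorChart k b S).subschemeι_map q

theorem ker_divisorChart {S : F.cones} (hb : b ∈ S.1) : ker q(S) =
      F.orbitIdeal k (singleton_subset_iff.2 hb) := by
  rw [divisorQuot, SubschemeChart.ker_quot, chartIdeal_toricDivisor_of_mem hb, orbitIdeal_singleton]

theorem isDomain_divisorChart {S : F.cones} (hb : b ∈ S.1) : IsDomain (F.DivisorRing k b S) := by
  have h1 : (ker q(S)).IsPrime := by rw [ker_divisorChart hb]; infer_instance
  have h2 : (⊥ : Ideal (F.DivisorRing k b S)).IsPrime := by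
    have := Ideal.map_isPrime_of_surjective (divisorQuot_surjective S) (I := ker q(S)) le_rfl
    rwa [Ideal.map_eq_bot_iff_le_ker q(S) |>.2 le_rfl] at this
  exact IsDomain.of_bot_isPrime _

theorem divisorChart_quot_faceProj {S : F.cones} (hb : b ∈ S.1) (f : F.ChartRing k S.1) :
    q(S) (starProj(hb) f) = q(S) f := by
  have h1 := sub_faceProj_mem (singleton_subset_iff.2 hb) f
  rw [← ker_divisorChart hb, mem_ker, map_sub, sub_eq_zero] at h1
  exact h1.symm

theorem chartIdeal_divisorStratum {S : F.cones} (hb : b ∈ S.1) {T : Finset ι} (hT : T ⊆ S.1) :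
    I(δ(S), F.divisorStratum k b T) = (F.orbitIdeal k (insert_subset hb hT)).map q(S) := by
  have hker : ker q(S) ≤ F.orbitIdeal k (insert_subset hb hT) := by
    rw [ker_divisorChart hb]
    exact orbitIdeal_mono _ _ (by simp)
  have hprime := Ideal.map_isPrime_of_surjective (divisorQuot_surjective S) hker
  refine chartIdeal_vanishingIdeal_eq _ _ hprime.isRadical fun q => ?_
  have h1 : δ(S) q ∈ F.divisorStratum k b T ↔
      F.divisorInclusion k b (δ(S) q) ∈ stratum (F.toricDivisor k) T := Iff.rfl
  rw [h1, divisorInclusion_divisorMap, mem_stratum_chart, Ideal.map_le_iff_le_comap]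
  constructor
  · rintro ⟨h, h2⟩
    rw [orbitIdeal_eq_span, span_le]
    rintro _ ⟨c, hc, rfl⟩
    rw [Finset.mem_coe, mem_insert] at hc
    rcases hc with rfl | hc
    · have h3 : F.coordFun k S c ∈ ker (F.divisorQuot k c S) := by
        rw [ker_divisorChart hb, coordFun_mem_orbitIdeal _ hb]; simp
      show (F.divisorQuot k c S) _ ∈ q.asIdeal
      rw [mem_ker] at h3
      rw [h3]
      exact zero_mem _
    · exact h2 ((coordFun_mem_orbitIdeal _ (h hc)).2 hc)
  · intro h2
    exact ⟨hT, (orbitIdeal_mono _ _ (subset_insert _ _)).trans h2⟩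

theorem chartIdeal_divisorStratum_of_notMem {S : F.cones} {c : ι} (hc : c ∉ S.1) :
    I(δ(S), F.divisorStratum k b {c}) = ⊤ := by
  refine chartIdeal_vanishingIdeal_eq _ _ (fun _ _ => trivial) fun q => ?_
  have h1 : δ(S) q ∈ F.divisorStratum k b {c} ↔
      F.divisorInclusion k b (δ(S) q) ∈ stratum (F.toricDivisor k) {c} := Iff.rfl
  rw [h1, divisorInclusion_divisorMap, mem_stratum_chart]
  exact ⟨fun h => absurd (h.1 (mem_singleton_self c)) hc, fun h => absurd h (not_top_le_asIdeal q)⟩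

theorem chartIdeal_divisorStratum_singleton {S : F.cones} (hb : b ∈ S.1) {c : ι} (hc : c ∈ S.1) :
    I(δ(S), F.divisorStratum k b {c}) = span {q(S) (F.coordFun k S c)} := by
  rw [chartIdeal_divisorStratum hb (singleton_subset_iff.2 hc), orbitIdeal_eq_span, map_span]
  simp only [Finset.coe_insert, Finset.coe_singleton, Set.image_insert_eq, Set.image_singleton]
  have h3 : F.coordFun k S b ∈ ker q(S) := by
    rw [ker_divisorChart hb, coordFun_mem_orbitIdeal _ hb]; simp
  rw [mem_ker] at h3
  rw [h3, Ideal.span_insert_zero]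

/-- Comparison of the charts of a toric divisor. -/
theorem exists_divisorChart_hom {S T : F.cones} (h : T ≤ S) (hb : b ∈ T.1) :
    ∃ γ : (F.DivisorRing k b S) →+* (F.DivisorRing k b T),
      (∀ f, γ (q(S) f) = q(T) (F.restr k h f)) ∧
      SpecMap(γ) ≫ δ(S) = (F.divisorMap k b T) := by
  have hker : ker q(S) ≤ ker (q(T).comp (F.restr k h)) := by
    intro f hf
    rw [ker_divisorChart (h hb)] at hf
    rw [mem_ker, RingHom.comp_apply, ← mem_ker, ker_divisorChart hb]
    have h1 : starProj((h hb)) f = 0 := hf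
    show starProj(hb) (F.restr k h f) = 0
    rw [faceProj_restr h _ (singleton_subset_iff.2 (h hb)), h1, map_zero]
  let γ := q(S).liftOfSurjective (divisorQuot_surjective S) ⟨q(T).comp (F.restr k h), hker⟩
  have hγ : γ.comp q(S) = q(T).comp (F.restr k h) := RingHom.liftOfRightInverse_comp _ _ _ _
  refine ⟨γ, fun f => RingHom.congr_fun hγ f, ?_⟩
  rw [← cancel_mono (F.divisorInclusion k b),
    assoc, divisorMap_divisorInclusion, divisorMap_divisorInclusion,
    ← assoc, ← Spec.map_comp, ← ofHom_comp, hγ, ofHom_comp,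
    Spec.map_comp, assoc]
  exact congrArg (SpecMap(q(T)) ≫ ·) (F.restr_chart k h)

end SmoothFan

end

/-! ### Equations of a hypersurface in a toric divisor -/

section

namespace SmoothFan

variable {ι : Type} [DecidableEq ι] {k : Type u} [Field k]

/-- In the chart of `S`, the ideal of the hypersurface `H` in the divisor of `b` is `(x_b, f)`, where
`f` is the product of the Laurent polynomial `g` with a character that takes the values `a c` on the
rays `c ≠ b` of `S`. -/
structure IsLocalEquation {L : Type} [AddCommGroup L] (F : SmoothFan L ι) (b : ι)
    (H : Set (F.toricScheme k)) (a : ι → ℤ) (g : AddMonoidAlgebra k (L →+ ℤ))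
    (S : F.cones) (m : L →+ ℤ) (f : F.ChartRing k S.1) : Prop where
  apply_gen_self : m (F.gen b) = 0
  apply_gen : ∀ c ∈ S.1, c ≠ b → m (F.gen c) = a c
  embed_eq : F.embed k S.1 f = g * single m 1
  mem_iff : ∀ p : Spec(F.ChartRing k S.1),
    F.chart k S p ∈ H ↔ F.coordFun k S b ∈ p.asIdeal ∧ f ∈ p.asIdeal
  isRadical : (span {F.coordFun k S b, f}).IsRadical
  notMem : ∀ (T : Finset ι) (hT : T ⊆ S.1), b ∈ T → f ∉ F.orbitIdeal k hT

/-- A Laurent polynomial `g` that is an equation of the hypersurface `H` in the divisor of `b`, up to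
characters, on all charts. -/
structure IsEquation {L : Type} [AddCommGroup L] (F : SmoothFan L ι) (b : ι)
    (H : Set (F.toricScheme k)) (a : ι → ℤ) (g : AddMonoidAlgebra k (L →+ ℤ)) : Prop where
  ne_zero : g ≠ 0
  apply_gen_self : ∀ χ, g.coeff χ ≠ 0 → χ (F.gen b) = 0
  exists_local : ∀ S : F.cones, b ∈ S.1 → ∃ m f, F.IsLocalEquation b H a g S m f

section

variable {n : ℕ} {F : SmoothFan (Fin n → ℤ) ι} {b : ι} [Fintype ι]
  {J : (F.divisorScheme k b).IdealSheafData} {a : ι → ℤ}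

local notation "q(" S ")" => F.divisorQuot k b S
local notation "δ(" S ")" => F.divisorMap k b S

theorem chartIdeal_divisor_pow {S : F.cones} (hb : b ∈ S.1) (e : ι → ℕ) :
    chartIdeal δ(S) (∏ c ∈ F.link b, (vanishingIdeal (F.divisorStratum k b {c})) ^ e c) =
      span {q(S) (∏ c ∈ F.link b with c ∈ S.1, F.coordFun k S c ^ e c)} := by
  rw [chartIdeal_prod, Finset.prod_filter, map_prod, ← Ideal.prod_span_singleton]
  refine Finset.prod_congr rfl fun c _ => ?_
  rw [chartIdeal_pow]
  split_ifs with hc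
  · rw [chartIdeal_divisorStratum_singleton hb hc, Ideal.span_singleton_pow, map_pow]
  · rw [chartIdeal_divisorStratum_of_notMem hc, map_one, span_singleton_one, Ideal.top_pow]

theorem mem_link {S : F.cones} (hb : b ∈ S.1) {c : ι} (hc : c ∈ S.1) (h : c ≠ b) :
    c ∈ F.link b := by
  classical
  rw [link, mem_filter]
  exact ⟨mem_univ _, h, F.down_closed S.2 (by
    intro d hd
    rcases mem_insert.1 hd with rfl | hd
    · exact hb
    · rwa [mem_singleton.1 hd])⟩

theorem ne_of_mem_link {c : ι} (hc : c ∈ F.link b) : c ≠ b := by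
  classical
  rw [link, mem_filter] at hc
  exact hc.2.1

/-- A monomial with prescribed exponents on a cone. -/
def monomialChar (b : ι) (S : F.cones) (e : ι → ℕ) : F.dualMonoid S.1 :=
  ∑ c ∈ F.link b with c ∈ S.1, e c • F.coord S c

theorem prod_coordFun (S : F.cones) (e : ι → ℕ) :
    ∏ c ∈ F.link b with c ∈ S.1, F.coordFun k S c ^ e c = single (monomialChar b S e) 1 := by
  rw [monomialChar]
  induction (F.link b).filter (· ∈ S.1) using Finset.induction_on with
  | empty => simp; rfl
  | insert c s hc ih =>
    rw [prod_insert hc, sum_insert hc, ih, coordFun, single_pow,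
      single_mul_single, one_pow, one_mul]

theorem monomialChar_gen (S : F.cones) (e : ι → ℕ) (d : ι) : (monomialChar b S e).1 (F.gen d) =
      ∑ c ∈ F.link b with c ∈ S.1, (e c : ℤ) * (F.coord S c).1 (F.gen d) := by
  rw [monomialChar]
  simp [AddSubmonoid.coe_finset_sum]

theorem monomialChar_self {S : F.cones} (hb : b ∈ S.1) (e : ι → ℕ) :
    (monomialChar b S e).1 (F.gen b) = 0 := by
  rw [monomialChar_gen]
  refine sum_eq_zero fun c hc => ?_
  rw [coord_of_ne hb (ne_of_mem_link (mem_filter.1 hc).1).symm, mul_zero]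

theorem monomialChar_apply {S : F.cones} (hb : b ∈ S.1) (e : ι → ℕ) {d : ι} (hd : d ∈ S.1)
    (hdb : d ≠ b) : (monomialChar b S e).1 (F.gen d) = e d := by
  rw [monomialChar_gen, sum_eq_single d]
  · rw [coord_self hd, mul_one]
  · intro c _ hcd
    rw [coord_of_ne hd hcd.symm, mul_zero]
  · intro h
    exact absurd (mem_filter.2 ⟨mem_link hb hd hdb, hd⟩) h

local notation "x⁺(" S ")" => monomialChar b S fun c => Int.toNat (a c)
local notation "x⁻(" S ")" => monomialChar b S fun c => Int.toNat (-a c)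
-- the product of the ideals of the strata with negative coefficients, with which `J` is twisted
local notation "O⁻" =>
  ∏ c ∈ F.link b, (vanishingIdeal (F.divisorStratum k b (singleton c))) ^ Int.toNat (-a c)

theorem divisorQuot_eq_zero_iff {S : F.cones} (hb : b ∈ S.1) {x : F.ChartRing k S.1} :
    q(S) x = 0 ↔ starProj(hb) x = 0 := by
  rw [← mem_ker, ker_divisorChart hb]; rfl

theorem comap_span_divisorQuot {S : F.cones} (hb : b ∈ S.1) (f : F.ChartRing k S.1) :
    (span {q(S) f}).comap q(S) = span {F.coordFun k S b, f} := by
  have h3 : span {q(S) f} = (span {f}).map q(S) := by rw [map_span, Set.image_singleton]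
  rw [h3, Ideal.comap_map_of_surjective _ (divisorQuot_surjective S), ← RingHom.ker_eq_comap_bot,
    ker_divisorChart hb, orbitIdeal_singleton, sup_comm, ← Ideal.span_insert]

/-- The isomorphism of ideal sheaves in a linear equivalence, on a chart: a local equation of the
hypersurface, and the function that corresponds to `∏ x_c ^ a_c⁺`. -/
theorem exists_local_generator (e : ∀ U : (F.divisorScheme k b).affineOpens,
      (J * O⁻).ideal U ≃ₗ[Γ(F.divisorScheme k b, U.1)]
      (∏ c ∈ F.link b, (vanishingIdeal (F.divisorStratum k b {c})) ^ (a c).toNat).ideal U)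
    {S : F.cones} (hb : b ∈ S.1) :
    ∃ f : F.ChartRing k S.1, chartIdeal δ(S) J = span {q(S) f} ∧ q(S) (f * single x⁻(S) 1) ∈
        chartIdeal δ(S) (J * O⁻) ∧
      chartFun e δ(S) (q(S) (f * single x⁻(S) 1)) = q(S) (single x⁺(S) 1) := by
  have hdom := isDomain_divisorChart (k := k) hb
  have hA := chartIdeal_divisor_pow (k := k) hb (fun c => (-a c).toNat)
  have hB := chartIdeal_divisor_pow (k := k) hb (fun c => (a c).toNat)
  rw [prod_coordFun] at hA hB
  set mneg : F.ChartRing k S.1 := single x⁻(S) 1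
  set mpos : F.ChartRing k S.1 := single x⁺(S) 1
  have hmneg : q(S) mneg ≠ 0 := by
    intro h
    rw [← mem_ker, ker_divisorChart hb, single_mem_orbitIdeal] at h
    obtain ⟨d, hd, h⟩ := h
    rw [mem_singleton.1 hd] at h
    exact h (monomialChar_self hb _)
  obtain ⟨w, hw, hew⟩ := chartFun_surj e δ(S)
    (b := q(S) mpos) (by rw [hB]; exact mem_span_singleton_self _)
  have hw' := hw
  rw [chartIdeal_mul, hA, Ideal.mem_mul_span_singleton] at hw'
  obtain ⟨f', hf', rfl⟩ := hw'
  obtain ⟨f, rfl⟩ := divisorQuot_surjective S f'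
  refine ⟨f, le_antisymm ?_ ?_, ?_, ?_⟩
  · intro z hz
    have h1 : z * q(S) mneg ∈ chartIdeal δ(S) (J * O⁻) := by
      rw [chartIdeal_mul, hA]
      exact Ideal.mul_mem_mul hz (mem_span_singleton_self _)
    have h2 := chartFun_mem e δ(S) h1
    rw [hB, mem_span_singleton] at h2
    obtain ⟨r, hr⟩ := h2
    replace hr := hr.trans ((mul_comm _ _).trans
      ((congrArg (r * ·) hew.symm).trans (chartFun_mul e _ hw r).symm))
    have h3 := chartFun_inj e _ h1 (mul_mem_left _ r hw) hr
    rw [← mul_assoc] at h3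
    exact Ideal.mem_span_singleton'.2 ⟨r, (mul_right_cancel₀ hmneg h3).symm⟩
  · rwa [span_singleton_le_iff_mem]
  · rw [map_mul]; exact hw
  · rw [map_mul]; exact hew

theorem mem_image_divisorInclusion {S : F.cones} {f : F.ChartRing k S.1} (hb : b ∈ S.1)
    (hf : chartIdeal δ(S) J = span {q(S) f})
    (p : Spec(F.ChartRing k S.1)) :
    F.chart k S p ∈ F.divisorInclusion k b '' (J.support : Set (F.divisorScheme k b)) ↔
      F.coordFun k S b ∈ p.asIdeal ∧ f ∈ p.asIdeal := by
  have h1 := (F.divisorChart k b S).mem_image_support J p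
  refine h1.trans ?_
  show (chartIdeal δ(S) J).comap q(S) ≤ p.asIdeal ↔ _
  rw [hf, comap_span_divisorQuot hb, span_le]
  simp [Set.insert_subset_iff]

/-- A hypersurface in a toric divisor that meets the boundary transversally has a global equation, up
to characters. -/
theorem exists_isEquation (hb : {b} ∈ F.cones) (hJ : F.IsTransverseHypersurface k b J)
    (ha : F.IsToricRepresentative k b J a) :
    ∃ g, F.IsEquation b (F.divisorInclusion k b '' (J.support : Set (F.divisorScheme k b))) a g := by
  obtain ⟨e, he⟩ := ha
  have hloc := fun (S : F.cones) (hS : b ∈ S.1) => exists_local_generator e hS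
  choose f' hf'J hf'mem hf' using hloc
  -- the local equations, as functions on the divisor
  let f : ∀ (S : F.cones), b ∈ S.1 → F.ChartRing k S.1 := fun S hS => starProj(hS) (f' S hS)
  have hqf : ∀ S hS, q(S) (f S hS) = q(S) (f' S hS) := fun S hS => divisorChart_quot_faceProj hS _
  have hfJ : ∀ S hS, chartIdeal δ(S) J = span {q(S) (f S hS)} := fun S hS => by rw [hqf, hf'J]
  let τ : F.cones := ⟨{b}, hb⟩
  have hτ : b ∈ τ.1 := mem_singleton_self b
  let g := F.embed k τ.1 (f τ hτ)
  have hmτ : ∀ e : ι → ℕ, (single (monomialChar b τ e) 1 : F.ChartRing k τ.1) =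
      1 := by
    intro e
    have h1 : monomialChar b τ e = 0 := by
      rw [monomialChar]
      refine sum_eq_zero fun c hc => ?_
      have h2 := mem_filter.1 hc
      exact absurd (mem_singleton.1 h2.2) (ne_of_mem_link h2.1)
    rw [h1]; rfl
  let m : F.cones → (Fin n → ℤ) →+ ℤ := fun S => x⁺(S).1 - x⁻(S).1
  have hmb : ∀ S : F.cones, b ∈ S.1 → m S (F.gen b) = 0 := fun S hS => by
    simp [m, monomialChar_self hS]
  have hmc : ∀ S : F.cones, b ∈ S.1 → ∀ c ∈ S.1, c ≠ b → m S (F.gen c) = a c := by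
    intro S hS c hc hcb
    simp only [m, AddMonoidHom.sub_apply, monomialChar_apply hS _ hc hcb]
    omega
  have hembed : ∀ S hS, F.embed k S.1 (f S hS) = g * single (m S) 1 := by
    intro S hS
    have hle : τ ≤ S := singleton_subset_iff.2 hS
    obtain ⟨γ, hγ, hγj⟩ := exists_divisorChart_hom (k := k) hle hτ
    have h1 := chartFun_comp e he hγj (hf'mem S hS)
    rw [hf' S hS, hγ, hγ] at h1
    have h2 : q(τ) (F.restr k hle (f' S hS * single x⁻(S) 1)) = q(τ) (F.restr k hle
          (single x⁺(S) 1) * f' τ hτ) := by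
      have h3 := hf'mem τ hτ
      have h4 := hf' τ hτ
      rw [hmτ, mul_one] at h3 h4
      rw [hmτ, map_one] at h4
      have h5 : γ (q(S) (f' S hS * single x⁻(S) 1)) ∈ chartIdeal (δ(τ)) (J * O⁻) := by
        rw [← hγj, chartIdeal_specMap]
        exact mem_map_of_mem _ (hf'mem S hS)
      rw [hγ] at h5
      refine chartFun_inj e _ h5 ?_ ?_
      · rw [map_mul]
        exact mul_mem_left _ _ h3
      · rw [h1, map_mul]
        refine ((chartFun_mul e _ h3 _).trans ?_).symm
        rw [h4, mul_one]
    have h3 : starProj(hτ) (F.restr k hle (f' S hS * single x⁻(S) 1)) = starProj(hτ) (F.restr k hle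
          (single x⁺(S) 1) * f' τ hτ) := by
      rw [← sub_eq_zero, ← map_sub] at h2 ⊢
      exact (divisorQuot_eq_zero_iff hτ).1 h2
    have hpm : ∀ e : ι → ℕ, starProj(hS) (single (monomialChar b S e) (1 : k)) =
        single (monomialChar b S e) 1 := fun e =>
      faceProj_eq_self _ (fun c hc => by rw [mem_singleton.1 hc]; exact monomialChar_self hS e) 1
    rw [map_mul (faceProj _) (F.restr k hle _), faceProj_restr hle _ (singleton_subset_iff.2 hS),
      faceProj_restr hle _ (singleton_subset_iff.2 hS), map_mul, hpm, hpm] at h3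
    have h4 := congr_arg (F.embed k τ.1) h3
    rw [embed_restr, map_mul, map_mul, embed_restr, embed_single, embed_single] at h4
    have h5 : single x⁻(S).1 (1 : k) * single (-x⁻(S).1) 1 = 1 := by
      rw [single_mul_single, add_neg_cancel, one_mul]; rfl
    have h6 : single (m S) (1 : k) = single x⁺(S).1 1 * single (-x⁻(S).1) 1 := by
      rw [single_mul_single, one_mul, ← sub_eq_add_neg]
    rw [h6]
    linear_combination (single (-x⁻(S).1) 1) * h4 - F.embed k S.1 (f S hS) * h5
  have hiff : ∀ S hS, ∀ p : Spec(F.ChartRing k S.1),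
      F.chart k S p ∈ F.divisorInclusion k b '' (J.support : Set (F.divisorScheme k b)) ↔
      F.coordFun k S b ∈ p.asIdeal ∧ f S hS ∈ p.asIdeal := fun S hS p =>
    mem_image_divisorInclusion hS (hfJ S hS) p
  -- the property of vanishing on a stratum does not depend on the chart
  have hstr : ∀ (S S' : F.cones) hS hS' (T : Finset ι) (hT : T ⊆ S.1) (hT' : T ⊆ S'.1), b ∈ T →
      f S hS ∈ F.orbitIdeal k hT → f S' hS' ∈ F.orbitIdeal k hT' := by
    intro S S' hS hS' T hT hT' hbT h
    rw [mem_orbitIdeal_embed] at h ⊢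
    intro χ hχ
    rw [hembed, coeff_mul_single] at hχ
    obtain ⟨c, hc, h1⟩ := h (χ - m S' + m S) (by
      rw [hembed, coeff_mul_single, add_sub_cancel_right]; exact hχ)
    refine ⟨c, hc, ?_⟩
    have h2 : m S' (F.gen c) = m S (F.gen c) := by
      by_cases hcb : c = b
      · rw [hcb, hmb S hS, hmb S' hS']
      · rw [hmc S hS c (hT hc) hcb, hmc S' hS' c (hT' hc) hcb]
    simpa [h2] using h1
  have hnot : ∀ S hS (T : Finset ι) (hT : T ⊆ S.1), b ∈ T → f S hS ∉ F.orbitIdeal k hT := by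
    intro S hS T hT hbT hmem
    refine hJ.not_le T (F.down_closed S.2 hT) hbT fun x hx => ?_
    have h1 : F.divisorInclusion k b x ∈ stratum (F.toricDivisor k) T := hx
    obtain ⟨S', p, hp⟩ := F.chart_cover k (F.divisorInclusion k b x)
    rw [← hp, mem_stratum_chart] at h1
    obtain ⟨hT', h2⟩ := h1
    have hS' := hT' hbT
    have h3 := h2 (hstr S S' hS hS' T hT hT' hbT hmem)
    have h4 : F.coordFun k S' b ∈ p.asIdeal := h2 ((coordFun_mem_orbitIdeal hT' hS').2 hbT)
    obtain ⟨y, hy, hyx⟩ := (hiff S' hS' p).2 ⟨h4, h3⟩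
    rw [hp] at hyx
    have h5 : Function.Injective (F.divisorInclusion k b) :=
      (vanishingIdeal (F.toricDivisor k b)).subschemeι.isClosedEmbedding.injective
    rw [← h5 hyx]
    exact hy
  have hf0 : ∀ S hS, f S hS ≠ 0 := fun S hS h0 =>
    hnot S hS {b} (singleton_subset_iff.2 hS) (mem_singleton_self b) (by rw [h0]; exact zero_mem _)
  refine ⟨g, ?_, ?_, fun S hS => ⟨m S, f S hS, hmb S hS, hmc S hS, hembed S hS, hiff S hS, ?_,
    hnot S hS⟩⟩
  · exact fun h0 => hf0 τ hτ ((map_eq_zero_iff _ (embed_injective _)).1 h0)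
  · intro χ hχ
    have h1 : f τ hτ = starProj(hτ) (f τ hτ) := (faceProj_faceProj _ _).symm
    have h2 := mem_of_coeff_embed hχ
    have h3 : (f τ hτ).coeff ⟨χ, h2⟩ ≠ 0 := by rw [← coeff_embed]; exact hχ
    by_contra h4
    rw [h1, coeff_faceProj, if_neg] at h3
    · exact h3 rfl
    · intro h5
      exact h4 (h5 b (mem_singleton_self b))
  · -- smoothness implies reducedness
    have hdom := isDomain_divisorChart (k := k) hS
    have hZ : chartIdeal δ(S) (J ⊔ vanishingIdeal (F.divisorStratum k b {b})) =
        span {q(S) (f S hS)} := by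
      have h1 : q(S) (F.coordFun k S b) = 0 := by
        rw [← mem_ker, ker_divisorChart hS, coordFun_mem_orbitIdeal _ hS]; simp
      rw [chartIdeal_sup, hfJ S hS, chartIdeal_divisorStratum_singleton hS hS, h1,
        Ideal.span_singleton_zero, sup_bot_eq]
    have hsm := hJ.smooth {b} hb (mem_singleton_self b)
    have hκ : δ(S) ≫ F.divisorInclusion k b ≫ F.toSpec k =
        SpecMap(q(S).comp (algebraMap k (F.ChartRing k S.1))) := by
      rw [← assoc, divisorMap_divisorInclusion, assoc, chart_toSpec, ← Spec.map_comp, ← ofHom_comp]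
    have hproj : starProj(hS) (f S hS) = f S hS := faceProj_faceProj _ _
    have hrad := isRadical_of_smooth (J ⊔ vanishingIdeal (F.divisorStratum k b {b}))
      δ(S) hκ (g := q(S) (f S hS))
      (fun h0 => hf0 S hS (by rw [← hproj, (divisorQuot_eq_zero_iff hS).1 h0])) hZ (by
        intro z hz
        obtain ⟨z, rfl⟩ := divisorQuot_surjective S z
        obtain ⟨d, hd⟩ := hz
        obtain ⟨d, rfl⟩ := divisorQuot_surjective S d
        have h1 : starProj(hS) (z ^ 2 - f S hS ^ 2 * d) = 0 :=
          (divisorQuot_eq_zero_iff hS).1 (by rw [map_sub, map_mul, map_pow, map_pow, hd, sub_self])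
        rw [map_sub, map_mul, map_pow, map_pow, hproj, sub_eq_zero] at h1
        obtain ⟨q, hq⟩ := dvd_of_sq_dvd_sq S ⟨_, h1⟩
        exact ⟨q(S) q, by
          rw [← map_mul, ← hq]
          exact (divisorChart_quot_faceProj hS z).symm⟩)
    rw [← comap_span_divisorQuot hS]
    exact hrad.comap _

/-- The equation of a hypersurface in a complete fan contains a monomial that is regular on the charts
of all cones through the ray. -/
theorem IsEquation.exists_char {H : Set (F.toricScheme k)} {g : AddMonoidAlgebra k ((Fin n → ℤ) →+ ℤ)}
    (hg : F.IsEquation b H a g) :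
    ∃ χ : (Fin n → ℤ) →+ ℤ, χ (F.gen b) = 0 ∧ ∀ c ∈ F.link b, 0 ≤ a c + χ (F.gen c) := by
  obtain ⟨χ, hχ⟩ : ∃ χ, g.coeff χ ≠ 0 := by
    by_contra! h
    exact hg.ne_zero (AddMonoidAlgebra.coeff_eq_zero.1 (Finsupp.ext h))
  refine ⟨χ, hg.apply_gen_self χ hχ, fun c hc => ?_⟩
  have hcb := ne_of_mem_link hc
  have hmem : {b, c} ∈ F.cones := by
    classical
    rw [link, mem_filter] at hc
    exact hc.2.2
  obtain ⟨m, f, h⟩ := hg.exists_local ⟨{b, c}, hmem⟩ (by simp)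
  have h1 : (F.embed k {b, c} f).coeff (χ + m) ≠ 0 := by
    rw [h.embed_eq, coeff_mul_single, add_sub_cancel_right]; exact hχ
  have h2 := mem_of_coeff_embed h1 c (by simp)
  rw [AddMonoidHom.add_apply, h.apply_gen c (by simp) hcb] at h2
  omega

end

end SmoothFan

end

/-! ### The charts of the fan of the first blow-up -/

section

open TildeRay SmoothFan

variable {ι : Type} [DecidableEq ι] {k : Type u} [Field k]

theorem SmoothFan.exists_unit_single {L : Type} [AddCommGroup L] {ι : Type} {F : SmoothFan L ι}
    {S : Finset ι} (χ ψ : F.dualMonoid S) (h : ∀ b ∈ S, χ.1 (F.gen b) = ψ.1 (F.gen b)) :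
    ∃ v, IsUnit v ∧ single χ (1 : k) = v * single ψ 1 := by
  have h1 : χ.1 - ψ.1 ∈ F.dualMonoid S := fun b hb => by simp [h b hb]
  refine ⟨single ⟨_, h1⟩ 1, isUnit_single _ fun b hb => by simp [h b hb], ?_⟩
  rw [single_mul_single, one_mul]
  congr 1
  apply Subtype.ext
  simp

section Base

variable {L : Type} [AddCommGroup L] (F : SmoothFan L ι) {s : ℕ} (P : Fin s → ι)

local notation "F̃" => tildeFan F P
local notation "tgt(" S ")" => SmoothFan.FanMap.target (fanProjection F P) S

/-- No cone of the fan contains two of the rays `ρ_i`. -/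
abbrev SeparatedRays : Prop := ∀ σ ∈ F.cones, ∀ i j, i ≠ j → ¬(P i ∈ σ ∧ P j ∈ σ)

/-- A set of rays of the fan `Σ~` is admissible if it contains `(m_i, 1)` whenever it contains
`(m_i, 0)`. The charts of the admissible cones cover the toric variety. -/
def IsAdmissible (S : Finset (TildeRay ι s)) : Prop := ∀ i, horizontal (P i) ∈ S → exceptional i ∈ S

variable {F P}

/-- The pullback of functions along the projection `X_{Σ~} ⟶ X_Σ`, on charts. -/
def basePull (k : Type u) [Field k] (S : F̃.cones) :
    F.ChartRing k tgt(S).1 →+* F̃.ChartRing k S.1 :=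
  mapDomainRingHom k ((fanProjection F P).pull S)

theorem basePull_single (S : F̃.cones) (χ : F.dualMonoid tgt(S).1) (c : k) :
    basePull k S (single χ c) = single ((fanProjection F P).pull S χ) c := by
  simp [basePull]

theorem chart_toBase (S : F̃.cones) : F̃.chart k S ≫ toBase F P k = SpecMap(basePull k S) ≫
        F.chart k tgt(S) := by
  rw [toBase, FanMap.toricMap, chart_glueMap]
  rfl

/-- The function on a chart given by the projection to the affine line. -/
def lineCoord (k : Type u) [Field k] (S : F̃.cones) : F̃.ChartRing k S.1 :=
  single (⟨snd L ℤ, by rintro (b | _ | i) _ <;> simp [tildeFan, tildeGen]⟩ : F̃.dualMonoid S.1) 1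

theorem toLine_chart_mem (S : F̃.cones) (p : Spec(F̃.ChartRing k S.1)) :
    toLine F P k (F̃.chart k S p) ∈ lineOrigin k ↔ lineCoord k S ∈ p.asIdeal := by
  have h0 : ∀ b, 0 ≤ snd L ℤ (F̃.gen b) := by rintro (b | _ | i) <;> simp [tildeFan, tildeGen]
  have h1 : F̃.chart k S ≫ toLine F P k =
      SpecMap((F̃.charHom k (snd L ℤ) h0 S.1).toRingHom) := by rw [toLine, charMap, chart_glueMap]
  rw [← Hom.comp_apply, h1]
  have h2 : ∀ q : Spec(Polynomial k), q ∈ lineOrigin k ↔ Polynomial.X ∈ q.asIdeal := fun q => by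
    refine (PrimeSpectrum.mem_zeroLocus _ _).trans ?_
    simp
  rw [h2]
  have h3 : F̃.charHom k (snd L ℤ) h0 S.1 Polynomial.X = lineCoord k S := Polynomial.aeval_X _
  rw [← h3]
  rfl

theorem toBase_chart (S : F̃.cones) (p : Spec(F̃.ChartRing k S.1)) :
    toBase F P k (F̃.chart k S p) = F.chart k tgt(S) (SpecMap(basePull k S) p) := by
  rw [← Hom.comp_apply, chart_toBase, Hom.comp_apply]

theorem mem_base {S : Finset (TildeRay ι s)} {b : ι} :
    b ∈ baseSimplex P S ↔ horizontal b ∈ S ∨ ∃ i, exceptional i ∈ S ∧ P i = b := by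
  rw [baseSimplex, Finset.mem_biUnion]
  constructor
  · rintro ⟨a, ha, hb⟩
    rcases a with c | _ | i
    · rw [mem_singleton] at hb
      exact Or.inl (hb ▸ ha)
    · simp at hb
    · exact Or.inr ⟨i, ha, (mem_singleton.1 hb).symm⟩
  · rintro (h | ⟨i, h, rfl⟩)
    · exact ⟨_, h, mem_singleton_self _⟩
    · exact ⟨_, h, mem_singleton_self _⟩

theorem eq_of_exceptional_mem (hP' : SeparatedRays F P)
    (S : F̃.cones) {i j : Fin s} (hi : P i ∈ baseSimplex P S.1)
    (hj : P j ∈ baseSimplex P S.1) : i = j := by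
  by_contra h
  exact hP' _ (baseSimplex_mem F P S.2) i j h ⟨hi, hj⟩

theorem exists_admissible_ge (hP' : SeparatedRays F P)
    (S : F̃.cones) : ∃ S' : F̃.cones, S ≤ S' ∧ IsAdmissible P S'.1 := by
  by_cases h : IsAdmissible P S.1
  · exact ⟨S, le_rfl, h⟩
  · rw [IsAdmissible] at h
    push Not at h
    obtain ⟨i, hi, hei⟩ := h
    have hex : ∀ j, exceptional j ∉ S.1 := by
      intro j hj
      have := eq_of_exceptional_mem hP' S (horizontal_mem_base P hi) (exceptional_mem_base P hj)
      rw [this] at hei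
      exact hei hj
    have hS : insert (exceptional i) S.1 ∈ tildeCones F P := by
      obtain ⟨σ, hσ, h1, h2, h3⟩ := S.2
      refine ⟨σ, hσ, fun b hb => h1 b ?_, fun j hj => h2 j ?_, Or.inr ⟨i, h1 _ hi, fun j hj => ?_⟩⟩
      · simpa using hb
      · simpa using hj
      · rcases mem_insert.1 hj with h4 | h4
        · exact (TildeRay.exceptional.inj h4)
        · exact absurd h4 (hex j)
    refine ⟨⟨_, hS⟩, subset_insert _ _, fun j hj => ?_⟩
    have hj' : horizontal (P j) ∈ S.1 := by simpa using hj
    have := eq_of_exceptional_mem hP' S (horizontal_mem_base P hi) (horizontal_mem_base P hj')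
    rw [← this]
    exact mem_insert_self _ _

theorem exists_admissible_chart (hP' : SeparatedRays F P) (y : F̃.toricScheme k) :
    ∃ S : F̃.cones, IsAdmissible P S.1 ∧ y ∈ Set.range (F̃.chart k S) := by
  obtain ⟨S, hS⟩ := F̃.chart_cover k y
  obtain ⟨S', hle, h⟩ := exists_admissible_ge hP' S
  exact ⟨S', h, range_chart_mono hle hS⟩

end Base

section Transverse

variable {L : Type} [AddCommGroup L] {F : SmoothFan L ι} {s : ℕ} {P : Fin s → ι}

local notation "ℓ(" i ")" => TildeRay.horizontal (P i)
local notation "F̃" => tildeFan F P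
local notation "tgt(" S ")" => SmoothFan.FanMap.target (fanProjection F P) S

theorem vertical_notMem {S : F̃.cones} {i : Fin s} (hh : ℓ(i) ∈ S.1) :
    vertical ∉ S.1 := by
  obtain ⟨σ, hσ, h1, h2, h3⟩ := S.2
  exact fun h => h2 i ⟨hh, h⟩

variable (hP' : SeparatedRays F P)

include hP'

theorem mem_target_cases {S : F̃.cones} {i : Fin s} (hi : P i ∈ baseSimplex P S.1)
    {c : ι} (hc : c ∈ baseSimplex P S.1) : c = P i ∨ horizontal c ∈ S.1 := by
  rcases mem_base.1 hc with h | ⟨j, hj, rfl⟩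
  · exact Or.inr h
  · exact Or.inl (by rw [eq_of_exceptional_mem hP' S hi hc])

/-- The function `x_h` with divisor `(m_i, 0)` on a chart whose cone contains `(m_i, 0)` and
`(m_i, 1)` divides the pullback of the equation of `D_{ρ_i}`, with quotient the coordinate of the
line. -/
theorem basePull_coordFun {S : F̃.cones} {i : Fin s} (hh : ℓ(i) ∈ S.1)
    (he : exceptional i ∈ S.1) :
    ∃ v, IsUnit v ∧ basePull k S (F.coordFun k tgt(S) (P i)) =
      v * F̃.coordFun k S ℓ(i) * lineCoord k S := by
  have hi : P i ∈ tgt(S).1 := horizontal_mem_base P hh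
  set x := F.coord tgt(S) (P i) with hx
  have h1 : ∀ b ∈ S.1, (x.1.comp (fst L ℤ) - snd L ℤ) (F̃.gen b) = (F̃.coord S ℓ(i)).1
        (F̃.gen b) := by
    rintro (c | _ | j) hb
    · by_cases hc : c = P i
      · rw [hc, coord_self hh]
        simp [tildeFan, tildeGen, hx, coord_self hi]
      · rw [coord_of_ne hb (by simpa using hc)]
        simp [tildeFan, tildeGen, hx, coord_of_ne (S := tgt(S)) (horizontal_mem_base P hb) hc]
    · exact absurd hb (vertical_notMem hh)
    · have hj : i = j := eq_of_exceptional_mem hP' S hi (exceptional_mem_base P hb)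
      subst hj
      rw [coord_of_ne hb (by simp)]
      simp [tildeFan, tildeGen, hx, coord_self hi]
  have h2 : x.1.comp (fst L ℤ) - snd L ℤ ∈ F̃.dualMonoid S.1 := fun b hb => by
    rw [h1 b hb]
    exact (F̃.coord S ℓ(i)).2 b hb
  obtain ⟨v, hv, hvx⟩ := exists_unit_single (k := k) ⟨_, h2⟩ (F̃.coord S ℓ(i)) h1
  refine ⟨v, hv, ?_⟩
  have hvx' : v * F̃.coordFun k S ℓ(i) =
    single ⟨_, h2⟩ 1 := hvx.symm
  rw [hvx', lineCoord, single_mul_single, one_mul, coordFun, basePull_single]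
  congr 1
  apply Subtype.ext
  exact (sub_add_cancel _ _).symm

/-- On a chart whose cone contains `(m_i, 1)` but not `(m_i, 0)`, the pullback of the equation of
`D_{ρ_i}` divides the coordinate of the line. -/
theorem basePull_coordFun_dvd {S : F̃.cones} {i : Fin s}
    (hh : ℓ(i) ∉ S.1) (he : exceptional i ∈ S.1) :
    basePull k S (F.coordFun k tgt(S) (P i)) ∣ lineCoord k S := by
  have hi : P i ∈ tgt(S).1 := exceptional_mem_base P he
  set x := F.coord tgt(S) (P i) with hx
  have h2 : snd L ℤ - x.1.comp (fst L ℤ) ∈ F̃.dualMonoid S.1 := by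
    rintro (c | _ | j) hb
    · have hc : c ≠ P i := fun h => hh (h ▸ hb)
      simp [tildeFan, tildeGen, hx, coord_of_ne (S := tgt(S)) (horizontal_mem_base P hb) hc]
    · simp [tildeFan, tildeGen]
    · have hj : i = j := eq_of_exceptional_mem hP' S hi (exceptional_mem_base P hb)
      subst hj
      simp [tildeFan, tildeGen, hx, coord_self hi]
  refine ⟨single ⟨_, h2⟩ 1, ?_⟩
  rw [lineCoord, coordFun, basePull_single, single_mul_single, one_mul]
  congr 1
  apply Subtype.ext
  exact (add_sub_cancel _ _).symm

/-- The ideal `(x_h, f)` of a chart is the kernel of a map to a polynomial ring over the coordinate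
ring of the hypersurface, which sends the coordinate of the line to the variable. -/
theorem exists_hom_ker_eq {S : F̃.cones} {i : Fin s} (hh : ℓ(i) ∈ S.1)
    (he : exceptional i ∈ S.1) (f : F.ChartRing k tgt(S).1) :
    ∃ l : F̃.ChartRing k S.1 →+* Polynomial (F.ChartRing k tgt(S).1 ⧸
          span {F.coordFun k tgt(S) (P i), f}),
      ker l = span {F̃.coordFun k S ℓ(i),
        basePull k S f} ∧ l (lineCoord k S) = Polynomial.X := by
  classical
  let σ := tgt(S)
  have hi : P i ∈ σ.1 := horizontal_mem_base P hh
  set x := F.coord σ (P i) with hx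
  have hx1 : x.1 (F.gen (P i)) = 1 := coord_self hi
  have hx0 : ∀ c ∈ σ.1, c ≠ P i → x.1 (F.gen c) = 0 := fun c hc h => coord_of_ne hc h
  -- the character of the torus of the base, made trivial along `ρ_i`
  let r : F̃.dualMonoid S.1 →+ F.dualMonoid σ.1 :=
    { toFun := fun χ => ⟨χ.1.comp (AddMonoidHom.inl L ℤ) - (χ.1 (F.gen (P i), 0)) • x.1, by
        intro c hc
        rcases mem_target_cases hP' hi hc with rfl | h
        · simp [hx1]
        · by_cases hcP : c = P i
          · simp [hcP, hx1]
          · have h4 : 0 ≤ χ.1 (F.gen c, 0) := χ.2 _ h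
            simpa [hx0 c hc hcP] using h4⟩
      map_zero' := by apply Subtype.ext; simp
      map_add' := fun χ ψ => by
        apply Subtype.ext
        ext z
        simp
        ring }
  let μ₀ : Multiplicative (F̃.dualMonoid S.1) →* Polynomial (F.ChartRing k σ.1) :=
    { toFun := fun χ => Polynomial.C (single (r χ.toAdd) 1) *
        Polynomial.X ^ (χ.toAdd.1 (F.gen (P i), 1)).toNat
      map_one' := by
        have h1 : (single (r (1 : Multiplicative _).toAdd) (1 : k) :
          F.ChartRing k σ.1) = 1 := by rw [toAdd_one, map_zero]; rfl
        rw [h1]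
        simp
      map_mul' := fun χ ψ => by
        have h1 : (single (r (χ * ψ).toAdd) (1 : k) : F.ChartRing k σ.1) =
            single (r χ.toAdd) 1 * single (r ψ.toAdd) 1 := by
          rw [single_mul_single, one_mul, toAdd_mul, map_add]
        have h2 : ((χ * ψ).toAdd.1 (F.gen (P i), 1)).toNat =
            (χ.toAdd.1 (F.gen (P i), 1)).toNat + (ψ.toAdd.1 (F.gen (P i), 1)).toNat :=
          Int.toNat_add (χ.toAdd.2 _ he) (ψ.toAdd.2 _ he)
        rw [h1, h2, map_mul, pow_add]
        ring }
  let l₀ : F̃.ChartRing k S.1 →ₐ[k] Polynomial (F.ChartRing k σ.1) :=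
    truncHom (singleton_subset_iff.2 hh) μ₀
  have hl₀ : ∀ χ c, l₀ (single χ c) =
      if χ.1 (F.gen (P i), 0) = 0 then Polynomial.C (single (r χ) c) *
        Polynomial.X ^ (χ.1 (F.gen (P i), 1)).toNat else 0 := by
    intro χ c
    have h1 : (∀ b ∈ ({ℓ(i)} : Finset (TildeRay ι s)),
        χ.1 (F̃.gen b) = 0) ↔ χ.1 (F.gen (P i), 0) = 0 := by
      simp only [mem_singleton, forall_eq]; rfl
    have h2 := truncHom_single (singleton_subset_iff.2 hh) μ₀ χ c
    simp only [h1] at h2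
    refine h2.trans ?_
    split_ifs
    · have h3 : (single (r χ) c : F.ChartRing k σ.1) = algebraMap k _ c * single (r χ) 1 := by
        rw [AddMonoidAlgebra.coe_algebraMap]
        simp [single_mul_single]
      rw [h3, map_mul, mul_assoc]
      rfl
    · rfl
  let I : Ideal (F.ChartRing k σ.1) := span {F.coordFun k σ (P i), f}
  let l := (Polynomial.mapRingHom (quotMk I)).comp
    (l₀ : F̃.ChartRing k S.1 →+* Polynomial (F.ChartRing k σ.1))
  have hl : ∀ z, l z = Polynomial.map (quotMk I) (l₀ z) := fun z => rfl
  -- a section of `l₀` modulo `x_h`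
  let μ : Polynomial (F.ChartRing k σ.1) →+* F̃.ChartRing k S.1 :=
    Polynomial.eval₂RingHom (basePull k S) (lineCoord k S)
  have hμ : ∀ z, z - μ (l₀ z) ∈ span {F̃.coordFun k S ℓ(i)} := by
    intro z
    induction z using induction_linear with
    | zero => simp
    | add z w hz hw =>
      rw [map_add, map_add, add_sub_add_comm]
      exact add_mem hz hw
    | single χ c =>
      rw [hl₀]
      split_ifs with h0
      · have h1 : μ (Polynomial.C (single (r χ) c) *
            Polynomial.X ^ (χ.1 (F.gen (P i), 1)).toNat) = single χ c := by
          rw [map_mul, map_pow]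
          simp only [μ, Polynomial.coe_eval₂RingHom, Polynomial.eval₂_C, Polynomial.eval₂_X]
          rw [basePull_single, lineCoord, single_pow, single_mul_single, one_pow, mul_one]
          congr 1
          refine Subtype.ext (AddMonoidHom.ext fun z => ?_)
          have h2 : ((χ.1 (F.gen (P i), 1)).toNat : ℤ) = χ.1 (0, 1) := by
            rw [Int.toNat_of_nonneg (show 0 ≤ χ.1 (F.gen (P i), 1) from χ.2 _ he)]
            have : ((F.gen (P i), 1) : L × ℤ) = (F.gen (P i), 0) + (0, 1) := by simp
            rw [this, map_add, h0, zero_add]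
          have h3 : χ.1 (z.1, 0) + z.2 • χ.1 (0, 1) = χ.1 z := by
            rw [← map_zsmul, ← map_add]
            simp
          show χ.1 (z.1, 0) - (χ.1 (F.gen (P i), 0) • x.1) z.1 +
            ((χ.1 (F.gen (P i), 1)).toNat • snd L ℤ) z = χ.1 z
          rw [h0, zero_smul, ← h3, AddMonoidHom.nsmul_apply]
          simp only [AddMonoidHom.zero_apply, sub_zero, AddMonoidHom.coe_snd, nsmul_eq_mul, h2,
            zsmul_eq_mul, Int.cast_id]
          ring
        rw [h1, sub_self]
        exact zero_mem _
      · rw [map_zero, sub_zero, mem_span_singleton]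
        exact coordFun_dvd_single hh χ h0 c
  have hlβ : ∀ z, l (basePull k S z) = Polynomial.C (quotMk I z) := by
    intro z
    apply eq_of_single z
    intro χ c
    rw [basePull_single, hl, hl₀]
    have h1 : ((fanProjection F P).pull S χ).1 (F.gen (P i), 0) = χ.1 (F.gen (P i)) := rfl
    have h2 : ((fanProjection F P).pull S χ).1 (F.gen (P i), 1) = χ.1 (F.gen (P i)) := rfl
    rw [h1, h2]
    split_ifs with h0
    · have h3 : r ((fanProjection F P).pull S χ) = χ := by
        refine Subtype.ext (AddMonoidHom.ext fun z => ?_)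
        show χ.1 z - (((fanProjection F P).pull S χ).1 (F.gen (P i), 0) • x.1) z = χ.1 z
        rw [h1, h0]
        simp
      rw [h3, h0]
      simp
    · have h3 : (single χ c : F.ChartRing k σ.1) ∈ I :=
        Ideal.mem_of_dvd _ (coordFun_dvd_single hi χ h0 c) (subset_span (by simp))
      rw [eq_zero_iff_mem.2 h3]
      simp
  refine ⟨l, le_antisymm ?_ ?_, ?_⟩
  · intro z hz
    have h1 : l₀ z ∈ ker (Polynomial.mapRingHom (quotMk I)) := hz
    rw [Polynomial.ker_mapRingHom, Ideal.mk_ker] at h1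
    have h2 := mem_map_of_mem μ h1
    rw [Ideal.map_map, map_span, Set.image_pair] at h2
    have h3 : ∀ y, (μ.comp Polynomial.C) y = basePull k S y := fun y => by simp [μ]
    rw [h3, h3] at h2
    obtain ⟨v, -, hv⟩ := basePull_coordFun (k := k) hP' hh he
    have h4 : span {basePull k S (F.coordFun k σ (P i)), basePull k S f} ≤
        span {F̃.coordFun k S ℓ(i), basePull k S f} := by
      rw [span_le]
      rintro _ (rfl | rfl)
      · rw [hv, mul_comm v, mul_assoc]
        exact Ideal.mul_mem_right _ _ (subset_span (by simp))
      · exact subset_span (by simp)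
    have h5 := Ideal.span_mono (s := {F̃.coordFun k S ℓ(i)})
      (t := {F̃.coordFun k S ℓ(i), basePull k S f}) (by simp) (hμ z)
    have := add_mem h5 (h4 h2)
    rwa [sub_add_cancel] at this
  · rw [span_le]
    rintro _ (rfl | rfl)
    · show l _ = 0
      rw [coordFun, hl, hl₀, if_neg, Polynomial.map_zero]
      have h1 := coord_self hh
      intro h2
      exact one_ne_zero (h1.symm.trans h2)
    · show l _ = 0
      rw [hlβ, eq_zero_iff_mem.2 (subset_span (by simp)), map_zero]
  · rw [lineCoord, hl, hl₀]
    refine (congrArg (Polynomial.map (quotMk I)) (if_pos rfl)).trans ?_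
    have h1 : (r ⟨snd L ℤ, by
        rintro (b | _ | i) _ <;> simp [tildeFan, tildeGen]⟩ : F.dualMonoid σ.1) = 0 := by
      refine Subtype.ext (AddMonoidHom.ext fun z => ?_)
      simp [r]
    have h2 : (single (0 : F.dualMonoid σ.1) (1 : k) : F.ChartRing k σ.1) = 1 := rfl
    rw [h1, h2]
    simp

end Transverse

end

/-! ### The equations of the second centre -/

section

open TildeRay SmoothFan

theorem chartIdeal_vanishingIdeal_closure {X : Scheme.{u}} {A : Type u} [CommRing A]
    (j : Spec(A) ⟶ X) [IsOpenImmersion j] (W : Set X) (Z : Closeds X)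
    (hZ : (Z : Set X) = closure W) {I : Ideal A} (hI : I.IsRadical) (t : A)
    (ht : ∀ z, t * z ∈ I → z ∈ I) (h : ∀ p, j p ∈ W ↔ I ≤ p.asIdeal ∧ t ∉ p.asIdeal) :
    I(j, Z) = I := by
  have h1 : j ⁻¹' (Z : Set X) = closure (j ⁻¹' W) := by
    rw [hZ]
    exact j.isOpenEmbedding.isOpenMap.preimage_closure_eq_closure_preimage j.continuous W
  refine (chartIdeal_vanishingIdeal j Z).trans ((congrArg (PrimeSpectrum.vanishingIdeal (R := A))
    h1).trans ((PrimeSpectrum.vanishingIdeal_closure _).trans ?_))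
  apply le_antisymm
  · intro z hz
    replace hz := (mem_vanishingIdeal _ _).1 hz
    refine ht z ?_
    rw [← hI.radical, Ideal.radical_eq_sInf, Submodule.mem_sInf]
    rintro p ⟨hp, hprime⟩
    by_cases h1 : t ∈ p
    · exact Ideal.mul_mem_right _ _ h1
    · exact mul_mem_left _ _ (hz ⟨p, hprime⟩ ((h ⟨p, hprime⟩).2 ⟨hp, h1⟩))
  · intro z hz
    exact (mem_vanishingIdeal _ _).2 fun p hp => ((h p).1 hp).1 hz

variable {ι : Type} [DecidableEq ι] {k : Type u} [Field k]

namespace SmoothFan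

/-- In the chart of a cone `S` that contains the ray `h`, the ideal of `Z` is `(x_h, f)`, where `f` is
the product of the Laurent polynomial `g` in characters that vanish on `h` and a character `m` that
vanishes on `h`, and `f` does not vanish on any toric stratum contained in the divisor of `h`. -/
structure IsCenterEquation {L : Type} [AddCommGroup L] {ι : Type} [DecidableEq ι] (G : SmoothFan L ι)
    (h : ι) (Z : Closeds (G.toricScheme k)) (g : AddMonoidAlgebra k (L →+ ℤ)) (S : G.cones)
    (m : L →+ ℤ) (f : G.ChartRing k S.1) : Prop where
  mem : h ∈ S.1
  coeff_eq_zero : ∀ χ, χ (G.gen h) ≠ 0 → g.coeff χ = 0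
  apply_gen_self : m (G.gen h) = 0
  embed_eq : G.embed k S.1 f = g * single m 1
  chartIdeal_eq : I(G.chart k S, Z) = span {G.coordFun k S h, f}
  notMem : ∀ (T : Finset ι) (hT : T ⊆ S.1), h ∈ T → f ∉ G.orbitIdeal k hT

end SmoothFan

variable {n : ℕ} {F : SmoothFan (Fin n → ℤ) ι} {s : ℕ} {P : Fin s → ι}
  {J : ∀ i, (F.divisorScheme k (P i)).IdealSheafData}

local notation "F̃" => tildeFan F P
local notation "tgt(" S ")" => SmoothFan.FanMap.target (fanProjection F P) S
local notation "C̃" => tildeCenter F P k J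
local notation "ℓ(" i ")" => TildeRay.horizontal (P i)

/-- The image of a hypersurface of a toric divisor in the toric variety. -/
def hypersurfaceSet (J : ∀ i, (F.divisorScheme k (P i)).IdealSheafData) (i : Fin s) :
    Set (F.toricScheme k) :=
  F.divisorInclusion k (P i) '' ((J i).support : Set (F.divisorScheme k (P i)))

theorem hypersurfaceSet_subset (i : Fin s) : hypersurfaceSet J i ⊆ F.toricDivisor k (P i) := by
  rintro _ ⟨x, -, rfl⟩
  exact subschemeι_vanishingIdeal_mem _ x

theorem tildeHypersurface_eq_closure (i : Fin s) :
    (tildeHypersurface F P k J i : Set (F̃.toricScheme k)) =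
      closure {y | toBase F P k y ∈ hypersurfaceSet J i ∧ toLine F P k y ∉ lineOrigin k} := by
  have h1 : ∀ y, pullback.fst (F.toSpec k) (lineToSpec k) (blowdown F P k y) =
      toBase F P k y := fun y => by
    have h0 : blowdown F P k ≫ pullback.fst (F.toSpec k) (lineToSpec k) = toBase F P k :=
      pullback.lift_fst _ _ _
    rw [← Hom.comp_apply, h0]
  have h2 : ∀ y, pullback.snd (F.toSpec k) (lineToSpec k) (blowdown F P k y) =
      toLine F P k y := fun y => by
    have h0 : blowdown F P k ≫ pullback.snd (F.toSpec k) (lineToSpec k) = toLine F P k :=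
      pullback.lift_snd _ _ _
    rw [← Hom.comp_apply, h0]
  show closure _ = closure _
  congr 1
  ext y
  show (pullback.fst (F.toSpec k) (lineToSpec k) (blowdown F P k y) ∈ hypersurfaceSet J i ∧
    ¬ (pullback.snd (F.toSpec k) (lineToSpec k) (blowdown F P k y) ∈ lineOrigin k ∧
      ∃ j, pullback.fst (F.toSpec k) (lineToSpec k) (blowdown F P k y) ∈ F.toricDivisor k (P j))) ↔
    toBase F P k y ∈ hypersurfaceSet J i ∧ toLine F P k y ∉ lineOrigin k
  rw [h1, h2]
  constructor
  · rintro ⟨h3, h4⟩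
    exact ⟨h3, fun h5 => h4 ⟨h5, i, hypersurfaceSet_subset i h3⟩⟩
  · rintro ⟨h3, h4⟩
    exact ⟨h3, fun h5 => h4 h5.1⟩

theorem tildeCenter_eq_closure : (C̃ : Set (F̃.toricScheme k)) =
      closure {y | ∃ i, toBase F P k y ∈ hypersurfaceSet J i ∧ toLine F P k y ∉ lineOrigin k} := by
  have h1 : {y | ∃ i, toBase F P k y ∈ hypersurfaceSet J i ∧ toLine F P k y ∉ lineOrigin k} =
      ⋃ i, {y | toBase F P k y ∈ hypersurfaceSet J i ∧ toLine F P k y ∉ lineOrigin k} := by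
    ext y; simp
  rw [h1, closure_iUnion_of_finite]
  exact Set.iUnion_congr fun i => tildeHypersurface_eq_closure i

variable (hP' : SeparatedRays F P)

include hP'

theorem notMem_hypersurface_chart {S : F̃.cones} (hS : IsAdmissible P S.1) {i : Fin s}
    (hi : ℓ(i) ∉ S.1) (p : Spec(F̃.ChartRing k S.1)) :
    ¬ (toBase F P k (F̃.chart k S p) ∈ hypersurfaceSet J i ∧
      toLine F P k (F̃.chart k S p) ∉ lineOrigin k) := by
  rintro ⟨h1, h2⟩
  have h3 := hypersurfaceSet_subset i h1
  rw [toLine_chart_mem] at h2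
  rw [toBase_chart] at h3
  obtain ⟨h4, h5⟩ := (mem_toricDivisor_chart _ _ _).1 h3
  have he : exceptional i ∈ S.1 := by
    rcases mem_base.1 h4 with h6 | ⟨j, hj, h6⟩
    · exact absurd h6 hi
    · have : j = i := eq_of_exceptional_mem hP' S (exceptional_mem_base P hj) h4
      exact this ▸ hj
  exact h2 (Ideal.mem_of_dvd _ (basePull_coordFun_dvd hP' hi he) h5)

theorem chartIdeal_tildeHypersurface_of_notMem {S : F̃.cones} (hS : IsAdmissible P S.1)
    {i : Fin s} (hi : ℓ(i) ∉ S.1) :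
    I(F̃.chart k S, tildeHypersurface F P k J i) = ⊤ :=
  chartIdeal_vanishingIdeal_closure _ _ _ (tildeHypersurface_eq_closure i) (fun _ _ => trivial) 1
    (fun _ _ => trivial) fun p =>
    ⟨fun h => absurd h (notMem_hypersurface_chart hP' hS hi p),
      fun h => absurd h.1 (not_top_le_asIdeal p)⟩

theorem chartIdeal_tildeCenter_of_notMem {S : F̃.cones} (hS : IsAdmissible P S.1)
    (hi : ∀ i, ℓ(i) ∉ S.1) :
    I(F̃.chart k S, C̃) = ⊤ :=
  chartIdeal_vanishingIdeal_closure _ _ _ tildeCenter_eq_closure (fun _ _ => trivial) 1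
    (fun _ _ => trivial) fun p =>
    ⟨fun ⟨i, h⟩ => absurd h (notMem_hypersurface_chart hP' hS (hi i) p),
      fun h => absurd h.1 (not_top_le_asIdeal p)⟩

variable {a : Fin s → ι → ℤ} {g : ∀ _ : Fin s, AddMonoidAlgebra k ((Fin n → ℤ) →+ ℤ)}

theorem mem_hypersurface_chart_iff {S : F̃.cones} {i : Fin s}
    (hh : ℓ(i) ∈ S.1) (he : exceptional i ∈ S.1) {m : (Fin n → ℤ) →+ ℤ}
    {f : F.ChartRing k tgt(S).1}
    (hf : F.IsLocalEquation (P i) (hypersurfaceSet J i) (a i) (g i) tgt(S) m f)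
    (p : Spec(F̃.ChartRing k S.1)) :
    (toBase F P k (F̃.chart k S p) ∈ hypersurfaceSet J i ∧
      toLine F P k (F̃.chart k S p) ∉ lineOrigin k) ↔
    span {F̃.coordFun k S ℓ(i), basePull k S f} ≤ p.asIdeal ∧ lineCoord k S ∉ p.asIdeal := by
  rw [toLine_chart_mem, toBase_chart, hf.mem_iff]
  refine and_congr_left fun ht => ?_
  have h1 : F.coordFun k tgt(S) (P i) ∈ (SpecMap(basePull k S) p).asIdeal ↔
      F̃.coordFun k S ℓ(i) ∈ p.asIdeal := by
    obtain ⟨v, hv, hvx⟩ := basePull_coordFun (k := k) hP' hh he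
    show basePull k S _ ∈ p.asIdeal ↔ _
    rw [hvx]
    constructor
    · intro h
      rcases p.2.mem_or_mem h with h | h
      · rcases p.2.mem_or_mem h with h | h
        · exact absurd (Ideal.eq_top_of_isUnit_mem _ h hv) p.2.ne_top
        · exact h
      · exact absurd h ht
    · exact fun h => Ideal.mul_mem_right _ _ (mul_mem_left _ _ h)
  rw [h1, span_le]
  exact ⟨fun h => by rintro _ (rfl | rfl) <;> [exact h.1; exact h.2],
    fun h => ⟨h (by simp), h (by simp)⟩⟩

theorem isRadical_center {S : F̃.cones} {i : Fin s}
    (hh : ℓ(i) ∈ S.1) (he : exceptional i ∈ S.1) {m : (Fin n → ℤ) →+ ℤ}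
    {f : F.ChartRing k tgt(S).1}
    (hf : F.IsLocalEquation (P i) (hypersurfaceSet J i) (a i) (g i) tgt(S) m f) :
    (span {F̃.coordFun k S ℓ(i), basePull k S f}).IsRadical ∧
      ∀ z, lineCoord k S * z ∈ span {F̃.coordFun k S ℓ(i), basePull k S f} →
        z ∈ span {F̃.coordFun k S ℓ(i), basePull k S f} := by
  obtain ⟨l, hl, hlt⟩ := exists_hom_ker_eq hP' hh he f
  have hred := (Ideal.isRadical_iff_quotient_reduced _).1 hf.isRadical
  rw [← hl]
  constructor
  · intro z ⟨N, hz⟩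
    rw [mem_ker, map_pow] at hz
    rw [mem_ker]
    have h1 := Polynomial.isNilpotent_iff.1 (⟨N, hz⟩ : IsNilpotent (l z))
    exact Polynomial.ext fun i => (h1 i).eq_zero
  · intro z hz
    rw [mem_ker, map_mul, hlt] at hz
    exact (Polynomial.monic_X.mul_right_eq_zero_iff).1 hz

/-- The inclusion of the characters of the torus of `X_Σ` in those of the torus of `X_{Σ~}`. -/
def liftLaurent (g : AddMonoidAlgebra k ((Fin n → ℤ) →+ ℤ)) :
    AddMonoidAlgebra k ((Fin n → ℤ) × ℤ →+ ℤ) :=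
  mapDomainRingHom k (AddMonoidHom.compHom' (fst (Fin n → ℤ) ℤ)) g

omit hP' in
theorem embed_basePull (S : F̃.cones) (f : F.ChartRing k tgt(S).1) :
    F̃.embed k S.1 (basePull k S f) = liftLaurent (F.embed k _ f) := by
  have h1 : (F̃.embed k S.1).comp (basePull k S) = (mapDomainRingHom k
        (AddMonoidHom.compHom' (fst (Fin n → ℤ) ℤ))).comp
        (F.embed k tgt(S).1) := by
    rw [embed, basePull, embed, ← mapDomainRingHom_comp, ← mapDomainRingHom_comp]
    rfl
  exact RingHom.congr_fun h1 f

omit hP' in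
theorem liftLaurent_mul_single (g : AddMonoidAlgebra k ((Fin n → ℤ) →+ ℤ)) (m : (Fin n → ℤ) →+ ℤ) :
    liftLaurent (g * single m 1) = liftLaurent g * single (m.comp (fst (Fin n → ℤ) ℤ)) 1 := by
  rw [liftLaurent, map_mul]
  congr 1
  simp
  rfl

omit hP' in
theorem coeff_liftLaurent_eq_zero {g : AddMonoidAlgebra k ((Fin n → ℤ) →+ ℤ)} {b : ι}
    (hg : ∀ χ, g.coeff χ ≠ 0 → χ (F.gen b) = 0) {t : ℤ} (χ : (Fin n → ℤ) × ℤ →+ ℤ)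
    (hχ : χ (F.gen b, t) ≠ 0) : (liftLaurent g).coeff χ = 0 := by
  classical
  by_contra h
  have h1 : χ ∈ (liftLaurent g).coeff.support := Finsupp.mem_support_iff.2 h
  have h2 := Finsupp.mapDomain_support h1
  obtain ⟨ψ, hψ, rfl⟩ := Finset.mem_image.1 h2
  exact hχ (hg ψ (Finsupp.mem_support_iff.1 hψ))

omit hP' in
theorem basePull_notMem {S : F̃.cones}
    {f : F.ChartRing k tgt(S).1} {T : Finset (TildeRay ι s)} (hT : T ⊆ S.1)
    (h : f ∉ F.orbitIdeal k (show baseSimplex P T ⊆ tgt(S).1 from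
      Finset.biUnion_subset_biUnion_of_subset_left _ hT)) :
    basePull k S f ∉ F̃.orbitIdeal k hT := by
  rw [mem_orbitIdeal] at h ⊢
  push Not at h ⊢
  obtain ⟨χ, hχ, h1⟩ := h
  refine ⟨(fanProjection F P).pull S χ, ?_, ?_⟩
  · have hinj : Function.Injective ((fanProjection F P).pull S) := by
      intro χ ψ h2
      refine Subtype.ext (AddMonoidHom.ext fun z => ?_)
      exact congrArg (·.1 (z, 0)) h2
    have h3 : (basePull k S f).coeff ((fanProjection F P).pull S χ) = f.coeff χ :=
      Finsupp.mapDomain_apply hinj _ _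
    rw [h3]
    exact hχ
  · rintro (c | _ | j) hb
    · exact h1 c (horizontal_mem_base P hb)
    · exact map_zero χ.1
    · exact h1 _ (exceptional_mem_base P hb)

omit hP' in
/-- The slope of the piecewise linear function of `H_i`, on the rays of `Σ~`. -/
def twist [Fintype ι] (F : SmoothFan (Fin n → ℤ) ι) (P : Fin s → ι)
    (a : Fin s → ι → ℤ) (i : Fin s) : TildeRay ι s → ℤ
  | horizontal c => open Classical in if c ∈ F.link (P i) then a i c else 0
  | vertical => 0
  | exceptional _ => 0

/-- The centre of the second blow-up, in the chart of an admissible cone that contains `(m_i, 0)`. -/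
theorem exists_isCenterEquation [Fintype ι]
    (hg : ∀ i, F.IsEquation (P i) (hypersurfaceSet J i) (a i) (g i))
    {S : F̃.cones} (hS : IsAdmissible P S.1) {i : Fin s}
    (hh : ℓ(i) ∈ S.1) :
    ∃ m f, F̃.IsCenterEquation ℓ(i) C̃ (liftLaurent (g i)) S m f ∧
      I(F̃.chart k S, tildeHypersurface F P k J i) = span {F̃.coordFun k S ℓ(i), f} ∧
      ∀ b ∈ S.1, m (F̃.gen b) = twist F P a i b := by
  classical
  have he := hS i hh
  have hi : P i ∈ tgt(S).1 := horizontal_mem_base P hh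
  obtain ⟨m, f, hf⟩ := (hg i).exists_local _ hi
  obtain ⟨hrad, ht⟩ := isRadical_center hP' hh he hf
  refine ⟨m.comp (fst (Fin n → ℤ) ℤ), basePull k S f,
    ⟨hh, fun χ hχ => coeff_liftLaurent_eq_zero (hg i).apply_gen_self χ hχ, hf.apply_gen_self,
      ?_, ?_, fun T hT hhT => basePull_notMem hT (hf.notMem _ _ (horizontal_mem_base P hhT))⟩,
    ?_, ?_⟩
  · rw [embed_basePull, hf.embed_eq, liftLaurent_mul_single]
  · refine chartIdeal_vanishingIdeal_closure _ _ _ tildeCenter_eq_closure hrad _ ht fun p => ?_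
    rw [← mem_hypersurface_chart_iff hP' hh he hf]
    constructor
    · rintro ⟨j, hj⟩
      have hjS : horizontal (P j) ∈ S.1 := by
        by_contra h
        exact notMem_hypersurface_chart hP' hS h p hj
      rwa [eq_of_exceptional_mem hP' S hi (horizontal_mem_base P hjS)]
    · exact fun h => ⟨i, h⟩
  · exact chartIdeal_vanishingIdeal_closure _ _ _ (tildeHypersurface_eq_closure i) hrad _ ht
      fun p => mem_hypersurface_chart_iff hP' hh he hf p
  · rintro (c | _ | j) hb
    · by_cases hc : c = P i
      · subst hc
        have h1 : P i ∉ F.link (P i) := fun h => ne_of_mem_link h rfl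
        simp only [twist, if_neg h1]
        exact hf.apply_gen_self
      · have hcS : c ∈ tgt(S).1 := horizontal_mem_base P hb
        simp only [twist, if_pos (mem_link hi hcS hc)]
        exact hf.apply_gen c hcS hc
    · exact absurd hb (vertical_notMem hh)
    · have hj : i = j := eq_of_exceptional_mem hP' S hi (exceptional_mem_base P hb)
      subst hj
      exact hf.apply_gen_self

end

/-! ### Sheared fans -/

section

namespace SmoothFan

variable {N : Type} [AddCommGroup N] {β : Type} [DecidableEq β]

/-- The star of the ray `h`, with the generators `m_b` of the other rays moved to `m_b + a_b m_h`. -/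
def shear (G : SmoothFan N β) (h : β) (hh : {h} ∈ G.cones) (a : β → ℤ) (ha : a h = 0) :
    SmoothFan N β where
  gen b := G.gen b + a b • G.gen h
  cones := {S | insert h S ∈ G.cones}
  empty_mem := hh
  down_closed hT hST := G.down_closed hT (Finset.insert_subset_insert _ hST)
  unimodular := by
    intro T hT c
    obtain ⟨χ, hχ⟩ := G.unimodular (insert h T) hT (fun b =>
      if b = h then if h ∈ T then c h else 0 else c b - a b * if h ∈ T then c h else 0)
    refine ⟨χ, fun b hb => ?_⟩
    rw [map_add, map_zsmul, hχ h (mem_insert_self _ _), hχ b (mem_insert_of_mem hb)]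
    by_cases hbh : b = h
    · subst hbh
      simp [hb, ha]
    · simp [hbh]

variable {k : Type u} [Field k] {G : SmoothFan N β} {h : β} {hh : {h} ∈ G.cones} {a : β → ℤ}
  {ha : a h = 0}

local notation "G♯" => G.shear h hh a ha

theorem shear_gen (b : β) : G♯.gen b = G.gen b + a b • G.gen h := rfl

theorem shear_gen_self : G♯.gen h = G.gen h := by rw [shear_gen, ha, zero_smul, add_zero]

/-- A cone that contains `h`, as a cone of the sheared fan. -/
abbrev shearCone (hh : {h} ∈ G.cones) (ha : a h = 0) (S : G.cones) (hS : h ∈ S.1) :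
    (G.shear h hh a ha).cones :=
  ⟨S.1, show insert h S.1 ∈ G.cones by rw [Finset.insert_eq_self.2 hS]; exact S.2⟩

section

variable {S : G.cones} {m : N →+ ℤ} (hS : h ∈ S.1) (hmh : m (G.gen h) = 0)
  (hm : ∀ b ∈ S.1, m (G.gen b) = a b)

include hm hmh hS

theorem apply_shear_gen (χ : N →+ ℤ) {b : β} (hb : b ∈ S.1) :
    (χ - χ (G.gen h) • m) (G♯.gen b) = χ (G.gen b) := by
  simp only [shear_gen, AddMonoidHom.sub_apply, AddMonoidHom.coe_smul, Pi.smul_apply, map_add,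
    map_zsmul, hm b hb, hmh, smul_eq_mul]
  ring

theorem sub_mem_shear (χ : G.dualMonoid S.1) :
    χ.1 - χ.1 (G.gen h) • m ∈ G♯.dualMonoid S.1 := fun b hb => by
  rw [apply_shear_gen hS hmh hm χ.1 hb]
  exact χ.2 b hb

omit hmh hS in
theorem add_mem_of_shear (ψ : G♯.dualMonoid S.1) :
    ψ.1 + ψ.1 (G.gen h) • m ∈ G.dualMonoid S.1 := fun b hb => by
  have h1 := ψ.2 b hb
  rw [shear_gen, map_add, map_zsmul] at h1
  simp only [AddMonoidHom.add_apply, AddMonoidHom.coe_smul, Pi.smul_apply, hm b hb, smul_eq_mul] at h1 ⊢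
  linarith [mul_comm (a b) (ψ.1 (G.gen h))]

variable (f' : (G.shear h hh a ha).ChartRing k S.1)

/-- The homomorphism to the coordinate ring of a chart of the blow-up of `(x_h, f)`, the chart on
which `f` generates the inverse image ideal. It sends a character `χ` to `f ^ χ(m_h)` times
`χ - χ(m_h) m`. -/
def shearHom : G.ChartRing k S.1 →ₐ[k] G♯.ChartRing k S.1 :=
  AddMonoidAlgebra.lift k _ (G.dualMonoid S.1)
    { toFun := fun χ => f' ^ (χ.toAdd.1 (G.gen h)).toNat *
        single ⟨_, sub_mem_shear hS hmh hm χ.toAdd⟩ 1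
      map_one' := by
        have h1 : (single (⟨_, sub_mem_shear (hh := hh) (ha := ha) hS hmh hm
          (1 : Multiplicative (G.dualMonoid S.1)).toAdd⟩ : G♯.dualMonoid S.1) (1 : k)) = 1 := by
          rw [AddMonoidAlgebra.one_def]
          congr 1
          apply Subtype.ext
          simp
        rw [h1]
        simp
      map_mul' := fun χ ψ => by
        have h1 : ((χ * ψ).toAdd.1 (G.gen h)).toNat =
            (χ.toAdd.1 (G.gen h)).toNat + (ψ.toAdd.1 (G.gen h)).toNat :=
          Int.toNat_add (χ.toAdd.2 _ hS) (ψ.toAdd.2 _ hS)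
        have h2 : (single (⟨_, sub_mem_shear (hh := hh) (ha := ha) hS hmh hm
            (χ * ψ).toAdd⟩ : G♯.dualMonoid S.1) (1 : k)) =
            single ⟨_, sub_mem_shear hS hmh hm χ.toAdd⟩ 1 *
            single ⟨_, sub_mem_shear hS hmh hm ψ.toAdd⟩ 1 := by
          rw [single_mul_single, one_mul]
          congr 1
          apply Subtype.ext
          simp [add_smul]
          abel
        rw [h1, h2, pow_add]
        ring }

theorem shearHom_single (χ : G.dualMonoid S.1) (c : k) : shearHom hS hmh hm f' (single χ c) =
      f' ^ (χ.1 (G.gen h)).toNat *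
        single ⟨_, sub_mem_shear hS hmh hm χ⟩ c := by
  rw [shearHom, lift_single]
  show c • (f' ^ (χ.1 (G.gen h)).toNat * single (⟨_, sub_mem_shear hS hmh hm χ⟩ :
    G♯.dualMonoid S.1) (1 : k)) = _
  rw [← mul_smul_comm, AddMonoidAlgebra.smul_single, smul_eq_mul, mul_one]

theorem shearHom_of_apply_eq_zero {χ : G.dualMonoid S.1} (hχ : χ.1 (G.gen h) = 0) (c : k)
    (hχ' : χ.1 ∈ G♯.dualMonoid S.1) :
    shearHom hS hmh hm f' (single χ c) = single ⟨χ.1, hχ'⟩ c := by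
  have h1 : (⟨_, sub_mem_shear hS hmh hm χ⟩ : G♯.dualMonoid S.1) = ⟨χ.1, hχ'⟩ :=
    Subtype.ext (by simp [hχ])
  rw [shearHom_single, h1, hχ, Int.toNat_zero, pow_zero, one_mul]

theorem embed_shearHom_faceProj (z : G.ChartRing k S.1) : G♯.embed k S.1
      (shearHom hS hmh hm f' (starProj(hS) z)) =
      G.embed k S.1 (starProj(hS) z) := by
  classical
  apply eq_of_single z
  intro χ c
  rw [faceProj_single]
  split_ifs with h1
  · have h2 := h1 h (mem_singleton_self h)
    have h3 : χ.1 ∈ G♯.dualMonoid S.1 := by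
      simpa [h2] using sub_mem_shear (hh := hh) (ha := ha) hS hmh hm χ
    rw [shearHom_of_apply_eq_zero hS hmh hm f' h2 c h3, embed_single, embed_single]
  · simp

end

section

local notation "σ(" hE "," hm ")" =>
  SmoothFan.shearHom (SmoothFan.IsCenterEquation.mem hE) (SmoothFan.IsCenterEquation.apply_gen_self hE) hm

variable {Z : Closeds (G.toricScheme k)} {g : AddMonoidAlgebra k (N →+ ℤ)}
  {S : G.cones} {m : N →+ ℤ} {f : G.ChartRing k S.1}

theorem IsCenterEquation.apply_eq_zero (hE : G.IsCenterEquation h Z g S m f)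
    {χ : N →+ ℤ} (hχ : (G.embed k S.1 f).coeff χ ≠ 0) : χ (G.gen h) = 0 := by
  rw [hE.embed_eq, coeff_mul_single] at hχ
  by_contra h1
  refine hχ (hE.coeff_eq_zero _ ?_)
  rwa [AddMonoidHom.sub_apply, hE.apply_gen_self, sub_zero]

theorem IsCenterEquation.faceProj_eq (hE : G.IsCenterEquation h Z g S m f) :
    starProj(hE.mem) f = f := by
  apply AddMonoidAlgebra.ext
  refine Finsupp.ext fun χ => ?_
  rw [coeff_faceProj]
  split_ifs with h1
  · rfl
  · by_contra h2
    refine h1 fun b hb => ?_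
    rw [mem_singleton.1 hb]
    refine hE.apply_eq_zero ?_
    rw [coeff_embed]
    exact fun h3 => h2 h3.symm

theorem IsCenterEquation.exists_shear (hE : G.IsCenterEquation h Z g S m f) :
    ∃ f' : G♯.ChartRing k S.1, G♯.embed k S.1 f' = G.embed k S.1 f := by
  refine exists_embed fun χ hχ b hb => ?_
  have h1 := mem_of_coeff_embed hχ b hb
  rwa [shear_gen, map_add, map_zsmul, hE.apply_eq_zero hχ, smul_zero, add_zero]

theorem IsCenterEquation.shear_notMem (hE : G.IsCenterEquation h Z g S m f)
    {f' : (G.shear h hh a ha).ChartRing k S.1}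
    (hf' : (G.shear h hh a ha).embed k S.1 f' = G.embed k S.1 f)
    {T : Finset β} (hT : T ⊆ S.1) : f' ∉ G♯.orbitIdeal k hT := by
  intro h1
  have h0 : insert h T ⊆ S.1 := insert_subset hE.mem hT
  refine hE.notMem (insert h T) h0 (mem_insert_self _ _) ?_
  rw [mem_orbitIdeal_embed] at h1 ⊢
  intro χ hχ
  obtain ⟨b, hb, h2⟩ := h1 χ (by rw [hf']; exact hχ)
  rw [shear_gen, map_add, map_zsmul, hE.apply_eq_zero hχ, smul_zero, add_zero] at h2
  exact ⟨b, mem_insert_of_mem hb, h2⟩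

variable (hE : G.IsCenterEquation h Z g S m f) (hm : ∀ b ∈ S.1, m (G.gen b) = a b)
  {f' : (G.shear h hh a ha).ChartRing k S.1}
  (hf' : (G.shear h hh a ha).embed k S.1 f' = G.embed k S.1 f)

include hf'

theorem IsCenterEquation.shearHom_self : σ(hE, hm) f' f = f' := by
  apply embed_injective
  rw [hf']
  have h1 := embed_shearHom_faceProj hE.mem hE.apply_gen_self hm f' f
  rwa [hE.faceProj_eq] at h1

omit hf' in
theorem IsCenterEquation.shearHom_coordFun_of_ne {b : β} (hb : b ∈ S.1) (hbh : b ≠ h) :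
    ∃ v, IsUnit v ∧ σ(hE, hm) f' (G.coordFun k S b) =
      v * G♯.coordFun k (shearCone hh ha S hE.mem) b := by
  have h0 : (G.coord S b).1 (G.gen h) = 0 := coord_of_ne hE.mem hbh.symm
  have h1 : ∀ c, (G.coord S b).1 (G♯.gen c) = (G.coord S b).1 (G.gen c) := by
    intro c
    rw [shear_gen, map_add, map_zsmul, h0, smul_zero, add_zero]
  have h2 : (G.coord S b).1 ∈ G♯.dualMonoid S.1 := fun c hc => by
    rw [h1]; exact (G.coord S b).2 c hc
  obtain ⟨v, hv, hvx⟩ := exists_unit_single (k := k) (S := (shearCone hh ha S hE.mem).1)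
    ⟨_, h2⟩ (G♯.coord (shearCone hh ha S hE.mem) b) (fun c hc => by
      by_cases hcb : c = b
      · subst hcb
        rw [coord_self hc, h1, coord_self hb]
      · rw [coord_of_ne hc hcb, h1, coord_of_ne (S := S) hc hcb])
  refine ⟨v, hv, ?_⟩
  rw [coordFun, shearHom_of_apply_eq_zero _ _ _ _ h0 _ h2]
  exact hvx

omit hf' in
theorem IsCenterEquation.shearHom_coordFun_self : ∃ v, IsUnit v ∧ σ(hE, hm) f' (G.coordFun k S h) =
      f' * (v * G♯.coordFun k (shearCone hh ha S hE.mem) h) := by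
  have h0 : (G.coord S h).1 (G.gen h) = 1 := coord_self hE.mem
  obtain ⟨v, hv, hvx⟩ := exists_unit_single (k := k) (S := (shearCone hh ha S hE.mem).1)
    ⟨_, sub_mem_shear hE.mem hE.apply_gen_self hm (G.coord S h)⟩
    (G♯.coord (shearCone hh ha S hE.mem) h) (fun c hc => by
      rw [apply_shear_gen hE.mem hE.apply_gen_self hm _ hc]
      by_cases hcb : c = h
      · subst hcb
        rw [coord_self hc, h0]
      · rw [coord_of_ne hc hcb, coord_of_ne (S := S) hc hcb])
  refine ⟨v, hv, ?_⟩
  have hn : ((G.coord S h).1 (G.gen h)).toNat = 1 := by rw [h0]; rfl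
  rw [coordFun, shearHom_single, hn, pow_one]
  exact congrArg (f' * ·) hvx

/-- The universal property of the chart of the blow-up on which `f` generates the inverse image
ideal. -/
theorem IsCenterEquation.shear_universal (B : Type u) [CommRing B] (φ : G.ChartRing k S.1 →+* B)
    (hφ : φ f ∈ nonZeroDivisors B) (hx : φ (G.coordFun k S h) ∈ span {φ f}) :
    ∃! γ : G♯.ChartRing k S.1 →+* B, γ.comp (σ(hE, hm) f' : G.ChartRing k S.1 →+* _) = φ := by
  obtain ⟨v, hv⟩ := Ideal.mem_span_singleton'.1 hx
  have hξh : (G.coord S h).1 (G.gen h) = 1 := coord_self hE.mem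
  have hξ : ∀ c ∈ S.1, c ≠ h → (G.coord S h).1 (G.gen c) = 0 := fun c hc hch => coord_of_ne hc hch
  -- `ψ ↦ (ψ + ψ(m_h) m) - ψ(m_h) ξ`
  have hmem : ∀ ψ : G♯.dualMonoid S.1,
      ψ.1 + ψ.1 (G.gen h) • (m - (G.coord S h).1) ∈ G.dualMonoid S.1 := by
    intro ψ c hc
    have h1 := add_mem_of_shear hm ψ c hc
    simp only [AddMonoidHom.add_apply, AddMonoidHom.coe_smul, Pi.smul_apply, smul_eq_mul,
      AddMonoidHom.sub_apply] at h1 ⊢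
    by_cases hch : c = h
    · subst hch
      rw [hξh, hE.apply_gen_self]
      simp
    · rw [hξ c hc hch, sub_zero]
      exact h1
  have hnn : ∀ ψ : G♯.dualMonoid S.1, 0 ≤ ψ.1 (G.gen h) := fun ψ => by
    have := ψ.2 h hE.mem
    rwa [shear_gen_self] at this
  let φ₀ : k →+* B := φ.comp (algebraMap k _)
  let _ : Algebra k B := φ₀.toAlgebra
  have hφ₀ : ∀ c, algebraMap k B c = φ (single 0 c) := fun c => rfl
  let γ₀ : Multiplicative (G♯.dualMonoid S.1) →* B :=
    { toFun := fun ψ => φ (single ⟨_, hmem ψ.toAdd⟩ 1) * v ^ (ψ.toAdd.1 (G.gen h)).toNat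
      map_one' := by
        have h1 : (single (⟨_, hmem (1 : Multiplicative _).toAdd⟩ :
            G.dualMonoid S.1) (1 : k)) = 1 := by
          rw [AddMonoidAlgebra.one_def]
          congr 1
          apply Subtype.ext
          simp
        rw [h1]
        simp
      map_mul' := fun χ ψ => by
        have h1 : ((χ * ψ).toAdd.1 (G.gen h)).toNat =
            (χ.toAdd.1 (G.gen h)).toNat + (ψ.toAdd.1 (G.gen h)).toNat :=
          Int.toNat_add (hnn χ.toAdd) (hnn ψ.toAdd)
        have h2 : (single (⟨_, hmem (χ * ψ).toAdd⟩ : G.dualMonoid S.1) (1 : k)) =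
            single ⟨_, hmem χ.toAdd⟩ 1 *
            single ⟨_, hmem ψ.toAdd⟩ 1 := by
          rw [single_mul_single, one_mul]
          congr 1
          apply Subtype.ext
          simp [add_smul]
          abel
        rw [h1, h2, pow_add, map_mul]
        ring }
  let γ : G♯.ChartRing k S.1 →ₐ[k] B := AddMonoidAlgebra.lift k _ _ γ₀
  have hγ : ∀ ψ c, γ (single ψ c) = φ (single ⟨_, hmem ψ⟩ c) * v ^ (ψ.1 (G.gen h)).toNat := by
    intro ψ c
    have h1 : γ (single ψ c) = c • γ₀ (ofAdd ψ) := lift_single _ _ _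
    rw [h1, Algebra.smul_def, hφ₀]
    show _ * (φ _ * _) = _
    rw [← mul_assoc, ← map_mul, single_mul_single, mul_one]
    congr 3
    exact zero_add _
  have hγf : ∀ z, γ (σ(hE, hm) f' (starProj(hE.mem) z)) = φ (starProj(hE.mem) z) := by
    classical
    intro z
    apply eq_of_single z
    intro χ c
    rw [faceProj_single]
    split_ifs with h1
    · have h2 := h1 h (mem_singleton_self h)
      have h3 : χ.1 ∈ G♯.dualMonoid S.1 := by
        simpa [h2] using sub_mem_shear (hh := hh) (ha := ha) hE.mem hE.apply_gen_self hm χ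
      have h4 : (⟨_, hmem ⟨χ.1, h3⟩⟩ : G.dualMonoid S.1) = χ := Subtype.ext (by simp [h2])
      rw [shearHom_of_apply_eq_zero _ _ _ _ h2 c h3, hγ, h4]
      simp only [h2, Int.toNat_zero, pow_zero, mul_one]
    · simp
  have hγf' : γ f' = φ f := by
    have := hγf f
    rwa [hE.faceProj_eq, hE.shearHom_self hm hf'] at this
  refine ⟨γ, ?_, ?_⟩
  · refine RingHom.ext fun z => ?_
    show γ (σ(hE, hm) f' z) = φ z
    apply eq_of_single z
    intro χ c
    rw [shearHom_single, map_mul, map_pow, hγf', hγ]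
    have h2 : (χ.1 - χ.1 (G.gen h) • m) (G.gen h) = χ.1 (G.gen h) := by simp [hE.apply_gen_self]
    simp only [h2]
    have h3 : φ f ^ (χ.1 (G.gen h)).toNat * v ^ (χ.1 (G.gen h)).toNat =
        φ (single ((χ.1 (G.gen h)).toNat • G.coord S h) 1) := by
      rw [← mul_pow, mul_comm (φ f), hv, ← map_pow, coordFun, single_pow, one_pow]
    rw [mul_left_comm, h3, ← map_mul, single_mul_single, mul_one]
    congr 2
    apply Subtype.ext
    have h4 : ((χ.1 (G.gen h)).toNat : ℤ) = χ.1 (G.gen h) := Int.toNat_of_nonneg (χ.2 h hE.mem)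
    show χ.1 - χ.1 (G.gen h) • m + χ.1 (G.gen h) • (m - (G.coord S h).1) +
      (χ.1 (G.gen h)).toNat • (G.coord S h).1 = χ.1
    rw [← natCast_zsmul, h4]
    module
  · intro γ' hγ'
    have h1 : ∀ z, γ' (σ(hE, hm) f' z) = φ z := fun z => RingHom.congr_fun hγ' z
    -- the quotient `x_h / f`
    let V : G♯.ChartRing k S.1 :=
      single ⟨_, sub_mem_shear hE.mem hE.apply_gen_self hm (G.coord S h)⟩ 1
    have hV : σ(hE, hm) f' (G.coordFun k S h) = f' * V := by
      have hn : ((G.coord S h).1 (G.gen h)).toNat = 1 := by rw [hξh]; rfl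
      rw [coordFun, shearHom_single, hn, pow_one]
    have hγV : γ' V = v := by
      have h2 := h1 (G.coordFun k S h)
      rw [hV, map_mul, ← hE.shearHom_self hm hf', h1, ← hv, mul_comm v] at h2
      exact (mul_cancel_left_mem_nonZeroDivisors hφ).1 h2
    refine RingHom.ext fun z => ?_
    show γ' z = γ z
    apply eq_of_single z
    intro ψ c
    have h2 : (single ψ c : G♯.ChartRing k S.1) = σ(hE, hm) f' (single ⟨_, hmem ψ⟩ c) *
          V ^ (ψ.1 (G.gen h)).toNat := by
      have h3 : (ψ.1 + ψ.1 (G.gen h) • (m - (G.coord S h).1)) (G.gen h) = 0 := by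
        simp [hE.apply_gen_self, hξh]
      have h4 : ((ψ.1 (G.gen h)).toNat : ℤ) = ψ.1 (G.gen h) := Int.toNat_of_nonneg (hnn ψ)
      rw [shearHom_single]
      simp only [h3, Int.toNat_zero, pow_zero, one_mul, V, single_pow, one_pow,
        single_mul_single, mul_one]
      congr 1
      apply Subtype.ext
      show ψ.1 = ψ.1 + ψ.1 (G.gen h) • (m - (G.coord S h).1) - (0 : ℤ) • m +
        (ψ.1 (G.gen h)).toNat • ((G.coord S h).1 - (G.coord S h).1 (G.gen h) • m)
      rw [← natCast_zsmul, h4, hξh]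
      module
    rw [h2, map_mul, map_pow, h1, hγV, ← h2, hγ]

end

end SmoothFan

end

local notation "σ(" hE "," hm ")" =>
  SmoothFan.shearHom (SmoothFan.IsCenterEquation.mem hE) (SmoothFan.IsCenterEquation.apply_gen_self hE) hm

/-! ### The ring obtained by adjoining a quotient -/

section

section RatioRing

open Polynomial

variable {A : Type u} [CommRing A] [IsDomain A]

/-- The subring `A[f / x]` of the fraction field of the domain `A`, presented as a quotient of
`A[T]`. -/
abbrev RatioRing (x f : A) : Type u := A[X] ⧸ ker (eval₂RingHom (algebraMap A (FractionRing A))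
    (algebraMap A (FractionRing A) f / algebraMap A (FractionRing A) x))

variable {x f : A}

instance : IsDomain (RatioRing x f) :=
  (Ideal.Quotient.isDomain_iff_prime _).2 (RingHom.ker_isPrime _)

variable (x f) in
/-- The structure map of `A[f / x]`. -/
def ratioMap : A →+* RatioRing x f := (quotMk _).comp C

variable (x f) in
/-- The element `f / x` of `A[f / x]`. -/
def ratio : RatioRing x f := quotMk _ X

theorem ratioMap_mul_ratio (hx : x ≠ 0) : ratioMap x f x * ratio x f = ratioMap x f f := by
  refine Ideal.Quotient.eq.2 ?_
  have hx' : algebraMap A (FractionRing A) x ≠ 0 := by simpa using hx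
  rw [mem_ker]
  simp only [map_sub, map_mul, coe_eval₂RingHom, eval₂_C, eval₂_X]
  field_simp
  ring

theorem ratioMap_injective : Function.Injective (ratioMap x f) := by
  refine (injective_iff_map_eq_zero _).2 fun a ha => ?_
  have h1 := eq_zero_iff_mem.1 (show quotMk _ (C a) = 0 from ha)
  rw [mem_ker, coe_eval₂RingHom, eval₂_C] at h1
  exact (IsFractionRing.injective A (FractionRing A)) (by rw [h1, map_zero])

/-- The universal property of the chart of the blow-up of `(x, f)` on which `x` generates the
inverse image ideal. -/
theorem ratioMap_universal (hx : x ≠ 0) {B : Type u} [CommRing B] (β : A →+* B)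
    (hβ : β x ∈ nonZeroDivisors B) (hf : β f ∈ span {β x}) :
    ∃! γ : RatioRing x f →+* B, γ.comp (ratioMap x f) = β := by
  obtain ⟨w, hw⟩ := Ideal.mem_span_singleton'.1 hf
  have hx' : algebraMap A (FractionRing A) x ≠ 0 := by simpa using hx
  have hker : ∀ p ∈ ker (eval₂RingHom (algebraMap A (FractionRing A))
      (algebraMap A (FractionRing A) f / algebraMap A (FractionRing A) x)),
      eval₂RingHom β w p = 0 := by
    intro p hp
    rw [mem_ker, coe_eval₂RingHom] at hp
    have h1 : algebraMap A (FractionRing A) x *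
        (algebraMap A (FractionRing A) f / algebraMap A (FractionRing A) x) =
        algebraMap A (FractionRing A) f := by field_simp
    have h2 := scaleRoots_eval₂_mul (p := p) (algebraMap A (FractionRing A))
      (algebraMap A (FractionRing A) f / algebraMap A (FractionRing A) x) x
    rw [h1, hp, mul_zero, eval₂_at_apply, map_eq_zero_iff _ (IsFractionRing.injective _ _)] at h2
    have h3 := scaleRoots_eval₂_mul (p := p) β w x
    rw [mul_comm, hw, eval₂_at_apply, h2, map_zero] at h3
    exact (mul_left_mem_nonZeroDivisors_eq_zero_iff (pow_mem hβ _)).1 h3.symm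
  refine ⟨Ideal.Quotient.lift _ _ hker, ?_, fun γ hγ => ?_⟩
  · refine RingHom.ext fun a => ?_
    refine (Ideal.Quotient.lift_mk _ _ hker).trans ?_
    simp
  · refine Ideal.Quotient.ringHom_ext (Polynomial.ringHom_ext (fun a => ?_) ?_)
    · have := RingHom.congr_fun hγ a
      simpa [ratioMap] using this
    · have h1 := congrArg γ (ratioMap_mul_ratio (f := f) hx)
      have h2 : ∀ a, γ (ratioMap x f a) = β a := fun a => RingHom.congr_fun hγ a
      rw [map_mul, h2, h2, ← hw, mul_comm w] at h1
      have h3 := (mul_cancel_left_mem_nonZeroDivisors hβ).1 h1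
      simpa [ratio] using h3

/-- A prime element `y` with `(x, y)` prime and `f ∉ (x, y)` remains prime in `A[f / x]`. -/
theorem ratioMap_prime (hx : x ≠ 0) {y : A} (hy : Prime y) (hxy : ¬ y ∣ x)
    (hp : (span {x, y}).IsPrime) (hf : f ∉ span {x, y}) :
    Prime (ratioMap x f y) ∧ ¬ ratioMap x f y ∣ ratioMap x f x := by
  have hyp : (span {y}).IsPrime := (Ideal.span_singleton_prime hy.ne_zero).2 hy
  let Q := A ⧸ span {y}
  let K := FractionRing Q
  let β : A →+* K := (algebraMap Q K).comp (quotMk _)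
  have hβ : ∀ a, β a = 0 ↔ y ∣ a := fun a => by
    rw [← mem_span_singleton, ← eq_zero_iff_mem,
      ← map_eq_zero_iff (algebraMap Q K) (IsFractionRing.injective Q K)]
    rfl
  have hx0 : β x ≠ 0 := fun h => hxy ((hβ x).1 h)
  obtain ⟨γ, hγ, -⟩ := ratioMap_universal (f := f) hx β (mem_nonZeroDivisors_of_ne_zero hx0)
    (by rw [Ideal.span_singleton_eq_top.2 (isUnit_iff_ne_zero.2 hx0)]; trivial)
  have hγ' : ∀ a, γ (ratioMap x f a) = β a := fun a => RingHom.congr_fun hγ a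
  -- a polynomial in `f / x` that vanishes modulo `y` is a multiple of `y`: induct on its degree
  have key : ∀ (N : ℕ) (p : A[X]), p.natDegree ≤ N → γ (quotMk _ p) = 0 →
      ratioMap x f y ∣ quotMk _ p := by
    intro N
    induction N with
    | zero =>
      intro p hpN h0
      rw [Polynomial.eq_C_of_natDegree_le_zero hpN] at h0 ⊢
      obtain ⟨c, hc⟩ := (hβ _).1 ((hγ' _).symm.trans h0)
      exact ⟨ratioMap x f c, by rw [← map_mul, ← hc]; rfl⟩
    | succ N ih =>
      intro p hpN h0
      have h1 : p.coeff (N + 1) * f ^ (N + 1) ∈ span {x, y} := by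
        have e1 : γ (quotMk _ p) = eval₂ β (γ (ratio x f)) p := by
          have : (γ.comp (quotMk _)) = eval₂RingHom β (γ (ratio x f)) := by
            refine Polynomial.ringHom_ext (fun a => ?_) ?_
            · rw [coe_eval₂RingHom, eval₂_C]
              exact hγ' a
            · rw [coe_eval₂RingHom, eval₂_X]
              rfl
          exact RingHom.congr_fun this p
        have e2 : β x * γ (ratio x f) = β f := by
          rw [← hγ', ← hγ', ← map_mul, ratioMap_mul_ratio hx]
        have e3 : β (∑ i ∈ Finset.range (N + 2), p.coeff i * (f ^ i * x ^ (N + 1 - i))) = 0 := by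
          rw [e1, eval₂_eq_sum_range' β (Nat.lt_succ_of_le hpN)] at h0
          rw [map_sum, ← mul_zero (β x ^ (N + 1)), ← h0, Finset.mul_sum]
          refine sum_congr rfl fun i hi => ?_
          have hi' : i + (N + 1 - i) = N + 1 := by
            have := Finset.mem_range.1 hi
            omega
          rw [map_mul, map_mul, map_pow, map_pow, ← e2, mul_pow]
          conv_rhs => rw [← hi', pow_add]
          ring
        have e4 := mem_span_singleton.2 ((hβ _).1 e3)
        rw [Finset.sum_range_succ, Nat.sub_self, pow_zero, mul_one] at e4
        have e5 : ∑ i ∈ Finset.range (N + 1), p.coeff i * (f ^ i * x ^ (N + 1 - i)) ∈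
            span {x, y} := by
          refine Ideal.sum_mem _ fun i hi => ?_
          refine mul_mem_left _ _ (mul_mem_left _ _ ?_)
          have : N + 1 - i ≠ 0 := by
            have := Finset.mem_range.1 hi
            omega
          exact Ideal.pow_mem_of_mem _ (subset_span (by simp)) _ (Nat.pos_of_ne_zero this)
        have e6 : span {y} ≤ span {x, y} := Ideal.span_mono (by simp)
        exact (Ideal.add_mem_iff_right _ e5).1 (e6 e4)
      have h2 : p.coeff (N + 1) ∈ span {x, y} := by
        rcases hp.mem_or_mem h1 with h | h
        · exact h
        · exact absurd (hp.mem_of_pow_mem _ h) hf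
      obtain ⟨d, e, hde⟩ := Ideal.mem_span_pair.1 h2
      let q : A[X] := p - C (p.coeff (N + 1)) * X ^ (N + 1) + C (d * f) * X ^ N
      have hqN : q.natDegree ≤ N := by
        refine Polynomial.natDegree_le_iff_coeff_eq_zero.2 fun m hm => ?_
        simp only [q, coeff_add, coeff_sub, coeff_C_mul_X_pow]
        rcases eq_or_ne m (N + 1) with rfl | hm'
        · simp
        · have : m > N + 1 := lt_of_le_of_ne hm (Ne.symm hm')
          rw [coeff_eq_zero_of_natDegree_lt (lt_of_le_of_lt hpN this)]
          have : m ≠ N := by omega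
          simp [hm', this]
      have hpq : (quotMk _ p : RatioRing x f) =
          quotMk _ q + ratioMap x f y * (ratioMap x f e * ratio x f ^ (N + 1)) := by
        have h3 : (quotMk _ q : RatioRing x f) = quotMk _ p -
            ratioMap x f (p.coeff (N + 1)) * ratio x f ^ (N + 1) +
            ratioMap x f (d * f) * ratio x f ^ N := by
          simp only [q, ratioMap, ratio, map_sub, map_add, map_mul, map_pow, RingHom.comp_apply]
        rw [h3, ← hde, map_mul, map_add, map_mul, map_mul, ← ratioMap_mul_ratio (f := f) hx]
        ring
      rw [hpq]
      refine dvd_add (ih q hqN ?_) (dvd_mul_right _ _)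
      have h4 : γ (ratioMap x f y) = 0 := by rw [hγ', hβ]
      have h5 := congrArg γ hpq
      rwa [h0, map_add, map_mul, h4, zero_mul, add_zero, eq_comm] at h5
  have hdvd : ∀ z, ratioMap x f y ∣ z ↔ γ z = 0 := by
    intro z
    constructor
    · rintro ⟨c, rfl⟩
      rw [map_mul, hγ', (hβ y).2 dvd_rfl, zero_mul]
    · obtain ⟨p, rfl⟩ := mk_surjective z
      exact key p.natDegree p le_rfl
  refine ⟨⟨?_, fun hu => ?_, fun a b h => ?_⟩, ?_⟩
  · rw [Ne, map_eq_zero_iff _ ratioMap_injective]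
    exact hy.ne_zero
  · have := (hdvd 1).1 (isUnit_iff_dvd_one.1 hu)
    rw [map_one] at this
    exact one_ne_zero this
  · simp only [hdvd, map_mul, mul_eq_zero] at h ⊢
    exact h
  · rw [hdvd, hγ']
    exact hx0

end RatioRing

/-- Over an affine open set that does not meet the centre, a blow-up is an isomorphism. -/
theorem IsBlowup.exists_chart_of_top {X Y : Scheme.{u}} {A : Type u} [CommRing A] {π : X ⟶ Y}
    {I : Y.IdealSheafData} (hπ : IsBlowup π I) (c : Spec(A) ⟶ Y)
    [IsOpenImmersion c] (hI : chartIdeal c I = ⊤) :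
    ∃ j : Spec(A) ⟶ X, IsOpenImmersion j ∧ j ≫ π = c ∧ Set.range j = π ⁻¹' Set.range c := by
  have hI' : chartIdeal c I = span {(1 : A), 0} := by
    rw [hI, eq_comm, Ideal.eq_top_iff_one]
    exact subset_span (by simp)
  obtain ⟨j, hj, h1, h2, h3⟩ := hπ.exists_chart c (a := 1) (b := 0) hI' (RingHom.id A)
    (by simp [one_mem]) (by simp) (fun B _ β _ _ => ⟨β, rfl, fun γ hγ => hγ⟩)
  have h1' : j ≫ π = c := by
    rw [h1]
    have : SpecMap(RingHom.id A) = 𝟙 (Spec(A)) := Spec.map_id _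
    rw [this, id_comp]
  refine ⟨j, hj, h1', Set.Subset.antisymm ?_ ?_⟩
  · rintro _ ⟨p, rfl⟩
    exact ⟨p, by rw [← h1']; rfl⟩
  · intro z hz
    rw [h2]
    rcases generatorLocus_cover hπ.isEffectiveCartier c hI' hz with h | h
    · exact h
    · obtain ⟨B, _, j', _, β, ⟨p, -⟩, -, hnz, -⟩ := h
      rw [map_zero] at hnz
      have h0 : (1 : B) = 0 := (mul_left_mem_nonZeroDivisors_eq_zero_iff hnz).1 (zero_mul 1)
      exact absurd (p.asIdeal.eq_top_iff_one.2 (h0 ▸ p.asIdeal.zero_mem)) p.2.ne_top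

end

/-! ### The two charts over a chart that meets the centre -/

section

namespace SmoothFan

variable {N : Type} [AddCommGroup N] {β : Type} [DecidableEq β] {k : Type u} [Field k]
  {G : SmoothFan N β} {Z : Closeds (G.toricScheme k)} {X : Scheme.{u}} {π : X ⟶ G.toricScheme k}

theorem mem_toricDivisor_of_chart {R : Type u} [CommRing R] {S : G.cones}
    {j : Spec(R) ⟶ X} {θ : G.ChartRing k S.1 →+* R}
    (hj : j ≫ π = SpecMap(θ) ≫ G.chart k S) (b : β)
    (p : Spec(R)) :
    π (j p) ∈ G.toricDivisor k b ↔ b ∈ S.1 ∧ θ (G.coordFun k S b) ∈ p.asIdeal := by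
  have h1 : π (j p) = G.chart k S (SpecMap(θ) p) := by rw [← Hom.comp_apply, hj, Hom.comp_apply]
  rw [h1]
  exact mem_toricDivisor_chart S b _

theorem mem_preimage_diff_chart {R : Type u} [CommRing R] {S : G.cones}
    {j : Spec(R) ⟶ X} {θ : G.ChartRing k S.1 →+* R}
    (hj : j ≫ π = SpecMap(θ) ≫ G.chart k S) {e : R}
    (he : chartIdeal j ((vanishingIdeal Z).comap π) = span {e}) (b : β)
    (p : Spec(R)) :
    j p ∈ π ⁻¹' ((G.toricDivisor k b : Set (G.toricScheme k)) \ Z) ↔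
      (b ∈ S.1 ∧ θ (G.coordFun k S b) ∈ p.asIdeal) ∧ e ∉ p.asIdeal := by
  have h1 : π (j p) ∈ Z ↔ e ∈ p.asIdeal := by
    have h2 := mem_support_chart (j ≫ π) (vanishingIdeal Z) p
    rw [← chartIdeal_comap, he, span_singleton_le_iff_mem, Hom.comp_apply] at h2
    rw [← h2]
    exact (Set.ext_iff.1 (coe_support_vanishingIdeal Z) _).symm
  exact and_congr (mem_toricDivisor_of_chart hj b p) (not_congr h1)

/-- The strict transform of a toric divisor in an affine chart of the blow-up. -/
theorem chartIdeal_strictTransform {R : Type u} [CommRing R] {S : G.cones}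
    {j : Spec(R) ⟶ X} [IsOpenImmersion j] {θ : G.ChartRing k S.1 →+* R}
    (hj : j ≫ π = SpecMap(θ) ≫ G.chart k S) {e : R}
    (he : chartIdeal j ((vanishingIdeal Z).comap π) = span {e}) {b : β} {y : R}
    (hy : Prime y) (hye : ¬ y ∣ e)
    (h : ∀ p : Spec(R), e ∉ p.asIdeal →
      (y ∈ p.asIdeal ↔ b ∈ S.1 ∧ θ (G.coordFun k S b) ∈ p.asIdeal)) :
    I(j, strictTransform π Z (G.toricDivisor k b)) = span {y} := by
  refine chartIdeal_vanishingIdeal_closure j _ _ rfl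
    ((Ideal.span_singleton_prime hy.ne_zero).2 hy).isRadical e (fun z hz => ?_) fun p => ?_
  · rw [mem_span_singleton] at hz ⊢
    exact (hy.dvd_or_dvd hz).resolve_left hye
  · rw [mem_preimage_diff_chart hj he, span_singleton_le_iff_mem]
    constructor
    · exact fun h1 => ⟨(h p h1.2).2 h1.1, h1.2⟩
    · exact fun h1 => ⟨(h p h1.2).1 h1.1, h1.2⟩

theorem chartIdeal_strictTransform_eq_top {R : Type u} [CommRing R] {S : G.cones}
    {j : Spec(R) ⟶ X} [IsOpenImmersion j] {θ : G.ChartRing k S.1 →+* R}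
    (hj : j ≫ π = SpecMap(θ) ≫ G.chart k S) {e : R}
    (he : chartIdeal j ((vanishingIdeal Z).comap π) = span {e}) {b : β}
    (h : b ∈ S.1 → e ∣ θ (G.coordFun k S b) ∧ θ (G.coordFun k S b) ∣ e) :
    I(j, strictTransform π Z (G.toricDivisor k b)) = ⊤ := by
  refine chartIdeal_vanishingIdeal_closure j _ _ rfl (Ideal.radical_eq_iff.1 (Ideal.radical_top R)) 1 (fun z _ => trivial)
    fun p => ?_
  rw [mem_preimage_diff_chart hj he]
  constructor
  · rintro ⟨⟨h1, h2⟩, h3⟩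
    exact absurd (Ideal.mem_of_dvd _ (h h1).2 h2) h3
  · exact fun h1 => absurd h1.1 (not_top_le_asIdeal p)

/-- The part of the blow-up over an affine open set that does not meet the centre. -/
theorem exists_plain_chart (hπ : IsBlowup π (vanishingIdeal Z)) {R : Type u}
    [CommRing R] {S : G.cones} (θ : G.ChartRing k S.1 →+* R)
    [IsOpenImmersion (SpecMap(θ))]
    (hI : I(G.chart k S, Z).map θ = ⊤) :
    ∃ j : Spec(R) ⟶ X, IsOpenImmersion j ∧ j ≫ π = SpecMap(θ) ≫ G.chart k S ∧
      Set.range j = π ⁻¹' Set.range (SpecMap(θ) ≫ G.chart k S) ∧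
      chartIdeal j ((vanishingIdeal Z).comap π) = ⊤ ∧
      ∀ b, I(j, strictTransform π Z (G.toricDivisor k b)) =
        I(G.chart k S, G.toricDivisor k b).map θ := by
  have hI' := (chartIdeal_specMap θ (G.chart k S) (vanishingIdeal Z)).trans hI
  obtain ⟨j, hj, h1, h2⟩ := hπ.exists_chart_of_top _ hI'
  have he : chartIdeal j ((vanishingIdeal Z).comap π) = span {(1 : R)} := by
    rw [chartIdeal_comap, h1, hI', span_singleton_one]
  refine ⟨j, hj, h1, h2, he.trans span_singleton_one, fun b => ?_⟩
  rw [← chartIdeal_specMap]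
  have h3 := chartIdeal_vanishingIdeal (SpecMap(θ) ≫ G.chart k S) (G.toricDivisor k b)
  refine chartIdeal_vanishingIdeal_closure j _ _ rfl ?_ 1 (fun z hz => by rwa [one_mul] at hz)
    fun p => ?_
  · rw [h3]
    exact PrimeSpectrum.isRadical_vanishingIdeal _
  · have h4 := mem_support_chart (SpecMap(θ) ≫ G.chart k S) (vanishingIdeal (G.toricDivisor k b)) p
    rw [mem_preimage_diff_chart h1 he, ← mem_toricDivisor_of_chart h1, ← h4, ← Hom.comp_apply, h1]
    refine and_congr_left fun _ => ?_
    exact (Set.ext_iff.1 (coe_support_vanishingIdeal (G.toricDivisor k b)) _).symm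

variable {h : β} {hh : {h} ∈ G.cones} {a : β → ℤ} {ha : a h = 0}
  {g : AddMonoidAlgebra k (N →+ ℤ)} {S : G.cones} {m : N →+ ℤ} {f : G.ChartRing k S.1}
  (hE : G.IsCenterEquation h Z g S m f) (hm : ∀ b ∈ S.1, m (G.gen b) = a b)
  (hπ : IsBlowup π (vanishingIdeal Z))

local notation "G♯" => G.shear h hh a ha

include hE

theorem IsCenterEquation.ne_zero : f ≠ 0 := by
  rintro rfl
  exact hE.notMem {h} (singleton_subset_iff.2 hE.mem) (mem_singleton_self h) (Ideal.zero_mem _)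

theorem IsCenterEquation.shear_ne_zero {f' : (G.shear h hh a ha).ChartRing k S.1}
    (hf' : (G.shear h hh a ha).embed k S.1 f' = G.embed k S.1 f) : f' ≠ 0 := by
  rintro rfl
  rw [map_zero, eq_comm, map_eq_zero_iff _ (embed_injective _)] at hf'
  exact hE.ne_zero hf'

include hπ

include hm in
/-- The chart of the blow-up on which `f` generates the inverse image ideal is the affine toric
variety of the sheared cone. -/
theorem IsCenterEquation.exists_shear_chart : ∃ (f' : G♯.ChartRing k S.1)
    (j : Spec(G♯.ChartRing k S.1) ⟶ X),
    G♯.embed k S.1 f' = G.embed k S.1 f ∧ IsOpenImmersion j ∧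
    j ≫ π = Spec.map (ofHom (σ(hE, hm) f' : G.ChartRing k S.1 →+* _)) ≫ G.chart k S ∧
    Set.range j = generatorLocus π (vanishingIdeal Z) (G.chart k S) f ∧
    chartIdeal j ((vanishingIdeal Z).comap π) = span {f'} ∧
    ∀ b, I(j, strictTransform π Z (G.toricDivisor k b)) =
      if b ∈ S.1 then span {G♯.coordFun k (shearCone hh ha S hE.mem) b}
      else ⊤ := by
  obtain ⟨f', hf'⟩ := hE.exists_shear (hh := hh) (a := a) (ha := ha)
  have h0 := hE.shearHom_self hm hf'
  have hI : I(G.chart k S, Z) =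
      span {f, G.coordFun k S h} := by rw [hE.chartIdeal_eq, Set.pair_comm]
  obtain ⟨v, hv, hvx⟩ := hE.shearHom_coordFun_self (f' := f') hm (hh := hh) (ha := ha)
  obtain ⟨j, hj, h1, h2, h3⟩ := hπ.exists_chart (G.chart k S) hI
    (σ(hE, hm) f' : G.ChartRing k S.1 →+* _)
    (mem_nonZeroDivisors_of_ne_zero (by
      show σ(hE, hm) f' f ≠ 0
      rw [h0]
      exact hE.shear_ne_zero hf'))
    (by
      show σ(hE, hm) f' _ ∈ span {σ(hE, hm) f' f}
      rw [h0, hvx]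
      exact mem_span_singleton.2 (dvd_mul_right _ _))
    (fun B _ φ h4 h5 => hE.shear_universal hm hf' B φ h4 h5)
  have h3' : chartIdeal j ((vanishingIdeal Z).comap π) = span {f'} := by
    rw [h3]
    exact congrArg (fun z => span {z}) h0
  refine ⟨f', j, hf', hj, h1, h2, h3', fun b => ?_⟩
  split_ifs with hb
  · have hb' : b ∈ (shearCone hh ha S hE.mem).1 := hb
    refine chartIdeal_strictTransform h1 h3' (coordFun_prime hb') ?_ fun p hp => ?_
    · rw [← mem_span_singleton,
        ← orbitIdeal_singleton (S := shearCone hh ha S hE.mem) (singleton_subset_iff.2 hb')]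
      exact hE.shear_notMem hf' _
    · by_cases hbh : b = h
      · subst hbh
        refine (iff_of_eq ?_).trans (and_iff_right hb).symm
        show _ = (σ(hE, hm) f' (G.coordFun k S b) ∈ p.asIdeal)
        rw [hvx, p.2.mul_mem_iff_mem_or_mem, Ideal.unit_mul_mem_iff_mem _ hv, or_iff_right hp]
      · obtain ⟨w, hw, hwx⟩ := hE.shearHom_coordFun_of_ne (f' := f') hm (hh := hh) (ha := ha) hb hbh
        refine (iff_of_eq ?_).trans (and_iff_right hb).symm
        show _ = (σ(hE, hm) f' (G.coordFun k S b) ∈ p.asIdeal)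
        rw [hwx, Ideal.unit_mul_mem_iff_mem _ hw]
  · exact chartIdeal_strictTransform_eq_top h1 h3' fun h => absurd h hb

/-- The chart of the blow-up on which `x_h` generates the inverse image ideal. It does not meet the
strict transform of the divisor of `h`. -/
theorem IsCenterEquation.exists_ratio_chart :
    ∃ j : Spec(RatioRing (G.coordFun k S h) f) ⟶ X, IsOpenImmersion j ∧
    j ≫ π = SpecMap(ratioMap (G.coordFun k S h) f) ≫ G.chart k S ∧
    Set.range j = generatorLocus π (vanishingIdeal Z) (G.chart k S) (G.coordFun k S h) ∧
    chartIdeal j ((vanishingIdeal Z).comap π) =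
      span {ratioMap (G.coordFun k S h) f (G.coordFun k S h)} ∧
    ∀ b, I(j, strictTransform π Z (G.toricDivisor k b)) =
      if b ∈ S.1 ∧ b ≠ h then span {ratioMap (G.coordFun k S h) f (G.coordFun k S b)}
      else ⊤ := by
  have hx := G.coordFun_ne_zero (k := k) S h
  have hmr := ratioMap_mul_ratio (f := f) hx
  have hx' : ratioMap (G.coordFun k S h) f (G.coordFun k S h) ≠ 0 := by
    rwa [Ne, map_eq_zero_iff _ ratioMap_injective]
  obtain ⟨j, hj, h1, h2, h3⟩ := hπ.exists_chart (G.chart k S) hE.chartIdeal_eq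
    (ratioMap (G.coordFun k S h) f) (mem_nonZeroDivisors_of_ne_zero hx')
    (by
      rw [← hmr]
      exact mem_span_singleton.2 (dvd_mul_right _ _))
    (fun B _ φ h4 h5 => ratioMap_universal hx φ h4 h5)
  refine ⟨j, hj, h1, h2, h3, fun b => ?_⟩
  split_ifs with hb
  · obtain ⟨hb, hbh⟩ := hb
    have hsub : {h, b} ⊆ S.1 := by simp [Finset.insert_subset_iff, hE.mem, hb]
    have hsp : span {G.coordFun k S h, G.coordFun k S b} = G.orbitIdeal k hsub := by
      rw [orbitIdeal_eq_span]
      simp [Set.image_pair]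
    have h4 := ratioMap_prime (f := f) hx (coordFun_prime hb) (by
      rw [← mem_span_singleton, ← orbitIdeal_singleton (singleton_subset_iff.2 hb),
        coordFun_mem_orbitIdeal _ hE.mem, mem_singleton]
      exact hbh.symm) (by rw [hsp]; infer_instance)
      (by rw [hsp]; exact hE.notMem _ _ (mem_insert_self _ _))
    exact chartIdeal_strictTransform h1 h3 h4.1 h4.2 fun p _ => (and_iff_right hb).symm
  · refine chartIdeal_strictTransform_eq_top h1 h3 fun hbS => ?_
    have : b = h := by
      by_contra h5
      exact hb ⟨hbS, h5⟩
    subst this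
    exact ⟨dvd_rfl, dvd_rfl⟩

end SmoothFan

end

/-! ### Intersection numbers from linear relations -/

section

theorem mem_closeds_chart {X : Scheme.{u}} {R : Type u} [CommRing R] (j : Spec(R) ⟶ X)
    (D : Closeds X) (p : Spec(R)) :
    j p ∈ D ↔ I(j, D) ≤ p.asIdeal := by
  rw [← mem_support_chart]
  exact (Set.ext_iff.1 (coe_support_vanishingIdeal D) _).symm

theorem mem_stratum {X : Scheme.{u}} {A : Type} {D : A → Closeds X} {T : Finset A} {x : X} :
    x ∈ stratum D T ↔ ∀ b ∈ T, x ∈ D b :=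
  Set.mem_iInter₂

/-- A ring homomorphism that behaves like the localization at an element `g`: a homomorphism that
inverts `g` extends, and the kernel of the extension is generated by the kernel. -/
def IsAwayHom {A R : Type u} [CommRing A] [CommRing R] (φ : A →+* R) (g : A) : Prop :=
  ∀ (B : Type u) [CommRing B] (ρ : A →+* B), IsUnit (ρ g) →
    ∃ ρ' : R →+* B, ρ'.comp φ = ρ ∧ ker ρ' = (ker ρ).map φ

theorem isAwayHom_id {A : Type u} [CommRing A] (g : A) : IsAwayHom (RingHom.id A) g :=
  fun _ _ ρ _ => ⟨ρ, rfl, (Ideal.map_id _).symm⟩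

theorem isAwayHom_localization {A : Type u} [CommRing A] (g : A) :
    IsAwayHom (algebraMap A (Away g)) g := by
  intro B _ ρ hg
  refine ⟨IsLocalization.Away.lift g hg, RingHom.ext fun z => lift_eq g hg z, le_antisymm ?_ ?_⟩
  · intro z hz
    obtain ⟨N, w, hw⟩ := surj g z
    have hu : IsUnit (algebraMap A (Away g) g ^ N) := (algebraMap_isUnit g).pow N
    rw [← Ideal.mul_unit_mem_iff_mem _ hu, hw]
    refine mem_map_of_mem _ ?_
    rw [mem_ker] at hz ⊢
    rw [← lift_eq (S := Away g) g hg w, ← hw, map_mul, hz, zero_mul]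
  · rw [Ideal.map_le_iff_le_comap]
    intro z hz
    rw [Ideal.mem_comap, mem_ker, lift_eq]
    exact hz

namespace SmoothFan

open Polynomial

variable {N : Type} [AddCommGroup N] {β : Type} [DecidableEq β] {k : Type u} [Field k]
  {G : SmoothFan N β}

/-- The restriction of functions to the orbit closure of `T`, a line in the chart of `S`, with the
coordinate of the ray `a`. -/
def lineHom (k : Type u) [Field k] {S T : Finset β} (h : T ⊆ S) {a : β} (ha : a ∈ S) :
    G.ChartRing k S →ₐ[k] k[X] :=
  truncHom h
    { toFun := fun χ => X ^ (χ.toAdd.1 (G.gen a)).toNat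
      map_one' := by simp
      map_mul' := fun χ ψ => by
        rw [← pow_add, ← Int.toNat_add (χ.toAdd.2 a ha) (ψ.toAdd.2 a ha)]
        rfl }

theorem lineHom_single {S T : Finset β} (h : T ⊆ S) {a : β} (ha : a ∈ S) (χ : G.dualMonoid S)
    (c : k) : lineHom k h ha (single χ c) =
      if ∀ b ∈ T, χ.1 (G.gen b) = 0 then C c * X ^ (χ.1 (G.gen a)).toNat else 0 :=
  truncHom_single _ _ _ _

/-- The restriction of functions to the torus orbit of a cone `T` of codimension one, with the
coordinate given by a vector `v`. -/
def torusHom (G : SmoothFan N β) (k : Type u) [Field k] (T : Finset β) (v : N) :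
    G.ChartRing k T →ₐ[k] LaurentPolynomial k :=
  truncHom (subset_refl T)
    { toFun := fun χ => LaurentPolynomial.T (χ.toAdd.1 v)
      map_one' := by simp
      map_mul' := fun χ ψ => by
        rw [← T_add]
        rfl }

theorem torusHom_single (T : Finset β) (v : N) (χ : G.dualMonoid T) (c : k) :
    torusHom G k T v (single χ c) =
      if ∀ b ∈ T, χ.1 (G.gen b) = 0 then LaurentPolynomial.C c * LaurentPolynomial.T (χ.1 v)
      else 0 :=
  truncHom_single _ _ _ _

theorem mem_orbitIdeal_iff_faceProj {S T : Finset β} (h : T ⊆ S) (z : G.ChartRing k S) :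
    z ∈ G.orbitIdeal k h ↔ faceProj h z = 0 := Iff.rfl

theorem truncHom_faceProj {S T : Finset β} (h : T ⊆ S) {B : Type*} [CommRing B] [Algebra k B]
    (f : Multiplicative (G.dualMonoid S) →* B) (z : G.ChartRing k S) :
    truncHom h f (faceProj h z) = truncHom h f z := by
  apply eq_of_single z
  intro χ c
  rw [faceProj_single]
  split_ifs with h1
  · rfl
  · rw [map_zero, truncHom_single, if_neg h1]

section

variable {S T : G.cones} {a : β} (haT : a ∉ T.1) (hS : S.1 = insert a T.1)
  (hfull : ∀ χ : N →+ ℤ, (∀ b ∈ S.1, χ (G.gen b) = 0) → χ = 0)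

include haT hS

theorem coord_apply_of_extra {b : β} (hb : b ∈ T.1) : (G.coord S a).1 (G.gen b) = 0 :=
  coord_of_ne (hS ▸ mem_insert_of_mem hb) (by rintro rfl; exact haT hb)

include hfull

theorem eq_zsmul_coord {χ : N →+ ℤ} (hχ : ∀ b ∈ T.1, χ (G.gen b) = 0) :
    χ = χ (G.gen a) • (G.coord S a).1 := by
  rw [← sub_eq_zero]
  refine hfull _ fun b hb => ?_
  rw [AddMonoidHom.sub_apply, zsmul_apply]
  rw [hS] at hb
  rcases mem_insert.1 hb with rfl | hb
  · rw [coord_self (hS ▸ mem_insert_self _ _)]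
    simp
  · rw [hχ b hb, coord_apply_of_extra haT hS hb]
    simp

theorem lineHom_surjective_and_ker (h : T.1 ⊆ S.1) (ha : a ∈ S.1) :
    Function.Surjective (lineHom k (G := G) h ha) ∧
      ker (lineHom k (G := G) h ha : G.ChartRing k S.1 →+* k[X]) = G.orbitIdeal k h := by
  let σ : k[X] →ₐ[k] G.ChartRing k S.1 := aeval (single (G.coord S a) 1)
  have hσ : ∀ z, σ (lineHom k h ha z) = faceProj h z := by
    intro z
    apply eq_of_single z
    intro χ c
    rw [lineHom_single, faceProj_single]
    split_ifs with h1
    · rw [map_mul, map_pow, aeval_X, aeval_C, single_pow, one_pow]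
      show single 0 c * _ = _
      rw [single_mul_single, mul_one, zero_add]
      congr 1
      apply Subtype.ext
      show (χ.1 (G.gen a)).toNat • (G.coord S a).1 = χ.1
      rw [← natCast_zsmul, Int.toNat_of_nonneg (χ.2 a ha)]
      exact (eq_zsmul_coord haT hS hfull h1).symm
    · simp
  constructor
  · have h1 : (lineHom k h ha).comp σ = AlgHom.id k k[X] := by
      refine Polynomial.algHom_ext ?_
      rw [AlgHom.comp_apply, aeval_X, lineHom_single,
        if_pos fun b hb => coord_apply_of_extra haT hS hb]
      rw [show (G.coord S a).1 (G.gen a) = 1 from coord_self ha]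
      simp
    exact fun q => ⟨σ q, DFunLike.congr_fun h1 q⟩
  · ext z
    rw [mem_orbitIdeal_iff_faceProj]
    constructor
    · intro hz
      have hz' : lineHom k h ha z = 0 := hz
      rw [← hσ, hz', map_zero]
    · intro hz
      show lineHom k h ha z = 0
      have h1 : lineHom k h ha (faceProj h z) = lineHom k h ha z := truncHom_faceProj _ _ _
      rw [← h1, hz, map_zero]

theorem torusHom_surjective_and_ker (hTS : T.1 ⊆ S.1) (ha : a ∈ S.1) :
    Function.Surjective (torusHom G k T.1 (G.gen a)) ∧
      ker (torusHom G k T.1 (G.gen a) : G.ChartRing k T.1 →+* LaurentPolynomial k) =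
        G.orbitIdeal k (subset_refl T.1) := by
  have hmem : ∀ m : ℤ, m • (G.coord S a).1 ∈ G.dualMonoid T.1 := fun m b hb => by
    rw [zsmul_apply, coord_apply_of_extra haT hS hb, smul_zero]
  let e : ℤ →+ G.dualMonoid T.1 :=
    { toFun := fun m => ⟨_, hmem m⟩
      map_zero' := Subtype.ext (zero_smul _ _)
      map_add' := fun _ _ => Subtype.ext (add_smul _ _ _) }
  let σ : LaurentPolynomial k →+* G.ChartRing k T.1 := mapDomainRingHom k e
  have hσ1 : ∀ m c, σ (LaurentPolynomial.C c * LaurentPolynomial.T m) =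
      single (e m) c := fun m c => by
    rw [← single_eq_C_mul_T]
    exact AddMonoidAlgebra.mapDomain_single
  have hσ : ∀ z, σ (torusHom G k T.1 (G.gen a) z) = faceProj (subset_refl T.1) z := by
    intro z
    apply eq_of_single z
    intro χ c
    rw [torusHom_single, faceProj_single]
    split_ifs with h1
    · rw [hσ1]
      congr 1
      exact Subtype.ext (eq_zsmul_coord haT hS hfull h1).symm
    · simp
  constructor
  · intro q
    refine ⟨σ q, ?_⟩
    induction q using LaurentPolynomial.induction_on' with
    | add p q hp hq => rw [map_add, map_add, hp, hq]
    | C_mul_T m c =>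
      rw [hσ1, torusHom_single, if_pos fun b hb => by
        show (m • (G.coord S a).1) _ = 0
        rw [zsmul_apply, coord_apply_of_extra haT hS hb, smul_zero]]
      congr 2
      show (m • (G.coord S a).1) _ = m
      rw [zsmul_apply, coord_self ha, smul_eq_mul, mul_one]
  · ext z
    rw [mem_orbitIdeal_iff_faceProj]
    constructor
    · intro hz
      have hz' : torusHom G k T.1 (G.gen a) z = 0 := hz
      rw [← hσ, hz', map_zero]
    · intro hz
      show torusHom G k T.1 (G.gen a) z = 0
      have h1 : torusHom G k T.1 (G.gen a) (faceProj (subset_refl T.1) z) =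
          torusHom G k T.1 (G.gen a) z := truncHom_faceProj _ _ _
      rw [← h1, hz, map_zero]

end

/-- The orbit closure of `T` in a localization of the chart of `S`. -/
theorem chartIdeal_stratum_of_away {X : Scheme.{u}} {D : β → Closeds X} {S T : G.cones}
    (h : T.1 ⊆ S.1) {R B : Type u} [CommRing R] [CommRing B] [IsDomain B]
    {j : Spec(R) ⟶ X} [IsOpenImmersion j] {φ : G.ChartRing k S.1 →+* R}
    (hD : ∀ b ∈ T.1, I(j, D b) = span {φ (G.coordFun k S b)})
    {ρ : R →+* B} (hρ : ker ρ = (G.orbitIdeal k h).map φ) :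
    ker ρ = I(j, stratum D T.1) := by
  refine (chartIdeal_vanishingIdeal_eq j _ (RingHom.ker_isPrime ρ).isRadical fun p => ?_).symm
  rw [mem_stratum, hρ, orbitIdeal_eq_span, map_span, span_le]
  constructor
  · rintro h1 _ ⟨_, ⟨b, hb, rfl⟩, rfl⟩
    have h2 := (mem_closeds_chart j _ p).1 (h1 b hb)
    rwa [hD b hb, span_singleton_le_iff_mem] at h2
  · intro h1 b hb
    rw [mem_closeds_chart, hD b hb, span_singleton_le_iff_mem]
    exact h1 ⟨_, ⟨b, hb, rfl⟩, rfl⟩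

theorem isUnit_of_sub_mem_orbitIdeal {S T : Finset β} (h : T ⊆ S) {B : Type*} [CommRing B]
    [Algebra k B] (ρ : G.ChartRing k S →ₐ[k] B)
    (hρ : ker (ρ : G.ChartRing k S →+* B) = G.orbitIdeal k h) {g : G.ChartRing k S} {c : k}
    (hc : c ≠ 0) (hg : g - algebraMap k _ c ∈ G.orbitIdeal k h) : IsUnit (ρ g) := by
  rw [← hρ, mem_ker, map_sub, sub_eq_zero] at hg
  have h1 : ρ g = algebraMap k B c := by
    refine Eq.trans hg ?_
    exact ρ.commutes c
  rw [h1]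
  exact (isUnit_iff_ne_zero.2 hc).map _

/-- Let `C` be the stratum of a cone `T` of codimension one, and suppose that neighbourhoods of `C`
are open parts of the affine toric varieties of the two maximal cones `S`, `S'` containing `T`. Then
the intersection numbers with `C` are the coefficients of the relation between the generators of
`S ∪ S'`. -/
theorem intersectionNumber_eq_of_relation {X : Scheme.{u}} {f : X ⟶ Spec(k)}
    {D : β → Closeds X} {S S' T : G.cones} {a a' : β} (ha : a ∉ T.1) (ha' : a' ∉ T.1)
    (hS : S.1 = insert a T.1) (hS' : S'.1 = insert a' T.1)
    (hfull : ∀ χ : N →+ ℤ, (∀ b ∈ S.1, χ (G.gen b) = 0) → χ = 0)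
    {d : β → ℤ} (hd : G.gen a + G.gen a' + ∑ b ∈ T.1, d b • G.gen b = 0)
    (hT : T ≤ S) (hT' : T ≤ S') {R R' Rw : Type u} [CommRing R] [CommRing R'] [CommRing Rw]
    {φ : G.ChartRing k S.1 →+* R} {φ' : G.ChartRing k S'.1 →+* R'} {φw : G.ChartRing k T.1 →+* Rw}
    {g : G.ChartRing k S.1} {g' : G.ChartRing k S'.1} {gw : G.ChartRing k T.1}
    (hφ : IsAwayHom φ g) (hφ' : IsAwayHom φ' g') (hφw : IsAwayHom φw gw)
    {c c' cw : k} (hc : c ≠ 0) (hc' : c' ≠ 0) (hcw : cw ≠ 0)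
    (hg : g - algebraMap k _ c ∈ G.orbitIdeal k hT)
    (hg' : g' - algebraMap k _ c' ∈ G.orbitIdeal k hT')
    (hgw : gw - algebraMap k _ cw ∈ G.orbitIdeal k (subset_refl T.1))
    (hnz : ∀ χ, φw (single χ 1) ∈ nonZeroDivisors Rw)
    {j : Spec(R) ⟶ X} {j' : Spec(R') ⟶ X}
    {jw : Spec(Rw) ⟶ X} [IsOpenImmersion j] [IsOpenImmersion j']
    [IsOpenImmersion jw] {α : R →+* Rw} {α' : R' →+* Rw}
    (hα : SpecMap(α) ≫ j = jw)
    (hα' : SpecMap(α') ≫ j' = jw)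
    (hαφ : ∀ z, α (φ z) = φw (G.restr k hT z)) (hαφ' : ∀ z, α' (φ' z) = φw (G.restr k hT' z))
    (hα_ext : ∀ (B : Type u) [CommRing B] (γ γ' : R →+* B), γ.comp φ = γ'.comp φ → γ = γ')
    (hα_ext' : ∀ (B : Type u) [CommRing B] (γ γ' : R' →+* B), γ.comp φ' = γ'.comp φ' → γ = γ')
    (hD : ∀ b ∈ T.1, I(j, D b) = span {φ (G.coordFun k S b)})
    (hD' : ∀ b ∈ T.1, I(j', D b) = span {φ' (G.coordFun k S' b)})
    (hDw : ∀ b ∈ T.1, I(jw, D b) = span {φw (G.coordFun k T b)})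
    (hf : j ≫ f = SpecMap(φ.comp (algebraMap k _)))
    (hf' : j' ≫ f = SpecMap(φ'.comp (algebraMap k _)))
    (hcov : (stratum D T.1 : Set X) ⊆ Set.range j ∪ Set.range j')
    (hinter : (stratum D T.1 : Set X) ∩ (Set.range j ∩ Set.range j') ⊆ Set.range jw)
    {b : β} (hb : b ∈ T.1) (hex : ∃ e, HasIntersectionNumber f (D b) (stratum D T.1) e) :
    intersectionNumber f (D b) (stratum D T.1) = d b := by
  have haS : a ∈ S.1 := hS ▸ mem_insert_self _ _
  have haS' : a' ∈ S'.1 := hS' ▸ mem_insert_self _ _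
  have hrel : ∀ χ : N →+ ℤ, χ (G.gen a') = -χ (G.gen a) - ∑ b ∈ T.1, d b * χ (G.gen b) := by
    intro χ
    have := congrArg χ hd
    simp only [map_add, map_sum, map_zsmul, map_zero, smul_eq_mul] at this
    linarith
  have hrel0 : ∀ χ : N →+ ℤ, (∀ b ∈ T.1, χ (G.gen b) = 0) → χ (G.gen a') = -χ (G.gen a) := by
    intro χ hχ
    rw [hrel, sum_eq_zero fun b hb => by rw [hχ b hb, mul_zero], sub_zero]
  have hfull' : ∀ χ : N →+ ℤ, (∀ b ∈ S'.1, χ (G.gen b) = 0) → χ = 0 := by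
    intro χ hχ
    have h1 : ∀ b ∈ T.1, χ (G.gen b) = 0 := fun b hb => hχ b (hT' hb)
    refine hfull χ fun b hb => ?_
    rw [hS] at hb
    rcases mem_insert.1 hb with rfl | hb
    · have := hrel0 χ h1
      rw [hχ a' haS'] at this
      linarith
    · exact h1 b hb
  obtain ⟨hs, hk⟩ := lineHom_surjective_and_ker (k := k) ha hS hfull hT haS
  obtain ⟨hs', hk'⟩ := lineHom_surjective_and_ker (k := k) ha' hS' hfull' hT' haS'
  obtain ⟨hsw, hkw⟩ := torusHom_surjective_and_ker (k := k) ha hS hfull hT haS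
  have u₀ := isUnit_of_sub_mem_orbitIdeal hT _ hk hc hg
  have u₁ := isUnit_of_sub_mem_orbitIdeal hT' _ hk' hc' hg'
  have uw := isUnit_of_sub_mem_orbitIdeal (subset_refl T.1) _ hkw hcw hgw
  obtain ⟨ρ, hρ, hρk⟩ := hφ k[X] (lineHom k hT haS).toRingHom u₀
  obtain ⟨ρ', hρ', hρk'⟩ := hφ' k[X] (lineHom k hT' haS').toRingHom u₁
  obtain ⟨ρw, hρw, hρkw⟩ := hφw (LaurentPolynomial k) (torusHom G k T.1 (G.gen a)).toRingHom uw
  have e : ∀ z, ρ (φ z) = lineHom k hT haS z := fun z => RingHom.congr_fun hρ z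
  have e' : ∀ z, ρ' (φ' z) = lineHom k hT' haS' z := fun z => RingHom.congr_fun hρ' z
  have ew : ∀ z, ρw (φw z) = torusHom G k T.1 (G.gen a) z := fun z => RingHom.congr_fun hρw z
  replace hρk := hρk.trans (congrArg (Ideal.map φ) hk)
  replace hρk' := hρk'.trans (congrArg (Ideal.map φ') hk')
  replace hρkw := hρkw.trans (congrArg (Ideal.map φw) hkw)
  have hcomp : ρw.comp α = (toLaurent (R := k)).comp ρ := by
    refine hα_ext _ _ _ (RingHom.ext fun z => ?_)
    show ρw (α (φ z)) = toLaurent (ρ (φ z))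
    rw [hαφ, ew, e]
    apply eq_of_single z
    intro χ r
    rw [restr_single, torusHom_single, lineHom_single]
    have h1 : ∀ v, (AddSubmonoid.inclusion (G.dualMonoid_anti hT) χ).1 v = χ.1 v := fun _ => rfl
    simp only [h1]
    split_ifs with h2
    · rw [Polynomial.toLaurent_C_mul_X_pow, Int.toNat_of_nonneg (χ.2 a haS)]
    · rw [map_zero]
  have hcomp' : ρw.comp α' = (invert (R := k) :
      LaurentPolynomial k →+* LaurentPolynomial k).comp ((toLaurent (R := k)).comp ρ') := by
    refine hα_ext' _ _ _ (RingHom.ext fun z => ?_)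
    show ρw (α' (φ' z)) = invert (toLaurent (ρ' (φ' z)))
    rw [hαφ', ew, e']
    apply eq_of_single z
    intro χ r
    rw [restr_single, torusHom_single, lineHom_single]
    have h1 : ∀ v, (AddSubmonoid.inclusion (G.dualMonoid_anti hT') χ).1 v = χ.1 v := fun _ => rfl
    simp only [h1]
    split_ifs with h2
    · rw [Polynomial.toLaurent_C_mul_X_pow, Int.toNat_of_nonneg (χ.2 a' haS'), map_mul,
        LaurentPolynomial.invert_C, LaurentPolynomial.invert_T, hrel0 χ.1 h2, neg_neg]
    · rw [map_zero, map_zero]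
  let c₀ : ProjectiveLineCharts f (stratum D T.1) :=
    { R₀ := R, R₁ := R', Rw := Rw, j₀ := j, j₁ := j', jw := jw, α₀ := α, α₁ := α'
      specMap_α₀ := hα
      specMap_α₁ := hα'
      ρ₀ := ρ, ρ₁ := ρ', ρw := ρw
      surj₀ := fun q => by
        obtain ⟨z, hz⟩ := hs q
        exact ⟨φ z, (e z).trans hz⟩
      surj₁ := fun q => by
        obtain ⟨z, hz⟩ := hs' q
        exact ⟨φ' z, (e' z).trans hz⟩
      surjw := fun q => by
        obtain ⟨z, hz⟩ := hsw q
        exact ⟨φw z, (ew z).trans hz⟩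
      ρw_α₀ := fun z => RingHom.congr_fun hcomp z
      ρw_α₁ := fun z => RingHom.congr_fun hcomp' z
      ker₀ := chartIdeal_stratum_of_away hT hD hρk
      ker₁ := chartIdeal_stratum_of_away hT' hD' hρk'
      kerw := chartIdeal_stratum_of_away (subset_refl T.1) hDw hρkw
      κ₀ := φ.comp (algebraMap k _)
      κ₁ := φ'.comp (algebraMap k _)
      specMap_κ₀ := hf
      specMap_κ₁ := hf'
      ρ₀_κ₀ := fun r => (e _).trans ((lineHom k hT haS).commutes r)
      ρ₁_κ₁ := fun r => (e' _).trans ((lineHom k hT' haS').commutes r)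
      cover := hcov
      inter := hinter }
  -- the quotient of the two equations of `D_b`
  have hzero : ∀ t ∈ T.1, ((G.coord S' b).1 - (G.coord S b).1) (G.gen t) = 0 := fun t ht => by
    rw [AddMonoidHom.sub_apply]
    by_cases htb : t = b
    · subst htb
      rw [coord_self (hT ht), coord_self (hT' ht), sub_self]
    · rw [coord_of_ne (hT ht) htb, coord_of_ne (hT' ht) htb, sub_self]
  have hmem : (G.coord S' b).1 - (G.coord S b).1 ∈ G.dualMonoid T.1 := fun t ht => (hzero t ht).ge
  have hab : a ≠ b := by rintro rfl; exact ha hb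
  have hab' : a' ≠ b := by rintro rfl; exact ha' hb
  have hu : α' (φ' (G.coordFun k S' b)) = φw (single ⟨_, hmem⟩ 1) * α (φ (G.coordFun k S b)) := by
    rw [hαφ, hαφ', coordFun, coordFun, restr_single, restr_single, ← map_mul,
      single_mul_single, one_mul]
    congr 2
    apply Subtype.ext
    exact (sub_add_cancel _ _).symm
  have he : ρw (φw (single ⟨_, hmem⟩ 1)) = LaurentPolynomial.T (-d b) := by
    rw [ew, torusHom_single, if_pos hzero, map_one, one_mul]
    congr 1
    show (G.coord S' b).1 (G.gen a) - (G.coord S b).1 (G.gen a) = -d b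
    have h1 := hrel (G.coord S' b).1
    rw [coord_of_ne haS' hab', sum_eq_single b] at h1
    · rw [coord_self (hT' hb), mul_one] at h1
      rw [coord_of_ne haS hab]
      linarith
    · intro t ht htb
      rw [coord_of_ne (hT' ht) htb, mul_zero]
    · exact fun h => absurd hb h
  have h1 := c₀.intersectionNumber_eq (D := D b) (x₀ := φ (G.coordFun k S b))
    (x₁ := φ' (G.coordFun k S' b)) (hD b hb) (hD' b hb)
    (by
      show α (φ (G.coordFun k S b)) ∈ nonZeroDivisors Rw
      rw [hαφ, coordFun, restr_single]
      exact hnz _) hu he hex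
  rw [h1, neg_neg]

section

variable {N : Type} [AddCommGroup N] {β : Type} [DecidableEq β] {k : Type u} [Field k]
  {G : SmoothFan N β} {h : β} {hh : {h} ∈ G.cones} {a : β → ℤ} {ha : a h = 0}
  {Z : Closeds (G.toricScheme k)} {g : AddMonoidAlgebra k (N →+ ℤ)}

theorem IsCenterEquation.embed_shearHom {S : G.cones} {m : N →+ ℤ} {f : G.ChartRing k S.1}
    (hE : G.IsCenterEquation h Z g S m f) (hm : ∀ b ∈ S.1, m (G.gen b) = a b)
    {f' : (G.shear h hh a ha).ChartRing k S.1}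
    (hf' : (G.shear h hh a ha).embed k S.1 f' = G.embed k S.1 f) (χ : G.dualMonoid S.1) (c : k) :
    (G.shear h hh a ha).embed k S.1 (σ(hE, hm) f' (single χ c)) =
      g ^ (χ.1 (G.gen h)).toNat * single χ.1 c := by
  rw [shearHom_single, map_mul, map_pow, hf', hE.embed_eq, embed_single, mul_pow,
    single_pow, one_pow, mul_assoc, single_mul_single, one_mul]
  congr 2
  rw [← natCast_zsmul, Int.toNat_of_nonneg (χ.2 h hE.mem)]
  exact add_sub_cancel _ _

/-- The charts of the blow-up for the cones that contain `h` are compatible: the homomorphism of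
coordinate rings multiplies a character `χ` by `g ^ χ(m_h)`, independently of the cone. -/
theorem IsCenterEquation.restr_shearHom {S T : G.cones} (hTS : T ≤ S) {m m' : N →+ ℤ}
    {f : G.ChartRing k S.1} (hE : G.IsCenterEquation h Z g S m f)
    (hm : ∀ b ∈ S.1, m (G.gen b) = a b) {f' : (G.shear h hh a ha).ChartRing k S.1}
    (hf' : (G.shear h hh a ha).embed k S.1 f' = G.embed k S.1 f)
    {f₁ : G.ChartRing k T.1} (hE₁ : G.IsCenterEquation h Z g T m' f₁)
    (hm₁ : ∀ b ∈ T.1, m' (G.gen b) = a b) {f₁' : (G.shear h hh a ha).ChartRing k T.1}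
    (hf₁' : (G.shear h hh a ha).embed k T.1 f₁' = G.embed k T.1 f₁) (z : G.ChartRing k S.1) :
    (G.shear h hh a ha).restr k hTS (σ(hE, hm) f' z) = σ(hE₁, hm₁) f₁' (G.restr k hTS z) := by
  apply embed_injective
  rw [embed_restr]
  apply eq_of_single z
  intro χ c
  rw [hE.embed_shearHom hm hf', restr_single, hE₁.embed_shearHom hm₁ hf₁']
  rfl

end

end SmoothFan

end

/-! ### The divisors of the second blow-up -/

section

open TildeRay SmoothFan

variable {ι : Type} [DecidableEq ι] {k : Type u} [Field k]
  {n : ℕ} {F : SmoothFan (Fin n → ℤ) ι} {s : ℕ} {P : Fin s → ι}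
  {J : ∀ i, (F.divisorScheme k (P i)).IdealSheafData} {X : Scheme.{u}}
  {π : X ⟶ (tildeFan F P).toricScheme k}

local notation "F̃" => tildeFan F P
local notation "C̃" => tildeCenter F P k J
local notation "D̃" => tildeDivisor F P k J π
local notation "ℓ(" i ")" => TildeRay.horizontal (P i)

variable (J π) in
/-- The exceptional divisor over the strict transform of `H_i × 𝔸¹`, if `b` is the ray of `(m_i, 0)`;
the empty divisor for the other rays. It is the difference between the inverse image and the strict
transform of the toric divisor of `b`. -/
def exceptionalIdeal (b : TildeRay ι s) : X.IdealSheafData :=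
  ∏ i with ℓ(i) = b, (vanishingIdeal (tildeHypersurface F P k J i)).comap π

variable (J π) in
/-- An affine chart of the second blow-up over the chart of the cone `S`, on which the exceptional
divisors are principal. -/
structure IsDivisorChart (S : F̃.cones) {R : Type u} [CommRing R]
    (j : Spec(R) ⟶ X) (θ : F̃.ChartRing k S.1 →+* R) : Prop where
  isDomain : IsDomain R
  isOpenImmersion : IsOpenImmersion j
  comp : j ≫ π = SpecMap(θ) ≫ F̃.chart k S
  ne_zero : ∀ χ, θ (single χ 1) ≠ 0
  exists_generator : ∀ b, ∃ e, e ≠ 0 ∧ chartIdeal j (exceptionalIdeal J π b) = span {e}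
  mul_eq : ∀ b, I(j, D̃ b) *
    chartIdeal j (exceptionalIdeal J π b) = I(F̃.chart k S, F̃.toricDivisor k b).map θ

theorem twist_self [Fintype ι] (a : Fin s → ι → ℤ) (i : Fin s) : twist F P a i ℓ(i) = 0 := by
  have : P i ∉ F.link (P i) := by simp [link]
  simp [twist, this]

theorem horizontal_singleton_mem {S : F̃.cones} {b : TildeRay ι s} (h : b ∈ S.1) : {b} ∈ F̃.cones :=
  F̃.down_closed S.2 (singleton_subset_iff.2 h)

section

variable (hP' : SeparatedRays F P)
include hP'

theorem eq_of_horizontal_mem {S : F̃.cones} {i i' : Fin s}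
    (hi : ℓ(i) ∈ S.1) (hi' : horizontal (P i') ∈ S.1) : i = i' :=
  eq_of_exceptional_mem hP' S (horizontal_mem_base P hi) (horizontal_mem_base P hi')

variable {S : (tildeFan F P).cones} (hS : IsAdmissible P S.1) {R : Type u} [CommRing R]
  {j : Spec(R) ⟶ X} [IsOpenImmersion j]
  {θ : (tildeFan F P).ChartRing k S.1 →+* R}
  (hj : j ≫ π = SpecMap(θ) ≫ (tildeFan F P).chart k S)

include hS hj

theorem chartIdeal_exceptionalIdeal_eq_top {b : TildeRay ι s} (hb : ∀ i, ℓ(i) = b → b ∉ S.1) :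
    chartIdeal j (exceptionalIdeal J π b) = ⊤ := by
  rw [exceptionalIdeal, chartIdeal_prod, ← Ideal.one_eq_top]
  refine Finset.prod_eq_one fun i hi => ?_
  have hib := (mem_filter.1 hi).2
  rw [chartIdeal_comap, hj, chartIdeal_specMap,
    chartIdeal_tildeHypersurface_of_notMem hP' hS (by rw [hib]; exact hb i hib), Ideal.map_top]
  exact Ideal.one_eq_top.symm

theorem chartIdeal_exceptionalIdeal {i : Fin s} (hi : ℓ(i) ∈ S.1) :
    chartIdeal j (exceptionalIdeal J π ℓ(i)) = I(F̃.chart k S, tildeHypersurface F P k J i).map θ := by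
  rw [exceptionalIdeal, chartIdeal_prod, Finset.prod_eq_single i, chartIdeal_comap, hj,
    chartIdeal_specMap]
  · intro i' hi' hne
    have h1 : horizontal (P i') = ℓ(i) := (mem_filter.1 hi').2
    exact absurd (eq_of_horizontal_mem hP' (h1 ▸ hi) hi) hne
  · intro h
    simp at h

theorem isDivisorChart_of_mem [IsDomain R]
    (hne : ∀ χ, θ (single χ 1) ≠ 0) {i : Fin s} (hi : ℓ(i) ∈ S.1)
    {e : R} (he : e ≠ 0)
    (hexc : chartIdeal j (exceptionalIdeal J π ℓ(i)) = span {e})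
    (hself : I(j, D̃ ℓ(i)) * span {e} = span {θ (F̃.coordFun k S ℓ(i))})
    (hmem : ∀ b ∈ S.1, b ≠ ℓ(i) → I(j, D̃ b) = span {θ (F̃.coordFun k S b)})
    (hnot : ∀ b ∉ S.1, I(j, D̃ b) = ⊤) :
    IsDivisorChart J π S j θ := by
  have h6 : ∀ b, b ≠ ℓ(i) → chartIdeal j (exceptionalIdeal J π b) = ⊤ := by
    refine fun b hb => chartIdeal_exceptionalIdeal_eq_top hP' hS hj ?_
    rintro i' rfl hi'
    exact hb (congrArg (fun i => ℓ(i)) (eq_of_horizontal_mem hP' hi' hi))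
  refine ⟨inferInstance, inferInstance, hj, hne, fun b => ?_, fun b => ?_⟩
  · by_cases hb : b = ℓ(i)
    · exact ⟨e, he, hb ▸ hexc⟩
    · exact ⟨1, one_ne_zero, by rw [h6 b hb, span_singleton_one]⟩
  · by_cases hbi : b = ℓ(i)
    · subst hbi
      rw [chartIdeal_toricDivisor_of_mem hi, map_span, Set.image_singleton, hexc, hself]
    · rw [h6 b hbi, Ideal.mul_top]
      by_cases hb : b ∈ S.1
      · rw [chartIdeal_toricDivisor_of_mem hb, map_span, Set.image_singleton, hmem b hb hbi]
      · rw [chartIdeal_toricDivisor_of_notMem hb, Ideal.map_top, hnot b hb]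

end

theorem tildeDivisor_subset {x : X} {b : TildeRay ι s} (hx : x ∈ D̃ b) :
    π x ∈ F̃.toricDivisor k b := by
  have h1 : (D̃ b : Set X) ⊆ π ⁻¹' F̃.toricDivisor k b :=
    closure_minimal (fun y hy => hy.1) ((F̃.toricDivisor k b).isClosed.preimage π.continuous)
  exact h1 hx

theorem stratum_tildeDivisor_subset {x : X} {T : Finset (TildeRay ι s)} (hx : x ∈ stratum D̃ T) :
    π x ∈ stratum (F̃.toricDivisor k) T :=
  mem_stratum.2 fun b hb => tildeDivisor_subset (mem_stratum.1 hx b hb)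

section Cover

variable {S S' T : (tildeFan F P).cones}

/-- A stratum lies over the charts of the cones that contain it. -/
theorem stratum_subset_of_extra (hW : ∀ W : F̃.cones, T ≤ W → W ≤ S ∨ W ≤ S') :
    (stratum D̃ T.1 : Set X) ⊆
      π ⁻¹' Set.range (F̃.chart k S) ∪ π ⁻¹' Set.range (F̃.chart k S') := by
  intro x hx
  obtain ⟨W, p, hp⟩ := chart_cover F̃ k (π x)
  have h1 := stratum_tildeDivisor_subset hx
  rw [← hp, mem_stratum_chart] at h1
  rcases hW W h1.1 with h2 | h2
  · exact Or.inl (range_chart_mono h2 ⟨p, hp⟩)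
  · exact Or.inr (range_chart_mono h2 ⟨p, hp⟩)

theorem mem_range_chart_of_inter (hST : S.1 ∩ S'.1 = T.1) {y : F̃.toricScheme k}
    (h : y ∈ Set.range (F̃.chart k S)) (h' : y ∈ Set.range (F̃.chart k S')) :
    y ∈ Set.range (F̃.chart k T) := by
  have h1 := (range_chart_inter (k := k) S S').le ⟨h, h'⟩
  have h2 : F̃.interCone S S' = T := Subtype.ext hST
  rwa [h2] at h1

end Cover

theorem mem_range_of_comp {R : Type u} [CommRing R] {S : F̃.cones}
    {j : Spec(R) ⟶ X} {θ : F̃.ChartRing k S.1 →+* R}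
    (hj : j ≫ π = SpecMap(θ) ≫ F̃.chart k S) {x : X}
    (hx : x ∈ Set.range j) : π x ∈ Set.range (F̃.chart k S) := by
  obtain ⟨p, rfl⟩ := hx
  rw [← Hom.comp_apply, hj, Hom.comp_apply]
  exact ⟨_, rfl⟩

theorem comp_toSpec {R : Type u} [CommRing R] {S : F̃.cones}
    {j : Spec(R) ⟶ X} {θ : F̃.ChartRing k S.1 →+* R}
    (hj : j ≫ π = SpecMap(θ) ≫ F̃.chart k S) :
    j ≫ π ≫ F̃.toSpec k = SpecMap(θ.comp (algebraMap k _)) := by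
  rw [← assoc, hj, assoc, chart_toSpec, ← Spec.map_comp, ← ofHom_comp]

/-- A chart of the blow-up away from the centre, in which a curve lies that does not meet the
centre. -/
theorem exists_away_chart (hπ : IsBlowup π (vanishingIdeal C̃))
    {W T : F̃.cones} (hTW : T ≤ W) {g : F̃.ChartRing k W.1} {r : k}
    (hr : r ≠ 0) (hg : g - algebraMap k _ r ∈ F̃.orbitIdeal k hTW)
    (hgI : g ∈ I(F̃.chart k W, C̃)) :
    ∃ j : Spec(Away g) ⟶ X, IsOpenImmersion j ∧
      (∀ x ∈ stratum D̃ T.1, π x ∈ Set.range (F̃.chart k W) → x ∈ Set.range j) ∧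
      chartIdeal j ((vanishingIdeal C̃).comap π) = ⊤ ∧
      (∀ b ∈ T.1, I(j, D̃ b) = span {algebraMap _ (Away g) (F̃.coordFun k W b)}) ∧
      j ≫ π = SpecMap(algebraMap _ (Away g)) ≫ F̃.chart k W := by
  have hop : IsOpenImmersion (SpecMap(algebraMap _ (Away g))) := IsOpenImmersion.of_isLocalization g
  obtain ⟨j, hj, e1, e2, e3, e4⟩ := exists_plain_chart hπ (algebraMap _ (Away g))
    (Ideal.eq_top_of_isUnit_mem _ (mem_map_of_mem _ hgI) (algebraMap_isUnit g))
  refine ⟨j, hj, fun x hx hxW => ?_, e3, fun b hb => ?_, e1⟩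
  · obtain ⟨p, hp⟩ := hxW
    have h1 := stratum_tildeDivisor_subset hx
    rw [← hp, mem_stratum_chart] at h1
    obtain ⟨_, h1⟩ := h1
    have h2 : g ∉ p.asIdeal := fun hgp => by
      have h3 : algebraMap k _ r ∈ p.asIdeal := by
        have := p.asIdeal.sub_mem hgp (h1 hg)
        rwa [sub_sub_cancel] at this
      exact p.2.ne_top (Ideal.eq_top_of_isUnit_mem _ h3 ((isUnit_iff_ne_zero.2 hr).map _))
    have h3 : p ∈ Set.range (PrimeSpectrum.comap (algebraMap _ (Away g))) := by
      rw [PrimeSpectrum.localization_away_comap_range (Away g) g]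
      exact h2
    obtain ⟨q, hq⟩ := h3
    rw [e2]
    refine ⟨q, ?_⟩
    have h6 : SpecMap(algebraMap _ (Away g)) q = p := hq
    refine (Hom.comp_apply (Spec.map (ofHom (algebraMap _ (Away g)))) (F̃.chart k W) q).trans ?_
    exact (congrArg (F̃.chart k W) h6).trans hp
  · have h5 := e4 b
    rw [chartIdeal_toricDivisor_of_mem (hTW hb), map_span, Set.image_singleton] at h5
    exact h5

variable [Fintype ι] (hP' : SeparatedRays F P)
  {a : Fin s → ι → ℤ} {g : ∀ _ : Fin s, AddMonoidAlgebra k ((Fin n → ℤ) →+ ℤ)}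
  (hg : ∀ i, F.IsEquation (P i) (hypersurfaceSet J i) (a i) (g i))

include hP' hg

/-- A function that vanishes on the centre and is a nonzero constant on the curve of `T`. -/
theorem exists_const_mod {W T : F̃.cones} (hW : IsAdmissible P W.1) {c : TildeRay ι s}
    (hWT : W.1 = insert c T.1) (hT : ∀ i, ℓ(i) ∉ T.1) (hTW : T ≤ W)
    (hfull : ∀ χ : (Fin n → ℤ) × ℤ →+ ℤ, (∀ b ∈ W.1, χ (F̃.gen b) = 0) → χ = 0) :
    ∃ (f : F̃.ChartRing k W.1) (r : k), r ≠ 0 ∧ f - algebraMap k _ r ∈ F̃.orbitIdeal k hTW ∧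
      f ∈ I(F̃.chart k W, C̃) := by
  by_cases h : ∃ i, ℓ(i) ∈ W.1
  · obtain ⟨i, hi⟩ := h
    obtain ⟨m, f, hE, -, -⟩ := exists_isCenterEquation hP' hg hW hi
    have hc : c = ℓ(i) := by
      rw [hWT] at hi
      exact ((mem_insert.1 hi).resolve_right (hT i)).symm
    have hzero : ∀ χ : F̃.dualMonoid W.1, f.coeff χ ≠ 0 →
        (∀ b ∈ T.1, χ.1 (F̃.gen b) = 0) → χ = 0 := by
      intro χ hχ hT0
      refine Subtype.ext (hfull χ.1 fun b hb => ?_)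
      rw [hWT] at hb
      rcases mem_insert.1 hb with rfl | hb
      · rw [hc]
        exact hE.apply_eq_zero (χ := χ.1) (by rwa [coeff_embed])
      · exact hT0 b hb
    refine ⟨f, f.coeff 0, ?_, ?_, ?_⟩
    · intro h0
      refine hE.notMem W.1 (subset_refl _) hi ((mem_orbitIdeal _ _).2 fun χ hχ => ?_)
      by_contra! h1
      rw [hzero χ hχ fun b hb => h1 b (hTW hb)] at hχ
      exact hχ h0
    · rw [mem_orbitIdeal]
      intro χ hχ
      by_contra! h1
      have h2 : (f - algebraMap k (F̃.ChartRing k W.1) (f.coeff 0)).coeff χ =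
          f.coeff χ - (single (0 : F̃.dualMonoid W.1) (f.coeff 0)).coeff χ := rfl
      rw [h2] at hχ
      by_cases h3 : χ = 0
      · subst h3
        rw [coeff_single, Finsupp.single_eq_same, sub_self] at hχ
        exact hχ rfl
      · rw [coeff_single, Finsupp.single_eq_of_ne h3, sub_zero] at hχ
        exact h3 (hzero χ hχ h1)
    · rw [hE.chartIdeal_eq]
      exact subset_span (by simp)
  · refine ⟨1, 1, one_ne_zero, by rw [map_one, sub_self]; exact Ideal.zero_mem _, ?_⟩
    rw [chartIdeal_tildeCenter_of_notMem hP' hW (not_exists.1 h)]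
    trivial

variable (hπ : IsBlowup π (vanishingIdeal (tildeCenter F P k J)))

include hπ

omit hP' hg hπ in
variable (J π a g) in
/-- A chart of the blow-up over the chart of a cone `W` that contains the ray `h` of `(m_i, 0)`, the
part on which the equation `f` of the strict transform of `H_i × 𝔸¹` generates the inverse image ideal.
It is the affine toric variety of the sheared fan. -/
structure ShearedChart (W : F̃.cones) {i : Fin s} (h : {ℓ(i)} ∈ F̃.cones) where
  m : (Fin n → ℤ) × ℤ →+ ℤ
  f : F̃.ChartRing k W.1
  eqn : F̃.IsCenterEquation ℓ(i) C̃ (liftLaurent (g i)) W m f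
  m_gen : ∀ b ∈ W.1, m (F̃.gen b) = twist F P a i b
  f' : (F̃.shear _ h _ (twist_self a i)).ChartRing k W.1
  j : Spec((F̃.shear _ h _ (twist_self a i)).ChartRing k W.1) ⟶ X
  embed_f' : (F̃.shear _ h _ (twist_self a i)).embed k W.1 f' = F̃.embed k W.1 f
  range_j : Set.range j = generatorLocus π (vanishingIdeal C̃) (F̃.chart k W) f
  center : chartIdeal j ((vanishingIdeal C̃).comap π) = span {f'}
  exc : chartIdeal j (exceptionalIdeal J π ℓ(i)) = span {f'}
  divisor : ∀ b, I(j, D̃ b) =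
    if b ∈ W.1 then span {coordFun _ k (shearCone h (twist_self a i) W eqn.mem) b} else ⊤
  isChart : IsDivisorChart J π W j (σ(eqn, m_gen) f' : F̃.ChartRing k W.1 →+* _)

theorem nonempty_shearedChart {S : F̃.cones} (hS : IsAdmissible P S.1) {i : Fin s}
    (hi : ℓ(i) ∈ S.1) :
    Nonempty (ShearedChart J π a g S (horizontal_singleton_mem hi)) := by
  obtain ⟨m, f, hE, hH, hm⟩ := exists_isCenterEquation hP' hg hS hi
  have hh := horizontal_singleton_mem hi
  obtain ⟨f', j, hf', hj, h1, h2, h3, h4⟩ := hE.exists_shear_chart hm hπ (hh := hh)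
    (ha := twist_self a i)
  have h5 : chartIdeal j (exceptionalIdeal J π ℓ(i)) = span {f'} := by
    rw [chartIdeal_exceptionalIdeal hP' hS h1 hi, hH, ← hE.chartIdeal_eq, ← h3, chartIdeal_comap,
      h1, chartIdeal_specMap]
  refine ⟨⟨m, f, hE, hm, f', j, hf', h2, h3, h5, h4, isDivisorChart_of_mem hP' hS h1 (fun χ => ?_) hi
    (hE.shear_ne_zero hf') h5 ?_ (fun b hb hbi => ?_) fun b hb => (h4 b).trans (if_neg hb)⟩⟩
  · show σ(hE, hm) f' (single χ 1) ≠ 0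
    rw [shearHom_single]
    exact mul_ne_zero (pow_ne_zero _ (hE.shear_ne_zero hf')) (single_ne_zero' _)
  · obtain ⟨v, hv, hvx⟩ := hE.shearHom_coordFun_self (f' := f') hm (hh := hh) (ha := twist_self a i)
    refine Eq.trans ?_ (congrArg (fun z => span {z}) hvx).symm
    refine (congrArg (· * span {f'}) ((h4 _).trans (if_pos hi))).trans ?_
    rw [Ideal.span_singleton_mul_span_singleton, Ideal.span_singleton_eq_span_singleton]
    exact ⟨hv.unit, by rw [IsUnit.unit_spec]; ring⟩
  · obtain ⟨v, hv, hvx⟩ := hE.shearHom_coordFun_of_ne (f' := f') hm (hh := hh)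
      (ha := twist_self a i) hb hbi
    refine Eq.trans ?_ (congrArg (fun z => span {z}) hvx).symm
    refine ((h4 b).trans (if_pos hb)).trans ?_
    rw [Ideal.span_singleton_eq_span_singleton]
    exact associated_unit_mul_right _ _ hv

omit hg in
/-- The chart of an admissible cone that contains none of the `(m_i, 0)` misses the centre. -/
theorem exists_unblown_chart {S : F̃.cones} (hS : IsAdmissible P S.1) (hi : ∀ i, ℓ(i) ∉ S.1) :
    ∃ j : Spec(F̃.ChartRing k S.1) ⟶ X, IsDivisorChart J π S j (RingHom.id _) ∧
      Set.range j = π ⁻¹' Set.range (F̃.chart k S) ∧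
      (∀ b, chartIdeal j (exceptionalIdeal J π b) = ⊤) ∧
      ∀ b ∈ S.1, I(j, D̃ b) = span {F̃.coordFun k S b} := by
  have hid : SpecMap(RingHom.id (F̃.ChartRing k S.1)) = 𝟙 _ := Spec.map_id _
  have hop : IsOpenImmersion (SpecMap(RingHom.id (F̃.ChartRing k S.1))) := by
    rw [hid]; infer_instance
  obtain ⟨j, hj, e1, e2, -, e4⟩ := exists_plain_chart hπ (RingHom.id (F̃.ChartRing k S.1))
    (by rw [chartIdeal_tildeCenter_of_notMem hP' hS hi, Ideal.map_top])
  have h6 : ∀ b, chartIdeal j (exceptionalIdeal J π b) = ⊤ := by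
    refine fun b => chartIdeal_exceptionalIdeal_eq_top hP' hS e1 ?_
    rintro i' rfl
    exact hi i'
  refine ⟨j, ⟨inferInstance, hj, e1, fun χ => single_ne_zero' χ,
    fun b => ⟨1, one_ne_zero, by rw [h6, span_singleton_one]⟩, fun b => ?_⟩, ?_, h6, fun b hb => ?_⟩
  · rw [h6, Ideal.mul_top]
    exact e4 b
  · rw [e2, hid, id_comp]
  · exact (e4 b).trans (by rw [chartIdeal_toricDivisor_of_mem hb, Ideal.map_id])

/-- The charts on which the exceptional divisors are principal cover the second blow-up. -/
theorem exists_isDivisorChart (x : X) : ∃ (S : F̃.cones) (R : Type u)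
    (_ : CommRing R) (j : Spec(R) ⟶ X)
    (θ : F̃.ChartRing k S.1 →+* R), IsDivisorChart J π S j θ ∧ x ∈ Set.range j := by
  obtain ⟨S, hS, hx⟩ := exists_admissible_chart hP' (k := k) (π x)
  by_cases h : ∃ i, ℓ(i) ∈ S.1
  · obtain ⟨i, hi⟩ := h
    obtain ⟨c⟩ := nonempty_shearedChart hP' hg hπ hS hi
    rcases generatorLocus_cover hπ.isEffectiveCartier _ c.eqn.chartIdeal_eq hx with h3 | h3
    · obtain ⟨j', hj', e1, e2, e3, e4⟩ := c.eqn.exists_ratio_chart hπ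
      have h5 : chartIdeal j' (exceptionalIdeal J π ℓ(i)) =
          span {ratioMap _ c.f (F̃.coordFun k S ℓ(i))} := by
        obtain ⟨_, _, hE', hH, -⟩ := exists_isCenterEquation hP' hg hS hi
        rw [chartIdeal_exceptionalIdeal hP' hS e1 hi, hH, ← hE'.chartIdeal_eq, ← e3,
          chartIdeal_comap, e1, chartIdeal_specMap]
      have hne : ∀ {z}, z ≠ 0 → ratioMap (F̃.coordFun k S ℓ(i)) c.f z ≠ 0 :=
        fun hz => by rwa [Ne, map_eq_zero_iff _ ratioMap_injective]
      refine ⟨S, _, _, j', _, isDivisorChart_of_mem hP' hS e1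
        (fun χ => hne (single_ne_zero' χ)) hi (hne (coordFun_ne_zero _ _)) h5 ?_
        (fun b hb hbi => (e4 b).trans (if_pos ⟨hb, hbi⟩))
        (fun b hb => (e4 b).trans (if_neg fun h => hb h.1)), e2 ▸ h3⟩
      refine (congrArg (· * _) ((e4 _).trans (if_neg fun h => h.2 rfl))).trans (Ideal.top_mul _)
    · exact ⟨S, _, _, _, _, c.isChart, c.range_j ▸ h3⟩
  · obtain ⟨j, h1, h2, -⟩ := exists_unblown_chart hP' hπ hS (not_exists.1 h)
    exact ⟨S, _, _, j, _, h1, h2 ▸ hx⟩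

/-- A stratum of the second blow-up has points outside the exceptional divisors. -/
theorem exists_mem_stratum {S : F̃.cones} (hS : IsAdmissible P S.1)
    {T : Finset (TildeRay ι s)} (hT : T ⊆ S.1) :
    ∃ x ∈ stratum D̃ T, π x ∈ Set.range (F̃.chart k S) ∧
      ∀ b, x ∉ (exceptionalIdeal J π b).support := by
  by_cases h : ∃ i, ℓ(i) ∈ S.1
  · obtain ⟨i, hi⟩ := h
    obtain ⟨c⟩ := nonempty_shearedChart hP' hg hπ hS hi
    have := c.isChart.isOpenImmersion
    let p : Spec((F̃.shear _ (horizontal_singleton_mem hi) (twist F P a i)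
        (twist_self a i)).ChartRing k S.1) :=
      ⟨orbitIdeal k hT, inferInstance⟩
    refine ⟨c.j p, mem_stratum.2 fun b hb => (mem_closeds_chart c.j _ _).2 ?_,
      mem_range_of_comp c.isChart.comp ⟨p, rfl⟩, fun b hb => ?_⟩
    · refine ((c.divisor b).trans (if_pos (hT hb))).le.trans ?_
      rw [span_singleton_le_iff_mem]
      exact (coordFun_mem_orbitIdeal (S := shearCone (horizontal_singleton_mem hi)
        (twist_self a i) S c.eqn.mem) hT (hT hb)).2 hb
    · have h5 := (mem_support_chart c.j _ p).1 hb
      by_cases hbi : b = ℓ(i)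
      · subst hbi
        rw [c.exc, span_singleton_le_iff_mem] at h5
        exact c.eqn.shear_notMem c.embed_f' hT h5
      · rw [chartIdeal_exceptionalIdeal_eq_top hP' hS c.isChart.comp] at h5
        · exact not_top_le_asIdeal _ h5
        · rintro i' rfl hi'
          exact hbi (congrArg (fun i => ℓ(i)) (eq_of_horizontal_mem hP' hi' hi))
  · obtain ⟨j, h1, -, h3, h4⟩ := exists_unblown_chart hP' hπ hS (not_exists.1 h)
    have := h1.isOpenImmersion
    let p : Spec(F̃.ChartRing k S.1) := ⟨F̃.orbitIdeal k hT, inferInstance⟩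
    refine ⟨j p, mem_stratum.2 fun b hb => (mem_closeds_chart j _ _).2 ?_,
      mem_range_of_comp h1.comp ⟨p, rfl⟩, fun b hb => not_top_le_asIdeal p
        ((h3 b).ge.trans ((mem_support_chart j _ p).1 hb))⟩
    rw [h4 b (hT hb), span_singleton_le_iff_mem]
    exact (coordFun_mem_orbitIdeal hT (hT hb)).2 hb

theorem tropCones_tildeDivisor : tropCones D̃ = tildeCones F P := by
  ext T
  constructor
  · rintro ⟨x, hx⟩
    obtain ⟨S, p, hp⟩ := chart_cover F̃ k (π x)
    have h1 := stratum_tildeDivisor_subset hx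
    rw [← hp, mem_stratum_chart] at h1
    exact F̃.down_closed S.2 h1.1
  · intro hT
    obtain ⟨S, hS, hS'⟩ := exists_admissible_ge hP' ⟨T, hT⟩
    obtain ⟨x, hx, -⟩ := exists_mem_stratum hP' hg hπ hS' hS
    exact ⟨x, hx⟩

omit [Fintype ι] hP' hg in
/-- By the universal property, charts of the blow-up are compatible if they are so below it. -/
theorem specMap_comp_eq {T W : F̃.cones} (hTW : T ≤ W) {R Rw : Type u} [CommRing R] [CommRing Rw]
    {j : Spec(R) ⟶ X} {θ : F̃.ChartRing k W.1 →+* R} (hj : j ≫ π = SpecMap(θ) ≫ F̃.chart k W)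
    {jw : Spec(Rw) ⟶ X} {θw : F̃.ChartRing k T.1 →+* Rw}
    (hjw : jw ≫ π = SpecMap(θw) ≫ F̃.chart k T) {e : Rw} (he : e ∈ nonZeroDivisors Rw)
    (hI : chartIdeal jw ((vanishingIdeal C̃).comap π) = span {e}) {α : R →+* Rw}
    (hα : ∀ z, α (θ z) = θw (F̃.restr k hTW z)) : SpecMap(α) ≫ j = jw := by
  have h1 : (SpecMap(α) ≫ j) ≫ π = jw ≫ π := by
    rw [assoc, hj, hjw, ← assoc, ← Spec.map_comp, ← ofHom_comp, ← F̃.restr_chart k hTW, ← assoc,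
      ← Spec.map_comp, ← ofHom_comp]
    congr 3
    exact RingHom.ext hα
  refine hπ.hom_ext h1 ?_
  rw [h1]
  exact isEffectiveCartier_comap_spec _ he (by rw [← chartIdeal_comap]; exact hI)

open Classical in
/-- The component `D~_b` has an intersection number with `D~_T` for `b ∈ T`: a character that is `1`
on `b` and `0` on the other rays of `T` moves `D~_b` away from `D~_T`. -/
theorem exists_hasIntersectionNumber {T : F̃.cones} (hT : IsAdmissible P T.1)
    {b : TildeRay ι s} (hb : b ∈ T.1) (f : X ⟶ Spec(k)) :
    ∃ d, HasIntersectionNumber f (D̃ b) (stratum D̃ T.1) d := by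
  obtain ⟨χ, hχ⟩ := F̃.unimodular T.1 T.2 (fun c => if c = b then 1 else 0)
  have hχb : χ (F̃.gen b) = 1 := by rw [hχ b hb, if_pos rfl]
  let pull : TildeRay ι s → X.IdealSheafData := fun c =>
    (vanishingIdeal (F̃.toricDivisor k c)).comap π
  let num : TildeRay ι s → ℤ := fun c => χ (F̃.gen c)
  let R₀ : Finset (TildeRay ι s) := Finset.univ.erase b
  let I₁ : X.IdealSheafData := ∏ c ∈ R₀, pull c ^ (-num c).toNat
  let I₂ : X.IdealSheafData := exceptionalIdeal J π b * ∏ c ∈ R₀, pull c ^ (num c).toNat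
  -- the exponents in the chart of `S`
  let ξ : ∀ S : F̃.cones, TildeRay ι s → F̃.dualMonoid S.1 :=
    fun S c => if c ∈ S.1 then F̃.coord S c else 0
  have hξ : ∀ S : F̃.cones, ∀ c d, d ∈ S.1 → (ξ S c).1 (F̃.gen d) = if c = d then 1 else 0 := by
    intro S c d hd
    by_cases hcd : c = d
    · subst hcd
      simp only [ξ, if_pos hd, if_pos]
      exact coord_self hd
    · rw [if_neg hcd]
      by_cases hc : c ∈ S.1
      · simp only [ξ, if_pos hc]
        exact coord_of_ne hd (Ne.symm hcd)
      · simp only [ξ, if_neg hc]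
        rfl
  have hsum : ∀ (S : F̃.cones) (e : TildeRay ι s → ℕ) (d), d ∈ S.1 →
      (∑ c ∈ R₀, e c • ξ S c).1 (F̃.gen d) = if d = b then 0 else (e d : ℤ) := by
    intro S e d hd
    rw [AddSubmonoid.coe_finset_sum, AddMonoidHom.finset_sum_apply]
    have h1 : ∀ c, ((e c • ξ S c : F̃.dualMonoid S.1) : (Fin n → ℤ) × ℤ →+ ℤ)
        (F̃.gen d) = if c = d then (e c : ℤ) else 0 := by
      intro c
      have h2 := hξ S c d hd
      rw [AddSubmonoidClass.coe_nsmul, AddMonoidHom.nsmul_apply, h2]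
      split_ifs <;> simp
    simp only [h1, Finset.sum_ite_eq', R₀, Finset.mem_erase, mem_univ, and_true]
    split_ifs <;> simp_all
  let lneg : ∀ S : F̃.cones, F̃.dualMonoid S.1 := fun S => ∑ c ∈ R₀, (-num c).toNat • ξ S c
  have hl : ∀ S : F̃.cones, (lneg S).1 + χ ∈ F̃.dualMonoid S.1 := by
    intro S d hd
    rw [AddMonoidHom.add_apply, hsum S _ d hd]
    split_ifs with hdb
    · rw [hdb, hχb]; norm_num
    · have := Int.self_le_toNat (-num d)
      show 0 ≤ ((-num d).toNat : ℤ) + num d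
      omega
  have hpull : ∀ (S : F̃.cones) (c), I(F̃.chart k S, F̃.toricDivisor k c) =
      span {single (ξ S c) 1} := by
    intro S c
    by_cases hc : c ∈ S.1
    · simp only [ξ, if_pos hc]
      exact chartIdeal_toricDivisor_of_mem hc
    · simp only [ξ, if_neg hc]
      rw [chartIdeal_toricDivisor_of_notMem hc, eq_comm]
      exact span_singleton_one
  choose S R hR j θ hD hx using exists_isDivisorChart hP' hg hπ
  have hop : ∀ x, IsOpenImmersion (j x) := fun x => (hD x).isOpenImmersion
  have hdom : ∀ x, IsDomain (R x) := fun x => (hD x).isDomain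
  have hprod : ∀ x (e : TildeRay ι s → ℕ), chartIdeal (j x) (∏ c ∈ R₀, pull c ^ e c) =
      span {θ x (single (∑ c ∈ R₀, e c • ξ (S x) c) 1)} := by
    intro x e
    rw [chartIdeal_prod]
    have h1 : ∀ c, chartIdeal (j x) (pull c ^ e c) = span {θ x (single (e c • ξ (S x) c) 1)} := by
      intro c
      rw [chartIdeal_pow, chartIdeal_comap, (hD x).comp, chartIdeal_specMap, hpull, map_span,
        Set.image_singleton, Ideal.span_singleton_pow, ← map_pow, single_pow,
        one_pow]
    simp only [h1]
    rw [Ideal.prod_span_singleton, ← map_prod]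
    congr 3
    induction R₀ using Finset.induction_on with
    | empty => simp; rfl
    | insert c s hc ih => rw [prod_insert hc, sum_insert hc, ih, single_mul_single, one_mul]
  have hI₁ : ∀ x, chartIdeal (j x) I₁ = span {θ x (single (lneg (S x)) 1)} := fun x => hprod x _
  have hI₂ : ∀ x, chartIdeal (j x) (vanishingIdeal (D̃ b) * I₂) =
      span {θ x (single ⟨_, hl (S x)⟩ 1)} := by
    intro x
    rw [chartIdeal_mul, chartIdeal_mul, ← mul_assoc, (hD x).mul_eq, hpull, hprod, map_span,
      Set.image_singleton, Ideal.span_singleton_mul_span_singleton, ← map_mul,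
      single_mul_single, one_mul]
    obtain ⟨v, hv, hvx⟩ := exists_unit_single (k := k) (S := (S x).1)
      (ξ (S x) b + ∑ c ∈ R₀, (num c).toNat • ξ (S x) c) ⟨_, hl (S x)⟩ (fun d hd => by
        show (ξ (S x) b).1 _ + (∑ c ∈ R₀, (num c).toNat • ξ (S x) c).1 _ = (lneg (S x)).1 _ + χ _
        rw [hξ (S x) b d hd, hsum (S x) _ d hd, hsum (S x) _ d hd]
        by_cases hdb : d = b
        · subst hdb
          simp [hχb]
        · rw [if_neg (Ne.symm hdb), if_neg hdb, if_neg hdb]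
          show (0 : ℤ) + ((num d).toNat : ℤ) = ((-num d).toNat : ℤ) + num d
          omega)
    rw [hvx, map_mul, Ideal.span_singleton_eq_span_singleton]
    exact associated_unit_mul_left _ _ (hv.map (θ x))
  obtain ⟨x₀, hx₀, hx₁, hx₂⟩ := exists_mem_stratum hP' hg hπ hT (subset_refl T.1)
  have hpull₀ : ∀ c, c ∉ T.1 → x₀ ∉ (pull c).support := by
    intro c hc h
    obtain ⟨p, hp⟩ := hx x₀
    rw [← hp, mem_support_chart, chartIdeal_comap, ← mem_support_chart] at h
    have h1 : π x₀ ∈ F̃.toricDivisor k c := by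
      rw [Hom.comp_apply, hp] at h
      exact (Set.ext_iff.1 (coe_support_vanishingIdeal (F̃.toricDivisor k c)) _).1 h
    obtain ⟨q, hq⟩ := hx₁
    rw [← hq, mem_toricDivisor_chart] at h1
    exact hc h1.1
  have hnot : ∀ e : TildeRay ι s → ℕ, (∀ c ∈ T.1, c ≠ b → e c = 0) →
      ∃ p, j x₀ p = x₀ ∧ ¬ chartIdeal (j x₀) (∏ c ∈ R₀, pull c ^ e c) ≤ p.asIdeal := by
    intro e he
    obtain ⟨p, hp⟩ := hx x₀
    refine ⟨p, hp, fun h => ?_⟩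
    rw [chartIdeal_prod, p.2.prod_le] at h
    obtain ⟨c, hc, h⟩ := h
    rw [chartIdeal_pow] at h
    have hcb : c ≠ b := (Finset.mem_erase.1 hc).1
    by_cases hcT : c ∈ T.1
    · rw [he c hcT hcb, pow_zero, Ideal.one_eq_top] at h
      exact not_top_le_asIdeal _ h
    · refine hpull₀ c hcT ?_
      rw [← hp, mem_support_chart]
      have : p.asIdeal.IsPrime := p.2
      exact Ideal.IsPrime.le_of_pow_le h
  have hnum : ∀ c ∈ T.1, c ≠ b → num c = 0 := fun c hc hcb => by
    show χ _ = 0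
    rw [hχ c hc, if_neg hcb]
  refine ⟨_, I₁, I₂, ?_, ?_, ?_, ?_, ?_, rfl⟩
  · refine isEffectiveCartier_of_charts fun x => ⟨_, _, j x, hop x, hx x, _, ?_, hI₁ x⟩
    exact mem_nonZeroDivisors_of_ne_zero ((hD x).ne_zero _)
  · refine isEffectiveCartier_of_charts fun x => ⟨_, _, j x, hop x, hx x, ?_⟩
    obtain ⟨e, he, hE⟩ := (hD x).exists_generator b
    refine ⟨e * θ x (single (∑ c ∈ R₀, (num c).toNat • ξ (S x) c) 1),
      mem_nonZeroDivisors_of_ne_zero (mul_ne_zero he ((hD x).ne_zero _)), ?_⟩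
    rw [chartIdeal_mul, hE, hprod, Ideal.span_singleton_mul_span_singleton]
  · intro h
    obtain ⟨p, hp, h1⟩ := hnot (fun c => (-num c).toNat) (fun c hc hcb => by simp [hnum c hc hcb])
    refine h1 ((mem_support_chart _ _ _).1 ?_)
    rw [hp]
    exact h hx₀
  · intro h
    obtain ⟨p, hp, h1⟩ := hnot (fun c => (num c).toNat) (fun c hc hcb => by simp [hnum c hc hcb])
    have h2 : j x₀ p ∈ I₂.support := by
      rw [hp]
      exact h hx₀
    rw [mem_support_chart, chartIdeal_mul, p.2.mul_le] at h2
    rcases h2 with h2 | h2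
    · refine hx₂ b ?_
      rw [← hp, mem_support_chart]
      exact h2
    · exact h1 h2
  · refine idealIso_of_charts R j (fun x => ⟨x, hx x⟩) _ _
      (fun x => mem_nonZeroDivisors_of_ne_zero ((hD x).ne_zero ⟨_, hl (S x)⟩))
      (fun x => mem_nonZeroDivisors_of_ne_zero ((hD x).ne_zero (lneg (S x)))) hI₂ hI₁ ?_
    intro x y W _ α γ hαγ
    have h1 : SpecMap(α.comp (θ x)) ≫ F̃.chart k (S x) =
        SpecMap(γ.comp (θ y)) ≫ F̃.chart k (S y) := by
      rw [ofHom_comp, ofHom_comp, Spec.map_comp, Spec.map_comp,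
        assoc, assoc, ← (hD x).comp, ← (hD y).comp, ← assoc, hαγ,
        assoc]
    obtain ⟨δ, hδ1, hδ2⟩ := exists_restr_of_chart_eq h1
    have e1 : ∀ z, α (θ x z) = δ (F̃.restr k _ z) := fun z => RingHom.congr_fun hδ1.symm z
    have e2 : ∀ z, γ (θ y z) = δ (F̃.restr k _ z) := fun z => RingHom.congr_fun hδ2.symm z
    rw [e1, e1, e2, e2, ← map_mul, ← map_mul, restr_single, restr_single,
      restr_single, restr_single, single_mul_single,
      single_mul_single]
    congr 2
    apply Subtype.ext
    show (lneg (S x)).1 + χ + (lneg (S y)).1 = (lneg (S y)).1 + χ + (lneg (S x)).1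
    abel

variable {S S' T : (tildeFan F P).cones} {c c' : TildeRay ι s} (hc : c ∉ T.1) (hc' : c' ∉ T.1)
  (hcc' : c ≠ c') (hS : S.1 = insert c T.1) (hS' : S'.1 = insert c' T.1)
  (hfull : ∀ χ : (Fin n → ℤ) × ℤ →+ ℤ, (∀ b ∈ S.1, χ ((tildeFan F P).gen b) = 0) → χ = 0)
  (hfull' : ∀ χ : (Fin n → ℤ) × ℤ →+ ℤ, (∀ b ∈ S'.1, χ ((tildeFan F P).gen b) = 0) → χ = 0)
  (hW : ∀ W : (tildeFan F P).cones, T ≤ W → W ≤ S ∨ W ≤ S')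
  {d : TildeRay ι s → ℤ} {b : TildeRay ι s} (hb : b ∈ T.1)

include hc hc' hcc' hS hS' hfull hW hb

/-- The intersection numbers with the curve of a cone that contains `(m_i, 0)`: near this curve the
blow-up is the toric variety of the sheared fan. -/
theorem intersectionNumber_of_horizontal_mem {i : Fin s} (hi : ℓ(i) ∈ T.1)
    (he : exceptional i ∈ T.1)
    (hd : (F̃.gen c + twist F P a i c • F̃.gen ℓ(i)) +
      (F̃.gen c' + twist F P a i c' • F̃.gen ℓ(i)) +
      ∑ b ∈ T.1, d b • (F̃.gen b + twist F P a i b • F̃.gen ℓ(i)) = 0) :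
    intersectionNumber (π ≫ F̃.toSpec k) (D̃ b) (stratum D̃ T.1) = d b := by
  have hT : T ≤ S := (subset_insert c T.1).trans hS.ge
  have hT' : T ≤ S' := (subset_insert c' T.1).trans hS'.ge
  have hadm : ∀ W : F̃.cones, T ≤ W → IsAdmissible P W.1 := fun W hTW i' hi' => by
    rw [eq_of_horizontal_mem hP' hi' (hTW hi)]
    exact hTW he
  have hin : S.1 ∩ S'.1 = T.1 := by
    rw [hS, hS', Finset.insert_inter_of_notMem (by simp [hcc', hc]),
      Finset.inter_eq_left.2 (subset_insert _ _)]
  let hhi := horizontal_singleton_mem hi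
  let G' := F̃.shear _ hhi (twist F P a i) (twist_self a i)
  have key : ∀ W : F̃.cones, T ≤ W → ∃ c : ShearedChart J π a g W hhi,
      ∀ x ∈ stratum D̃ T.1, π x ∈ Set.range (F̃.chart k W) → x ∈ Set.range c.j := by
    intro W hTW
    obtain ⟨c⟩ := nonempty_shearedChart hP' hg hπ (hadm W hTW) (hTW hi)
    refine ⟨c, fun x hx hxW => ?_⟩
    rcases generatorLocus_cover hπ.isEffectiveCartier _ c.eqn.chartIdeal_eq hxW with h3 | h3
    · obtain ⟨j', hj', -, e2, -, e4⟩ := c.eqn.exists_ratio_chart hπ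
      rw [← e2] at h3
      obtain ⟨p, rfl⟩ := h3
      have h6 := (mem_closeds_chart j' _ p).1 (mem_stratum.1 hx _ hi)
      have h7 := (e4 ℓ(i)).trans (if_neg fun h => h.2 rfl)
      exact absurd (h7.ge.trans h6) (not_top_le_asIdeal _)
    · rw [c.range_j]; exact h3
  obtain ⟨C, hx⟩ := key S hT
  obtain ⟨C₁, hx₁⟩ := key S' hT'
  obtain ⟨Cw, hxw⟩ := key T le_rfl
  have := C.isChart.isOpenImmersion
  have := C₁.isChart.isOpenImmersion
  have := Cw.isChart.isOpenImmersion
  have hcompat : ∀ {W : F̃.cones} (hTW : T ≤ W) (C : ShearedChart J π a g W hhi),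
      SpecMap(G'.restr k hTW) ≫ C.j = Cw.j := fun hTW C =>
    specMap_comp_eq hπ hTW C.isChart.comp Cw.isChart.comp
      (mem_nonZeroDivisors_of_ne_zero (Cw.eqn.shear_ne_zero Cw.embed_f')) Cw.center
      (C.eqn.restr_shearHom hTW C.m_gen C.embed_f' Cw.eqn Cw.m_gen Cw.embed_f')
  have hD : ∀ {W : F̃.cones} (hTW : T ≤ W) (C : ShearedChart J π a g W hhi), ∀ b ∈ T.1,
      I(C.j, D̃ b) = span {coordFun _ k (shearCone hhi (twist_self a i) W C.eqn.mem) b} :=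
    fun hTW C b hb => (C.divisor b).trans (if_pos (hTW hb))
  have halg : ∀ {W : F̃.cones} (C : ShearedChart J π a g W hhi), C.j ≫ π ≫ F̃.toSpec k =
      SpecMap((RingHom.id (G'.ChartRing k W.1)).comp (algebraMap k _)) := fun C =>
    (comp_toSpec C.isChart.comp).trans (congrArg (fun r => SpecMap(r)) (AlgHom.comp_algebraMap _))
  have h1 : ∀ {Q : Finset (TildeRay ι s)} (h : T.1 ⊆ Q),
      (1 : G'.ChartRing k Q) - algebraMap k _ 1 ∈ G'.orbitIdeal k h := fun h => by
    rw [map_one, sub_self]; exact Ideal.zero_mem _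
  refine intersectionNumber_eq_of_relation (G := G') (S := shearCone hhi (twist_self a i) S C.eqn.mem)
    (S' := shearCone hhi (twist_self a i) S' C₁.eqn.mem)
    (T := shearCone hhi (twist_self a i) T hi) hc hc' hS hS' ?_ hd hT hT'
    (φ := RingHom.id _) (φ' := RingHom.id _) (φw := RingHom.id _)
    (isAwayHom_id 1) (isAwayHom_id 1) (isAwayHom_id 1) one_ne_zero one_ne_zero one_ne_zero
    (h1 _) (h1 _) (h1 _) (fun χ => mem_nonZeroDivisors_of_ne_zero (single_ne_zero' χ))
    (hcompat hT C) (hcompat hT' C₁) (fun _ => rfl) (fun _ => rfl) (fun _ _ _ _ h => h)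
    (fun _ _ _ _ h => h) (hD hT C) (hD hT' C₁) (hD le_rfl Cw) (halg C) (halg C₁)
    ?_ ?_ hb (exists_hasIntersectionNumber hP' hg hπ (hadm T le_rfl) hb _)
  · intro χ hχ
    have h2 : χ (F̃.gen ℓ(i)) = 0 := by
      have := hχ ℓ(i) (hT hi)
      rwa [shear_gen_self] at this
    refine hfull χ fun b hb => ?_
    have := hχ b hb
    rwa [shear_gen, map_add, map_zsmul, h2, smul_zero, add_zero] at this
  · intro x hxC
    exact (stratum_subset_of_extra hW hxC).imp (hx x hxC) (hx₁ x hxC)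
  · rintro x ⟨hxC, hxj, hxj₁⟩
    exact hxw x hxC (mem_range_chart_of_inter hin (mem_range_of_comp C.isChart.comp hxj)
      (mem_range_of_comp C₁.isChart.comp hxj₁))

include hfull'

/-- The intersection numbers with the curve of a cone that contains none of the `(m_i, 0)`: this curve
does not meet the centre. -/
theorem intersectionNumber_of_horizontal_notMem (hT₀ : ∀ i, ℓ(i) ∉ T.1)
    (hSa : IsAdmissible P S.1) (hSa' : IsAdmissible P S'.1)
    (hd : F̃.gen c + F̃.gen c' + ∑ b ∈ T.1, d b • F̃.gen b = 0) :
    intersectionNumber (π ≫ F̃.toSpec k) (D̃ b) (stratum D̃ T.1) = d b := by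
  have hT : T ≤ S := (subset_insert c T.1).trans hS.ge
  have hT' : T ≤ S' := (subset_insert c' T.1).trans hS'.ge
  have hTa : IsAdmissible P T.1 := fun i hi => absurd hi (hT₀ i)
  have hin : S.1 ∩ S'.1 = T.1 := by
    rw [hS, hS', Finset.insert_inter_of_notMem (by simp [hcc', hc]),
      Finset.inter_eq_left.2 (subset_insert _ _)]
  obtain ⟨f, r, hr, hf, hfI⟩ := exists_const_mod hP' hg hSa hS hT₀ hT hfull
  obtain ⟨f', r', hr', hf', hfI'⟩ := exists_const_mod hP' hg hSa' hS' hT₀ hT' hfull'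
  let ρ := F̃.restr k hT
  let ρ' := F̃.restr k hT'
  have hmap : ∀ {Q : F̃.cones} (hTQ : T ≤ Q) {f r},
      f - algebraMap k _ r ∈ F̃.orbitIdeal k (show T.1 ⊆ Q.1 from hTQ) →
      F̃.restr k hTQ f - algebraMap k _ r ∈ F̃.orbitIdeal k (subset_refl T.1) := by
    intro Q hTQ f r h
    have h1 : F̃.restr k hTQ f - algebraMap k _ r = F̃.restr k hTQ (f - algebraMap k _ r) := by
      rw [map_sub]
      congr 1
      exact (F̃.restr_single k hTQ 0 r).symm
    rw [h1, mem_orbitIdeal_embed, embed_restr, ← mem_orbitIdeal_embed]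
    exact h
  have hfw : ρ f * ρ' f' - algebraMap k _ (r * r') ∈ F̃.orbitIdeal k (subset_refl T.1) := by
    have h1 : ρ f * ρ' f' - algebraMap k _ (r * r') =
        (ρ f - algebraMap k _ r) * ρ' f' + algebraMap k _ r * (ρ' f' - algebraMap k _ r') := by
      rw [map_mul]; ring
    rw [h1]
    exact Ideal.add_mem _ (Ideal.mul_mem_right _ _ (hmap hT hf)) (mul_mem_left _ _ (hmap hT' hf'))
  have hfIw : ρ f * ρ' f' ∈ I(F̃.chart k T, C̃) := by
    rw [chartIdeal_tildeCenter_of_notMem hP' hTa hT₀]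
    trivial
  obtain ⟨j, hj, hx, -, hD, hjc⟩ := exists_away_chart hπ hT hr hf hfI
  obtain ⟨j', hj', hx', -, hD', hjc'⟩ := exists_away_chart hπ hT' hr' hf' hfI'
  obtain ⟨jw, hjw, hxw, hIw, hDw, hjcw⟩ :=
    exists_away_chart hπ (le_refl T) (mul_ne_zero hr hr') hfw hfIw
  let φw := algebraMap (F̃.ChartRing k T.1) (Away (ρ f * ρ' f'))
  have huw : IsUnit (φw (ρ f * ρ' f')) := algebraMap_isUnit _
  rw [map_mul, IsUnit.mul_iff] at huw
  let α : Away f →+* Away (ρ f * ρ' f') := IsLocalization.Away.lift f (g := φw.comp ρ) huw.1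
  let α' : Away f' →+* Away (ρ f * ρ' f') := IsLocalization.Away.lift f' (g := φw.comp ρ') huw.2
  have hα : ∀ z, α (algebraMap _ _ z) = φw (ρ z) := fun z => lift_eq f _ z
  have hα' : ∀ z, α' (algebraMap _ _ z) = φw (ρ' z) := fun z => lift_eq f' _ z
  replace hIw := hIw.trans span_singleton_one.symm
  have hflat : φw.Flat := by
    rw [RingHom.flat_algebraMap_iff]
    exact IsLocalization.flat _ (powers (ρ f * ρ' f'))
  refine intersectionNumber_eq_of_relation hc hc' hS hS' hfull hd hT hT'
    (isAwayHom_localization f) (isAwayHom_localization f') (isAwayHom_localization (ρ f * ρ' f'))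
    hr hr' (mul_ne_zero hr hr') hf hf' hfw
    (fun χ => nonZeroDivisors_of_flat hflat (mem_nonZeroDivisors_of_ne_zero (single_ne_zero' χ)))
    (specMap_comp_eq hπ hT hjc hjcw (one_mem _) hIw hα)
    (specMap_comp_eq hπ hT' hjc' hjcw (one_mem _) hIw hα') hα hα'
    (fun _ _ _ _ h => IsLocalization.ringHom_ext (powers f) h)
    (fun _ _ _ _ h => IsLocalization.ringHom_ext (powers f') h) hD hD' hDw
    (comp_toSpec hjc) (comp_toSpec hjc') ?_ ?_ hb
    (exists_hasIntersectionNumber hP' hg hπ hTa hb _)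
  · intro x hxC
    exact (stratum_subset_of_extra hW hxC).imp (hx x hxC) (hx' x hxC)
  · rintro x ⟨hxC, hxj, hxj'⟩
    exact hxw x hxC (mem_range_chart_of_inter hin (mem_range_of_comp hjc hxj)
      (mem_range_of_comp hjc' hxj'))

end

/-! ### Points of the fan in coordinates -/

section

open TildeRay Filter Topology

section Lattice

variable {n : ℕ}

/-- The inclusion of the lattice `ℤ ^ n × ℤ` into `ℝ ^ n × ℝ`. -/
def castHom (n : ℕ) : (Fin n → ℤ) × ℤ →+ (Fin n → ℝ) × ℝ :=
  AddMonoidHom.prodMap (AddMonoidHom.compLeft (Int.castAddHom ℝ) (Fin n)) (Int.castAddHom ℝ)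

theorem castHom_mem (v : (Fin n → ℤ) × ℤ) : castHom n v ∈ integralPoints n := ⟨v, rfl⟩

theorem castHom_injective : Function.Injective (castHom n) := by
  intro v w h
  refine Prod.ext (funext fun j => ?_) ?_
  · exact Int.cast_injective (α := ℝ) (congrFun (congrArg Prod.fst h) j)
  · exact Int.cast_injective (α := ℝ) (congrArg Prod.snd h)

/-- The real linear extension of an additive map on the lattice. -/
def realExt {V : Type*} [AddCommGroup V] [Module ℝ V] (f : (Fin n → ℤ) × ℤ →+ V) :
    (Fin n → ℝ) × ℝ →ₗ[ℝ] V :=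
  (Fintype.linearCombination ℝ fun j => f (Pi.single j 1, 0)).comp (LinearMap.fst ℝ _ _) +
    (LinearMap.snd ℝ _ _).smulRight (f (0, 1))

theorem realExt_castHom {V : Type*} [AddCommGroup V] [Module ℝ V] (f : (Fin n → ℤ) × ℤ →+ V)
    (v : (Fin n → ℤ) × ℤ) : realExt f (castHom n v) = f v := by
  have h1 : v = ∑ j, v.1 j • ((Pi.single j 1 : Fin n → ℤ), (0 : ℤ)) + v.2 • (0, 1) := by
    refine Prod.ext (funext fun i => ?_) ?_
    · simp [Prod.fst_sum, Finset.sum_apply, Pi.single_apply]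
    · simp [Prod.snd_sum]
  have h2 : f v = ∑ j, v.1 j • f (Pi.single j 1, 0) + v.2 • f (0, 1) := by
    conv_lhs => rw [h1, map_add, map_sum, map_zsmul]
    simp only [map_zsmul]
  rw [h2]
  simp [realExt, castHom, Fintype.linearCombination_apply, Int.cast_smul_eq_zsmul]

theorem linearMap_ext_castHom {V : Type*} [AddCommGroup V] [Module ℝ V]
    {f g : (Fin n → ℝ) × ℝ →ₗ[ℝ] V} (h : ∀ v, f (castHom n v) = g (castHom n v)) : f = g := by
  refine LinearMap.prod_ext (LinearMap.pi_ext' fun j => LinearMap.ext_ring ?_)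
    (LinearMap.ext_ring ?_)
  · have e : castHom n (Pi.single j 1, 0) = (Pi.single j 1, 0) := by
      ext i <;> simp [castHom, Pi.single_apply, apply_ite]
    have h1 := h (Pi.single j 1, 0)
    rwa [e] at h1
  · have e : castHom n (0, 1) = (0, 1) := by ext i <;> simp [castHom]
    have h1 := h (0, 1)
    rwa [e] at h1

/-- The real linear extension of an automorphism of the lattice. -/
theorem exists_integral_extension (τ : (Fin n → ℤ) × ℤ ≃+ (Fin n → ℤ) × ℤ) :
    ∃ θ : ((Fin n → ℝ) × ℝ) ≃ₗ[ℝ] (Fin n → ℝ) × ℝ,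
      (∀ v, θ v ∈ integralPoints n ↔ v ∈ integralPoints n) ∧
      ∀ v, θ (castHom n v) = castHom n (τ v) := by
  let ext (τ : (Fin n → ℤ) × ℤ ≃+ (Fin n → ℤ) × ℤ) := realExt ((castHom n).comp τ.toAddMonoidHom)
  have hext : ∀ τ v, ext τ (castHom n v) = castHom n (τ v) := fun τ v => realExt_castHom _ v
  have hinv : ∀ τ τ', (∀ v, τ' (τ v) = v) → (ext τ').comp (ext τ) = LinearMap.id := fun τ τ' h =>
    linearMap_ext_castHom fun v => by rw [LinearMap.comp_apply, hext, hext, h, LinearMap.id_apply]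
  have h1 := hinv τ τ.symm τ.symm_apply_apply
  refine ⟨LinearEquiv.ofLinear (ext τ) (ext τ.symm) (hinv τ.symm τ τ.apply_symm_apply) h1,
    fun v => ⟨?_, ?_⟩, hext τ⟩
  · rintro ⟨u, hu⟩
    refine ⟨τ.symm u, (hext τ.symm u).symm.trans ?_⟩
    rw [show castHom n u = _ from hu]
    exact LinearMap.congr_fun h1 v
  · rintro ⟨u, rfl⟩
    exact ⟨τ u, (hext τ u).symm⟩

/-- Two lattice bases are related by an integral linear automorphism. -/
theorem exists_integral_equiv {A : Type} {w w' : A → (Fin n → ℝ) × ℝ} {S : Finset A}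
    (h : IsLatticeBasis (integralPoints n) w S) (h' : IsLatticeBasis (integralPoints n) w' S) :
    ∃ θ : ((Fin n → ℝ) × ℝ) ≃ₗ[ℝ] (Fin n → ℝ) × ℝ,
      (∀ v, θ v ∈ integralPoints n ↔ v ∈ integralPoints n) ∧ ∀ a ∈ S, θ (w a) = w' a := by
  obtain ⟨β, hβ⟩ := h
  obtain ⟨β', hβ'⟩ := h'
  let e : (Fin n → ℤ) × ℤ ≃+ integralPoints n := AddMonoidHom.ofInjective castHom_injective
  have he : ∀ y, castHom n (e.symm y) = y := fun y => congrArg Subtype.val (e.apply_symm_apply y)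
  obtain ⟨θ, hθ, hθ'⟩ := exists_integral_extension
    ((e.trans (β.equiv β' (Equiv.refl _)).toAddEquiv).trans e.symm)
  refine ⟨θ, hθ, fun a ha => ?_⟩
  have h1 := hθ' (e.symm (β ⟨a, ha⟩))
  simpa [he, hβ, hβ'] using h1

end Lattice

variable {ι : Type} [Fintype ι] [DecidableEq ι] {n s : ℕ} {F : SmoothFan (Fin n → ℤ) ι}
  {P : Fin s → ι}

local notation "F̃" => tildeFan F P

theorem sum_tildeRay {M : Type*} [AddCommMonoid M] (f : TildeRay ι s → M) :
    ∑ a, f a = ∑ b, f (horizontal b) + f vertical + ∑ i, f (exceptional i) := by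
  let e : (ι ⊕ Unit) ⊕ Fin s ≃ TildeRay ι s :=
    { toFun := Sum.elim (Sum.elim horizontal fun _ => vertical) exceptional
      invFun := fun a => match a with
        | horizontal b => Sum.inl (Sum.inl b)
        | vertical => Sum.inl (Sum.inr ())
        | exceptional i => Sum.inr i
      left_inv := by rintro ((b | _) | i) <;> rfl
      right_inv := by rintro (b | _ | i) <;> rfl }
  rw [← e.sum_comp]
  simp [e, Fintype.sum_sum_type]

/-- A combination of the generators of a cone of `Σ~` determines its coefficients. -/
theorem exists_coordinate {T : Finset (TildeRay ι s)} (hT : T ∈ tildeCones F P) :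
    ∃ χ : TildeRay ι s → (Fin n → ℝ) × ℝ →ₗ[ℝ] ℝ, ∀ b, ∀ a ∈ T,
      χ b (tildeRealGen F P a) = if a = b then 1 else 0 := by
  choose χ hχ using fun b => F̃.unimodular T hT fun a => if a = b then 1 else 0
  refine ⟨fun b => realExt ((Int.castAddHom ℝ).comp (χ b)), fun b a ha => ?_⟩
  refine (realExt_castHom _ (tildeGen F P a)).trans ?_
  rw [AddMonoidHom.comp_apply, show χ b (tildeGen F P a) = _ from hχ b a ha]
  split_ifs <;> simp

theorem coordinate_sum {T : Finset (TildeRay ι s)}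
    {χ : TildeRay ι s → (Fin n → ℝ) × ℝ →ₗ[ℝ] ℝ} (hχ : ∀ b, ∀ a ∈ T,
      χ b (tildeRealGen F P a) = if a = b then 1 else 0) {x : TildeRay ι s → ℝ}
    (hx : ∀ a ∉ T, x a = 0) {b : TildeRay ι s} (hb : b ∈ T) :
    χ b (∑ a, x a • tildeRealGen F P a) = x b := by
  rw [map_sum, sum_eq_single b]
  · rw [map_smul, hχ b b hb, if_pos rfl, smul_eq_mul, mul_one]
  · intro a _ hab
    by_cases ha : a ∈ T
    · rw [map_smul, hχ b a ha, if_neg hab, smul_zero]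
    · rw [hx a ha, zero_smul, map_zero]
  · exact fun h => absurd (mem_univ b) h

section Complete

variable (hF : F.IsCompleteFan)
include hF

omit hF [DecidableEq ι] in
theorem horizontal_image_mem [DecidableEq ι] {σ : Finset ι} (hσ : σ ∈ F.cones) :
    σ.image horizontal ∈ tildeCones F P :=
  ⟨σ, hσ, by simp, by simp, Or.inl (by simp)⟩

/-- In a fan the coordinates of a vector are unique. -/
theorem coefficients_unique {σ τ : Finset ι} (hσ : σ ∈ F.cones) (hτ : τ ∈ F.cones) {c d : ι → ℝ}
    (hc : ∀ b, 0 ≤ c b) (hd : ∀ b, 0 ≤ d b) (hcσ : ∀ b ∉ σ, c b = 0) (hdτ : ∀ b ∉ τ, d b = 0)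
    (h : ∑ b, c b • F.realGen b = ∑ b, d b • F.realGen b) : c = d := by
  have key : ∀ {ρ : Finset ι}, ρ ∈ F.cones → ∀ {c d : ι → ℝ}, (∀ b ∉ ρ, c b = 0) →
      (∀ b ∉ ρ, d b = 0) → ∑ b, c b • F.realGen b = ∑ b, d b • F.realGen b → c = d := by
    intro ρ hρ c d hcρ hdρ h
    obtain ⟨χ, hχ⟩ := exists_coordinate (horizontal_image_mem (P := (Fin.elim0 : Fin 0 → ι)) hρ)
    let lift : (ι → ℝ) → TildeRay ι 0 → ℝ := fun c a => match a with
      | horizontal b => c b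
      | _ => 0
    have h1 : ∀ {c : ι → ℝ}, (∀ b ∉ ρ, c b = 0) → ∀ b ∈ ρ,
        χ (horizontal b) (∑ b, c b • F.realGen b, 0) = c b := by
      intro c hc b hb
      have h2 := coordinate_sum hχ (x := lift c) (fun a ha => by
        rcases a with b | _ | i
        · exact hc b fun hb => ha (Finset.mem_image_of_mem _ hb)
        · rfl
        · rfl) (Finset.mem_image_of_mem horizontal hb)
      rw [sum_tildeRay] at h2
      simp only [lift, zero_smul, Finset.sum_const_zero, add_zero] at h2
      rw [← h2]
      congr 1
      refine Prod.ext ?_ ?_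
      · rw [Prod.fst_sum]; rfl
      · rw [Prod.snd_sum]
        simp [tildeRealGen, tildeGen]
    funext b
    by_cases hb : b ∈ ρ
    · rw [← h1 hcρ b hb, ← h1 hdρ b hb, h]
    · rw [hcρ b hb, hdρ b hb]
  have hmem : ∀ {ρ : Finset ι} {c : ι → ℝ}, (∀ b, 0 ≤ c b) → (∀ b ∉ ρ, c b = 0) →
      ∑ b, c b • F.realGen b ∈ F.realCone ρ := fun {ρ c} hc hcρ =>
    ⟨c, hc, (Finset.sum_subset (Finset.subset_univ ρ) fun b _ hb => by
      rw [hcρ b hb, zero_smul]).symm⟩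
  obtain ⟨e, he, he'⟩ := hF.inter_subset σ hσ τ hτ ⟨hmem hc hcσ, h ▸ hmem hd hdτ⟩
  let e' : ι → ℝ := fun b => if b ∈ σ ∩ τ then e b else 0
  have hee : ∑ b, c b • F.realGen b = ∑ b, e' b • F.realGen b := by
    rw [he']
    simp only [e', ite_smul, zero_smul]
    rw [Finset.sum_ite_mem, Finset.univ_inter]
  have h1 : c = e' := key hσ hcσ (fun b hb => if_neg fun h => hb (Finset.mem_inter.1 h).1) hee
  have h2 : d = e' := key hτ hdτ (fun b hb => if_neg fun h => hb (Finset.mem_inter.1 h).2) (h ▸ hee)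
  rw [h1, h2]

variable (hP : Function.Injective P) (hP' : SeparatedRays F P)

omit hF in
/-- The first component of a point of `Σ~` in the coordinates of `Σ`. -/
theorem fst_sum_tildeRealGen (x : TildeRay ι s → ℝ) : (∑ a, x a • tildeRealGen F P a).1 =
      ∑ b, (x (horizontal b) + ∑ i with P i = b, x (exceptional i)) • F.realGen b := by
  rw [Prod.fst_sum, sum_tildeRay]
  have h1 : ∑ i, (x (exceptional i) • tildeRealGen F P (exceptional i)).1 =
      ∑ b, (∑ i with P i = b, x (exceptional i)) • F.realGen b := by
    rw [← Finset.sum_fiberwise (s := Finset.univ) (g := P)]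
    refine sum_congr rfl fun b _ => ?_
    rw [sum_smul]
    refine sum_congr rfl fun i hi => ?_
    rw [← (mem_filter.1 hi).2]
    rfl
  rw [h1]
  have h2 : (x vertical • tildeRealGen F P vertical).1 = 0 := by
    funext j
    simp [tildeRealGen, tildeGen]
  rw [h2, add_zero, ← sum_add_distrib]
  exact sum_congr rfl fun b _ => (add_smul _ _ _).symm

omit hF in
theorem snd_sum_tildeRealGen (x : TildeRay ι s → ℝ) :
    (∑ a, x a • tildeRealGen F P a).2 = x vertical + ∑ i, x (exceptional i) := by
  rw [Prod.snd_sum, sum_tildeRay]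
  simp [tildeRealGen, tildeGen]

/-- The coordinates in `Σ~` of a vector with height `r` and coordinates `c` in `Σ`. -/
def recover (P : Fin s → ι) (c : ι → ℝ) (r : ℝ) : TildeRay ι s → ℝ
  | horizontal b => c b - ∑ i with P i = b, min (c b) r
  | vertical => r - ∑ i, min (c (P i)) r
  | exceptional i => min (c (P i)) r

include hP hP'

omit hF in
theorem eq_recover {T : Finset (TildeRay ι s)} (hT : T ∈ tildeCones F P) {x : TildeRay ι s → ℝ}
    (hx : ∀ a, 0 ≤ x a) (hxT : ∀ a ∉ T, x a = 0) :
    x = recover P (fun b => x (horizontal b) + ∑ i with P i = b, x (exceptional i))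
      (x vertical + ∑ i, x (exceptional i)) := by
  have hfib : ∀ i, ∑ i' with P i' = P i, x (exceptional i') = x (exceptional i) := by
    intro i
    rw [sum_eq_single i]
    · intro j hj hji
      exact absurd (hP (mem_filter.1 hj).2) hji
    · intro h
      simp at h
  have hbase : ∀ i, x (horizontal (P i)) ≠ 0 ∨ x (exceptional i) ≠ 0 → P i ∈ baseSimplex P T := by
    rintro i (h | h)
    · exact horizontal_mem_base P (by_contra fun h' => h (hxT _ h'))
    · exact exceptional_mem_base P (by_contra fun h' => h (hxT _ h'))
  have hmin : ∀ i, min (x (horizontal (P i)) + x (exceptional i))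
      (x vertical + ∑ i, x (exceptional i)) = x (exceptional i) := by
    intro i
    by_cases hi : P i ∈ baseSimplex P T
    · have hsum : ∑ j, x (exceptional j) = x (exceptional i) := by
        refine sum_eq_single i (fun j _ hji => ?_) (fun h => absurd (mem_univ i) h)
        by_contra h
        exact hji (eq_of_exceptional_mem hP' ⟨T, hT⟩ (hbase j (Or.inr h)) hi)
      have h0 : x (horizontal (P i)) = 0 ∨ x vertical = 0 := by
        obtain ⟨σ, -, -, h2, -⟩ := hT
        by_contra! h
        exact h2 i ⟨by_contra fun h' => h.1 (hxT _ h'), by_contra fun h' => h.2 (hxT _ h')⟩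
      rw [hsum]
      rcases h0 with h0 | h0
      · rw [h0, zero_add, min_eq_left (le_add_of_nonneg_left (hx _))]
      · rw [h0, zero_add, min_eq_right (le_add_of_nonneg_left (hx _))]
    · have h1 : x (horizontal (P i)) = 0 := by_contra fun h => hi (hbase i (Or.inl h))
      have h2 : x (exceptional i) = 0 := by_contra fun h => hi (hbase i (Or.inr h))
      rw [h1, h2, zero_add, min_eq_left]
      exact add_nonneg (hx _) (sum_nonneg fun j _ => hx _)
  funext a
  rcases a with b | _ | i
  · simp only [recover]
    by_cases hb : ∃ i, P i = b
    · obtain ⟨i, rfl⟩ := hb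
      rw [hfib, hmin, sum_eq_single i]
      · ring
      · intro j hj hji
        exact absurd (hP (mem_filter.1 hj).2) hji
      · intro h
        simp at h
    · have : Finset.univ.filter (fun i => P i = b) = ∅ := by
        ext i
        simpa using fun h => hb ⟨i, h⟩
      rw [this]
      simp
  · simp only [recover, hfib, hmin]
    ring
  · simp only [recover, hfib, hmin]

omit hF in
theorem recover_spec {σ : Finset ι} (hσ : σ ∈ F.cones) {c : ι → ℝ} (hc : ∀ b, 0 ≤ c b)
    (hcσ : ∀ b ∉ σ, c b = 0) {r : ℝ} (hr : 0 ≤ r) :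
    (∀ a, 0 ≤ recover P c r a) ∧ (∃ T ∈ tildeCones F P, ∀ a ∉ T, recover P c r a = 0) ∧
      ∑ a, recover P c r a • tildeRealGen F P a = (∑ b, c b • F.realGen b, r) := by
  have h0 : ∀ i, 0 ≤ min (c (P i)) r := fun i => le_min (hc _) hr
  have hne : ∀ i, min (c (P i)) r ≠ 0 → P i ∈ σ := fun i h => by
    by_contra h1
    rw [hcσ _ h1, min_eq_left hr] at h
    exact h rfl
  have hsum : ∀ i, P i ∈ σ → ∑ j, min (c (P j)) r = min (c (P i)) r := by
    intro i hi
    refine sum_eq_single i (fun j _ hji => ?_) (fun h => absurd (mem_univ i) h)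
    by_contra h
    exact hP' σ hσ j i hji ⟨hne j h, hi⟩
  have hfib : ∀ i, ∑ j with P j = P i, min (c (P i)) r = min (c (P i)) r := by
    intro i
    refine sum_eq_single i (fun j hj hji => ?_) (fun h => by simp at h)
    exact absurd (hP (mem_filter.1 hj).2) hji
  have hfib0 : ∀ b, (¬ ∃ i, P i = b) → Finset.univ.filter (fun i => P i = b) = ∅ := by
    intro b hb
    ext i
    simpa using fun h => hb ⟨i, h⟩
  have hle : ∑ j, min (c (P j)) r ≤ r := by
    by_cases h : ∃ i, P i ∈ σ
    · obtain ⟨i, hi⟩ := h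
      rw [hsum i hi]
      exact min_le_right _ _
    · rw [sum_eq_zero]
      · exact hr
      · intro i _
        by_contra h1
        exact h ⟨i, hne i h1⟩
  refine ⟨?_, ?_, ?_⟩
  · rintro (b | _ | i)
    · simp only [recover]
      by_cases hb : ∃ i, P i = b
      · obtain ⟨i, rfl⟩ := hb
        rw [hfib]
        exact sub_nonneg.2 (min_le_left _ _)
      · rw [hfib0 b hb]
        simpa using hc b
    · exact sub_nonneg.2 hle
    · exact h0 i
  · classical
    refine ⟨Finset.univ.filter fun a => recover P c r a ≠ 0, ⟨σ, hσ, fun b hb => ?_, fun i hi => ?_, ?_⟩,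
      fun a ha => by simpa using ha⟩
    · by_contra h
      refine (mem_filter.1 hb).2 ?_
      simp [recover, hcσ b h, hr]
    · have h1 := (mem_filter.1 hi.1).2
      have h2 := (mem_filter.1 hi.2).2
      simp only [recover] at h1 h2
      rw [hfib] at h1
      have h3 : r ≤ c (P i) := by
        by_contra! h
        exact h1 (by rw [min_eq_left h.le, sub_self])
      have h4 : P i ∈ σ := by
        by_contra h
        rw [hcσ _ h, min_eq_left hr, sub_self] at h1
        exact h1 rfl
      rw [hsum i h4, min_eq_right h3, sub_self] at h2
      exact h2 rfl
    · by_cases h : ∃ i, P i ∈ σ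
      · obtain ⟨i, hi⟩ := h
        refine Or.inr ⟨i, hi, fun j hj => ?_⟩
        by_contra hji
        exact hP' σ hσ j i hji ⟨hne j (mem_filter.1 hj).2, hi⟩
      · exact Or.inl fun j hj => h ⟨j, hne j (mem_filter.1 hj).2⟩
  · refine Prod.ext ?_ ?_
    · rw [fst_sum_tildeRealGen]
      refine sum_congr rfl fun b _ => ?_
      congr 1
      simp only [recover]
      rw [sub_add, sub_eq_self, sub_eq_zero]
      exact sum_congr rfl fun i hi => by rw [(mem_filter.1 hi).2]
    · rw [snd_sum_tildeRealGen]
      simp [recover]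

end Complete

end

/-! ### Topology and charts of tropical spaces -/

section

open TildeRay Filter Topology

section Support

variable {X : Scheme.{u}} {A : Type} [Fintype A] {D : A → Closeds X}

open Classical in
/-- The cone whose relative interior contains `x`. -/
def tropSupport (x : TropSpace D) : Finset A := Finset.univ.filter fun a => x.1 a ≠ 0

theorem mem_tropSupport {x : TropSpace D} {a : A} : a ∈ tropSupport x ↔ x.1 a ≠ 0 := by
  simp [tropSupport]

theorem tropSupport_subset {x : TropSpace D} {T : Finset A} : tropSupport x ⊆ T ↔ x ∈ tropCell D T :=
  ⟨fun h a ha => by_contra fun hx => ha (h (mem_tropSupport.2 hx)),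
    fun h a ha => by_contra fun hT => mem_tropSupport.1 ha (h a hT)⟩

theorem tropSupport_mem (x : TropSpace D) : tropSupport x ∈ tropCones D := by
  obtain ⟨T, ⟨p, hp⟩, hx⟩ := x.2.2
  exact ⟨p, Set.biInter_subset_biInter_left (tropSupport_subset.2 hx) hp⟩

theorem mem_tropStar {x : TropSpace D} {T : Finset A} : x ∈ tropStar D T ↔ T ⊆ tropSupport x := by
  refine ⟨?_, fun h => ⟨_, tropSupport_mem x, h, fun a => mem_tropSupport.symm⟩⟩
  rintro ⟨S, -, hTS, hx⟩ a ha
  exact mem_tropSupport.2 ((hx a).2 (hTS ha))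

theorem continuous_coord (a : A) : Continuous fun x : TropSpace D => x.1 a :=
  (continuous_apply a).comp continuous_subtype_val

theorem isOpen_tropStar (T : Finset A) : IsOpen (tropStar D T) := by
  have : tropStar D T = ⋂ a ∈ T, {x | x.1 a ≠ 0} := by
    ext x
    simp [mem_tropStar, Finset.subset_iff, mem_tropSupport]
  rw [this]
  exact isOpen_biInter_finset fun a _ => isOpen_ne_fun (continuous_coord a) continuous_const

theorem eventually_tropSupport (x : TropSpace D) : ∀ᶠ y in 𝓝 x, tropSupport x ⊆ tropSupport y :=
  Filter.mem_of_superset ((isOpen_tropStar _).mem_nhds (mem_tropStar.2 (subset_refl (tropSupport x))))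
    fun _ => mem_tropStar.1

theorem isClosed_tropCell (T : Finset A) : IsClosed (tropCell D T) := by
  have : tropCell D T = ⋂ a, ⋂ _ : a ∉ T, {x | x.1 a = 0} := by
    ext x
    simp [tropCell]
  rw [this]
  exact isClosed_iInter fun a => isClosed_iInter fun _ =>
    isClosed_eq (continuous_coord a) continuous_const

theorem notMem_tropDiscriminant {x : TropSpace D} {N : ℕ} (h : x ∉ tropDiscriminant D N) :
    N < (tropSupport x).card + 2 := by
  by_contra! h'
  exact h ⟨_, tropSupport_mem x, h', tropSupport_subset.1 subset_rfl⟩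

theorem tropStar_subset_compl {T : Finset A} {N : ℕ} (hT : T.card + 1 = N) :
    tropStar D T ⊆ (tropDiscriminant D N)ᶜ := by
  rintro x hx ⟨S, -, hS, hxS⟩
  have := Finset.card_le_card ((mem_tropStar.1 hx).trans (tropSupport_subset.2 hxS))
  omega

variable {E : Type} [NormedAddCommGroup E] [NormedSpace ℝ E]

/-- The piecewise linear map with prescribed values on the generators of the cones. -/
def tropMap (D : A → Closeds X) (w : A → E) (x : TropSpace D) : E := ∑ a, x.1 a • w a

theorem continuous_tropMap (w : A → E) : Continuous (tropMap D w) :=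
  continuous_finset_sum _ fun a _ => (continuous_coord a).smul continuous_const

theorem eventually_tropMap {x : TropSpace D} {w w' : A → E} {θ : E →ₗ[ℝ] E}
    (h : ∀ S ∈ tropCones D, tropSupport x ⊆ S → ∀ a ∈ S, θ (w a) = w' a) :
    ∀ᶠ y in 𝓝 x, tropMap D w' y = θ (tropMap D w y) := by
  filter_upwards [eventually_tropSupport x] with y hy
  rw [tropMap, tropMap, map_sum]
  refine sum_congr rfl fun a _ => ?_
  rw [map_smul]
  by_cases ha : y.1 a = 0
  · rw [ha, zero_smul, zero_smul]
  · rw [h _ (tropSupport_mem y) hy a (mem_tropSupport.2 ha)]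

end Support

section Slide

variable {X : Scheme.{u}} {A : Type} [Fintype A] [DecidableEq A] {D : A → Closeds X}

open Classical in
/-- Add the affine function `u = N + ∑ x_a μ_a` to the `h`-th coordinate of `x`, wherever that keeps
the coordinate positive. -/
def slide (D : A → Closeds X) (h : A) (μ : A → ℝ) (N : ℝ) (x : TropSpace D) :
    TropSpace D :=
  if hx : 0 < x.1 h ∧ 0 < x.1 h + (N + tropMap D μ x) then
    ⟨Function.update x.1 h (x.1 h + (N + tropMap D μ x)), fun a => by
        rcases eq_or_ne a h with rfl | ha
        · simpa using hx.2.le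
        · simpa [ha] using x.2.1 a,
      x.2.2.imp fun T hT => ⟨hT.1, fun a ha => by
        have : a ≠ h := by
          rintro rfl
          exact hx.1.ne' (hT.2 a ha)
        simpa [this] using hT.2 a ha⟩⟩
  else x

variable {h : A} {μ : A → ℝ} {N : ℝ} {x : TropSpace D}

theorem slide_val (h0 : 0 < x.1 h) (h1 : 0 < x.1 h + (N + tropMap D μ x)) :
    (slide D h μ N x).1 = Function.update x.1 h (x.1 h + (N + tropMap D μ x)) :=
  congrArg Subtype.val (dif_pos ⟨h0, h1⟩)

theorem tropMap_slide {E : Type} [NormedAddCommGroup E] [NormedSpace ℝ E] (w : A → E)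
    (h0 : 0 < x.1 h) (h1 : 0 < x.1 h + (N + tropMap D μ x)) :
    tropMap D w (slide D h μ N x) = tropMap D w x + (N + tropMap D μ x) • w h := by
  have h2 : ∑ a ∈ Finset.univ.erase h, (slide D h μ N x).1 a • w a =
      ∑ a ∈ Finset.univ.erase h, x.1 a • w a :=
    sum_congr rfl fun a ha => by
      rw [slide_val h0 h1, Function.update_of_ne (Finset.ne_of_mem_erase ha)]
  have h3 := Finset.add_sum_erase _ (fun a => (slide D h μ N x).1 a • w a) (mem_univ h)
  have h4 := Finset.add_sum_erase _ (fun a => x.1 a • w a) (mem_univ h)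
  simp only [h2] at h3
  have h5 : (slide D h μ N x).1 h = x.1 h + (N + tropMap D μ x) := by
    rw [slide_val h0 h1, Function.update_self]
  rw [h5, add_smul, add_right_comm, h4] at h3
  exact h3.symm

theorem tropSupport_slide (h0 : 0 < x.1 h) (h1 : 0 < x.1 h + (N + tropMap D μ x)) :
    tropSupport (slide D h μ N x) = tropSupport x := by
  ext a
  rw [mem_tropSupport, mem_tropSupport, slide_val h0 h1]
  rcases eq_or_ne a h with rfl | ha
  · simpa [h1.ne'] using h0.ne'
  · simp [ha]

variable (hμ : μ h = 0)
include hμ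

/-- The function that is added does not involve the coordinate that is changed, so the slide with
the opposite function is inverse to the slide. -/
theorem slide_slide (h0 : 0 < x.1 h) (h1 : 0 < x.1 h + (N + tropMap D μ x)) :
    slide D h (-μ) (-N) (slide D h μ N x) = x := by
  have h2 : tropMap D (-μ) (slide D h μ N x) = -tropMap D μ x := by
    rw [tropMap_slide _ h0 h1, Pi.neg_apply, hμ, neg_zero, smul_zero, add_zero]
    simp [tropMap]
  have h3 : (slide D h μ N x).1 h = x.1 h + (N + tropMap D μ x) := by
    rw [slide_val h0 h1, Function.update_self]
  refine Subtype.ext ?_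
  rw [slide_val (by rw [h3]; exact h1) (by rw [h3, h2]; linarith), h3, h2, slide_val h0 h1,
    Function.update_idem]
  convert Function.update_eq_self h x.1 using 2
  ring

omit hμ in
theorem eventually_slide (h0 : 0 < x.1 h) (h1 : 0 < x.1 h + (N + tropMap D μ x)) :
    ∀ᶠ y in 𝓝 x, 0 < y.1 h ∧ 0 < y.1 h + (N + tropMap D μ y) :=
  ((continuous_coord h).continuousAt.eventually_const_lt h0).and
    (((continuous_coord h).add (continuous_const.add (continuous_tropMap μ))).continuousAt
      |>.eventually_const_lt h1)

omit hμ in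
theorem tendsto_slide (h0 : 0 < x.1 h) (h1 : 0 < x.1 h + (N + tropMap D μ x)) :
    Tendsto (slide D h μ N) (𝓝 x) (𝓝 (slide D h μ N x)) := by
  refine tendsto_subtype_rng.2 ?_
  have h2 : Continuous fun y : TropSpace D =>
      Function.update y.1 h (y.1 h + (N + tropMap D μ y)) :=
    continuous_subtype_val.update h
      ((continuous_coord h).add (continuous_const.add (continuous_tropMap μ)))
  rw [slide_val h0 h1]
  refine (h2.tendsto x).congr' ?_
  filter_upwards [eventually_slide h0 h1] with y hy
  rw [slide_val hy.1 hy.2]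

theorem map_slide_nhds (h0 : 0 < x.1 h) (h1 : 0 < x.1 h + (N + tropMap D μ x)) :
    map (slide D h μ N) (𝓝 x) = 𝓝 (slide D h μ N x) := by
  refine le_antisymm (tendsto_slide h0 h1) fun s hs => ?_
  set y := slide D h μ N x with hy
  have hyx := slide_slide hμ h0 h1
  have h3 : y.1 h = x.1 h + (N + tropMap D μ x) := by rw [hy, slide_val h0 h1, Function.update_self]
  have h4 : tropMap D (-μ) y = -tropMap D μ x := by
    rw [hy, tropMap_slide _ h0 h1, Pi.neg_apply, hμ, neg_zero, smul_zero, add_zero]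
    simp [tropMap]
  have h5 : 0 < y.1 h := h3 ▸ h1
  have h6 : 0 < y.1 h + (-N + tropMap D (-μ) y) := by rw [h3, h4]; linarith
  have h7 := tendsto_slide h5 h6
  rw [hyx] at h7
  filter_upwards [h7 hs, eventually_slide h5 h6] with z hz hz'
  have h8 := slide_slide (by rw [Pi.neg_apply, hμ, neg_zero]) hz'.1 hz'.2
  rw [neg_neg, neg_neg] at h8
  rw [← h8]
  exact hz

end Slide

section Charts

theorem mem_halfSpace_of_map_nhds {n : ℕ} {B : Type} [TopologicalSpace B]
    {f : B → (Fin n → ℝ) × ℝ} {x : B} (hf : map f (𝓝 x) = 𝓝[{y | 0 ≤ y.2}] (f x)) :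
    0 ≤ (f x).2 := by
  have h1 : {y : (Fin n → ℝ) × ℝ | 0 ≤ y.2} ∈ map f (𝓝 x) := by rw [hf]; exact self_mem_nhdsWithin
  exact (mem_of_mem_nhds (s := f ⁻¹' {y | 0 ≤ y.2}) h1 :)

/-- An injective map that is open onto a half-space is a chart. -/
def halfSpaceChart {n : ℕ} {B : Type} [TopologicalSpace B] (O : Set B) (hO : IsOpen O)
    (f : B → (Fin n → ℝ) × ℝ) (hinj : Set.InjOn f O)
    (hf : ∀ x ∈ O, map f (𝓝 x) = 𝓝[{y | 0 ≤ y.2}] (f x)) :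
    AffineChart ((Fin n → ℝ) × ℝ) B where
  source := O
  isOpen_source := hO
  toFun := f
  isEmbedding := by
    have hmem : ∀ x ∈ O, f x ∈ {y : (Fin n → ℝ) × ℝ | 0 ≤ y.2} := fun x hx =>
      mem_halfSpace_of_map_nhds (hf x hx)
    refine ⟨isInducing_iff_nhds.2 fun x => ?_, Set.injOn_iff_injective.1 hinj⟩
    have h1 : map (O.domRestrict f) (𝓝 x) = 𝓝[{y | 0 ≤ y.2}] (f x) := by
      rw [← hf x x.2, ← map_nhds_subtype_coe_eq_nhds x.2 (hO.mem_nhds x.2), map_map]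
      rfl
    rw [← comap_map (Set.injOn_iff_injective.1 hinj) (f := 𝓝 x), h1, nhdsWithin, comap_inf,
      comap_principal, inf_eq_left.2]
    · rfl
    · rw [le_principal_iff]
      exact univ_mem' fun y => hmem y y.2
  locally_half x hx := by
    rcases lt_or_ge 0 (f x).2 with h | h
    · left
      rw [hf x hx]
      exact nhdsWithin_eq_nhds.2 ((continuous_snd.tendsto (f x)).eventually (eventually_ge_nhds h))
    · refine Or.inr ⟨LinearMap.snd ℝ _ _, fun h => ?_, ?_⟩
      · simpa using LinearMap.congr_fun h (0, 1)
      · rw [hf x hx]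
        simp [le_antisymm h (mem_halfSpace_of_map_nhds (hf x hx))]

variable {E : Type} [NormedAddCommGroup E] [NormedSpace ℝ E] {Λ : AddSubgroup E}
  {B : Type} [TopologicalSpace B] {x : B} {f g h : B → E}

/-- Near `x`, the maps `f` and `g` differ by an integral affine transformation. -/
def CompatAt (Λ : AddSubgroup E) (x : B) (f g : B → E) : Prop :=
  ∃ (θ : E ≃ₗ[ℝ] E) (b : E), (∀ v, θ v ∈ Λ ↔ v ∈ Λ) ∧ b ∈ Λ ∧ ∀ᶠ y in 𝓝 x, g y = θ (f y) + b

theorem CompatAt.of_linear {θ : E ≃ₗ[ℝ] E} (hθ : ∀ v, θ v ∈ Λ ↔ v ∈ Λ)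
    (h : ∀ᶠ y in 𝓝 x, g y = θ (f y)) : CompatAt Λ x f g :=
  ⟨θ, 0, hθ, Λ.zero_mem, by simpa using h⟩

theorem CompatAt.of_eventuallyEq (h : ∀ᶠ y in 𝓝 x, g y = f y) : CompatAt Λ x f g :=
  .of_linear (θ := LinearEquiv.refl ℝ E) (fun _ => Iff.rfl) h

theorem CompatAt.symm : CompatAt Λ x f g → CompatAt Λ x g f := by
  rintro ⟨θ, b, hθ, hb, h⟩
  refine ⟨θ.symm, -θ.symm b, fun v => ?_, ?_, h.mono fun y hy => by simp [hy]⟩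
  · rw [← hθ, LinearEquiv.apply_symm_apply]
  · rw [Λ.neg_mem_iff, ← hθ, LinearEquiv.apply_symm_apply]
    exact hb

theorem CompatAt.trans : CompatAt Λ x f g → CompatAt Λ x g h → CompatAt Λ x f h := by
  rintro ⟨θ, b, hθ, hb, h⟩ ⟨θ', b', hθ', hb', h'⟩
  refine ⟨θ.trans θ', θ' b + b', fun v => by simp [hθ, hθ'], Λ.add_mem ((hθ' b).2 hb) hb', ?_⟩
  filter_upwards [h, h'] with y hy hy'
  simp [hy, hy', add_assoc]

/-- The maximal atlas that contains a given atlas. -/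
def atlas (S : Set B) (C : Set (AffineChart E B)) (hS : ∀ c ∈ C, c.source ⊆ S)
    (hcov : ∀ x ∈ S, ∃ c ∈ C, x ∈ c.source)
    (hC : ∀ c ∈ C, ∀ c' ∈ C, c.Compatible Λ c') : IntegralAffineStructure Λ S where
  charts := {e | e.source ⊆ S ∧ ∀ c ∈ C, e.Compatible Λ c}
  source_subset _ h := h.1
  covers x hx := (hcov x hx).imp fun c hc => ⟨⟨hS c hc.1, hC c hc.1⟩, hc.2⟩
  compatible e he e' he' x hx := by
    obtain ⟨c, hc, hxc⟩ := hcov x (he.1 hx.1)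
    exact CompatAt.trans (he.2 c hc x ⟨hx.1, hxc⟩) (CompatAt.symm (he'.2 c hc x ⟨hx.2, hxc⟩))
  maximal e he h := ⟨he, fun c hc => h c ⟨hS c hc, hC c hc⟩⟩

/-- The restriction of an integral affine structure to a smaller set that is covered by charts. -/
def IntegralAffineStructure.restrict {S : Set B} (𝒜 : IntegralAffineStructure Λ S) (S' : Set B)
    (hS : S' ⊆ S) (hcov : ∀ x ∈ S', ∃ c ∈ 𝒜.charts, c.source ⊆ S' ∧ x ∈ c.source) :
    IntegralAffineStructure Λ S' where
  charts := {e ∈ 𝒜.charts | e.source ⊆ S'}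
  source_subset _ h := h.2
  covers x hx := (hcov x hx).imp fun c hc => ⟨⟨hc.1, hc.2.1⟩, hc.2.2⟩
  compatible e he e' he' := 𝒜.compatible e he.1 e' he'.1
  maximal e he h := ⟨𝒜.maximal e (he.trans hS) fun e' he' x hx => by
    obtain ⟨c, hc, hcS, hxc⟩ := hcov x (he hx.1)
    exact CompatAt.trans (h c ⟨hc, hcS⟩ x ⟨hx.1, hxc⟩) (𝒜.compatible c hc e' he' x ⟨hxc, hx.2⟩), he⟩

end Charts

end

/-! ### The map to the half space -/

section

open TildeRay Filter Topology

variable {ι : Type} [Fintype ι] [DecidableEq ι] {n s : ℕ} {F : SmoothFan (Fin n → ℤ) ι}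
  {P : Fin s → ι} {X : Scheme.{u}} {D : TildeRay ι s → Closeds X}

theorem baseCoeff_eq_zero (z : TropSpace D) {b : ι} (hb : b ∉ baseSimplex P (tropSupport z)) :
    z.1 (horizontal b) + ∑ i with P i = b, z.1 (exceptional i) = 0 := by
  rw [mem_base] at hb
  push Not at hb
  rw [sum_eq_zero fun i hi => ?_, add_zero]
  · exact by_contra fun h => hb.1 (mem_tropSupport.2 h)
  · exact by_contra fun h => hb.2 i (mem_tropSupport.2 h) (mem_filter.1 hi).2

theorem baseCoeff_nonneg (z : TropSpace D) (b : ι) :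
    0 ≤ z.1 (horizontal b) + ∑ i with P i = b, z.1 (exceptional i) :=
  add_nonneg (z.2.1 _) (sum_nonneg fun i _ => z.2.1 _)

section Homeomorphism

variable (hF : F.IsCompleteFan) (hP : Function.Injective P)
  (hP' : SeparatedRays F P) (hD : tropCones D = tildeCones F P)

include hF hP hP' hD

theorem Psi_injective : Function.Injective (Psi F P D) := by
  intro x y h
  have hs : ∀ z : TropSpace D, tropSupport z ∈ tildeCones F P := fun z => hD ▸ tropSupport_mem z
  have h0 : ∀ z : TropSpace D, ∀ a ∉ tropSupport z, z.1 a = 0 := fun z =>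
    tropSupport_subset.1 (Finset.Subset.refl _)
  have h1 := congrArg Prod.fst h
  have h2 := congrArg Prod.snd h
  rw [Psi, Psi, fst_sum_tildeRealGen, fst_sum_tildeRealGen] at h1
  rw [Psi, Psi, snd_sum_tildeRealGen, snd_sum_tildeRealGen] at h2
  have h3 := coefficients_unique hF (baseSimplex_mem F P (hs x)) (baseSimplex_mem F P (hs y))
    (baseCoeff_nonneg x) (baseCoeff_nonneg y)
    (fun _ => baseCoeff_eq_zero x) (fun _ => baseCoeff_eq_zero y) h1
  refine Subtype.ext ?_
  rw [eq_recover hP hP' (hs x) x.2.1 (h0 x), eq_recover hP hP' (hs y) y.2.1 (h0 y), h3, h2]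

theorem range_Psi : Set.range (Psi F P D) = {y | 0 ≤ y.2} := by
  ext ⟨m, r⟩
  constructor
  · rintro ⟨x, hx⟩
    rw [Set.mem_setOf_eq, ← hx, Psi, snd_sum_tildeRealGen]
    exact add_nonneg (x.2.1 _) (sum_nonneg fun i _ => x.2.1 _)
  · intro hr
    obtain ⟨σ, hσ, c, hc, hm⟩ := hF.complete m
    obtain ⟨h1, ⟨T, hT, h2⟩, h3⟩ := recover_spec hP hP' hσ (c := fun b => if b ∈ σ then c b else 0)
      (fun b => by split_ifs; exacts [hc b, le_rfl]) (fun b hb => if_neg hb) hr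
    refine ⟨⟨recover P _ r, h1, T, hD ▸ hT, h2⟩, h3.trans (Prod.ext ?_ rfl)⟩
    simp only [ite_smul, zero_smul, Finset.sum_ite_mem, Finset.univ_inter, hm]

theorem isClosedEmbedding_Psi : IsClosedEmbedding (Psi F P D) := by
  refine .of_continuous_injective_isClosedMap (continuous_tropMap (tildeRealGen F P))
    (Psi_injective hF hP hP' hD) fun C hC => ?_
  obtain ⟨C₀, hC₀, rfl⟩ := isClosed_induced_iff.1 hC
  choose χ hχ using fun T : tildeCones F P => exists_coordinate T.2
  -- the coordinates on the linear span of a cone, extended by zero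
  let lam (T : tildeCones F P) (v : (Fin n → ℝ) × ℝ) (a : TildeRay ι s) : ℝ :=
    if a ∈ T.1 then χ T a v else 0
  have hlam : ∀ T, Continuous (lam T) := fun T => continuous_pi fun a => by
    by_cases ha : a ∈ T.1
    · simpa only [lam, if_pos ha] using (χ T a).continuous_of_finiteDimensional
    · simpa only [lam, if_neg ha] using continuous_const
  have himage : Psi F P D '' (Subtype.val ⁻¹' C₀) = ⋃ T : tildeCones F P, {v | lam T v ∈ C₀ ∧
      (∀ a, 0 ≤ lam T v a) ∧ ∑ a, lam T v a • tildeRealGen F P a = v} := by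
    ext v
    simp only [Set.mem_iUnion, Set.mem_setOf_eq]
    constructor
    · rintro ⟨x, hx, rfl⟩
      let T : tildeCones F P := ⟨tropSupport x, hD ▸ tropSupport_mem x⟩
      have h0 : ∀ a ∉ T.1, x.1 a = 0 := tropSupport_subset.1 (Finset.Subset.refl _)
      have h1 : lam T (Psi F P D x) = x.1 := funext fun a => by
        by_cases ha : a ∈ T.1
        · exact (if_pos ha).trans (coordinate_sum (hχ T) h0 ha)
        · exact (if_neg ha).trans (h0 a ha).symm
      refine ⟨T, ?_⟩
      rw [h1]
      exact ⟨hx, x.2.1, rfl⟩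
    · rintro ⟨T, h1, h2, h3⟩
      exact ⟨⟨lam T v, h2, T.1, by rw [hD]; exact T.2, fun a ha => if_neg ha⟩, h1, h3⟩
  rw [himage]
  refine isClosed_iUnion_of_finite fun T => (hC₀.preimage (hlam T)).inter (IsClosed.inter ?_ ?_)
  · show IsClosed {v | ∀ a, 0 ≤ lam T v a}
    rw [Set.setOf_forall]
    exact isClosed_iInter fun a => isClosed_le continuous_const ((continuous_apply a).comp (hlam T))
  · exact isClosed_eq (continuous_finset_sum _ fun a _ =>
      ((continuous_apply a).comp (hlam T)).smul continuous_const) continuous_id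

theorem map_Psi_nhds (x : TropSpace D) :
    map (Psi F P D) (𝓝 x) = 𝓝[{y | 0 ≤ y.2}] (Psi F P D x) := by
  rw [← range_Psi hF hP hP' hD]
  exact (isClosedEmbedding_Psi hF hP hP' hD).isEmbedding.map_nhds_eq x

end Homeomorphism

end

/-! ### Sheared generators and their relations -/

section

open TildeRay Filter Topology

variable {ι : Type} [Fintype ι] [DecidableEq ι] {n s : ℕ} {F : SmoothFan (Fin n → ℤ) ι}
  {P : Fin s → ι}

section Lattice

variable (F P) in
/-- The generators of `Σ~` after a shear in the direction of the generator of `h`. -/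
def shearGen (μ : TildeRay ι s → ℤ) (h a : TildeRay ι s) : (Fin n → ℤ) × ℤ :=
  tildeGen F P a + μ a • tildeGen F P h

variable (F P) in
/-- The sheared generators as real vectors. -/
def shearRealGen (μ : TildeRay ι s → ℤ) (h a : TildeRay ι s) : (Fin n → ℝ) × ℝ :=
  castHom n (shearGen F P μ h a)

theorem shearRealGen_eq (μ : TildeRay ι s → ℤ) (h a : TildeRay ι s) :
    shearRealGen F P μ h a = tildeRealGen F P a + (μ a : ℝ) • tildeRealGen F P h := by
  rw [shearRealGen, shearGen, map_add, map_zsmul, Int.cast_smul_eq_zsmul]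
  rfl

theorem card_le_of_mem {T : Finset (TildeRay ι s)} (hT : T ∈ tildeCones F P) : T.card ≤ n + 1 := by
  obtain ⟨χ, hχ⟩ := exists_coordinate hT
  have h1 : LinearIndependent ℝ fun a : T => tildeRealGen F P a := by
    rw [Fintype.linearIndependent_iff]
    intro g hg a
    have h2 := congrArg (χ a) hg
    simp only [map_sum, map_smul, map_zero, hχ a _ (Subtype.prop _), smul_eq_mul] at h2
    simpa [Subtype.coe_inj] using h2
  simpa using h1.fintype_card_le_finrank

variable {S : Finset (TildeRay ι s)} (hS : S ∈ tildeCones F P) {μ : TildeRay ι s → ℤ}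
  {h : TildeRay ι s} (hμ : μ h = 0) (hh : μ = 0 ∨ h ∈ S)

include hS hμ hh

theorem exists_char_shearGen (c : TildeRay ι s → ℤ) :
    ∃ χ : (Fin n → ℤ) × ℤ →+ ℤ, ∀ a ∈ S, χ (shearGen F P μ h a) = c a := by
  rcases hh with rfl | hh
  · obtain ⟨χ, hχ⟩ := (tildeFan F P).unimodular S hS c
    refine ⟨χ, fun a ha => ?_⟩
    have h1 : χ (tildeGen F P a) = _ := hχ a ha
    simp [shearGen, h1]
  · obtain ⟨χ, hχ⟩ := (tildeFan F P).unimodular S hS fun a => c a - μ a * c h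
    refine ⟨χ, fun a ha => ?_⟩
    have h1 : χ (tildeGen F P a) = _ := hχ a ha
    have h2 : χ (tildeGen F P h) = _ := hχ h hh
    rw [shearGen, map_add, map_zsmul, h1, h2, hμ, smul_eq_mul]
    ring

theorem isLatticeBasis_shearRealGen (hcard : S.card = n + 1) :
    IsLatticeBasis (integralPoints n) (shearRealGen F P μ h) S := by
  choose χ hχ using fun b => exists_char_shearGen hS hμ hh fun a => if a = b then 1 else 0
  let f : (Fin n → ℤ) × ℤ →ₗ[ℤ] S → ℤ := LinearMap.pi fun b => (χ b).toIntLinearMap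
  have hf : ∀ a : S, f (shearGen F P μ h a) = Pi.single a 1 := fun a => funext fun b => by
    have h1 : f (shearGen F P μ h a) b = _ := hχ b a a.2
    simp [h1, Pi.single_apply, Subtype.coe_inj, eq_comm]
  have hsurj : Function.Surjective f := fun c => by
    refine ⟨∑ a, c a • shearGen F P μ h a, ?_⟩
    simp only [map_sum, map_zsmul, hf]
    ext b
    simp [Finset.sum_apply, Pi.single_apply]
  let e : ((Fin n → ℤ) × ℤ) ≃ₗ[ℤ] (S → ℤ) := LinearEquiv.ofFinrankEq _ _ (by simp [hcard])
  have hinj : Function.Injective f := by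
    have h1 := OrzechProperty.injective_of_surjective_endomorphism (f ∘ₗ e.symm.toLinearMap)
      (hsurj.comp e.symm.surjective)
    intro v w hvw
    exact e.injective (h1 (by simpa using hvw))
  let β := Module.Basis.ofEquivFun (LinearEquiv.ofBijective f ⟨hinj, hsurj⟩)
  have hβ : ∀ a : S, β a = shearGen F P μ h a := fun a => by
    apply hinj
    rw [hf, Module.Basis.coe_ofEquivFun]
    exact LinearEquiv.apply_symm_apply (LinearEquiv.ofBijective f ⟨hinj, hsurj⟩) _
  let τ : ((Fin n → ℤ) × ℤ) ≃ₗ[ℤ] integralPoints n :=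
    (AddMonoidHom.ofInjective castHom_injective).toIntLinearEquiv
  exact ⟨β.map τ, fun a => by rw [Module.Basis.map_apply, hβ]; rfl⟩

theorem exists_sum_shearGen (hcard : S.card = n + 1) (v : (Fin n → ℤ) × ℤ) :
    ∃ c : TildeRay ι s → ℤ, v = ∑ a ∈ S, c a • shearGen F P μ h a := by
  obtain ⟨β, hβ⟩ := isLatticeBasis_shearRealGen hS hμ hh hcard
  have h1 := congrArg Subtype.val (β.sum_repr ⟨castHom n v, castHom_mem v⟩)
  refine ⟨fun a => if ha : a ∈ S then β.repr ⟨castHom n v, castHom_mem v⟩ ⟨a, ha⟩ else 0,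
    castHom_injective ?_⟩
  rw [AddSubgroup.val_finset_sum] at h1
  rw [← Finset.sum_coe_sort, map_sum]
  refine (show castHom n v = _ from h1.symm).trans ?_
  refine sum_congr rfl fun a _ => ?_
  beta_reduce
  rw [AddSubgroup.coe_zsmul, hβ, dif_pos a.2, map_zsmul]
  rfl

end Lattice

section Relations

variable {X : Scheme.{u}} {D : TildeRay ι s → Closeds X}
  (hF : F.IsCompleteFan) (hP : Function.Injective P)
  (hP' : SeparatedRays F P) (hD : tropCones D = tildeCones F P)

include hF hP hP' hD

/-- The fan `Σ~` is pure, since a neighbourhood of a point in the interior of a maximal cone maps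
onto a neighbourhood in the half-space. -/
theorem exists_full {T : Finset (TildeRay ι s)} (hT : T ∈ tildeCones F P) :
    ∃ S ∈ tildeCones F P, T ⊆ S ∧ S.card = n + 1 := by
  obtain ⟨S, hTS, hS⟩ := (Set.toFinite (tildeCones F P)).exists_le_maximal hT
  refine ⟨S, hS.1, hTS, (card_le_of_mem hS.1).antisymm ?_⟩
  let x : TropSpace D := ⟨fun a => if a ∈ S then 1 else 0, fun a => by beta_reduce; split_ifs <;> simp, S,
    by rw [hD]; exact hS.1, fun a ha => if_neg ha⟩
  have hxS : S ⊆ tropSupport x := fun a ha => mem_tropSupport.2 (by simp [x, ha])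
  let W : Submodule ℝ ((Fin n → ℝ) × ℝ) := Submodule.span ℝ (S.image (tildeRealGen F P))
  have hW : (W : Set ((Fin n → ℝ) × ℝ)) ∈ 𝓝[{y | 0 ≤ y.2}] (Psi F P D x) := by
    rw [← map_Psi_nhds hF hP hP' hD]
    refine Filter.mem_map.2 ?_
    filter_upwards [(isOpen_tropStar S).mem_nhds (mem_tropStar.2 hxS)] with y hy
    have h1 : tropSupport y ⊆ S := hS.2 (by rw [← hD]; exact tropSupport_mem y) (mem_tropStar.1 hy)
    refine Submodule.sum_mem _ fun a _ => ?_
    by_cases ha : a ∈ S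
    · exact W.smul_mem _ (Submodule.subset_span (Finset.mem_coe.2 (Finset.mem_image_of_mem _ ha)))
    · rw [tropSupport_subset.1 h1 a ha, zero_smul]
      exact W.zero_mem
  have h0 : Psi F P D x ∈ {y : (Fin n → ℝ) × ℝ | 0 ≤ y.2} :=
    mem_halfSpace_of_map_nhds (map_Psi_nhds hF hP hP' hD x)
  have hpos : ∀ v : (Fin n → ℝ) × ℝ, 0 ≤ v.2 → v ∈ W := fun v hv => by
    have h1 : Tendsto (fun t : ℝ => Psi F P D x + t • v) (𝓝[>] 0)
        (𝓝[{y | 0 ≤ y.2}] (Psi F P D x)) := by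
      refine tendsto_nhdsWithin_iff.2 ⟨?_, ?_⟩
      · have h2 : Continuous fun t : ℝ => Psi F P D x + t • v := by fun_prop
        simpa using (h2.tendsto 0).mono_left nhdsWithin_le_nhds
      · filter_upwards [self_mem_nhdsWithin] with t ht
        exact add_nonneg h0 (mul_nonneg (le_of_lt ht) hv)
    obtain ⟨t, ht, ht0⟩ := ((h1.eventually (p := (· ∈ W)) hW).and self_mem_nhdsWithin).exists
    have h3 := W.sub_mem ht (mem_of_mem_nhdsWithin h0 hW)
    rw [add_sub_cancel_left] at h3
    exact (W.smul_mem_iff (ne_of_gt ht0)).1 h3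
  have htop : W = ⊤ := eq_top_iff.2 fun v _ => by
    rcases le_total 0 v.2 with hv | hv
    · exact hpos v hv
    · exact W.neg_mem_iff.1 (hpos (-v) (by simpa using hv))
  have h4 := (finrank_span_finset_le_card (R := ℝ) (S.image (tildeRealGen F P))).trans
    Finset.card_image_le
  change Module.finrank ℝ W ≤ _ at h4
  rw [htop, finrank_top] at h4
  simpa using h4

variable {T : Finset (TildeRay ι s)} {c c' : TildeRay ι s} (hc : c ∉ T) (hc' : c' ∉ T)
  (hcc' : c ≠ c') (hS : insert c T ∈ tildeCones F P) (hS' : insert c' T ∈ tildeCones F P)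

include hc hc' hcc' hS hS'

/-- Two cones with a common facet do not lie on the same side of it. -/
theorem not_same_side (d : TildeRay ι s → ℤ) :
    tildeGen F P c' ≠ tildeGen F P c + ∑ b ∈ T, d b • tildeGen F P b := by
  intro heq
  let N : ℝ := ∑ b ∈ T, |(d b : ℝ)|
  have hN : ∀ b ∈ T, 0 ≤ N + d b := fun b hb => by
    have h1 := Finset.single_le_sum (f := fun b => |(d b : ℝ)|) (fun _ _ => abs_nonneg _) hb
    have h2 := neg_abs_le (d b : ℝ)
    have h3 : |(d b : ℝ)| ≤ N := h1
    linarith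
  let pt (e : TildeRay ι s) (f : TildeRay ι s → ℝ) (he : insert e T ∈ tildeCones F P)
      (hf : ∀ b ∈ T, 0 ≤ f b) : TropSpace D :=
    ⟨fun a => if a = e then 1 else if a ∈ T then f a else 0,
      fun a => by beta_reduce; split_ifs with h1 h2; exacts [zero_le_one, hf a h2, le_rfl],
      insert e T, by rw [hD]; exact he, fun a ha => by
        rw [mem_insert, not_or] at ha
        beta_reduce
        rw [if_neg ha.1, if_neg ha.2]⟩
  have hpt : ∀ e f he hf, e ∉ T → Psi F P D (pt e f he hf) =
      tildeRealGen F P e + ∑ b ∈ T, f b • tildeRealGen F P b := by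
    intro e f he hf heT
    have h1 : ∀ a, (pt e f he hf).1 a • tildeRealGen F P a =
        (if a = e then tildeRealGen F P a else 0) +
          if a ∈ T then f a • tildeRealGen F P a else 0 := fun a => by
      by_cases hae : a = e
      · subst hae
        simp [pt, heT]
      · by_cases haT : a ∈ T <;> simp [pt, hae, haT]
    rw [Psi, sum_congr rfl fun a _ => h1 a, sum_add_distrib, Finset.sum_ite_eq',
      if_pos (mem_univ _), Finset.sum_ite_mem, Finset.univ_inter]
  have hreal : tildeRealGen F P c' =
      tildeRealGen F P c + ∑ b ∈ T, (d b : ℝ) • tildeRealGen F P b := by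
    have h1 := congrArg (castHom n) heq
    simp only [map_add, map_sum, map_zsmul, ← Int.cast_smul_eq_zsmul ℝ] at h1
    exact h1
  have hN' : ∀ b ∈ T, 0 ≤ N := fun _ _ => sum_nonneg fun _ _ => abs_nonneg _
  have h1 : pt c' (fun _ => N) hS' hN' = pt c (fun b => N + d b) hS hN :=
    Psi_injective hF hP hP' hD (by
      rw [hpt c' _ hS' hN' hc', hpt c _ hS hN hc, hreal, add_assoc, ← sum_add_distrib]
      simp only [add_smul, add_comm])
  have h2 := congrFun (congrArg Subtype.val h1) c'
  simp [pt, hcc'.symm, hc'] at h2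

variable (hcard : T.card = n)
include hcard

theorem exists_relation_shearGen {μ : TildeRay ι s → ℤ} {h : TildeRay ι s} (hμ : μ h = 0)
    (hh : μ = 0 ∨ h ∈ T) : ∃ d : TildeRay ι s → ℤ,
      shearGen F P μ h c + shearGen F P μ h c' + ∑ b ∈ T, d b • shearGen F P μ h b = 0 := by
  have hcard' : (insert c T).card = n + 1 := by rw [Finset.card_insert_of_notMem hc, hcard]
  have h0 : ∀ a, shearGen F P 0 h a = tildeGen F P a := fun a => by simp [shearGen]
  obtain ⟨e, he⟩ := exists_sum_shearGen (μ := 0) (h := h) hS rfl (Or.inl rfl) hcard' (tildeGen F P c')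
  simp only [h0, sum_insert hc] at he
  obtain ⟨χ, hχ⟩ := (tildeFan F P).unimodular _ hS' fun a => if a = c' then 1 else 0
  have hχT : ∀ b ∈ T, χ (tildeGen F P b) = 0 := fun b hb =>
    (hχ b (mem_insert_of_mem hb)).trans (if_neg fun hbc : b = c' => hc' (hbc ▸ hb))
  have h1 := congrArg χ he
  rw [map_add, map_sum, map_zsmul, sum_eq_zero fun b hb => by rw [map_zsmul, hχT b hb,
    smul_zero], add_zero, show χ (tildeGen F P c') = 1 from
    (hχ c' (mem_insert_self _ _)).trans (if_pos rfl), smul_eq_mul] at h1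
  have h2 : e c = -1 := (Int.eq_one_or_neg_one_of_mul_eq_one h1.symm).resolve_left fun h2 =>
    not_same_side hF hP hP' hD hc hc' hcc' hS hS' e (by rw [he, h2, one_smul])
  have hplain : tildeGen F P c + tildeGen F P c' + ∑ b ∈ T, (-e b) • tildeGen F P b = 0 := by
    simp only [he, h2, neg_smul, Finset.sum_neg_distrib, one_smul]
    abel
  rcases hh with rfl | hh
  · exact ⟨fun b => -e b, by simpa only [h0] using hplain⟩
  · -- the shear changes the sum by a multiple of the generator of `h`
    let m : ℤ := μ c + μ c' + ∑ b ∈ T, -e b * μ b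
    refine ⟨fun b => -e b - if b = h then m else 0, ?_⟩
    have h3 : ∑ b ∈ T, (-e b - if b = h then m else 0) • shearGen F P μ h b =
        ∑ b ∈ T, (-e b) • tildeGen F P b + (∑ b ∈ T, -e b * μ b) • tildeGen F P h -
          m • tildeGen F P h := by
      simp only [sub_smul, Finset.sum_sub_distrib, ite_smul, zero_smul, Finset.sum_ite_eq',
        if_pos hh]
      congr 1
      · rw [sum_smul, ← sum_add_distrib]
        exact sum_congr rfl fun b _ => by rw [shearGen, smul_add, smul_smul]
      · rw [shearGen, hμ, zero_smul, add_zero]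
    rw [h3, shearGen, shearGen, eq_neg_of_add_eq_zero_right hplain]
    simp only [m, add_smul]
    abel

theorem eq_or_eq_of_insert_mem {c'' : TildeRay ι s} (hc'' : c'' ∉ T)
    (hS'' : insert c'' T ∈ tildeCones F P) : c'' = c ∨ c'' = c' := by
  by_contra! hne
  obtain ⟨d, hd⟩ := exists_relation_shearGen hF hP hP' hD hc hc' hcc' hS hS' hcard (μ := 0)
    (h := vertical) rfl (Or.inl rfl)
  obtain ⟨d', hd'⟩ := exists_relation_shearGen hF hP hP' hD hc hc'' hne.1.symm hS hS'' hcard (μ := 0)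
    (h := vertical) rfl (Or.inl rfl)
  refine not_same_side hF hP hP' hD hc'' hc' hne.2 hS'' hS' (fun b => d' b - d b) ?_
  simp only [shearGen, Pi.zero_apply, zero_smul, add_zero] at hd hd'
  simp only [sub_smul, Finset.sum_sub_distrib]
  rw [← sub_eq_zero, ← sub_eq_zero.2 (hd.trans hd'.symm)]
  abel

end Relations

local notation "F̃" => tildeFan F P

section Reference

variable (P) in
/-- The direction of the shear of the reference chart with index `o`; there is no shear for `none`,
and any ray will do. -/
def refRay : Option (Fin s) → TildeRay ι s
  | none => vertical
  | some i => horizontal (P i)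

variable (F P) in
/-- The coefficients of the shear of the reference chart with index `o`. -/
def refTwist (a : Fin s → ι → ℤ) : Option (Fin s) → TildeRay ι s → ℤ
  | none => 0
  | some i => twist F P a i

variable (F P) in
/-- The images of the generators of the cones under the reference chart: `Ψ` for `none`, and the sheared
chart on the open star of `ρ~_i` for `some i`. -/
def refGen (a : Fin s → ι → ℤ) (o : Option (Fin s)) : TildeRay ι s → (Fin n → ℝ) × ℝ :=
  shearRealGen F P (refTwist F P a o) (refRay P o)

variable (P) in
/-- The reference chart with index `o` is the one that extends to a neighbourhood of the relative
interior of `T`. -/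
def IsFrame (T : Finset (TildeRay ι s)) (o : Option (Fin s)) : Prop :=
  ∀ i, (horizontal (P i) ∈ T ∧ exceptional i ∈ T) ↔ o = some i

variable {a : Fin s → ι → ℤ} {T : Finset (TildeRay ι s)} {o : Option (Fin s)}

theorem refTwist_refRay : refTwist F P a o (refRay P o) = 0 := by
  cases o
  exacts [rfl, twist_self _ _]

theorem refTwist_eq_zero_or (h : ∀ i, o = some i → horizontal (P i) ∈ T) :
    refTwist F P a o = 0 ∨ refRay P o ∈ T := by
  cases o
  exacts [Or.inl rfl, Or.inr (h _ rfl)]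

theorem exists_isFrame (hP' : SeparatedRays F P)
    (hT : T ∈ tildeCones F P) : ∃ o, IsFrame P T o := by
  by_cases h : ∃ i, horizontal (P i) ∈ T ∧ exceptional i ∈ T
  · obtain ⟨i, hi⟩ := h
    refine ⟨some i, fun j => ⟨fun hj => ?_, fun hj => Option.some_injective _ hj ▸ hi⟩⟩
    rw [eq_of_horizontal_mem hP' (S := ⟨T, hT⟩) hi.1 hj.1]
  · exact ⟨none, fun j => ⟨fun hj => absurd ⟨j, hj⟩ h, fun hj => by simp at hj⟩⟩

theorem isAdmissible_of_card (hP' : SeparatedRays F P)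
    (hT : T ∈ tildeCones F P) (hcard : T.card = n + 1) : IsAdmissible P T := by
  obtain ⟨S, hTS, hS⟩ := exists_admissible_ge hP' ⟨T, hT⟩
  have h : T = S.1 := Finset.eq_of_subset_of_card_le hTS ((card_le_of_mem S.2).trans hcard.ge)
  rwa [h]

theorem isLatticeBasis_refGen {S : Finset (TildeRay ι s)} (hS : S ∈ tildeCones F P)
    (hcard : S.card = n + 1) (h : ∀ i, o = some i → horizontal (P i) ∈ S) :
    IsLatticeBasis (integralPoints n) (refGen F P a o) S :=
  isLatticeBasis_shearRealGen hS refTwist_refRay (refTwist_eq_zero_or h) hcard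

theorem eq_of_card_le {S S' : Finset (TildeRay ι s)} (hS' : S' ∈ tildeCones F P)
    (hcard : n + 1 ≤ S.card) (h : S ⊆ S') : S = S' :=
  Finset.eq_of_subset_of_card_le h ((card_le_of_mem hS').trans hcard)

end Reference

section Relation

variable {k : Type u} [Field k] [IsAlgClosed k] [CharZero k]
  {J : ∀ i, (F.divisorScheme k (P i)).IdealSheafData} {X : Scheme.{u}}
  {π : X ⟶ (tildeFan F P).toricScheme k} (hF : F.IsCompleteFan) (hP : Function.Injective P)
  (hP' : SeparatedRays F P)
  (hπ : IsBlowup π (vanishingIdeal (tildeCenter F P k J)))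
  {a : Fin s → ι → ℤ} {g : Fin s → AddMonoidAlgebra k ((Fin n → ℤ) →+ ℤ)}
  (hg : ∀ i, F.IsEquation (P i) (hypersurfaceSet J i) (a i) (g i))

include hF hP hP' hπ hg

/-- The reference chart of a facet satisfies the relation that defines the affine structure along
this facet. -/
theorem refGen_add_refGen {T : Finset (TildeRay ι s)} {o : Option (Fin s)} (ho : IsFrame P T o)
    (hcard : T.card = n) {c c' : TildeRay ι s} (hc : c ∉ T) (hc' : c' ∉ T) (hcc' : c ≠ c')
    (hS : insert c T ∈ tildeCones F P) (hS' : insert c' T ∈ tildeCones F P) :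
    refGen F P a o c + refGen F P a o c' = -∑ b ∈ T,
      (intersectionNumber (π ≫ F̃.toSpec k) (tildeDivisor F P k J π b)
        (stratum (tildeDivisor F P k J π) T) : ℝ) • refGen F P a o b := by
  have hD := tropCones_tildeDivisor hP' hg hπ
  have hmem : ∀ i, o = some i → horizontal (P i) ∈ T := fun i hi => ((ho i).2 hi).1
  obtain ⟨d, hd⟩ := exists_relation_shearGen hF hP hP' hD hc hc' hcc' hS hS' hcard
    (refTwist_refRay (a := a) (o := o)) (refTwist_eq_zero_or hmem)
  have hnum : ∀ b ∈ T, intersectionNumber (π ≫ F̃.toSpec k)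
      (tildeDivisor F P k J π b) (stratum (tildeDivisor F P k J π) T) = d b := by
    intro b hb
    have hT : T ∈ tildeCones F P := F̃.down_closed hS (subset_insert _ _)
    have hcard' : ∀ {e}, e ∉ T → (insert e T).card = n + 1 := fun he => by
      rw [Finset.card_insert_of_notMem he, hcard]
    have hfull : ∀ {S}, S ∈ tildeCones F P → S.card = n + 1 → ∀ χ : (Fin n → ℤ) × ℤ →+ ℤ,
        (∀ b ∈ S, χ (F̃.gen b) = 0) → χ = 0 := fun hS hc χ hχ => by
      refine AddMonoidHom.ext fun v => ?_
      obtain ⟨e, rfl⟩ := exists_sum_shearGen (μ := 0) (h := vertical) hS rfl (Or.inl rfl) hc v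
      rw [map_sum]
      refine sum_eq_zero fun b hb => ?_
      rw [map_zsmul, shearGen, Pi.zero_apply, zero_smul, add_zero,
        show χ (tildeGen F P b) = 0 from hχ b hb, smul_zero]
    have hW : ∀ W : F̃.cones, (⟨T, hT⟩ : F̃.cones) ≤ W →
        W ≤ ⟨insert c T, hS⟩ ∨ W ≤ ⟨insert c' T, hS'⟩ := by
      intro W hTW
      by_cases hWT : W.1 ⊆ T
      · exact Or.inl (hWT.trans (subset_insert _ _))
      · obtain ⟨e, heW, heT⟩ := Finset.not_subset.1 hWT
        have h1 : insert e T ⊆ W.1 := insert_subset heW hTW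
        have h2 := eq_of_card_le W.2 (hcard' heT).ge h1
        rcases eq_or_eq_of_insert_mem hF hP hP' hD hc hc' hcc' hS hS' hcard heT
          (F̃.down_closed W.2 h1) with rfl | rfl
        · exact Or.inl h2.ge
        · exact Or.inr h2.ge
    have hadm := isAdmissible_of_card hP' hS (hcard' hc)
    have hadm' := isAdmissible_of_card hP' hS' (hcard' hc')
    cases o with
    | some i =>
      have hi := (ho i).2 rfl
      exact intersectionNumber_of_horizontal_mem (S := ⟨_, hS⟩) (S' := ⟨_, hS'⟩) (T := ⟨T, hT⟩)
        hP' hg hπ hc hc' hcc' rfl rfl (hfull hS (hcard' hc)) hW hb hi.1 hi.2 hd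
    | none =>
      refine intersectionNumber_of_horizontal_notMem (S := ⟨_, hS⟩) (S' := ⟨_, hS'⟩) (T := ⟨T, hT⟩)
        hP' hg hπ hc hc' hcc' rfl rfl (hfull hS (hcard' hc)) (hfull hS' (hcard' hc')) hW hb
        (fun i hi => ?_) hadm hadm' ?_
      · -- otherwise both maximal cones contain `(m_i, 1)`, and so does `T`
        have h1 := hadm i (mem_insert_of_mem hi)
        have h2 := hadm' i (mem_insert_of_mem hi)
        have h3 : exceptional i ∈ T := by
          rcases mem_insert.1 h1 with rfl | h1
          · exact (mem_insert.1 h2).resolve_left hcc'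
          · exact h1
        exact absurd ((ho i).1 ⟨hi, h3⟩) (by simp)
      · simp only [shearGen, refTwist, Pi.zero_apply, zero_smul, add_zero] at hd
        exact hd
  have h1 := congrArg (castHom n) hd
  simp only [map_add, map_sum, map_zsmul, map_zero, ← Int.cast_smul_eq_zsmul ℝ] at h1
  rw [sum_congr rfl fun b hb => by rw [hnum b hb]]
  exact eq_neg_of_add_eq_zero_left h1

/-- Near `x`, a chart with the properties of a facet chart differs from a reference chart by an
integral linear map. -/
theorem exists_equiv_refGen {T : Finset (TildeRay ι s)} {w : TildeRay ι s → (Fin n → ℝ) × ℝ}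
    (hcard : T.card = n)
    (hw : ∀ S ∈ tildeCones F P, T ⊆ S → S.card = n + 1 → IsLatticeBasis (integralPoints n) w S)
    (hw' : ∀ c c', c ∉ T → c' ∉ T → c ≠ c' → insert c T ∈ tildeCones F P →
      insert c' T ∈ tildeCones F P → w c + w c' = -∑ b ∈ T,
      (intersectionNumber (π ≫ F̃.toSpec k) (tildeDivisor F P k J π b)
        (stratum (tildeDivisor F P k J π) T) : ℝ) • w b)
    {R : Finset (TildeRay ι s)} (hR : R ∈ tildeCones F P) (hTR : T ⊆ R) {o : Option (Fin s)}
    (ho : ∀ i, o = some i → horizontal (P i) ∈ R) (hRT : R = T → IsFrame P T o) :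
    ∃ θ : ((Fin n → ℝ) × ℝ) ≃ₗ[ℝ] (Fin n → ℝ) × ℝ,
      (∀ v, θ v ∈ integralPoints n ↔ v ∈ integralPoints n) ∧
      ∀ S ∈ tildeCones F P, R ⊆ S → ∀ c ∈ S, θ (w c) = refGen F P a o c := by
  have hD := tropCones_tildeDivisor hP' hg hπ
  obtain ⟨S₀, hS₀, hRS₀, hcard₀⟩ := exists_full hF hP hP' hD hR
  obtain ⟨θ, hθ, hθw⟩ := exists_integral_equiv (hw S₀ hS₀ (hTR.trans hRS₀) hcard₀)
    (isLatticeBasis_refGen (a := a) hS₀ hcard₀ fun i hi => hRS₀ (ho i hi))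
  refine ⟨θ, hθ, fun S hS hRS c' hc' => ?_⟩
  by_cases hc₀ : c' ∈ S₀
  · exact hθw c' hc₀
  have hlt : R.card < S₀.card := by
    refine Finset.card_lt_card ⟨hRS₀, fun h => ?_⟩
    have h1 := eq_of_card_le hS hcard₀.ge (h.trans hRS)
    exact hc₀ (h1 ▸ hc')
  obtain rfl : T = R := Finset.eq_of_subset_of_card_le hTR (by omega)
  obtain ⟨c, hc, rfl⟩ : ∃ c, c ∉ T ∧ insert c T = S₀ :=
    (Finset.exists_eq_insert_iff.2 ⟨hRS₀, by omega⟩)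
  have hcT : c' ∉ T := fun h => hc₀ (mem_insert_of_mem h)
  have hcc' : c ≠ c' := by
    rintro rfl
    exact hc₀ (mem_insert_self _ _)
  have hS' : insert c' T ∈ tildeCones F P := F̃.down_closed hS (insert_subset hc' hRS)
  have h1 := congrArg θ (eq_sub_of_add_eq' (hw' c c' hc hcT hcc' hS₀ hS'))
  rw [h1, eq_sub_of_add_eq'
    (refGen_add_refGen hF hP hP' hπ hg (hRT rfl) hcard hc hcT hcc' hS₀ hS'), map_sub, map_neg,
    map_sum, hθw c (mem_insert_self _ _)]
  congr 2
  exact sum_congr rfl fun b hb => by rw [map_smul, hθw b (mem_insert_of_mem hb)]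

end Relation

end

/-! ### The charts on `U` and on the stars -/

section

open TildeRay Filter Topology

variable {ι : Type} [Fintype ι] [DecidableEq ι] {n s : ℕ} {F : SmoothFan (Fin n → ℤ) ι}
  {P : Fin s → ι} {X : Scheme.{u}} {D : TildeRay ι s → Closeds X}

section Stars

theorem mem_starTilde {x : TropSpace D} {i : Fin s} :
    x ∈ starTilde P D i ↔ horizontal (P i) ∈ tropSupport x ∧ exceptional i ∈ tropSupport x := by
  simp [starTilde, mem_tropStar, cellTilde, Finset.insert_subset_iff, and_comm]

theorem isOpen_openU : IsOpen (openU F P D) := by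
  have : openU F P D = (⋃ p : Fin s × Finset ι,
      {x | p.2 ∈ F.cones ∧ P p.1 ∈ p.2 ∧ p.2.card + 1 = n ∧
        x ∈ tropCell D (cellTilde p.1 p.2)})ᶜ := by
    ext x
    simp [openU]
  rw [this]
  refine (isClosed_iUnion_of_finite fun p => ?_).isOpen_compl
  simp only [← and_assoc]
  exact isClosed_const.and (isClosed_tropCell _)

variable (F P D) in
/-- The domain of the reference chart with index `o`. -/
def refSource : Option (Fin s) → Set (TropSpace D)
  | none => openU F P D
  | some i => starTilde P D i

theorem isOpen_refSource (o : Option (Fin s)) : IsOpen (refSource F P D o) := by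
  cases o
  exacts [isOpen_openU, isOpen_tropStar _]

theorem horizontal_mem_of_refSource {x : TropSpace D} {o : Option (Fin s)}
    (hx : x ∈ refSource F P D o) (i : Fin s) (hi : o = some i) :
    horizontal (P i) ∈ tropSupport x := by
  subst hi
  exact (mem_starTilde.1 hx).1

theorem card_cellTilde (i : Fin s) (σ : Finset ι) : (cellTilde i σ).card = σ.card + 1 := by
  rw [cellTilde, Finset.card_insert_of_notMem (by simp),
    Finset.card_image_of_injective _ fun _ _ h => by injection h]

variable (hP' : SeparatedRays F P)

include hP'

theorem eq_cellTilde {T : Finset (TildeRay ι s)} (hT : T ∈ tildeCones F P) {i : Fin s}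
    (hh : horizontal (P i) ∈ T) (he : exceptional i ∈ T) : T = cellTilde i (baseSimplex P T) := by
  have hi := horizontal_mem_base P hh
  ext (b | _ | j)
  · simp only [cellTilde, mem_insert, reduceCtorEq, Finset.mem_image, horizontal.injEq,
      exists_eq_right, false_or]
    refine ⟨horizontal_mem_base P, fun hb => ?_⟩
    rcases mem_target_cases (S := ⟨T, hT⟩) hP' hi hb with rfl | h
    exacts [hh, h]
  · simpa [cellTilde] using vertical_notMem (S := ⟨T, hT⟩) hh
  · simp only [cellTilde, mem_insert, exceptional.injEq, Finset.mem_image, reduceCtorEq,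
      and_false, exists_false, or_false]
    refine ⟨fun hj => eq_of_exceptional_mem hP' ⟨T, hT⟩ (exceptional_mem_base P hj) hi, ?_⟩
    rintro rfl
    exact he

variable (hF : F.IsCompleteFan) (hP : Function.Injective P) (hD : tropCones D = tildeCones F P)

include hD

theorem eq_of_mem_starTilde {x : TropSpace D} {i j : Fin s} (hi : x ∈ starTilde P D i)
    (hj : x ∈ starTilde P D j) : i = j :=
  eq_of_horizontal_mem hP' (S := ⟨tropSupport x,
    (hD ▸ tropSupport_mem x : tropSupport x ∈ tildeCones F P)⟩) (mem_starTilde.1 hi).1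
    (mem_starTilde.1 hj).1

theorem compl_subset_tropDiscriminant :
    (openU F P D ∪ openV P D)ᶜ ⊆ tropDiscriminant D (n + 1) := by
  intro x hx
  rw [Set.mem_compl_iff, Set.mem_union, not_or] at hx
  obtain ⟨i, T, -, hiT, hT, hxT⟩ := not_not.1 hx.1
  refine ⟨_, tropSupport_mem x, ?_, tropSupport_subset.1 subset_rfl⟩
  have h1 : (tropSupport x).card < (cellTilde i T).card := by
    refine Finset.card_lt_card ⟨tropSupport_subset.2 hxT, fun h => hx.2 ?_⟩
    refine Set.mem_iUnion.2 ⟨i, mem_starTilde.2 ⟨h ?_, h (mem_insert_self _ _)⟩⟩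
    exact mem_insert_of_mem (Finset.mem_image_of_mem _ hiT)
  rw [card_cellTilde] at h1
  omega

include hF hP

/-- The set `U` meets the star of `ρ~_i` only in the interiors of maximal cones. -/
theorem card_of_mem_openU {x : TropSpace D} (hx : x ∈ openU F P D) {i : Fin s}
    (hi : x ∈ starTilde P D i) : (tropSupport x).card = n + 1 := by
  have hT : tropSupport x ∈ tildeCones F P := hD ▸ tropSupport_mem x
  obtain ⟨hh, he⟩ := mem_starTilde.1 hi
  obtain ⟨S, hS, hTS, hcard⟩ := exists_full hF hP hP' hD hT
  by_contra hne
  have h1 := eq_cellTilde hP' hT hh he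
  have h2 := eq_cellTilde hP' hS (hTS hh) (hTS he)
  have h3 : baseSimplex P (tropSupport x) ⊆ baseSimplex P S :=
    Finset.biUnion_subset_biUnion_of_subset_left _ hTS
  have h4 : (baseSimplex P S).card = n := by
    have := congrArg Finset.card h2
    rw [card_cellTilde] at this
    omega
  have h5 := congrArg Finset.card h1
  rw [card_cellTilde] at h5
  have h6 := card_le_of_mem hT
  obtain ⟨σ, hσ1, hσ2, hσ⟩ := Finset.exists_subsuperset_card_eq (n := n - 1) h3 (by omega) (by omega)
  have hPσ : P i ∈ σ := hσ1 (horizontal_mem_base P hh)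
  have h7 := Finset.card_le_card h3
  have h8 : 0 < (baseSimplex P (tropSupport x)).card :=
    Finset.card_pos.2 ⟨_, horizontal_mem_base P hh⟩
  refine hx ⟨i, σ, F.down_closed (baseSimplex_mem F P hS) hσ2, hPσ, by omega,
    tropSupport_subset.1 ?_⟩
  rw [h1]
  exact Finset.insert_subset_insert _ (Finset.image_subset_image hσ1)

theorem isFrame_of_mem {x : TropSpace D} {o : Option (Fin s)} (hx : x ∈ refSource F P D o)
    (hcard : (tropSupport x).card = n) : IsFrame P (tropSupport x) o := by
  cases o with
  | none =>
    refine fun i => ⟨fun hi => ?_, fun hi => by simp at hi⟩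
    have := card_of_mem_openU hP' hF hP hD hx (mem_starTilde.2 hi)
    omega
  | some i =>
    refine fun j => ⟨fun hj => ?_, fun hj => ?_⟩
    · rw [eq_of_mem_starTilde hP' hD hx (mem_starTilde.2 hj)]
    · rw [← Option.some_injective _ hj]
      exact mem_starTilde.1 hx

theorem compatAt_refGen {a : Fin s → ι → ℤ} {x : TropSpace D} {o o' : Option (Fin s)}
    (hx : x ∈ refSource F P D o) (hx' : x ∈ refSource F P D o') :
    CompatAt (integralPoints n) x (tropMap D (refGen F P a o)) (tropMap D (refGen F P a o')) := by
  by_cases hoo : o = o'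
  · exact hoo ▸ .of_eventuallyEq (Eventually.of_forall fun _ => rfl)
  have hcard : (tropSupport x).card = n + 1 := by
    rcases o with _ | i <;> rcases o' with _ | j
    · exact absurd rfl hoo
    · exact card_of_mem_openU hP' hF hP hD hx hx'
    · exact card_of_mem_openU hP' hF hP hD hx' hx
    · exact absurd (congrArg some (eq_of_mem_starTilde hP' hD hx hx')) hoo
  have hT : tropSupport x ∈ tildeCones F P := hD ▸ tropSupport_mem x
  obtain ⟨θ, hθ, h⟩ := exists_integral_equiv
    (isLatticeBasis_refGen (a := a) hT hcard (horizontal_mem_of_refSource hx))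
    (isLatticeBasis_refGen (a := a) hT hcard (horizontal_mem_of_refSource hx'))
  refine .of_linear hθ (eventually_tropMap (θ := θ.toLinearMap) fun S hS hTS c hc => h c ?_)
  rwa [eq_of_card_le (hD ▸ hS) hcard.ge hTS]

end Stars

section ShearCharts

theorem tropMap_shearRealGen (μ : TildeRay ι s → ℤ) (h : TildeRay ι s) (x : TropSpace D) :
    tropMap D (shearRealGen F P μ h) x =
      Psi F P D x + tropMap D (fun c => (μ c : ℝ)) x • tildeRealGen F P h := by
  rw [tropMap, tropMap, Psi, sum_smul, ← sum_add_distrib]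
  exact sum_congr rfl fun c _ => by rw [shearRealGen_eq, smul_add, smul_smul, smul_eq_mul]

theorem shearMap_eq {μ : TildeRay ι s → ℤ} {i : Fin s} {φ : QuotientByRay F (P i) → ℝ}
    {x : TropSpace D} (h : φ (Submodule.Quotient.mk (Psi F P D x).1) =
      tropMap D (fun c => (μ c : ℝ)) x) :
    shearMap F P D i φ x = tropMap D (shearRealGen F P μ (horizontal (P i))) x := by
  rw [tropMap_shearRealGen, shearMap, h]
  refine Prod.ext rfl ?_
  simp [tildeRealGen, tildeGen]

variable {μ : TildeRay ι s → ℤ} {h : TildeRay ι s}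

local notation "μ♯" => fun c : TildeRay ι s => (μ c : ℝ)
local notation "Φ" => tropMap D (shearRealGen F P μ h)

theorem tropMap_shearRealGen_eq_slide (N : ℝ) {x : TropSpace D} (h0 : 0 < x.1 h)
    (h1 : 0 < x.1 h + (N + tropMap D μ♯ x)) :
    Φ x =
      Psi F P D (slide D h μ♯ N x) + -(N • tildeRealGen F P h) := by
  rw [tropMap_shearRealGen, show Psi F P D (slide D h _ N x) = _ from tropMap_slide _ h0 h1, add_smul]
  show Psi F P D x + _ = Psi F P D x + _ + _
  abel

variable (hF : F.IsCompleteFan) (hP : Function.Injective P)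
  (hP' : SeparatedRays F P) (hD : tropCones D = tildeCones F P)
  (hμ : μ h = 0)

include hF hP hP' hD hμ

theorem tropMap_shearRealGen_injOn : {x | h ∈ tropSupport x}.InjOn
    Φ := by
  intro x hx y hy hxy
  let u : TropSpace D → ℝ := tropMap D μ♯
  have hx0 := (x.2.1 h).lt_of_ne' (mem_tropSupport.1 hx)
  have hy0 := (y.2.1 h).lt_of_ne' (mem_tropSupport.1 hy)
  have hx1 : 0 < x.1 h + (|u x| + |u y| + u x) := by linarith [neg_abs_le (u x), abs_nonneg (u y)]
  have hy1 : 0 < y.1 h + (|u x| + |u y| + u y) := by linarith [neg_abs_le (u y), abs_nonneg (u x)]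
  rw [tropMap_shearRealGen_eq_slide _ hx0 hx1, tropMap_shearRealGen_eq_slide _ hy0 hy1] at hxy
  have h1 := Psi_injective hF hP hP' hD (add_right_cancel hxy)
  have hμ' : μ♯ h = 0 := by simp [hμ]
  rw [← slide_slide (μ := μ♯) hμ' hx0 hx1, h1,
    slide_slide (μ := μ♯) hμ' hy0 hy1]

theorem map_tropMap_shearRealGen_nhds (hh : (tildeRealGen F P h).2 = 0) {x : TropSpace D}
    (hx : h ∈ tropSupport x) : map Φ (𝓝 x) =
      𝓝[{y | 0 ≤ y.2}] (Φ x) := by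
  set u : TropSpace D → ℝ := tropMap D μ♯ with hu
  have hx0 := (x.2.1 h).lt_of_ne' (mem_tropSupport.1 hx)
  have hx1 : 0 < x.1 h + (|u x| + u x) := by linarith [neg_abs_le (u x)]
  have hμ' : μ♯ h = 0 := by simp [hμ]
  set v := -(|u x| • tildeRealGen F P h) with hv
  have hv2 : v.2 = 0 := by simp [hv, hh]
  have h1 : Φ =ᶠ[𝓝 x]
      (Homeomorph.addRight v) ∘ Psi F P D ∘ slide D h μ♯ |u x| := by
    filter_upwards [eventually_slide hx0 hx1] with y hy
    exact tropMap_shearRealGen_eq_slide _ hy.1 hy.2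
  have h2 : Homeomorph.addRight v '' {y | 0 ≤ y.2} = {y | 0 ≤ y.2} := by
    ext y
    rw [Homeomorph.coe_addRight, Set.image_add_right]
    simp [hv2]
  rw [map_congr h1, ← map_map, ← map_map, map_slide_nhds (μ := μ♯) hμ' hx0 hx1,
    map_Psi_nhds hF hP hP' hD, (Homeomorph.addRight v).isEmbedding.map_nhdsWithin_eq, h2,
    tropMap_shearRealGen_eq_slide _ hx0 hx1]
  rfl

omit hμ in
theorem exists_refChart (a : Fin s → ι → ℤ) (o : Option (Fin s)) {O : Set (TropSpace D)}
    (hO : IsOpen O) (h : ∀ x ∈ O, ∀ i, o = some i → horizontal (P i) ∈ tropSupport x) :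
    ∃ e : AffineChart ((Fin n → ℝ) × ℝ) (TropSpace D), e.source = O ∧
      e.toFun = tropMap D (refGen F P a o) := by
  cases o with
  | none =>
    have h1 : tropMap D (refGen F P a none) = Psi F P D := funext fun x => by
      rw [refGen, tropMap_shearRealGen]
      simp [refTwist, tropMap]
    rw [h1]
    exact ⟨halfSpaceChart O hO _ (Psi_injective hF hP hP' hD).injOn
      fun x _ => map_Psi_nhds hF hP hP' hD x, rfl, rfl⟩
  | some i =>
    exact ⟨halfSpaceChart O hO _ ((tropMap_shearRealGen_injOn hF hP hP' hD
      (twist_self a i)).mono fun x hx => h x hx i rfl) fun x hx =>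
      map_tropMap_shearRealGen_nhds hF hP hP' hD (twist_self a i)
        (by simp [tildeRealGen, tildeGen]) (h x hx i rfl), rfl, rfl⟩

end ShearCharts

variable (hP' : SeparatedRays F P) (hD : tropCones D = tildeCones F P)

section SupportFunction

/-- The real linear extension of a character of `ℤ ^ n`. -/
def realChar (χ : (Fin n → ℤ) →+ ℤ) : (Fin n → ℝ) →ₗ[ℝ] ℝ :=
  (realExt ((Int.castAddHom ℝ).comp (χ.comp (fst _ ℤ)))).comp (LinearMap.inl ℝ _ _)

theorem realChar_cast (χ : (Fin n → ℤ) →+ ℤ) (z : Fin n → ℤ) :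
    realChar χ (fun j => (z j : ℝ)) = χ z := by
  have h1 := realExt_castHom ((Int.castAddHom ℝ).comp (χ.comp (fst _ ℤ))) (z, 0)
  refine Eq.trans ?_ h1
  rw [realChar, LinearMap.comp_apply]
  congr 1
  exact Prod.ext rfl Int.cast_zero.symm

theorem realChar_Psi (χ : (Fin n → ℤ) →+ ℤ) (x : TropSpace D) :
    realChar χ (Psi F P D x).1 = tropMap D (fun c => (χ (tildeGen F P c).1 : ℝ)) x := by
  rw [Psi, Prod.fst_sum, map_sum]
  refine sum_congr rfl fun c _ => ?_
  rw [Prod.smul_fst, map_smul]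
  exact congrArg _ (realChar_cast χ _)

/-- The shear `v ↦ v + χ(v) (m_b, 0)`. -/
theorem exists_shear (χ : (Fin n → ℤ) →+ ℤ) {b : ι} (hb : χ (F.gen b) = 0) :
    ∃ θ : ((Fin n → ℝ) × ℝ) ≃ₗ[ℝ] (Fin n → ℝ) × ℝ,
      (∀ v, θ v ∈ integralPoints n ↔ v ∈ integralPoints n) ∧
      ∀ v, θ (castHom n v) = castHom n (v + χ v.1 • (F.gen b, 0)) := by
  have h : ∀ (v : (Fin n → ℤ) × ℤ) (m : ℤ), χ (v + m • (F.gen b, 0)).1 = χ v.1 := fun v m =>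
    (map_add χ v.1 (m • F.gen b)).trans (by rw [map_zsmul, hb, smul_zero, add_zero])
  exact exists_integral_extension
    { toFun := fun v => v + χ v.1 • (F.gen b, 0)
      invFun := fun v => v + (-χ v.1) • (F.gen b, 0)
      left_inv := fun v => by
        beta_reduce
        rw [h, add_assoc, ← add_smul, add_neg_cancel, zero_smul, add_zero]
      right_inv := fun v => by
        beta_reduce
        rw [h, add_assoc, ← add_smul, neg_add_cancel, zero_smul, add_zero]
      map_add' := fun v w => by
        rw [Prod.fst_add, map_add, add_smul]
        abel }

theorem mem_link_of_mem {σ : Finset ι} (hσ : σ ∈ F.cones) {b c : ι} (hb : b ∈ σ) (hc : c ∈ σ)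
    (h : c ≠ b) : c ∈ F.link b := by
  classical
  rw [SmoothFan.link, mem_filter]
  exact ⟨mem_univ _, h, F.down_closed hσ (insert_subset hb (singleton_subset_iff.2 hc))⟩

variable {k : Type u} [Field k] {i : Fin s} {J : (F.divisorScheme k (P i)).IdealSheafData}
  {φ : QuotientByRay F (P i) → ℝ} {a : Fin s → ι → ℤ}

include hP' hD

theorem supportFunction_Psi (hφ : IsSupportFunction F k (P i) J φ)
    (ha : ∀ c ∈ F.link (P i), φ (Submodule.Quotient.mk (F.realGen c)) = a i c)
    {x : TropSpace D} (hx : x ∈ starTilde P D i) :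
    φ (Submodule.Quotient.mk (Psi F P D x).1) = tropMap D (fun c => (twist F P a i c : ℝ)) x := by
  have hT : tropSupport x ∈ tildeCones F P := hD ▸ tropSupport_mem x
  have hi := horizontal_mem_base P (mem_starTilde.1 hx).1
  obtain ⟨h, hh⟩ := hφ.piecewise_linear _ (baseSimplex_mem F P hT) hi
  have hself : h (Submodule.Quotient.mk (F.realGen (P i))) = 0 := by
    rw [(Submodule.Quotient.mk_eq_zero _).2 (Submodule.mem_span_singleton_self _), map_zero]
  have h1 : (Psi F P D x).1 ∈ F.realCone (baseSimplex P (tropSupport x)) := by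
    rw [Psi, fst_sum_tildeRealGen]
    exact ⟨_, baseCoeff_nonneg x, (Finset.sum_subset (Finset.subset_univ _) fun b _ hb => by
      rw [baseCoeff_eq_zero x hb, zero_smul]).symm⟩
  rw [hh _ h1]
  let q : (Fin n → ℝ) →ₗ[ℝ] ℝ := h.comp (Submodule.mkQ _)
  show q (Psi F P D x).1 = _
  rw [Psi, Prod.fst_sum, map_sum]
  refine sum_congr rfl fun c _ => ?_
  rw [Prod.smul_fst, map_smul]
  by_cases hc : x.1 c = 0
  · rw [hc, zero_smul, zero_smul]
  refine congrArg (x.1 c • ·) ?_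
  rw [← Ne.eq_def, ← mem_tropSupport] at hc
  rcases c with b | _ | j
  · show h (Submodule.Quotient.mk (F.realGen b)) = _
    rcases eq_or_ne b (P i) with rfl | hbi
    · beta_reduce
      rw [hself, twist_self, Int.cast_zero]
    · have hb := horizontal_mem_base P hc
      have hlink := mem_link_of_mem (baseSimplex_mem F P hT) hi hb hbi
      have h2 : F.realGen b ∈ F.realCone (baseSimplex P (tropSupport x)) :=
        ⟨fun c => if c = b then 1 else 0, fun c => by beta_reduce; split_ifs <;> simp,
          by simp [ite_smul, hb]⟩
      beta_reduce
      rw [← hh _ h2, ha b hlink, twist, if_pos hlink]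
  · have h2 : (tildeRealGen F P (vertical : TildeRay ι s)).1 = 0 := by
      funext j
      simp [tildeRealGen, tildeGen]
    beta_reduce
    rw [h2, map_zero, twist, Int.cast_zero]
  · obtain rfl := eq_of_exceptional_mem hP' ⟨_, hT⟩ (exceptional_mem_base P hc) hi
    exact hself.trans (by beta_reduce; rw [twist, Int.cast_zero])

end SupportFunction

section Union

variable (a : Fin s → ι → ℤ) (χ : Fin s → (Fin n → ℤ) →+ ℤ)

variable (F P) in
/-- The coefficients of the shear after a linear function is added to the support function. -/
def shiftedTwist (i : Fin s) (c : TildeRay ι s) : ℤ := twist F P a i c + χ i (tildeGen F P c).1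

open Classical in
variable (F P D) in
/-- The shears on the disjoint open stars of the `ρ~_i`, combined into one map. -/
def unionShear (x : TropSpace D) : (Fin n → ℝ) × ℝ := if h : ∃ i, x ∈ starTilde P D i then
    tropMap D (shearRealGen F P (shiftedTwist F P a χ h.choose) (horizontal (P h.choose))) x
  else 0

variable {a χ} (hχ0 : ∀ i, χ i (F.gen (P i)) = 0)
  (hχ : ∀ i, ∀ c ∈ F.link (P i), 0 ≤ a i c + χ i (F.gen c))

include hχ0 in
theorem shiftedTwist_self (i : Fin s) : shiftedTwist F P a χ i (horizontal (P i)) = 0 := by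
  rw [shiftedTwist, twist_self, tildeGen, hχ0, add_zero]

include hP' hD

theorem unionShear_eq {i : Fin s} {x : TropSpace D} (hx : x ∈ starTilde P D i) :
    unionShear F P D a χ x =
      tropMap D (shearRealGen F P (shiftedTwist F P a χ i) (horizontal (P i))) x := by
  have h : ∃ i, x ∈ starTilde P D i := ⟨i, hx⟩
  rw [unionShear, dif_pos h, eq_of_mem_starTilde hP' hD h.choose_spec hx]

theorem eventually_unionShear {i : Fin s} {x : TropSpace D} (hx : x ∈ starTilde P D i) :
    ∀ᶠ y in 𝓝 x, unionShear F P D a χ y =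
      tropMap D (shearRealGen F P (shiftedTwist F P a χ i) (horizontal (P i))) y :=
  Filter.mem_of_superset ((isOpen_tropStar _).mem_nhds hx) fun _ => unionShear_eq hP' hD

include hχ0 in
theorem compatAt_unionShear {i : Fin s} {x : TropSpace D} (hx : x ∈ starTilde P D i) :
    CompatAt (integralPoints n) x (tropMap D (refGen F P a (some i))) (unionShear F P D a χ) := by
  obtain ⟨θ, hθ, h⟩ := exists_shear (χ i) (hχ0 i)
  have h1 := eventually_tropMap (D := D) (x := x) (w := refGen F P a (some i)) (θ := θ.toLinearMap)
    (w' := shearRealGen F P (shiftedTwist F P a χ i) (horizontal (P i))) fun S _ _ c _ => by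
    refine (h _).trans (congrArg _ ?_)
    have h2 : (shearGen F P (twist F P a i) (horizontal (P i)) c).1 =
      (tildeGen F P c).1 + twist F P a i c • F.gen (P i) := rfl
    rw [refTwist, refRay, h2, map_add, map_zsmul, hχ0, smul_zero, add_zero, shearGen, shearGen,
      shiftedTwist, add_smul, add_assoc]
    rfl
  refine .of_linear hθ ?_
  filter_upwards [h1, eventually_unionShear hP' hD hx] with y hy hy'
  exact hy'.trans hy

variable (hF : F.IsCompleteFan) (hP : Function.Injective P)

include hF hP hχ0 hχ

/-- The shifted shears only move points away from the boundary of the stars, into the stars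
themselves, so that their images are disjoint. -/
theorem unionShear_injOn : (openV P D).InjOn (unionShear F P D a χ) := by
  have key : ∀ i, ∀ x ∈ starTilde P D i, ∃ y : TropSpace D, y ∈ starTilde P D i ∧
      unionShear F P D a χ x = Psi F P D y := by
    intro i x hx
    have hT : tropSupport x ∈ tildeCones F P := hD ▸ tropSupport_mem x
    have hi := (mem_starTilde.1 hx).1
    have hbi := horizontal_mem_base P hi
    have h0 := (x.2.1 _).lt_of_ne' (mem_tropSupport.1 hi)
    have hnonneg : 0 ≤ tropMap D (fun c => (shiftedTwist F P a χ i c : ℝ)) x := by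
      refine sum_nonneg fun c _ => ?_
      by_cases hc : x.1 c = 0
      · rw [hc, zero_smul]
      refine mul_nonneg (x.2.1 c) (Int.cast_nonneg ?_)
      rw [← Ne.eq_def, ← mem_tropSupport] at hc
      rcases c with b | _ | j
      · rcases eq_or_ne b (P i) with rfl | hb
        · exact (shiftedTwist_self hχ0 i).ge
        · have hlink := mem_link_of_mem (baseSimplex_mem F P hT) hbi (horizontal_mem_base P hc) hb
          rw [shiftedTwist, twist, if_pos hlink]
          exact hχ i b hlink
      · simp [shiftedTwist, twist, tildeGen]
      · obtain rfl := eq_of_exceptional_mem hP' ⟨_, hT⟩ (exceptional_mem_base P hc) hbi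
        simp [shiftedTwist, twist, tildeGen, hχ0]
    have h1 : 0 < x.1 (horizontal (P i)) +
        (0 + tropMap D (fun c => (shiftedTwist F P a χ i c : ℝ)) x) := by linarith
    refine ⟨slide D (horizontal (P i)) _ 0 x, ?_, (unionShear_eq hP' hD hx).trans
      ((tropMap_shearRealGen_eq_slide 0 h0 h1).trans (by rw [zero_smul, neg_zero, add_zero]))⟩
    rw [mem_starTilde, tropSupport_slide h0 h1]
    exact mem_starTilde.1 hx
  intro x hx y hy hxy
  obtain ⟨i, hi⟩ := Set.mem_iUnion.1 hx
  obtain ⟨j, hj⟩ := Set.mem_iUnion.1 hy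
  obtain ⟨x', hx', h1⟩ := key i x hi
  obtain ⟨y', hy', h2⟩ := key j y hj
  obtain rfl : x' = y' := Psi_injective hF hP hP' hD (by rw [← h1, ← h2, hxy])
  obtain rfl := eq_of_mem_starTilde hP' hD hx' hy'
  rw [unionShear_eq hP' hD hi, unionShear_eq hP' hD hj] at hxy
  exact tropMap_shearRealGen_injOn hF hP hP' hD (shiftedTwist_self hχ0 i) (mem_starTilde.1 hi).1
    (mem_starTilde.1 hj).1 hxy

theorem exists_unionChart : ∃ e : AffineChart ((Fin n → ℝ) × ℝ) (TropSpace D),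
    e.source = openV P D ∧ e.toFun = unionShear F P D a χ := by
  refine ⟨halfSpaceChart _ (isOpen_iUnion fun i => isOpen_tropStar _) _
    (unionShear_injOn hP' hD hχ0 hχ hF hP) fun x hx => ?_, rfl, rfl⟩
  obtain ⟨i, hi⟩ := Set.mem_iUnion.1 hx
  rw [map_congr (eventually_unionShear hP' hD hi), unionShear_eq hP' hD hi]
  exact map_tropMap_shearRealGen_nhds hF hP hP' hD (shiftedTwist_self hχ0 i)
    (by simp [tildeRealGen, tildeGen]) (mem_starTilde.1 hi).1

end Union

end

end

end TropBlowup

open TropBlowup TildeRay Filter Topology in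
theorem theorem3p3 {k : Type u} [Field k] [IsAlgClosed k] [CharZero k] {n s : ℕ}
    {ι : Type} [Fintype ι] [DecidableEq ι]
    (F : SmoothFan (Fin n → ℤ) ι) (hF : F.IsCompleteFan)
    (P : Fin s → ι) (hP : Function.Injective P)
    (hP' : ∀ σ ∈ F.cones, ∀ i j, i ≠ j → ¬(P i ∈ σ ∧ P j ∈ σ))
    (J : ∀ i, (F.divisorScheme k (P i)).IdealSheafData)
    (hJ : ∀ i, F.IsTransverseHypersurface k (P i) (J i))
    (X : Scheme.{u}) (π : X ⟶ (tildeFan F P).toricScheme k)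
    (hπ : IsBlowup π (Scheme.IdealSheafData.vanishingIdeal (tildeCenter F P k J)))
    (φ : ∀ i, QuotientByRay F (P i) → ℝ)
    (hφ : ∀ i, IsSupportFunction F k (P i) (J i) (φ i)) :
    let D := tildeDivisor F P k J π
    let Δ := tropDiscriminant D (n + 1)
    let Δ' := (openU F P D ∪ openV P D)ᶜ
    (∃ Ψ : TropSpace D ≃ₜ {p : (Fin n → ℝ) × ℝ // 0 ≤ p.2}, ∀ x, (Ψ x).1 = Psi F P D x) ∧
    (∀ i j, i ≠ j → Disjoint (starTilde P D i) (starTilde P D j)) ∧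
    Δ' ⊆ Δ ∧
    (∀ T ∈ tropCones D, T.card = n →
      ∃ e, IsFacetChart D (π ≫ (tildeFan F P).toSpec k) (n + 1) (integralPoints n) T e) ∧
    ∃ 𝒜₀ : IntegralAffineStructure (integralPoints n) Δᶜ,
      (∀ T e, IsFacetChart D (π ≫ (tildeFan F P).toSpec k) (n + 1) (integralPoints n) T e →
        e ∈ 𝒜₀.charts) ∧
      ∃ 𝒜 : IntegralAffineStructure (integralPoints n) Δ'ᶜ,
        𝒜₀.charts = {e ∈ 𝒜.charts | e.source ⊆ Δᶜ} ∧
        (∃ e ∈ 𝒜.charts, e.source = openU F P D ∧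
          ∀ x ∈ openU F P D, e.toFun x = Psi F P D x) ∧
        (∀ i, ∃ e ∈ 𝒜.charts, e.source = starTilde P D i ∧
          ∀ x ∈ starTilde P D i, e.toFun x = shearMap F P D i (φ i) x) ∧
        ∃ l : ∀ i, QuotientByRay F (P i) →ₗ[ℝ] ℝ,
          (∀ i (z : Fin n → ℤ), ∃ c : ℤ,
            l i (Submodule.Quotient.mk fun j => (z j : ℝ)) = c) ∧
          ∃ e ∈ 𝒜.charts, e.source = openV P D ∧
            ∀ i, ∀ x ∈ starTilde P D i,
              e.toFun x = shearMap F P D i (fun q => φ i q + l i q) x := by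
  intro D Δ Δ'
  choose a ha haφ using fun i => (hφ i).values
  choose g hg using fun i => SmoothFan.exists_isEquation (hF.singleton_mem (P i)) (hJ i) (ha i)
  choose χ hχ0 hχ using fun i => (hg i).exists_char
  have hD : tropCones D = tildeCones F P := tropCones_tildeDivisor hP' hg hπ
  have hΔ : Δᶜ ⊆ Δ'ᶜ := Set.compl_subset_compl.2 (compl_subset_tropDiscriminant hP' hD)
  have hΔ' : ∀ x, x ∈ Δ'ᶜ ↔ ∃ o, x ∈ refSource F P D o := fun x => by
    rw [compl_compl, Option.exists]
    exact or_congr Iff.rfl Set.mem_iUnion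
  have hnone : tropMap D (refGen F P a none) = Psi F P D := funext fun x => by
    rw [refGen, tropMap_shearRealGen]
    simp [refTwist, tropMap]
  have href := fun o => exists_refChart hF hP hP' hD a o (isOpen_refSource (F := F) o) fun x hx =>
    horizontal_mem_of_refSource hx
  -- the maximal atlas that contains the reference charts
  let C : Set (AffineChart ((Fin n → ℝ) × ℝ) (TropSpace D)) :=
    {e | ∃ o, e.source = refSource F P D o ∧ e.toFun = tropMap D (refGen F P a o)}
  let 𝒜 : IntegralAffineStructure (integralPoints n) Δ'ᶜ := atlas Δ'ᶜ C
    (fun e ⟨o, ho, _⟩ x hx => (hΔ' x).2 ⟨o, ho ▸ hx⟩)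
    (fun x hx => by
      obtain ⟨o, ho⟩ := (hΔ' x).1 hx
      obtain ⟨e, he, he'⟩ := href o
      exact ⟨e, ⟨o, he, he'⟩, he ▸ ho⟩)
    (fun e ⟨o, ho, ho'⟩ e' ⟨o', hoe, hoe'⟩ x hx => by
      rw [ho, hoe] at hx
      rw [ho', hoe']
      exact compatAt_refGen hP' hF hP hD hx.1 hx.2)
  have hmem : ∀ e : AffineChart ((Fin n → ℝ) × ℝ) (TropSpace D), e.source ⊆ Δ'ᶜ →
      (∀ x ∈ e.source, ∀ o, x ∈ refSource F P D o →
        CompatAt (integralPoints n) x e.toFun (tropMap D (refGen F P a o))) → e ∈ 𝒜.charts :=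
    fun e he h => ⟨he, fun c ⟨o, ho, ho'⟩ x hx => by
      have h1 := h x hx.1 o (ho ▸ hx.2)
      rw [← ho'] at h1
      exact h1⟩
  have hrefmem : ∀ o, ∃ e ∈ 𝒜.charts, e.source = refSource F P D o ∧
      e.toFun = tropMap D (refGen F P a o) := fun o => by
    obtain ⟨e, he, he'⟩ := href o
    refine ⟨e, hmem e (fun x hx => (hΔ' x).2 ⟨o, he ▸ hx⟩) fun x hx o' hx' => ?_, he, he'⟩
    rw [he']
    exact compatAt_refGen hP' hF hP hD (he ▸ hx) hx'
  have hfacetmem : ∀ T e, IsFacetChart D (π ≫ (tildeFan F P).toSpec k) (n + 1)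
      (integralPoints n) T e → e ∈ 𝒜.charts ∧ e.source ⊆ Δᶜ := by
    intro T e he
    obtain ⟨w, hw0, hw, hw'⟩ := he.exists_gens
    have hsub : e.source ⊆ Δᶜ := he.source ▸ tropStar_subset_compl he.card
    have hcard : T.card = n := Nat.succ_injective he.card
    refine ⟨hmem e (hsub.trans hΔ) fun x hx o hxo => ?_, hsub⟩
    rw [he.source] at hx
    have hTx := mem_tropStar.1 hx
    obtain ⟨θ, hθ, hθw⟩ := exists_equiv_refGen hF hP hP' hπ hg hcard
      (fun S hS => hw S (hD ▸ hS))
      (fun c c' hc hc' hcc' hS hS' => hw' c c' hc hc' hcc' (hD ▸ hS) (hD ▸ hS'))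
      (hD ▸ tropSupport_mem x) hTx (horizontal_mem_of_refSource hxo)
      (fun h => h ▸ isFrame_of_mem hP' hF hP hD hxo (by rw [h, hcard]))
    refine .of_linear hθ ?_
    filter_upwards [eventually_tropMap (D := D) (θ := θ.toLinearMap) fun S hS => hθw S (hD ▸ hS),
      (isOpen_tropStar T).mem_nhds hx] with y hy hyT
    rw [hw0 y hyT]
    exact hy
  have hfacet : ∀ T ∈ tropCones D, T.card = n → ∃ e,
      IsFacetChart D (π ≫ (tildeFan F P).toSpec k) (n + 1) (integralPoints n) T e := by
    intro T hT hcard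
    have hT' : T ∈ tildeCones F P := hD ▸ hT
    obtain ⟨o, ho⟩ := exists_isFrame hP' hT'
    have hoT : ∀ i, o = some i → horizontal (P i) ∈ T := fun i hi => ((ho i).2 hi).1
    obtain ⟨e, he, he'⟩ := exists_refChart hF hP hP' hD a o (isOpen_tropStar T) fun x hx i hi =>
      mem_tropStar.1 hx (hoT i hi)
    refine ⟨e, hT, by rw [hcard], he, refGen F P a o, fun x _ => congrFun he' x, ?_, ?_⟩
    · exact fun S hS hTS hS' => isLatticeBasis_refGen (hD ▸ hS) hS' fun i hi => hTS (hoT i hi)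
    · exact fun c c' hc hc' hcc' hS hS' => refGen_add_refGen hF hP hP' hπ hg ho hcard hc hc' hcc'
        (hD ▸ hS) (hD ▸ hS')
  have hcov : ∀ x ∈ Δᶜ, ∃ e ∈ 𝒜.charts, e.source ⊆ Δᶜ ∧ x ∈ e.source := by
    intro x hx
    obtain ⟨T, hTx, hT⟩ := Finset.exists_subset_card_eq (s := tropSupport x) (n := n) (by
      have := notMem_tropDiscriminant hx
      omega)
    obtain ⟨e, he⟩ := hfacet T (by
      rw [hD]
      exact (tildeFan F P).down_closed
        (hD ▸ tropSupport_mem x : tropSupport x ∈ tildeCones F P) hTx) hT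
    obtain ⟨h1, h2⟩ := hfacetmem T e he
    exact ⟨e, h1, h2, he.source ▸ mem_tropStar.2 hTx⟩
  refine ⟨⟨(isClosedEmbedding_Psi hF hP hP' hD).isEmbedding.toHomeomorph.trans
    (Homeomorph.setCongr (range_Psi hF hP hP' hD)), fun x => rfl⟩, fun i j hij =>
    Set.disjoint_left.2 fun x hi hj => hij (eq_of_mem_starTilde hP' hD hi hj),
    compl_subset_tropDiscriminant hP' hD, hfacet, 𝒜.restrict Δᶜ hΔ hcov, hfacetmem, 𝒜, rfl, ?_, ?_, ?_⟩
  · obtain ⟨e, he, he', he''⟩ := hrefmem none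
    exact ⟨e, he, he', fun x _ => by rw [he'', hnone]⟩
  · intro i
    obtain ⟨e, he, he', he''⟩ := hrefmem (some i)
    refine ⟨e, he, he', fun x hx => ?_⟩
    rw [he'', shearMap_eq (supportFunction_Psi hP' hD (hφ i) (haφ i) hx)]
    rfl
  · have hker : ∀ i, Submodule.span ℝ {F.realGen (P i)} ≤ LinearMap.ker (realChar (χ i)) := fun i => by
      rw [Submodule.span_singleton_le_iff_mem, LinearMap.mem_ker]
      exact (realChar_cast (χ i) _).trans (by rw [hχ0, Int.cast_zero])
    refine ⟨fun i => Submodule.liftQ _ (realChar (χ i)) (hker i),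
      fun i z => ⟨χ i z, realChar_cast (χ i) z⟩, ?_⟩
    obtain ⟨e, he, he'⟩ := exists_unionChart hP' hD hχ0 hχ hF hP
    refine ⟨e, hmem e ?_ ?_, he, fun i x hx => ?_⟩
    · rw [he, compl_compl]
      exact Set.subset_union_right
    · intro x hx o hxo
      rw [he] at hx
      obtain ⟨i, hi⟩ := Set.mem_iUnion.1 hx
      rw [he']
      exact (compatAt_unionShear hP' hD hχ0 hi).symm.trans
        (compatAt_refGen (o := some i) hP' hF hP hD hi hxo)
    · rw [he', unionShear_eq hP' hD hx, shearMap_eq]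
      show φ i _ + realChar (χ i) _ = _
      rw [supportFunction_Psi hP' hD (hφ i) (haφ i) hx, realChar_Psi, tropMap, tropMap,
        ← Finset.sum_add_distrib]
      refine Finset.sum_congr rfl fun c _ => ?_
      rw [← smul_add]
      simp only [shiftedTwist, Int.cast_add]
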